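/- Let $\mu_1,\mu_2,H_1,H_2,\kappa>0$. Let $\Pi_1=\mathbb R\times(0,H_1)$, $\Pi_2=\mathbb R\times(-H_2,0)$. A weight function is a pair of real functions $\mathcal Y_j$, harmonic in $\Pi_j$, continuous on $\overline{\Pi_j}$, with $\partial_Y\mathcal Y_j$ continuous up to the faces except at the crack tip $(0,0)$, such that: $\partial_Y\mathcal Y_1(X,H_1)=\partial_Y\mathcal Y_2(X,-H_2)=0$ for all $X$; $\partial_Y\mathcal Y_j(X,0)=0$ for $X<0$ (crack); for $X>0$, $[\mathcal Y](X):=\mathcal Y_1(X,0^+)-\mathcal Y_2(X,0^-)=\kappa\mu_1\partial_Y\mathcal Y_1(X,0^+)$ and $\mu_1\partial_Y\mathcal Y_1(X,0^+)=\mu_2\partial_Y\mathcal Y_2(X,0^-)$ (imperfect interface); uniformly in $Y$, for some rates $\gamma>0$, $\mathcal Y_j=O(e^{-\gamma X})$ as $X\to+\infty$ and $\mathcal Y_j=C_jX+D_j+O(e^{\gamma X})$ as $X\to-\infty$; and $\mathcal Y_j=\mathcal Y_j(0,0)+O(R\ln R)$ as $R=\sqrt{X^2+Y^2}\to0$. Put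 $$\Xi(\xi)=\frac1\xi\Big(\frac{\coth(\xi H_1)}{\mu_1}+\frac{\coth(\xi H_2)}{\mu_2}+\kappa\xi\Big),\quad \lambda=\sqrt{\frac{\mu_1H_1+\mu_2H_2}{\mu_1\mu_2H_1H_2\kappa}},\quad \Xi(\xi)=\frac{\kappa(\lambda^2+\xi^2)}{\xi^2}\,\Xi_*(\xi),\quad \alpha=\int_0^\infty\frac{\ln\Xi_*(t)}{t^2}\,dt,$$ $$\Xi_*^\pm(\xi)=\exp\Big\{\frac{\pm1}{2\pi i}\int_{-\infty\mp i\beta}^{\infty\mp i\beta}\frac{\ln\Xi_*(t)}{t-\xi}\,dt\Big\},\quad \Phi^+(\xi)=\mu_1\int_0^\infty\partial_Y\mathcal Y_1(X,0^+)e^{i\xi X}dX,\quad \Phi^-(\xi)=\int_{-\infty}^0\big([\mathcal Y]-\mu_1\kappa\,\partial_Y\mathcal Y_1(X,0^+)\big)e^{i\xi X}dX .$$ (i) $\Xi_*>0$ on $\mathbb R\setminus\{0\}$ and the integral $\alpha$ converges. Among the zeros of $\Xi$ in the open lower half-plane there is a smallest distance $\gamma_+>0$ to the real axis, and $\frac1{\mu_1}\cot(\gamma_+H_1)+\frac1{\mu_2}\cot(\gamma_+H_2)-\kappa\gamma_+=0$.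 For every $0<\beta<\gamma_+$, $\Xi_*^+$ is analytic in $\operatorname{Im}\xi>-\beta$, $\Xi_*^-$ is analytic in $\operatorname{Im}\xi<\beta$, and $\Xi_*=\Xi_*^+\Xi_*^-$ for $|\operatorname{Im}\xi|<\beta$, $\xi\ne0$. (ii) For every weight function $\mathcal Y$ there is $\mathcal A\in\mathbb R$ such that, for every $0<\beta<\gamma_+$, with convergent integrals, $$\Phi^+(\xi)=-\frac{\mathcal A}{\kappa(\lambda-i\xi)\Xi_*^+(\xi)}\ (\operatorname{Im}\xi>-\beta),\qquad \Phi^-(\xi)=\frac{\mathcal A(\lambda+i\xi)\Xi_*^-(\xi)}{\xi^2}\ (\operatorname{Im}\xi<0),$$ and, for $-\gamma_+<\operatorname{Im}\xi<0$, $\Phi^-(\xi)=-\Xi(\xi)\Phi^+(\xi)$ and, for $Y$ in the closed section of material $j$, $$\int_{-\infty}^\infty e^{i\xi X}\mathcal Y_j(X,Y)\,dX=-\frac{\Phi^+(\xi)}{\mu_j\xi}\,\frac{\cosh(\xi(Y+(-1)^jH_j))}{\sinh((-1)^{j+1}\xi H_j)},\quad j=1,2.$$ (iii) A weight function with $\mathcal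 A=\kappa\lambda$ exists. For it, $$C_j=\frac{(-1)^{j+1}}{\mu_jH_j},\qquad D_j=\frac{(-1)^j}{\mu_jH_j}\Big(\frac\alpha\pi+\frac1\lambda\Big),$$ and its crack-tip constant is $a_0=\lambda$, in the sense that for some $k\in\mathbb R$ and $b_1,b_2>0$, as $R\to0$, uniformly in the polar angle $\theta$ ($\theta\in[0,\pi]$ for $j=1$, $\theta\in[-\pi,0]$ for $j=2$; upper signs for $j=1$), $$\mathcal Y_j=k+\frac{(-1)^ja_0}{\pi\mu_j}\Big\{\frac{\mu_1\kappa\pi}{1+\mu_1/\mu_2}-\Big[1-\ln\frac R{b_j}\Big]R\cos\theta\pm(\pi\mp\theta)R\sin\theta\Big\}+o(R);$$ moreover $[\mathcal Y]\to-\kappa a_0$ and $\mu_1\partial_Y\mathcal Y_1(X,0^+)\to-a_0$ as $X\to0^+$. The largest $\gamma$ with $\mathcal Y_j=O(e^{-\gamma X})$ at $+\infty$ for both $j$ is $\gamma_+$, and the largest $\gamma$ with $\mathcal Y_j=C_jX+D_j+O(e^{\gamma X})$ at $-\infty$ for both $j$ is $\gamma_-=\pi\min\{1/H_1,1/H_2\}$.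 For a weight function with general $\mathcal A$, the constants $C_j,D_j,a_0$ are these multiplied by $\mathcal A/(\kappa\lambda)$, and the decay rates are the same if $\mathcal A\ne0$. -/

import Mathlib

open Real Set Filter Topology MeasureTheory Asymptotics

noncomputable section

namespace BimaterialStrip

/-- Parameters of the bi-material strip. Index `0` is the upper material (subscript `1` in
the usual notation), index `1` the lower one (subscript `2`): shear moduli `μ j`, thicknesses `H j`, and the interface
imperfection parameter `κ`. -/
structure StripParams where
  μ : Fin 2 → ℝ
  H : Fin 2 → ℝ
  κ : ℝ
  μ_pos : ∀ j, 0 < μ j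
  H_pos : ∀ j, 0 < H j
  κ_pos : 0 < κ

/-- `+1` for the upper material, `-1` for the lower one. -/
def side (j : Fin 2) : ℝ := (-1) ^ (j : ℕ)

variable (P : StripParams)

/-! ### The geometry -/

/-- Closed range of `Y` in material `j`: `[0, H₁]` above, `[-H₂, 0]` below. -/
def section_ (j : Fin 2) : Set ℝ := {Y | side j * Y ∈ Icc 0 (P.H j)}

/-- The open strip of material `j`, as a subset of the complex plane `X + i Y`. -/
def openStrip (j : Fin 2) : Set ℂ := {z | side j * z.im ∈ Ioo 0 (P.H j)}

/-- The closed strip of material `j`, including both of its faces. -/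
def closedStrip (j : Fin 2) : Set (ℝ × ℝ) := {p | p.2 ∈ section_ P j}

/-! ### The boundary value problem

A displacement is a pair `u j X Y`, `j = 0, 1`; `u j X 0` is the trace on the interface from the
side of material `j`. -/

/-- The derivative `∂u_j/∂Y`, one-sided on the two faces of the strip of material `j`. -/
def dY (u : Fin 2 → ℝ → ℝ → ℝ) (j : Fin 2) (X Y : ℝ) : ℝ :=
  derivWithin (fun y => u j X y) (section_ P j) Y

/-- The jump `u₁(X,0+) - u₂(X,0-)`. -/
def jump (u : Fin 2 → ℝ → ℝ → ℝ) (X : ℝ) : ℝ := u 0 X 0 - u 1 X 0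

/-- `u_j = O(exp(-γ X))` as `X → +∞`, uniformly across the strip, for both `j`. -/
def DecaysRight (u : Fin 2 → ℝ → ℝ → ℝ) (γ : ℝ) : Prop :=
  ∀ j, (fun p : ℝ × ℝ => u j p.1 p.2) =O[atTop ×ˢ 𝓟 (section_ P j)]
    fun p => Real.exp (-γ * p.1)

/-- `u_j = C_j X + D_j + O(exp(γ X))` as `X → -∞`, uniformly across the strip, for both `j`. -/
def LinearLeft (u : Fin 2 → ℝ → ℝ → ℝ) (C D : Fin 2 → ℝ) (γ : ℝ) : Prop :=
  ∀ j, (fun p : ℝ × ℝ => u j p.1 p.2 - (C j * p.1 + D j)) =O[atBot ×ˢ 𝓟 (section_ P j)]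
    fun p => Real.exp (γ * p.1)

/-- Classical solutions of the (homogeneous) anti-plane problem in the strip with a semi-infinite
traction-free crack on `X < 0` and an imperfect interface on `X > 0`, with linear growth
`C_j X + D_j` along the crack and exponential decay along the interface. -/
structure IsWeightFunction (u : Fin 2 → ℝ → ℝ → ℝ) (C D : Fin 2 → ℝ) : Prop where
  harmonic : ∀ j, InnerProductSpace.HarmonicOnNhd (fun z : ℂ => u j z.re z.im) (openStrip P j)
  cont : ∀ j, ContinuousOn (fun p : ℝ × ℝ => u j p.1 p.2) (closedStrip P j)
  cont_dY : ∀ j, ContinuousOn (fun p : ℝ × ℝ => dY P u j p.1 p.2) (closedStrip P j \ {0})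
  outer_free : ∀ j X, P.μ j * dY P u j X (side j * P.H j) = 0
  crack_free : ∀ j X, X < 0 → P.μ j * dY P u j X 0 = 0
  imperfect : ∀ X, 0 < X → jump u X = P.κ * (P.μ 0 * dY P u 0 X 0)
  traction : ∀ X, 0 < X → P.μ 0 * dY P u 0 X 0 = P.μ 1 * dY P u 1 X 0
  right : ∃ γ > 0, DecaysRight P u γ
  left : ∃ γ > 0, LinearLeft P u C D γ
  tip : ∀ j, (fun p : ℝ × ℝ => u j p.1 p.2 - u j 0 0) =O[𝓝[closedStrip P j] 0]
    fun p => √(p.1 ^ 2 + p.2 ^ 2) * Real.log √(p.1 ^ 2 + p.2 ^ 2)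

/-- `a` is the crack-tip constant of `u`: in polar coordinates `(R, θ)` about the tip
(`0 ≤ θ ≤ π` above, `-π ≤ θ ≤ 0` below), up to a rigid translation `k`, up to `o(R)` and
with length scales `b j`, `u` has the near-tip form
`∓ a/(π μ_j) {μ₁κπ/(1+μ₁/μ₂) - [1 - ln (R/b_j)] R cos θ ± (π ∓ θ) R sin θ}`. -/
def HasTipConstant (u : Fin 2 → ℝ → ℝ → ℝ) (a : ℝ) : Prop :=
  ∃ (k : ℝ) (b : Fin 2 → ℝ), (∀ j, 0 < b j) ∧ ∀ j,
    (fun p : ℝ × ℝ => u j (p.1 * Real.cos p.2) (p.1 * Real.sin p.2) -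
      (k + -side j * a / (π * P.μ j) *
        (P.μ 0 * P.κ * π / (1 + P.μ 0 / P.μ 1)
          - (1 - Real.log (p.1 / b j)) * (p.1 * Real.cos p.2)
          + side j * (π - side j * p.2) * (p.1 * Real.sin p.2))))
    =o[𝓝[>] 0 ×ˢ 𝓟 {θ : ℝ | side j * θ ∈ Icc 0 π}] fun p => p.1

/-! ### Transforms -/

/-- Integrand of the Fourier transform in `X` of `u_j(·, Y)`. -/
def fourierIntegrand (u : Fin 2 → ℝ → ℝ → ℝ) (j : Fin 2) (ξ : ℂ) (Y X : ℝ) : ℂ :=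
  Complex.exp (Complex.I * ξ * X) * (u j X Y : ℂ)

/-- The Fourier transform `∫ exp(iξX) u_j(X, Y) dX`. -/
def fourierX (u : Fin 2 → ℝ → ℝ → ℝ) (j : Fin 2) (ξ : ℂ) (Y : ℝ) : ℂ :=
  ∫ X : ℝ, fourierIntegrand u j ξ Y X

/-- Integrand of `Φ⁺`. -/
def phiPlusIntegrand (u : Fin 2 → ℝ → ℝ → ℝ) (ξ : ℂ) (X : ℝ) : ℂ :=
  ((P.μ 0 * dY P u 0 X 0 : ℝ) : ℂ) * Complex.exp (Complex.I * ξ * X)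

/-- `Φ⁺(ξ)`: half-line transform, over `X > 0`, of the interface traction. -/
def PhiPlus (u : Fin 2 → ℝ → ℝ → ℝ) (ξ : ℂ) : ℂ :=
  ∫ X in Ioi (0 : ℝ), phiPlusIntegrand P u ξ X

/-- Integrand of `Φ⁻`. -/
def phiMinusIntegrand (u : Fin 2 → ℝ → ℝ → ℝ) (ξ : ℂ) (X : ℝ) : ℂ :=
  ((jump u X - P.μ 0 * P.κ * dY P u 0 X 0 : ℝ) : ℂ) * Complex.exp (Complex.I * ξ * X)

/-- `Φ⁻(ξ)`: half-line transform, over `X < 0`, of the jump minus `κ` times the traction. -/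
def PhiMinus (u : Fin 2 → ℝ → ℝ → ℝ) (ξ : ℂ) : ℂ :=
  ∫ X in Iio (0 : ℝ), phiMinusIntegrand P u ξ X

/-! ### The Wiener–Hopf kernel and its factorisation -/

def coth (z : ℂ) : ℂ := Complex.cosh z / Complex.sinh z

def cothR (t : ℝ) : ℝ := Real.cosh t / Real.sinh t

/-- The constant `λ`. -/
def lam : ℝ :=
  √((P.μ 0 * P.H 0 + P.μ 1 * P.H 1) / (P.μ 0 * P.μ 1 * P.H 0 * P.H 1 * P.κ))

/-- The kernel `Ξ`. -/
def Xi (ξ : ℂ) : ℂ :=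
  1 / ξ * (1 / P.μ 0 * coth (ξ * P.H 0) + 1 / P.μ 1 * coth (ξ * P.H 1) + P.κ * ξ)

/-- The regularised kernel `Ξ_*` (used away from its removable singularity `ξ = 0`). -/
def XiStar (ξ : ℂ) : ℂ :=
  ξ * (P.μ 0 * coth (ξ * P.H 1) + P.μ 1 * coth (ξ * P.H 0) + P.μ 0 * P.μ 1 * P.κ * ξ) /
    (P.μ 0 * P.μ 1 * P.κ * ((lam P : ℂ) ^ 2 + ξ ^ 2))

/-- `Ξ_*` on the real line, where it is real. -/
def XiStarR (t : ℝ) : ℝ :=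
  t * (P.μ 0 * cothR (t * P.H 1) + P.μ 1 * cothR (t * P.H 0) + P.μ 0 * P.μ 1 * P.κ * t) /
    (P.μ 0 * P.μ 1 * P.κ * (lam P ^ 2 + t ^ 2))

theorem XiStar_ofReal (t : ℝ) : XiStar P (t : ℂ) = (XiStarR P t : ℂ) := by
  simp only [XiStar, XiStarR, coth, cothR]
  push_cast
  rfl

/-- The factor `Ξ_*⁺`: the contour is the line `Im t = -β`. -/
def XiStarPlus (β : ℝ) (ξ : ℂ) : ℂ :=
  Complex.exp (1 / (2 * π * Complex.I) *
    ∫ t : ℝ, Complex.log (XiStar P (t - Complex.I * β)) / ((t - Complex.I * β) - ξ))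

/-- The factor `Ξ_*⁻`: the contour is the line `Im t = β`. -/
def XiStarMinus (β : ℝ) (ξ : ℂ) : ℂ :=
  Complex.exp (-1 / (2 * π * Complex.I) *
    ∫ t : ℝ, Complex.log (XiStar P (t + Complex.I * β)) / ((t + Complex.I * β) - ξ))

/-- The constant `α`. -/
def alpha : ℝ := ∫ t in Ioi (0 : ℝ), Real.log (XiStarR P t) / t ^ 2

/-- Distances to the real axis of the zeros of `Ξ` in the open lower half-plane (points where a
`sinh` vanishes are poles of `Ξ`, hence not zeros). -/
def zeroDepths : Set ℝ :=
  {γ | 0 < γ ∧ ∃ ξ : ℂ, ξ.im = -γ ∧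
    Complex.sinh (ξ * P.H 0) ≠ 0 ∧ Complex.sinh (ξ * P.H 1) ≠ 0 ∧ Xi P ξ = 0}

/-- `γ₊`: the distance to the real axis of the first zero of `Ξ` below it. -/
def gammaPlus : ℝ := sInf (zeroDepths P)

/-- `γ₋ = π min(1/H₁, 1/H₂)`. -/
def gammaMinus : ℝ := π * min (1 / P.H 0) (1 / P.H 1)

/-- `C_j = ±1/(μ_j H_j)`, the slopes at `-∞` of the normalised weight function. -/
def constC (j : Fin 2) : ℝ := side j / (P.μ j * P.H j)

/-- `D_j = ∓(α/π + 1/λ)/(μ_j H_j)`, the constants at `-∞` of the normalised weight function. -/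
def constD (j : Fin 2) : ℝ := -side j / (P.μ j * P.H j) * (alpha P / π + 1 / lam P)

/-- The explicit Wiener–Hopf solution with constant `A`: the formulas for `Φ⁺`, `Φ⁻` and for
the Fourier transforms of `u`. -/
structure HasExplicitTransforms (u : Fin 2 → ℝ → ℝ → ℝ) (A : ℝ) : Prop where
  phiPlus : ∀ β, 0 < β → β < gammaPlus P → ∀ ξ : ℂ, -β < ξ.im →
    IntegrableOn (phiPlusIntegrand P u ξ) (Ioi 0) ∧
    PhiPlus P u ξ = -A / (P.κ * (lam P - Complex.I * ξ) * XiStarPlus P β ξ)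
  phiMinus : ∀ β, 0 < β → β < gammaPlus P → ∀ ξ : ℂ, ξ.im < 0 →
    IntegrableOn (phiMinusIntegrand P u ξ) (Iio 0) ∧
    PhiMinus P u ξ = A * (lam P + Complex.I * ξ) * XiStarMinus P β ξ / ξ ^ 2
  wienerHopf : ∀ ξ : ℂ, -gammaPlus P < ξ.im → ξ.im < 0 →
    PhiMinus P u ξ = -Xi P ξ * PhiPlus P u ξ
  transform : ∀ j, ∀ ξ : ℂ, -gammaPlus P < ξ.im → ξ.im < 0 → ∀ Y ∈ section_ P j,
    Integrable (fourierIntegrand u j ξ Y) ∧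
    fourierX u j ξ Y = -PhiPlus P u ξ / (P.μ j * ξ) *
      (Complex.cosh (ξ * (Y - side j * P.H j)) / Complex.sinh (ξ * (side j * P.H j)))

end BimaterialStrip

end

open BimaterialStrip

open scoped Complex
open Complex (I)

namespace BimaterialStrip

/-! ### Contour integrals in horizontal strips -/

theorem integrable_horizontal {f : ℂ → ℂ} {y C r : ℝ} (hr : 1 < r)
    (hf : Continuous fun x : ℝ => f (x + y * I))
    (hb : ∀ x : ℝ, ‖f (x + y * I)‖ ≤ C * (1 + |x|) ^ (-r)) :
    Integrable fun x : ℝ => f (x + y * I) := by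
  have h1 : Integrable fun x : ℝ => C * (1 + ‖x‖) ^ (-r) :=
    (integrable_one_add_norm (by simpa using hr)).const_mul C
  exact h1.mono' hf.aestronglyMeasurable (Eventually.of_forall fun x => by simpa using hb x)

theorem continuous_horizontal {f : ℂ → ℂ} {s : Set ℂ} (hf : ContinuousOn f s) {y : ℝ}
    (hs : ∀ x : ℝ, (x + y * I : ℂ) ∈ s) :
    Continuous fun x : ℝ => f (x + y * I) :=
  hf.comp_continuous (by fun_prop) hs

theorem tendsto_one_add_rpow_neg {r : ℝ} (hr : 0 < r) :
    Tendsto (fun x : ℝ => (1 + |x|) ^ (-r)) atTop (𝓝 0) := by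
  have h := (tendsto_rpow_neg_atTop hr).comp
    (tendsto_atTop_add_const_left atTop (1 : ℝ) tendsto_abs_atTop_atTop)
  exact h

/-- The integral over a horizontal line does not change under shifts within a strip of
holomorphy. -/
theorem integral_horizontal_eq {f : ℂ → ℂ} {y₁ y₂ C r : ℝ} (hy : y₁ ≤ y₂) (hr : 1 < r)
    (hf : DifferentiableOn ℂ f {z | z.im ∈ Icc y₁ y₂})
    (hb : ∀ z : ℂ, z.im ∈ Icc y₁ y₂ → ‖f z‖ ≤ C * (1 + |z.re|) ^ (-r)) :
    ∫ x : ℝ, f (x + y₁ * I) = ∫ x : ℝ, f (x + y₂ * I) := by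
  have hint : ∀ y ∈ Icc y₁ y₂, Integrable fun x : ℝ => f (x + y * I) := by
    intro y hy'
    refine integrable_horizontal (C := C) hr
      (continuous_horizontal hf.continuousOn fun x => by simpa using hy') fun x => ?_
    simpa using hb (x + y * I) (by simpa using hy')
  have ht : ∀ y ∈ Icc y₁ y₂, Tendsto (fun n : ℝ => ∫ x in (-n)..n, f (x + y * I)) atTop
      (𝓝 (∫ x : ℝ, f (x + y * I))) := fun y hy' =>
    intervalIntegral_tendsto_integral (hint y hy') tendsto_neg_atTop_atBot tendsto_id
  have hsub := (ht y₁ (left_mem_Icc.2 hy)).sub (ht y₂ (right_mem_Icc.2 hy))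
  have hvert : ∀ s : ℝ, (s = 1 ∨ s = -1) →
      Tendsto (fun n : ℝ => I • ∫ y in y₁..y₂, f ((s * n : ℝ) + y * I)) atTop
        (𝓝 0) := by
    intro s hs
    have hs1 : |s| = 1 := by rcases hs with rfl | rfl <;> simp
    have h0 : Tendsto (fun n : ℝ => C * (1 + |n|) ^ (-r) * |y₂ - y₁|) atTop (𝓝 0) := by
      simpa using ((tendsto_one_add_rpow_neg (by linarith : 0 < r)).const_mul C).mul_const |y₂ - y₁|
    refine squeeze_zero_norm (fun n => ?_) h0
    rw [norm_smul, Complex.norm_I, one_mul]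
    refine intervalIntegral.norm_integral_le_of_norm_le_const fun y hy' => ?_
    rw [uIoc_of_le hy] at hy'
    have := hb ((s * n : ℝ) + y * I) (by simpa using ⟨hy'.1.le, hy'.2⟩)
    simpa [abs_mul, hs1] using this
  have h := ((hsub.add (hvert 1 (Or.inl rfl))).sub (hvert (-1) (Or.inr rfl)))
  have hzero : Tendsto (fun n : ℝ => (((∫ x in (-n)..n, f (x + y₁ * I)) -
      ∫ x in (-n)..n, f (x + y₂ * I)) +
      I • ∫ y in y₁..y₂, f ((1 * n : ℝ) + y * I)) -
      I • ∫ y in y₁..y₂, f ((-1 * n : ℝ) + y * I)) atTop (𝓝 0) := by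
    refine tendsto_const_nhds.congr fun n => ?_
    have := Complex.integral_boundary_rect_eq_zero_of_differentiableOn f
      ((-n : ℝ) + y₁ * I) ((n : ℝ) + y₂ * I) (hf.mono fun z hz => by
        have := hz.2
        simpa [uIcc_of_le hy] using this)
    simp at this
    simp [this]
  have := tendsto_nhds_unique h hzero
  simpa [sub_eq_zero] using this

theorem div_mem_slitPlane {a b : ℂ} (ha : 0 < a.im) (hb : 0 < b.im) :
    a / b ∈ Complex.slitPlane := by
  rw [Complex.mem_slitPlane_iff_not_le_zero]
  intro h
  have hb0 : b ≠ 0 := fun h => by simp [h] at hb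
  obtain ⟨h1, h2⟩ := Complex.le_def.1 h
  have e : a = a / b * b := by field_simp
  have := congrArg Complex.im e
  rw [Complex.mul_im, h2] at this
  simp only [Complex.zero_im, zero_mul, add_zero] at this
  have h3 : (a / b).re * b.im ≤ 0 := mul_nonpos_of_nonpos_of_nonneg (by simpa using h1) hb.le
  linarith

theorem div_mem_slitPlane' {a b : ℂ} (ha : a.im < 0) (hb : b.im < 0) :
    a / b ∈ Complex.slitPlane := by
  rw [← neg_div_neg_eq]
  exact div_mem_slitPlane (by simpa using ha) (by simpa using hb)

/-- Away from `ζ`, the weight `1 + |Re z|` is controlled by the distance to `ζ`. -/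
theorem one_add_abs_re_le {z ζ : ℂ} {δ : ℝ} (hδ : 0 < δ) (h : δ ≤ ‖z - ζ‖) :
    1 + |z.re| ≤ (1 + (1 + ‖ζ‖) / δ) * ‖z - ζ‖ := by
  have h1 : |z.re| ≤ ‖z - ζ‖ + ‖ζ‖ := by
    calc |z.re| ≤ ‖z‖ := Complex.abs_re_le_norm z
      _ = ‖(z - ζ) + ζ‖ := by ring_nf
      _ ≤ _ := norm_add_le _ _
  have h2 : 1 + ‖ζ‖ ≤ (1 + ‖ζ‖) / δ * ‖z - ζ‖ := by
    rw [div_mul_eq_mul_div, le_div_iff₀ hδ]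
    exact mul_le_mul_of_nonneg_left h (by positivity)
  nlinarith

theorem inv_norm_sub_le {z ζ : ℂ} {δ : ℝ} (hδ : 0 < δ) (h : δ ≤ ‖z - ζ‖) :
    ‖z - ζ‖⁻¹ ≤ (1 + (1 + ‖ζ‖) / δ) * (1 + |z.re|)⁻¹ := by
  have h1 := one_add_abs_re_le hδ h
  have h2 : 0 < ‖z - ζ‖ := hδ.trans_le h
  rw [← div_eq_mul_inv, inv_eq_one_div, div_le_div_iff₀ h2 (by positivity)]
  linarith

theorem rpow_neg_two_eq {a : ℝ} (ha : 0 ≤ a) : (1 + a) ^ (-2 : ℝ) = (1 + a)⁻¹ * (1 + a)⁻¹ := by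
  rw [rpow_neg (by positivity), rpow_two, pow_two, mul_inv]

theorem abs_im_sub_le_norm (z ζ : ℂ) : |z.im - ζ.im| ≤ ‖z - ζ‖ := by
  simpa using Complex.abs_im_le_norm (z - ζ)

/-- `∫ (1/(t-ξ) - 1/(t-w)) dt = 0` when both poles are on the same (lower) side. -/
theorem integral_inv_sub_inv_eq_zero {ξ w : ℂ} (hξ : ξ.im < 0) (hw : w.im < 0) :
    ∫ t : ℝ, (((t : ℂ) - ξ)⁻¹ - ((t : ℂ) - w)⁻¹) = 0 := by
  have hξ0 : ∀ t : ℝ, (t : ℂ) - ξ ≠ 0 := fun t h => by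
    have := congrArg Complex.im h; simp at this; linarith
  have hw0 : ∀ t : ℝ, (t : ℂ) - w ≠ 0 := fun t h => by
    have := congrArg Complex.im h; simp at this; linarith
  have hd : ∀ t : ℝ, HasDerivAt (fun t : ℝ => Complex.log (((t : ℂ) - ξ) / ((t : ℂ) - w)))
      (((t : ℂ) - ξ)⁻¹ - ((t : ℂ) - w)⁻¹) t := by
    intro t
    have h1 : HasDerivAt (fun z : ℂ => Complex.log ((z - ξ) / (z - w)))
        (((t : ℂ) - ξ)⁻¹ - ((t : ℂ) - w)⁻¹) (t : ℂ) := by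
      have h2 := (((hasDerivAt_id' (t : ℂ)).sub_const ξ).fun_div
        ((hasDerivAt_id' (t : ℂ)).sub_const w) (hw0 t)).clog
        (div_mem_slitPlane (by simpa using hξ) (by simpa using hw))
      convert h2 using 1
      have := hξ0 t
      have := hw0 t
      field_simp
    exact h1.comp_ofReal
  have hbd : ∀ t : ℝ, ‖((t : ℂ) - ξ)⁻¹ - ((t : ℂ) - w)⁻¹‖ ≤
      ‖ξ - w‖ * ((1 + (1 + ‖ξ‖) / |ξ.im|) * (1 + (1 + ‖w‖) / |w.im|)) * (1 + |t|) ^ (-2 : ℝ) := by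
    intro t
    have e : ((t : ℂ) - ξ)⁻¹ - ((t : ℂ) - w)⁻¹ =
        (ξ - w) * (((t : ℂ) - ξ)⁻¹ * ((t : ℂ) - w)⁻¹) := by
      have := hξ0 t
      have := hw0 t
      field_simp
      ring
    have h1 := inv_norm_sub_le (z := (t : ℂ)) (ζ := ξ) (abs_pos.2 hξ.ne)
      (by simpa using abs_im_sub_le_norm (t : ℂ) ξ)
    have h2 := inv_norm_sub_le (z := (t : ℂ)) (ζ := w) (abs_pos.2 hw.ne)
      (by simpa using abs_im_sub_le_norm (t : ℂ) w)
    simp only [Complex.ofReal_re] at h1 h2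
    rw [e, norm_mul, norm_mul, norm_inv, norm_inv, rpow_neg_two_eq (abs_nonneg t), mul_assoc]
    refine mul_le_mul_of_nonneg_left ?_ (norm_nonneg _)
    calc _ ≤ _ := mul_le_mul h1 h2 (by positivity) (by positivity)
      _ = _ := by ring
  have hi : Integrable fun t : ℝ => ((t : ℂ) - ξ)⁻¹ - ((t : ℂ) - w)⁻¹ := by
    have hc : Continuous fun t : ℝ => ((t : ℂ) - ξ)⁻¹ - ((t : ℂ) - w)⁻¹ :=
      (Continuous.inv₀ (by fun_prop) hξ0).sub (Continuous.inv₀ (by fun_prop) hw0)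
    have := integrable_horizontal (f := fun z => (z - ξ)⁻¹ - (z - w)⁻¹) (y := 0)
      (one_lt_two : (1 : ℝ) < 2) (by simpa using hc) (by simpa using hbd)
    simpa using this
  have hlim : ∀ l : Filter ℝ, Tendsto (fun t : ℝ => ‖(t : ℂ) - w‖) l atTop →
      Tendsto (fun t : ℝ => Complex.log (((t : ℂ) - ξ) / ((t : ℂ) - w))) l (𝓝 0) := by
    intro l hl
    have h1 : Tendsto (fun t : ℝ => ((t : ℂ) - ξ) / ((t : ℂ) - w)) l (𝓝 1) := by
      have h2 : Tendsto (fun t : ℝ => 1 + (w - ξ) * ((t : ℂ) - w)⁻¹) l (𝓝 (1 + (w - ξ) * 0)) := by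
        refine tendsto_const_nhds.add (tendsto_const_nhds.mul ?_)
        exact tendsto_inv₀_cobounded.comp (tendsto_norm_atTop_iff_cobounded.1 hl)
      rw [mul_zero, add_zero] at h2
      refine h2.congr fun t => ?_
      have := hw0 t
      field_simp
      ring
    have := h1.clog (by simp)
    simpa using this
  have hre : ∀ t : ℝ, |t| - |w.re| ≤ ‖(t : ℂ) - w‖ := fun t => by
    calc |t| - |w.re| ≤ |t - w.re| := abs_sub_abs_le_abs_sub _ _
      _ ≤ _ := by simpa using Complex.abs_re_le_norm ((t : ℂ) - w)
  have := integral_of_hasDerivAt_of_tendsto hd hi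
    (hlim atBot (tendsto_atTop_mono hre (tendsto_atTop_add_const_right _ _ tendsto_abs_atBot_atTop)))
    (hlim atTop (tendsto_atTop_mono hre (tendsto_atTop_add_const_right _ _ tendsto_abs_atTop_atTop)))
  simpa using this

/-- `∫ (1/(t-ξ) - 1/(t-w)) dt = 2πi` for `ξ` in the upper half-plane and `w = conj ξ`. -/
theorem integral_inv_sub_inv_conj {x c : ℝ} (hc : 0 < c) :
    ∫ t : ℝ, (((t : ℂ) - (x + c * I))⁻¹ - ((t : ℂ) - (x - c * I))⁻¹) =
      2 * π * I := by
  have e : ∀ t : ℝ, ((t : ℂ) - (x + c * I))⁻¹ - ((t : ℂ) - (x - c * I))⁻¹ =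
      (2 * I / c) * (((1 + ((t - x) / c) ^ 2)⁻¹ : ℝ) : ℂ) := by
    intro t
    have h1 : (t : ℂ) - (x + c * I) ≠ 0 := fun h => by
      have := congrArg Complex.im h; simp at this; linarith
    have h2 : (t : ℂ) - (x - c * I) ≠ 0 := fun h => by
      have := congrArg Complex.im h; simp at this; linarith
    have hc' : (c : ℂ) ≠ 0 := by exact_mod_cast hc.ne'
    have h3 : (1 + ((t - x) / c) ^ 2 : ℂ) =
        ((t : ℂ) - (x + c * I)) * ((t : ℂ) - (x - c * I)) / c ^ 2 := by
      field_simp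
      linear_combination ((c : ℂ) ^ 2) * Complex.I_sq
    push_cast
    rw [h3]
    field_simp
    ring
  simp_rw [e]
  rw [integral_const_mul, integral_complex_ofReal]
  have h1 : ∫ t : ℝ, (1 + ((t - x) / c) ^ 2)⁻¹ = c * π := by
    rw [integral_sub_right_eq_self (fun t : ℝ => (1 + (t / c) ^ 2)⁻¹) x,
      Measure.integral_comp_div (fun t : ℝ => (1 + t ^ 2)⁻¹) c, integral_univ_inv_one_add_sq,
      abs_of_pos hc, smul_eq_mul]
  rw [h1]
  have hc' : (c : ℂ) ≠ 0 := by exact_mod_cast hc.ne'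
  push_cast
  field_simp

/-- A continuous function on a closed strip with decay for large real part is bounded by the
same decay everywhere. -/
theorem exists_strip_bound {f : ℂ → ℂ} {y₁ y₂ C r R : ℝ}
    (hf : ContinuousOn f {z | z.im ∈ Icc y₁ y₂})
    (hb : ∀ z : ℂ, z.im ∈ Icc y₁ y₂ → R ≤ |z.re| → ‖f z‖ ≤ C * (1 + |z.re|) ^ (-r)) :
    ∃ C', 0 < C' ∧ ∀ z : ℂ, z.im ∈ Icc y₁ y₂ → ‖f z‖ ≤ C' * (1 + |z.re|) ^ (-r) := by
  have hK : IsCompact (Icc (-R) R ×ℂ Icc y₁ y₂) := isCompact_Icc.reProdIm isCompact_Icc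
  have hg : ContinuousOn (fun z : ℂ => ‖f z‖ * (1 + |z.re|) ^ r) (Icc (-R) R ×ℂ Icc y₁ y₂) := by
    refine ((hf.mono fun z hz => hz.2).norm).mul (ContinuousOn.rpow_const ?_ ?_)
    · fun_prop
    · intro z _; left; positivity
  obtain ⟨M, hM⟩ := (hK.bddAbove_image hg)
  refine ⟨max (max C M) 1, by positivity, fun z hz => ?_⟩
  have hp : (0 : ℝ) < (1 + |z.re|) ^ (-r) := by positivity
  by_cases h : R ≤ |z.re|
  · exact (hb z hz h).trans (mul_le_mul_of_nonneg_right
      ((le_max_left _ _).trans (le_max_left _ _)) hp.le)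
  · have h1 : ‖f z‖ * (1 + |z.re|) ^ r ≤ M :=
      hM ⟨z, ⟨abs_le.1 (not_le.1 h).le, hz⟩, rfl⟩
    have h2 : ‖f z‖ ≤ M * (1 + |z.re|) ^ (-r) := by
      rw [rpow_neg (by positivity), ← div_eq_mul_inv, le_div_iff₀ (by positivity)]
      exact h1
    exact h2.trans (mul_le_mul_of_nonneg_right ((le_max_right _ _).trans (le_max_left _ _)) hp.le)

/-- The Cauchy integral formula in a horizontal strip. -/
theorem cauchy_strip {f : ℂ → ℂ} {s : Set ℂ} (hs : IsOpen s) (hf : DifferentiableOn ℂ f s)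
    {y₁ y₂ C : ℝ} (hsub : ∀ z : ℂ, z.im ∈ Icc y₁ y₂ → z ∈ s)
    (hb : ∀ z : ℂ, z.im ∈ Icc y₁ y₂ → ‖f z‖ ≤ C * (1 + |z.re|)⁻¹)
    {ξ : ℂ} (h₁ : y₁ < ξ.im) (h₂ : ξ.im < y₂) :
    (∫ t : ℝ, f (t + y₁ * I) / (t + y₁ * I - ξ)) -
      ∫ t : ℝ, f (t + y₂ * I) / (t + y₂ * I - ξ) = 2 * π * I * f ξ := by
  set w : ℂ := ξ.re + ((2 * y₁ - ξ.im : ℝ) : ℂ) * I with hw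
  have hwim : w.im = 2 * y₁ - ξ.im := by simp [hw]
  have hwlt : w.im < y₁ := by rw [hwim]; linarith
  have hC0 : 0 ≤ C := by
    have := hb ξ ⟨h₁.le, h₂.le⟩
    by_contra h
    have h3 : C * (1 + |ξ.re|)⁻¹ < 0 := mul_neg_of_neg_of_pos (not_le.1 h) (by positivity)
    linarith [norm_nonneg (f ξ)]
  set k : ℂ → ℂ := fun z => f ξ * (ξ - w) / (z - w) with hk
  set s' : Set ℂ := s ∩ {z | w.im < z.im} with hs'
  have hs'o : IsOpen s' := hs.inter (isOpen_lt continuous_const Complex.continuous_im)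
  have hzw : ∀ z : ℂ, w.im < z.im → z - w ≠ 0 := fun z hz h => by
    have := congrArg Complex.im h; simp at this; linarith
  have hξw : ξ - w ≠ 0 := hzw ξ (by linarith)
  have hF : DifferentiableOn ℂ (fun z => f z - k z) s' := by
    refine (hf.mono inter_subset_left).sub fun z hz => ?_
    exact ((differentiableAt_const _).div (differentiableAt_id.sub_const w)
      (hzw z hz.2)).differentiableWithinAt
  have hF0 : (fun z => f z - k z) ξ = 0 := by
    simp only [hk]; field_simp; ring
  have hξs' : s' ∈ 𝓝 ξ := hs'o.mem_nhds ⟨hsub ξ ⟨h₁.le, h₂.le⟩, by simp only [mem_ofPred_eq]; linarith⟩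
  set φ := dslope (fun z => f z - k z) ξ with hφ
  have hφd : DifferentiableOn ℂ φ s' := (Complex.differentiableOn_dslope hξs').2 hF
  have hsub' : ∀ z : ℂ, z.im ∈ Icc y₁ y₂ → z ∈ s' := fun z hz =>
    ⟨hsub z hz, by simp only [mem_ofPred_eq]; linarith [hz.1]⟩
  have hφs : ∀ z, z ≠ ξ → φ z = (f z - k z) * (z - ξ)⁻¹ := by
    intro z hz
    rw [hφ, dslope_of_ne _ hz, slope_def_field]
    simp only at hF0
    rw [hF0, sub_zero, div_eq_mul_inv]
  have hφeq : ∀ z, w.im < z.im → z ≠ ξ →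
      φ z = f z / (z - ξ) - f ξ * ((z - ξ)⁻¹ - (z - w)⁻¹) := by
    intro z hz' hz
    rw [hφs z hz, hk]
    have := hzw z hz'
    simp only
    field_simp
    ring
  obtain ⟨M, hM, hφb⟩ := exists_strip_bound (f := φ) (y₁ := y₁) (y₂ := y₂) (r := 2)
    (R := |ξ.re| + 1)
    (C := (C + ‖f ξ * (ξ - w)‖ * (1 + (1 + ‖w‖) / (y₁ - w.im))) * (1 + (1 + ‖ξ‖) / 1))
    (hφd.continuousOn.mono hsub') (by
      intro z hz hR
      have h1 : 1 ≤ ‖z - ξ‖ := by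
        have h2 := Complex.abs_re_le_norm (z - ξ)
        have h3 := abs_sub_abs_le_abs_sub z.re ξ.re
        rw [Complex.sub_re] at h2
        linarith
      have hne : z ≠ ξ := fun h => by simp [h] at h1; linarith
      have h4 := inv_norm_sub_le one_pos h1
      have h5 : ‖z - w‖⁻¹ ≤ _ := inv_norm_sub_le (sub_pos.2 hwlt) (by
        refine le_trans ?_ (abs_im_sub_le_norm z w)
        exact (sub_le_sub_right hz.1 _).trans (le_abs_self _))
      rw [hφs z hne, norm_mul, norm_inv, rpow_neg_two_eq (abs_nonneg _)]
      calc ‖f z - k z‖ * ‖z - ξ‖⁻¹ ≤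
          (C * (1 + |z.re|)⁻¹ + ‖f ξ * (ξ - w)‖ * ((1 + (1 + ‖w‖) / (y₁ - w.im)) *
            (1 + |z.re|)⁻¹)) * ((1 + (1 + ‖ξ‖) / 1) * (1 + |z.re|)⁻¹) := by
            refine mul_le_mul ((norm_sub_le _ _).trans (add_le_add (hb z hz) ?_)) h4
              (by positivity) ?_
            · rw [hk]
              simp only
              rw [norm_div, div_eq_mul_inv]
              exact mul_le_mul_of_nonneg_left h5 (norm_nonneg _)
            · have : 0 < y₁ - w.im := sub_pos.2 hwlt
              positivity
        _ = _ := by ring)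
  have hshift := integral_horizontal_eq (h₁.trans h₂).le one_lt_two
    (hφd.mono hsub') hφb
  have hline : ∀ y ∈ Icc y₁ y₂, y ≠ ξ.im →
      Integrable fun t : ℝ => f (t + y * I) / (t + y * I - ξ) := by
    intro y hy hne
    have hpos : 0 < |y - ξ.im| := abs_pos.2 (sub_ne_zero.2 hne)
    refine integrable_horizontal (f := fun z => f z / (z - ξ)) (r := 2)
      (C := C * (1 + (1 + ‖ξ‖) / |y - ξ.im|)) one_lt_two ?_ fun t => ?_
    · refine (continuous_horizontal hf.continuousOn fun x => hsub _ (by simpa using hy)).div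
        (by fun_prop) fun t h => hne ?_
      have := congrArg Complex.im h
      simpa [sub_eq_zero] using this
    · have h1 := hb (t + y * I) (by simpa using hy)
      have h2 := inv_norm_sub_le (z := t + y * I) (ζ := ξ) hpos
        (by simpa using abs_im_sub_le_norm (t + y * I) ξ)
      rw [norm_div, div_eq_mul_inv, rpow_neg_two_eq (abs_nonneg _)]
      simp only [Complex.add_re, Complex.ofReal_re, Complex.mul_re, Complex.I_re, mul_zero,
        Complex.ofReal_im, Complex.I_im, mul_one, sub_self, add_zero] at h1 h2
      calc _ ≤ _ := mul_le_mul h1 h2 (by positivity) (by positivity)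
        _ = _ := by ring
  have hval : ∀ y ∈ Icc y₁ y₂, y ≠ ξ.im → ∫ t : ℝ, φ (t + y * I) =
      (∫ t : ℝ, f (t + y * I) / (t + y * I - ξ)) -
        f ξ * ∫ t : ℝ, (((t : ℂ) + y * I - ξ)⁻¹ - ((t : ℂ) + y * I - w)⁻¹) := by
    intro y hy hne
    have hφi : Integrable fun t : ℝ => φ (t + y * I) :=
      integrable_horizontal (C := M) one_lt_two
        (continuous_horizontal hφd.continuousOn fun x => hsub' _ (by simpa using hy))
        fun t => by simpa using hφb (t + y * I) (by simpa using hy)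
    rw [eq_sub_iff_add_eq, ← integral_const_mul]
    have he : ∀ t : ℝ, f ξ * (((t : ℂ) + y * I - ξ)⁻¹ - ((t : ℂ) + y * I - w)⁻¹) =
        f (t + y * I) / (t + y * I - ξ) - φ (t + y * I) := by
      intro t
      rw [hφeq _ (by simp; linarith [hy.1]) fun h => hne (by
        have := congrArg Complex.im h; simpa using this)]
      ring
    simp_rw [he]
    rw [integral_sub (hline y hy hne) hφi]
    ring
  rw [hval y₁ (left_mem_Icc.2 (h₁.trans h₂).le) h₁.ne,
    hval y₂ (right_mem_Icc.2 (h₁.trans h₂).le) h₂.ne'] at hshift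
  have hI1 : ∫ t : ℝ, (((t : ℂ) + y₁ * I - ξ)⁻¹ - ((t : ℂ) + y₁ * I - w)⁻¹) =
      2 * π * I := by
    rw [← integral_inv_sub_inv_conj (x := ξ.re) (sub_pos.2 h₁)]
    congr 1
    ext t
    congr 2
    · apply Complex.ext <;> simp
    · apply Complex.ext <;> simp [hw]; ring
  have hI2 : ∫ t : ℝ, (((t : ℂ) + y₂ * I - ξ)⁻¹ - ((t : ℂ) + y₂ * I - w)⁻¹) =
      0 := by
    rw [← integral_inv_sub_inv_eq_zero (ξ := ξ - y₂ * I) (w := w - y₂ * I)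
      (by simp; linarith) (by simp; linarith)]
    congr 1
    ext t
    congr 2 <;> ring
  rw [hI1, hI2] at hshift
  linear_combination hshift

end BimaterialStrip

namespace BimaterialStrip

/-! ### Entire functions of linear growth -/

theorem exists_affine_of_linear_growth {f : ℂ → ℂ} {C : ℝ} (hf : Differentiable ℂ f)
    (hb : ∀ z, ‖f z‖ ≤ C * (1 + ‖z‖)) : ∃ a b : ℂ, ∀ z, f z = a + b * z := by
  have hC : 0 ≤ C := by
    have := hb 0
    simp only [norm_zero, add_zero, mul_one] at this
    exact (norm_nonneg _).trans this
  have hd : Differentiable ℂ (dslope f 0) := by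
    rw [← differentiableOn_univ]
    exact (Complex.differentiableOn_dslope univ_mem).2 hf.differentiableOn
  obtain ⟨M, hM⟩ := (isCompact_closedBall (0 : ℂ) 1).exists_bound_of_continuousOn
    hd.continuous.continuousOn
  have hbd : Bornology.IsBounded (range (dslope f 0)) := by
    rw [isBounded_iff_forall_norm_le]
    refine ⟨max M (3 * C), ?_⟩
    rintro _ ⟨z, rfl⟩
    by_cases hz : ‖z‖ ≤ 1
    · exact (hM z (by simpa using hz)).trans (le_max_left _ _)
    · refine le_trans ?_ (le_max_right _ _)
      have hz' : 1 < ‖z‖ := not_le.1 hz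
      have hz0 : z ≠ 0 := fun h => by simp [h] at hz'; linarith
      rw [dslope_of_ne _ hz0, slope_def_field, sub_zero, norm_div, div_le_iff₀ (by linarith)]
      have h0 := hb 0
      simp only [norm_zero, add_zero, mul_one] at h0
      have := norm_sub_le (f z) (f 0)
      nlinarith [hb z]
  obtain ⟨b, hb'⟩ := hd.exists_const_forall_eq_of_bounded hbd
  refine ⟨f 0, b, fun z => ?_⟩
  have := sub_smul_dslope f 0 z
  rw [hb' z, sub_zero, smul_eq_mul] at this
  linear_combination -this

/-- Two functions holomorphic in overlapping half-planes which agree on the overlap and grow at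
most linearly are one and the same affine function. -/
theorem exists_affine_of_glue {f g : ℂ → ℂ} {γ s C : ℝ} (hs : 0 < s) (hsγ : s < γ)
    (hf : DifferentiableOn ℂ f {z | -γ < z.im}) (hg : DifferentiableOn ℂ g {z | z.im < 0})
    (hfg : ∀ z : ℂ, -γ < z.im → z.im < 0 → f z = g z)
    (hbf : ∀ z : ℂ, -s ≤ z.im → ‖f z‖ ≤ C * (1 + ‖z‖))
    (hbg : ∀ z : ℂ, z.im ≤ -s → ‖g z‖ ≤ C * (1 + ‖z‖)) :
    ∃ a b : ℂ, (∀ z : ℂ, -γ < z.im → f z = a + b * z) ∧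
      ∀ z : ℂ, z.im < 0 → g z = a + b * z := by
  classical
  set F : ℂ → ℂ := fun z => if -s ≤ z.im then f z else g z with hF
  have h1 : ∀ z : ℂ, -γ < z.im → F z = f z := by
    intro z hz
    by_cases h : -s ≤ z.im
    · simp [hF, h]
    · simp only [hF, h, if_false]
      exact (hfg z hz (by linarith [not_le.1 h])).symm
  have h2 : ∀ z : ℂ, z.im < 0 → F z = g z := by
    intro z hz
    by_cases h : -s ≤ z.im
    · simp only [hF, h, if_true]
      exact hfg z (by linarith) hz
    · simp [hF, h]
  have o1 : IsOpen {z : ℂ | -γ < z.im} := isOpen_lt continuous_const Complex.continuous_im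
  have o2 : IsOpen {z : ℂ | z.im < 0} := isOpen_lt Complex.continuous_im continuous_const
  have hd : Differentiable ℂ F := by
    intro z
    by_cases h : -γ < z.im
    · refine (hf.differentiableAt (o1.mem_nhds h)).congr_of_eventuallyEq ?_
      filter_upwards [o1.mem_nhds h] with w hw using h1 w hw
    · have h' : z.im < 0 := by linarith [not_lt.1 h]
      refine (hg.differentiableAt (o2.mem_nhds h')).congr_of_eventuallyEq ?_
      filter_upwards [o2.mem_nhds h'] with w hw using h2 w hw
  obtain ⟨a, b, hab⟩ := exists_affine_of_linear_growth (C := C) hd (fun z => by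
    by_cases h : -s ≤ z.im
    · simpa [hF, h] using hbf z h
    · simpa [hF, h] using hbg z (not_le.1 h).le)
  exact ⟨a, b, fun z hz => by rw [← h1 z hz, hab], fun z hz => by rw [← h2 z hz, hab]⟩

/-! ### One-sided transforms -/

theorem norm_cexp_I_mul (ξ : ℂ) (x : ℝ) :
    ‖cexp (I * ξ * x)‖ = exp (-ξ.im * x) := by
  rw [Complex.norm_exp]
  simp

theorem differentiableOn_transform {φ : ℝ → ℂ} {μ : Measure ℝ} {U : Set ℂ} (hU : IsOpen U)
    (hi : ∀ ξ ∈ U, Integrable (fun x : ℝ => φ x * cexp (I * ξ * x)) μ) :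
    DifferentiableOn ℂ (fun ξ => ∫ x : ℝ, φ x * cexp (I * ξ * x) ∂μ) U := by
  intro ξ₀ hξ₀
  obtain ⟨ε, hε, hball⟩ := Metric.isOpen_iff.1 hU ξ₀ hξ₀
  set δ := ε / 4 with hδ
  have hδ0 : 0 < δ := by positivity
  have hmem : ∀ t : ℝ, |t| < ε → ξ₀ + t * I ∈ U := fun t ht => hball (by
    simpa [Metric.mem_ball, dist_eq_norm] using ht)
  have hp := hi _ (hmem (2 * δ) (by rw [abs_of_pos (by positivity)]; linarith))
  have hm := hi _ (hmem (-(2 * δ)) (by rw [abs_neg, abs_of_pos (by positivity)]; linarith))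
  have hmeas : ∀ ξ ∈ U, AEStronglyMeasurable
      (fun x : ℝ => φ x * cexp (I * ξ * x)) μ := fun ξ h => (hi ξ h).1
  refine (hasDerivAt_integral_of_dominated_loc_of_deriv_le
    (F' := fun ξ x => φ x * (cexp (I * ξ * x) * (I * x)))
    (bound := fun x => 1 / δ * (‖φ x * cexp (I * (ξ₀ + (2 * δ : ℝ) * I) * x)‖ +
      ‖φ x * cexp (I * (ξ₀ + (-(2 * δ) : ℝ) * I) * x)‖))
    (Metric.ball_mem_nhds ξ₀ hδ0) ?_ (hi ξ₀ hξ₀) ?_ ?_ ((hp.norm.add hm.norm).const_mul _)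
    ?_).2.differentiableAt.differentiableWithinAt
  · filter_upwards [hU.mem_nhds hξ₀] with ξ h using hmeas ξ h
  · have : (fun x : ℝ => φ x * (cexp (I * ξ₀ * x) * (I * x))) =
        fun x : ℝ => (φ x * cexp (I * ξ₀ * x)) * (I * x) := by
      ext x; ring
    simp only [this]
    exact (hmeas ξ₀ hξ₀).mul (by fun_prop)
  · refine Eventually.of_forall fun x ξ hξ => ?_
    have him : |ξ.im - ξ₀.im| < δ := by
      rw [Metric.mem_ball, dist_eq_norm] at hξ
      exact (abs_im_sub_le_norm ξ ξ₀).trans_lt hξ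
    simp only [norm_mul, norm_cexp_I_mul, Complex.norm_I, one_mul, Complex.norm_real,
      norm_eq_abs, Complex.add_im, Complex.mul_im, Complex.ofReal_re, Complex.I_im, mul_one,
      Complex.ofReal_im, Complex.I_re, mul_zero, add_zero]
    have h1 : |x| ≤ 1 / δ * exp (δ * |x|) := by
      have := add_one_le_exp (δ * |x|)
      rw [one_div, inv_mul_eq_div, le_div_iff₀ hδ0]
      linarith
    have h2 : exp (-ξ.im * x) * exp (δ * |x|) ≤
        exp (-(ξ₀.im + 2 * δ) * x) + exp (-(ξ₀.im + -(2 * δ)) * x) := by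
      rw [← exp_add]
      rw [abs_lt] at him
      rcases le_total 0 x with hx | hx
      · refine le_trans (exp_le_exp.2 ?_) (le_add_of_nonneg_left (exp_pos _).le)
        rw [abs_of_nonneg hx]
        nlinarith
      · refine le_trans (exp_le_exp.2 ?_) (le_add_of_nonneg_right (exp_pos _).le)
        rw [abs_of_nonpos hx]
        nlinarith
    calc ‖φ x‖ * (exp (-ξ.im * x) * |x|)
        ≤ ‖φ x‖ * (exp (-ξ.im * x) * (1 / δ * exp (δ * |x|))) := by gcongr
      _ = 1 / δ * (‖φ x‖ * (exp (-ξ.im * x) * exp (δ * |x|))) := by ring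
      _ ≤ 1 / δ * (‖φ x‖ * (exp (-(ξ₀.im + 2 * δ) * x) +
          exp (-(ξ₀.im + -(2 * δ)) * x))) := by gcongr
      _ = _ := by ring
  · refine Eventually.of_forall fun x ξ _ => ?_
    have h1 : HasDerivAt (fun ξ : ℂ => I * ξ * x) (I * x) ξ := by
      simpa using ((hasDerivAt_id' ξ).const_mul I).mul_const (x : ℂ)
    exact (h1.cexp).const_mul (φ x)

/-- The right half-line transform `∫₀^∞ φ(x) exp(iξx) dx`. -/
noncomputable def rightTransform (φ : ℝ → ℂ) (ξ : ℂ) : ℂ :=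
  ∫ x in Ioi (0 : ℝ), φ x * cexp (I * ξ * x)

/-- The left half-line transform `∫_{-∞}^0 φ(x) exp(iξx) dx`. -/
noncomputable def leftTransform (φ : ℝ → ℂ) (ξ : ℂ) : ℂ :=
  ∫ x in Iio (0 : ℝ), φ x * cexp (I * ξ * x)

theorem norm_transform_le {φ : ℝ → ℂ} {C γ : ℝ} {ξ : ℂ} {x : ℝ}
    (hb : ‖φ x‖ ≤ C * exp (-γ * x)) :
    ‖φ x * cexp (I * ξ * x)‖ ≤ C * exp (-(γ + ξ.im) * x) := by
  rw [norm_mul, norm_cexp_I_mul]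
  calc _ ≤ C * exp (-γ * x) * exp (-ξ.im * x) := by gcongr
    _ = _ := by rw [mul_assoc, ← exp_add]; ring_nf

theorem integrableOn_right {φ : ℝ → ℂ} {C γ : ℝ} (hm : AEStronglyMeasurable φ (volume.restrict (Ioi 0)))
    (hb : ∀ x, 0 < x → ‖φ x‖ ≤ C * exp (-γ * x)) {ξ : ℂ} (hξ : -γ < ξ.im) :
    IntegrableOn (fun x : ℝ => φ x * cexp (I * ξ * x)) (Ioi 0) := by
  have h1 : IntegrableOn (fun x : ℝ => C * exp (-(γ + ξ.im) * x)) (Ioi 0) :=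
    (exp_neg_integrableOn_Ioi 0 (by linarith)).const_mul C
  refine Integrable.mono' h1 (hm.mul (by fun_prop)) ?_
  filter_upwards [ae_restrict_mem measurableSet_Ioi] with x hx
  exact norm_transform_le (hb x hx)

theorem norm_rightTransform_le {φ : ℝ → ℂ} {C γ : ℝ}
    (hb : ∀ x, 0 < x → ‖φ x‖ ≤ C * exp (-γ * x)) {ξ : ℂ} (hξ : -γ < ξ.im) :
    ‖rightTransform φ ξ‖ ≤ C / (γ + ξ.im) := by
  have hpos : 0 < γ + ξ.im := by linarith
  have h1 : IntegrableOn (fun x : ℝ => C * exp (-(γ + ξ.im) * x)) (Ioi 0) :=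
    (exp_neg_integrableOn_Ioi 0 hpos).const_mul C
  have h2 : ∫ x in Ioi (0 : ℝ), C * exp (-(γ + ξ.im) * x) = C / (γ + ξ.im) := by
    rw [integral_const_mul, integral_exp_mul_Ioi (by linarith), neg_div_neg_eq, mul_zero,
      exp_zero, mul_one_div]
  rw [← h2]
  refine norm_integral_le_of_norm_le h1 ?_
  filter_upwards [ae_restrict_mem measurableSet_Ioi] with x hx
  exact norm_transform_le (hb x hx)

theorem integrableOn_left {φ : ℝ → ℂ} {C γ : ℝ} (hm : AEStronglyMeasurable φ (volume.restrict (Iio 0)))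
    (hb : ∀ x, x < 0 → ‖φ x‖ ≤ C * exp (-γ * x)) {ξ : ℂ} (hξ : ξ.im < -γ) :
    IntegrableOn (fun x : ℝ => φ x * cexp (I * ξ * x)) (Iio 0) := by
  have h1 : IntegrableOn (fun x : ℝ => C * exp (-(γ + ξ.im) * x)) (Iio 0) :=
    ((integrableOn_exp_mul_Iic (by linarith) 0).mono_set Iio_subset_Iic_self).const_mul C
  refine Integrable.mono' h1 (hm.mul (by fun_prop)) ?_
  filter_upwards [ae_restrict_mem measurableSet_Iio] with x hx
  exact norm_transform_le (hb x hx)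

theorem norm_leftTransform_le {φ : ℝ → ℂ} {C γ : ℝ}
    (hb : ∀ x, x < 0 → ‖φ x‖ ≤ C * exp (-γ * x)) {ξ : ℂ} (hξ : ξ.im < -γ) :
    ‖leftTransform φ ξ‖ ≤ C / (-γ - ξ.im) := by
  have hpos : 0 < -(γ + ξ.im) := by linarith
  have h1 : IntegrableOn (fun x : ℝ => C * exp (-(γ + ξ.im) * x)) (Iio 0) :=
    ((integrableOn_exp_mul_Iic hpos 0).mono_set Iio_subset_Iic_self).const_mul C
  have h2 : ∫ x in Iio (0 : ℝ), C * exp (-(γ + ξ.im) * x) = C / (-γ - ξ.im) := by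
    rw [integral_const_mul, ← integral_Iic_eq_integral_Iio, integral_exp_mul_Iic hpos]
    simp [div_eq_mul_inv]
    ring_nf
    simp
  rw [← h2]
  refine norm_integral_le_of_norm_le h1 ?_
  filter_upwards [ae_restrict_mem measurableSet_Iio] with x hx
  exact norm_transform_le (hb x hx)

theorem differentiableOn_rightTransform {φ : ℝ → ℂ} {C γ : ℝ}
    (hm : AEStronglyMeasurable φ (volume.restrict (Ioi 0)))
    (hb : ∀ x, 0 < x → ‖φ x‖ ≤ C * exp (-γ * x)) :
    DifferentiableOn ℂ (rightTransform φ) {ξ | -γ < ξ.im} :=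
  differentiableOn_transform (isOpen_lt continuous_const Complex.continuous_im)
    fun _ hξ => integrableOn_right hm hb hξ

theorem differentiableOn_leftTransform {φ : ℝ → ℂ} {C γ : ℝ}
    (hm : AEStronglyMeasurable φ (volume.restrict (Iio 0)))
    (hb : ∀ x, x < 0 → ‖φ x‖ ≤ C * exp (-γ * x)) :
    DifferentiableOn ℂ (leftTransform φ) {ξ | ξ.im < -γ} :=
  differentiableOn_transform (isOpen_lt Complex.continuous_im continuous_const)
    fun _ hξ => integrableOn_left hm hb hξ

/-! ### Fourier inversion in the normalisation `∫ φ(x) exp(iξx) dx` -/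

theorem fourier_eq_transform (φ : ℝ → ℂ) (w : ℝ) :
    FourierTransform.fourier φ w =
      ∫ x : ℝ, φ x * cexp (I * ((-(2 * π * w) : ℝ) : ℂ) * x) := by
  rw [fourier_real_eq_integral_exp_smul]
  congr 1
  ext x
  rw [smul_eq_mul, mul_comm]
  congr 2
  push_cast
  ring

theorem eq_zero_of_transform_eq_zero {φ : ℝ → ℂ} (hi : Integrable φ)
    (h : ∀ t : ℝ, ∫ x : ℝ, φ x * cexp (I * t * x) = 0) {v : ℝ}
    (hv : ContinuousAt φ v) : φ v = 0 := by
  have h0 : FourierTransform.fourier φ = fun _ : ℝ => (0 : ℂ) := by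
    ext w
    rw [fourier_eq_transform, h]
  have := hi.fourierInv_fourier_eq (by rw [h0]; exact integrable_zero _ _ _) hv
  rw [← this, h0, fourierInv_eq']
  simp

theorem eq_zero_of_rightTransform_eq_zero {φ : ℝ → ℂ} {C γ : ℝ} (hγ : 0 < γ)
    (hc : ContinuousOn φ (Ioi 0)) (hb : ∀ x, 0 < x → ‖φ x‖ ≤ C * exp (-γ * x))
    (h : ∀ t : ℝ, rightTransform φ t = 0) : ∀ x, 0 < x → φ x = 0 := by
  intro x hx
  have hm := hc.aestronglyMeasurable (μ := volume) measurableSet_Ioi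
  have hi : Integrable ((Ioi (0 : ℝ)).indicator φ) := by
    rw [integrable_indicator_iff measurableSet_Ioi]
    have := integrableOn_right (ξ := 0) hm hb (by simpa using hγ)
    simpa using this
  have h0 := eq_zero_of_transform_eq_zero hi (fun t => by
    rw [← h t, rightTransform, ← integral_indicator measurableSet_Ioi]
    congr 1
    ext y
    by_cases hy : y ∈ Ioi (0 : ℝ) <;> simp [hy]) (v := x) (by
      refine (hc.continuousAt (Ioi_mem_nhds hx)).congr ?_
      filter_upwards [Ioi_mem_nhds hx] with y hy
      simp [indicator_of_mem hy])
  rwa [indicator_of_mem (show x ∈ Ioi (0 : ℝ) from hx)] at h0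

end BimaterialStrip

namespace BimaterialStrip

/-! ### Cauchy integrals over horizontal lines -/

/-- Holomorphic in the strip `|Im z| < g`, and `O(1/|z|)` there, locally uniformly in `Im z`. -/
structure StripDecay (f : ℂ → ℂ) (g : ℝ) : Prop where
  diff : DifferentiableOn ℂ f {z | |z.im| < g}
  bound : ∀ β, β < g → ∃ C, 0 < C ∧ ∀ z : ℂ, |z.im| ≤ β → ‖f z‖ ≤ C * (1 + |z.re|)⁻¹

/-- The Cauchy integral of `f` over the line `Im z = y`. -/
noncomputable def lineCauchy (f : ℂ → ℂ) (y : ℝ) (ξ : ℂ) : ℂ :=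
  ∫ t : ℝ, f (t + y * I) / (t + y * I - ξ)

variable {f : ℂ → ℂ} {g : ℝ}

theorem isOpen_strip (g : ℝ) : IsOpen {z : ℂ | |z.im| < g} :=
  isOpen_lt (continuous_abs.comp Complex.continuous_im) continuous_const

theorem StripDecay.continuous_line (hf : StripDecay f g) {y : ℝ} (hy : |y| < g) :
    Continuous fun t : ℝ => f (t + y * I) :=
  continuous_horizontal hf.diff.continuousOn fun x => by simpa using hy

theorem line_sub_ne {y t : ℝ} {ξ : ℂ} (h : ξ.im ≠ y) : (t + y * I - ξ : ℂ) ≠ 0 := by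
  intro h0
  have := congrArg Complex.im h0
  simp [sub_eq_zero] at this
  exact h this.symm

theorem le_norm_line_sub (y t : ℝ) (ξ : ℂ) : |ξ.im - y| ≤ ‖(t + y * I - ξ : ℂ)‖ := by
  have := abs_im_sub_le_norm (t + y * I) ξ
  rw [abs_sub_comm]
  simpa using this

theorem StripDecay.bound_line (hf : StripDecay f g) {y : ℝ} (hy : |y| < g) :
    ∃ C, 0 < C ∧ ∀ t : ℝ, ‖f (t + y * I)‖ ≤ C * (1 + |t|)⁻¹ := by
  obtain ⟨C, hC, h⟩ := hf.bound |y| hy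
  exact ⟨C, hC, fun t => by simpa using h (t + y * I) (by simp)⟩

theorem StripDecay.bound_line_div (hf : StripDecay f g) {y : ℝ} (hy : |y| < g) {ξ : ℂ}
    (h : ξ.im ≠ y) : ∃ C, 0 < C ∧ ∀ t : ℝ,
      ‖f (t + y * I)‖ * ‖(t + y * I - ξ : ℂ)‖⁻¹ ≤ C * (1 + |t|) ^ (-2 : ℝ) := by
  obtain ⟨C, hC, hb⟩ := hf.bound_line hy
  have hpos : 0 < |ξ.im - y| := abs_pos.2 (sub_ne_zero.2 h)
  refine ⟨C * (1 + (1 + ‖ξ‖) / |ξ.im - y|), by positivity, fun t => ?_⟩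
  have h2 := inv_norm_sub_le (z := t + y * I) (ζ := ξ) hpos (le_norm_line_sub y t ξ)
  simp only [Complex.add_re, Complex.ofReal_re, Complex.mul_re, Complex.I_re, mul_zero,
    Complex.ofReal_im, Complex.I_im, mul_one, sub_self, add_zero] at h2
  rw [rpow_neg_two_eq (abs_nonneg _)]
  calc _ ≤ _ := mul_le_mul (hb t) h2 (by positivity) (by positivity)
    _ = _ := by ring

theorem StripDecay.integrable_line (hf : StripDecay f g) {y : ℝ} (hy : |y| < g) {ξ : ℂ}
    (h : ξ.im ≠ y) :
    Integrable fun t : ℝ => f (t + y * I) / (t + y * I - ξ) := by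
  obtain ⟨C, _, hb⟩ := hf.bound_line_div hy h
  refine integrable_horizontal (f := fun z => f z / (z - ξ)) (C := C) one_lt_two
    ((hf.continuous_line hy).div (by fun_prop) fun t => line_sub_ne h) fun t => ?_
  rw [norm_div, div_eq_mul_inv]
  exact hb t

theorem StripDecay.hasDerivAt_lineCauchy (hf : StripDecay f g) {y : ℝ} (hy : |y| < g) {ξ : ℂ}
    (h : ξ.im ≠ y) : HasDerivAt (lineCauchy f y)
      (∫ t : ℝ, f (t + y * I) / (t + y * I - ξ) ^ 2) ξ := by
  set δ := |ξ.im - y| / 2 with hδ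
  have hδ0 : 0 < δ := by positivity
  have hball : ∀ ζ ∈ Metric.ball ξ δ, δ ≤ |ζ.im - y| ∧ ‖ζ - ξ‖ < δ := by
    intro ζ hζ
    rw [Metric.mem_ball, dist_eq_norm] at hζ
    have h1 := (abs_im_sub_le_norm ζ ξ).trans hζ.le
    have h2 := abs_sub_abs_le_abs_sub (ξ.im - y) (ξ.im - ζ.im)
    rw [abs_sub_comm ξ.im ζ.im] at h2
    have h3 : ξ.im - y - (ξ.im - ζ.im) = ζ.im - y := by ring
    rw [h3] at h2
    exact ⟨by linarith, hζ⟩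
  have hne : ∀ ζ ∈ Metric.ball ξ δ, ζ.im ≠ y := fun ζ hζ h0 => by
    have := (hball ζ hζ).1
    rw [h0, sub_self, abs_zero] at this
    linarith
  obtain ⟨C, hC, hb⟩ := hf.bound_line_div hy h
  refine (hasDerivAt_integral_of_dominated_loc_of_deriv_le
    (F' := fun ζ (t : ℝ) => f (t + y * I) / (t + y * I - ζ) ^ 2)
    (bound := fun t => 2 / δ * (C * (1 + ‖t‖) ^ (-2 : ℝ)))
    (Metric.ball_mem_nhds ξ hδ0) ?_ (hf.integrable_line hy h) ?_ ?_
    (((integrable_one_add_norm (by simp)).const_mul C).const_mul _) ?_).2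
  · filter_upwards [Metric.ball_mem_nhds ξ hδ0] with ζ hζ
    exact (hf.integrable_line hy (hne ζ hζ)).1
  · exact ((hf.continuous_line hy).div (by fun_prop) fun t =>
      pow_ne_zero 2 (line_sub_ne h)).aestronglyMeasurable
  · refine Eventually.of_forall fun t ζ hζ => ?_
    set z : ℂ := t + y * I with hz
    have h1 : δ ≤ ‖z - ζ‖ := (hball ζ hζ).1.trans (le_norm_line_sub y t ζ)
    have h2 : 2 * δ ≤ ‖z - ξ‖ := by
      have := le_norm_line_sub y t ξ
      rw [hδ]; linarith
    have h3 : ‖z - ξ‖ ≤ 2 * ‖z - ζ‖ := by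
      have e : z - ξ = (z - ζ) + (ζ - ξ) := by ring
      have := norm_add_le (z - ζ) (ζ - ξ)
      rw [← e] at this
      linarith [(hball ζ hζ).2]
    have h4 : 0 < ‖z - ζ‖ := hδ0.trans_le h1
    have h5 : 0 < ‖z - ξ‖ := by linarith
    rw [norm_div, norm_pow]
    calc ‖f z‖ / ‖z - ζ‖ ^ 2 = ‖f z‖ * (‖z - ζ‖⁻¹ * ‖z - ζ‖⁻¹) := by field_simp
      _ ≤ ‖f z‖ * ((2 * ‖z - ξ‖⁻¹) * δ⁻¹) := by
        gcongr
        rw [inv_le_comm₀ h4 (by positivity), mul_inv, inv_inv]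
        linarith
      _ = 2 / δ * (‖f z‖ * ‖z - ξ‖⁻¹) := by ring
      _ ≤ _ := mul_le_mul_of_nonneg_left (by simpa only [norm_eq_abs] using hb t)
        (by positivity)
  · refine Eventually.of_forall fun t ζ hζ => ?_
    have h0 := line_sub_ne (t := t) (hne ζ hζ)
    have h1 : HasDerivAt (fun ζ : ℂ => (t + y * I - ζ)) (-1) ζ := by
      simpa using (hasDerivAt_id' ζ).const_sub (t + y * I)
    have h2 := (h1.fun_inv h0).const_mul (f (t + y * I))
    exact (h2.congr_deriv (by ring)).congr_of_eventuallyEq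
      (Eventually.of_forall fun ζ => div_eq_mul_inv _ _)

theorem StripDecay.lineCauchy_sub (hf : StripDecay f g) {y₁ y₂ : ℝ} (h1 : -g < y₁) (h2 : y₂ < g)
    {ξ : ℂ} (h₁ : y₁ < ξ.im) (h₂ : ξ.im < y₂) :
    lineCauchy f y₁ ξ - lineCauchy f y₂ ξ = 2 * π * I * f ξ := by
  obtain ⟨C, _, hC⟩ := hf.bound (max |y₁| |y₂|)
    (max_lt (abs_lt.2 ⟨h1, by linarith⟩) (abs_lt.2 ⟨by linarith, h2⟩))
  refine cauchy_strip (isOpen_strip g) hf.diff (C := C) (fun z hz => ?_) (fun z hz => hC z ?_) h₁ h₂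
  · change |z.im| < g
    exact abs_lt.2 ⟨by linarith [hz.1], by linarith [hz.2]⟩
  · exact abs_le_max_abs_abs hz.1 hz.2

theorem StripDecay.lineCauchy_eq (hf : StripDecay f g) {y₁ y₂ : ℝ} (h1 : -g < y₁) (h2 : y₂ < g)
    (h12 : y₁ ≤ y₂) {ξ : ℂ} (hξ : ξ.im < y₁ ∨ y₂ < ξ.im) :
    lineCauchy f y₁ ξ = lineCauchy f y₂ ξ := by
  obtain ⟨C, hC0, hC⟩ := hf.bound (max |y₁| |y₂|)
    (max_lt (abs_lt.2 ⟨h1, by linarith⟩) (abs_lt.2 ⟨by linarith, h2⟩))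
  obtain ⟨δ, hδ, hd⟩ : ∃ δ > 0, ∀ z : ℂ, z.im ∈ Icc y₁ y₂ → δ ≤ ‖z - ξ‖ := by
    rcases hξ with h | h
    · refine ⟨y₁ - ξ.im, by linarith, fun z hz => le_trans ?_ (abs_im_sub_le_norm z ξ)⟩
      exact (sub_le_sub_right hz.1 _).trans (le_abs_self _)
    · refine ⟨ξ.im - y₂, by linarith, fun z hz => le_trans ?_ (abs_im_sub_le_norm z ξ)⟩
      rw [abs_sub_comm]
      exact (sub_le_sub_left hz.2 _).trans (le_abs_self _)
  refine integral_horizontal_eq (f := fun z => f z / (z - ξ))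
    (C := C * (1 + (1 + ‖ξ‖) / δ)) h12 one_lt_two ?_ fun z hz => ?_
  · intro z hz
    have hz' : z - ξ ≠ 0 := norm_pos_iff.1 (hδ.trans_le (hd z hz))
    have hzg : |z.im| < g := abs_lt.2 ⟨by linarith [hz.1], by linarith [hz.2]⟩
    have : DifferentiableAt ℂ f z := hf.diff.differentiableAt ((isOpen_strip g).mem_nhds hzg)
    exact (this.div (differentiableAt_id.sub_const ξ) hz').differentiableWithinAt
  · rw [norm_div, div_eq_mul_inv, rpow_neg_two_eq (abs_nonneg _)]
    calc _ ≤ _ := mul_le_mul (hC z (abs_le_max_abs_abs hz.1 hz.2)) (inv_norm_sub_le hδ (hd z hz))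
          (by positivity) (by positivity)
      _ = _ := by ring

theorem sqrt_add_mul_inv_le {τ d : ℝ} (hτ : 0 < τ) (hd : 0 < d) :
    (τ + d) ^ (1 / 2 : ℝ) * (τ⁻¹ * d⁻¹) ≤ 2 * (τ ^ (-(3 / 2) : ℝ) + d ^ (-(3 / 2) : ℝ)) := by
  have key : ∀ m M : ℝ, 0 < m → m ≤ M →
      (m + M) ^ (1 / 2 : ℝ) * (m⁻¹ * M⁻¹) ≤ 2 * m ^ (-(3 / 2) : ℝ) := by
    intro m M hm hmM
    have hM : 0 < M := hm.trans_le hmM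
    have h1 : (m + M) ^ (1 / 2 : ℝ) ≤ 2 * M ^ (1 / 2 : ℝ) := by
      have h4 : (4 : ℝ) ^ (1 / 2 : ℝ) = 2 := by
        rw [show (4 : ℝ) = 2 ^ (2 : ℝ) by norm_num, ← rpow_mul (by norm_num)]; norm_num
      calc (m + M) ^ (1 / 2 : ℝ) ≤ (4 * M) ^ (1 / 2 : ℝ) :=
            rpow_le_rpow (by linarith) (by linarith) (by norm_num)
        _ = _ := by rw [mul_rpow (by norm_num) hM.le, h4]
    have h2 : M ^ (1 / 2 : ℝ) * M⁻¹ = M ^ (-(1 / 2) : ℝ) := by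
      rw [← rpow_neg_one M, ← rpow_add hM]; norm_num
    have h3 : M ^ (-(1 / 2) : ℝ) ≤ m ^ (-(1 / 2) : ℝ) :=
      rpow_le_rpow_of_nonpos hm hmM (by norm_num)
    have h5 : m ^ (-(1 / 2) : ℝ) * m⁻¹ = m ^ (-(3 / 2) : ℝ) := by
      rw [← rpow_neg_one m, ← rpow_add hm]; norm_num
    calc _ ≤ 2 * M ^ (1 / 2 : ℝ) * (m⁻¹ * M⁻¹) := by gcongr
      _ = 2 * (M ^ (1 / 2 : ℝ) * M⁻¹) * m⁻¹ := by ring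
      _ ≤ 2 * m ^ (-(1 / 2) : ℝ) * m⁻¹ := by rw [h2]; gcongr
      _ = _ := by rw [mul_assoc, h5]
  rcases le_total τ d with h | h
  · refine (key τ d hτ h).trans ?_
    have : 0 < d ^ (-(3 / 2) : ℝ) := by positivity
    linarith
  · have := key d τ hd h
    rw [add_comm, mul_comm τ⁻¹]
    refine this.trans ?_
    have : 0 < τ ^ (-(3 / 2) : ℝ) := by positivity
    linarith

theorem StripDecay.exists_lineCauchy_le (hf : StripDecay f g) {y δ : ℝ} (hy : |y| < g) (hδ : 0 < δ) :
    ∃ C, 0 < C ∧ ∀ ξ : ℂ, δ ≤ |ξ.im - y| →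
      ‖lineCauchy f y ξ‖ ≤ C * (1 + ‖ξ‖) ^ (-(1 / 2) : ℝ) := by
  obtain ⟨C, hC, hb⟩ := hf.bound_line hy
  set J : ℝ := ∫ t : ℝ, (1 + ‖t‖) ^ (-(3 / 2) : ℝ) with hJ
  have hJi : Integrable fun t : ℝ => (1 + ‖t‖) ^ (-(3 / 2) : ℝ) :=
    integrable_one_add_norm (by norm_num)
  set K : ℝ := (1 + |y|) ^ (1 / 2 : ℝ) with hK
  set D : ℝ := (1 + 1 / δ) ^ (3 / 2 : ℝ) with hD
  refine ⟨C * K * (2 * (J + D * J)) + 1, by positivity, fun ξ hξ => ?_⟩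
  have hpt : ∀ t : ℝ, ‖f (t + y * I) / (t + y * I - ξ)‖ ≤
      C * K * (2 * ((1 + ‖t‖) ^ (-(3 / 2) : ℝ) + D * (1 + ‖t - ξ.re‖) ^ (-(3 / 2) : ℝ))) *
        (1 + ‖ξ‖) ^ (-(1 / 2) : ℝ) := by
    intro t
    set z : ℂ := t + y * I with hz
    set d := ‖z - ξ‖ with hd
    have hdδ : δ ≤ d := hξ.trans (le_norm_line_sub y t ξ)
    have hd0 : 0 < d := hδ.trans_le hdδ
    have hzn : ‖z‖ ≤ |t| + |y| := by
      refine (norm_add_le _ _).trans ?_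
      simp
    have h1 : 1 + ‖ξ‖ ≤ (1 + |y|) * ((1 + |t|) + d) := by
      have e : ξ = z - (z - ξ) := by ring
      have h2 : ‖ξ‖ ≤ ‖z‖ + d := by
        conv_lhs => rw [e]
        exact norm_sub_le _ _
      nlinarith [abs_nonneg y, abs_nonneg t, mul_nonneg (abs_nonneg y) (abs_nonneg t),
        mul_nonneg (abs_nonneg y) hd0.le]
    have h2 : (1 + ‖ξ‖) ^ (1 / 2 : ℝ) ≤ K * ((1 + |t|) + d) ^ (1 / 2 : ℝ) := by
      rw [hK, ← mul_rpow (by positivity) (by positivity)]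
      exact rpow_le_rpow (by positivity) h1 (by norm_num)
    have h3 : d ^ (-(3 / 2) : ℝ) ≤ D * (1 + ‖t - ξ.re‖) ^ (-(3 / 2) : ℝ) := by
      have h4 : 1 + ‖t - ξ.re‖ ≤ (1 + 1 / δ) * d := by
        have h5 : ‖t - ξ.re‖ ≤ d := by
          have := Complex.abs_re_le_norm (z - ξ)
          simpa [hz] using this
        have h6 : 1 ≤ 1 / δ * d := by
          rw [one_div, inv_mul_eq_div, le_div_iff₀ hδ]; linarith
        linarith
      rw [rpow_neg hd0.le, rpow_neg (by positivity), ← div_eq_mul_inv,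
        inv_eq_one_div, div_le_div_iff₀ (by positivity) (by positivity), one_mul, hD,
        ← mul_rpow (by positivity) hd0.le]
      exact rpow_le_rpow (by positivity) h4 (by norm_num)
    have h7 := sqrt_add_mul_inv_le (τ := 1 + |t|) (by positivity) hd0
    rw [rpow_neg (by positivity : (0 : ℝ) ≤ 1 + ‖ξ‖), ← div_eq_mul_inv,
      le_div_iff₀ (by positivity), norm_div, div_eq_mul_inv]
    calc ‖f z‖ * d⁻¹ * (1 + ‖ξ‖) ^ (1 / 2 : ℝ)
        ≤ (C * (1 + |t|)⁻¹) * d⁻¹ * (K * ((1 + |t|) + d) ^ (1 / 2 : ℝ)) := by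
          gcongr
          exact hb t
      _ = C * K * (((1 + |t|) + d) ^ (1 / 2 : ℝ) * ((1 + |t|)⁻¹ * d⁻¹)) := by ring
      _ ≤ C * K * (2 * ((1 + |t|) ^ (-(3 / 2) : ℝ) + d ^ (-(3 / 2) : ℝ))) := by gcongr
      _ ≤ C * K * (2 * ((1 + ‖t‖) ^ (-(3 / 2) : ℝ) + D * (1 + ‖t - ξ.re‖) ^ (-(3 / 2) : ℝ))) :=
          mul_le_mul_of_nonneg_left (mul_le_mul_of_nonneg_left (add_le_add le_rfl h3)
            zero_le_two) (by positivity)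
  have hi2 : Integrable fun t : ℝ => (1 + ‖t - ξ.re‖) ^ (-(3 / 2) : ℝ) :=
    hJi.comp_sub_right ξ.re
  have hint := (((hJi.add (hi2.const_mul D)).const_mul 2).const_mul (C * K)).mul_const
    ((1 + ‖ξ‖) ^ (-(1 / 2) : ℝ))
  have h8 := norm_integral_le_of_norm_le hint (Eventually.of_forall hpt)
  refine h8.trans ?_
  rw [integral_mul_const, integral_const_mul, integral_const_mul]
  have h9 : ∫ t : ℝ, ((fun t : ℝ => (1 + ‖t‖) ^ (-(3 / 2) : ℝ)) +
      fun t : ℝ => D * (1 + ‖t - ξ.re‖) ^ (-(3 / 2) : ℝ)) t = J + D * J := by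
    simp only [Pi.add_apply]
    rw [integral_add hJi (hi2.const_mul D), integral_const_mul,
      integral_sub_right_eq_self (fun t : ℝ => (1 + ‖t‖) ^ (-(3 / 2) : ℝ)) ξ.re]
  rw [h9]
  gcongr
  linarith

theorem lineCauchy_neg_of_even (hf : ∀ z, f (-z) = f z) (y : ℝ) (ξ : ℂ) :
    lineCauchy f y (-ξ) = -lineCauchy f (-y) ξ := by
  rw [lineCauchy, lineCauchy, ← integral_neg, ← integral_neg_eq_self]
  congr 1
  ext t
  have e : ((-t : ℝ) + y * I : ℂ) = -(t + ((-y : ℝ) : ℂ) * I) := by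
    push_cast; ring
  rw [e, hf, ← div_neg]
  congr 1
  ring

theorem conj_lineCauchy {y : ℝ}
    (hf : ∀ z : ℂ, z.im = y → f (starRingEnd ℂ z) = starRingEnd ℂ (f z)) (ξ : ℂ) :
    starRingEnd ℂ (lineCauchy f y ξ) = lineCauchy f (-y) (starRingEnd ℂ ξ) := by
  rw [lineCauchy, lineCauchy, ← integral_conj]
  congr 1
  ext t
  rw [map_div₀, ← hf _ (by simp)]
  simp

end BimaterialStrip

namespace BimaterialStrip

/-! ### The entire quotient `z coth z` -/

/-- `sinh z / z`, with its removable singularity removed. -/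
noncomputable def sinhc (z : ℂ) : ℂ := dslope Complex.sinh 0 z

/-- `z coth z`, with the removable singularity at `0` removed. -/
noncomputable def zcoth (z : ℂ) : ℂ := Complex.cosh z / sinhc z

theorem sinhc_zero : sinhc 0 = 1 := by simp [sinhc, dslope_same]

theorem sinhc_of_ne {z : ℂ} (hz : z ≠ 0) : sinhc z = Complex.sinh z / z := by
  rw [sinhc, dslope_of_ne _ hz, slope_def_field, Complex.sinh_zero, sub_zero, sub_zero]

theorem differentiable_sinhc : Differentiable ℂ sinhc := by
  rw [← differentiableOn_univ]
  exact (Complex.differentiableOn_dslope univ_mem).2 Complex.differentiable_sinh.differentiableOn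

theorem zcoth_zero : zcoth 0 = 1 := by simp [zcoth, sinhc_zero]

theorem zcoth_of_ne {z : ℂ} (hz : z ≠ 0) : zcoth z = z * coth z := by
  rw [zcoth, sinhc_of_ne hz, coth, div_div_eq_mul_div]
  ring

theorem zcoth_neg (z : ℂ) : zcoth (-z) = zcoth z := by
  by_cases hz : z = 0
  · simp [hz]
  · rw [zcoth_of_ne hz, zcoth_of_ne (neg_ne_zero.2 hz), coth, coth, Complex.cosh_neg,
      Complex.sinh_neg, div_neg]
    ring

theorem zcoth_conj (z : ℂ) : zcoth (starRingEnd ℂ z) = starRingEnd ℂ (zcoth z) := by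
  by_cases hz : z = 0
  · simp [hz, zcoth_zero]
  · rw [zcoth_of_ne hz, zcoth_of_ne (by simpa using hz), coth, coth, Complex.cosh_conj,
      Complex.sinh_conj, map_mul, map_div₀]

theorem normSq_sinh (z : ℂ) :
    Complex.normSq (Complex.sinh z) = sinh z.re ^ 2 + sin z.im ^ 2 := by
  have h : Complex.sinh z = (sinh z.re * cos z.im : ℝ) +
      (cosh z.re * sin z.im : ℝ) * I := by
    conv_lhs => rw [← Complex.re_add_im z]
    rw [Complex.sinh_add, Complex.sinh_mul_I, Complex.cosh_mul_I]
    push_cast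
    ring
  rw [h, Complex.normSq_add_mul_I]
  have h1 := cosh_sq z.re
  have h2 := sin_sq_add_cos_sq z.im
  nlinarith

theorem normSq_cosh (z : ℂ) :
    Complex.normSq (Complex.cosh z) = sinh z.re ^ 2 + cos z.im ^ 2 := by
  have h : Complex.cosh z = (cosh z.re * cos z.im : ℝ) +
      (sinh z.re * sin z.im : ℝ) * I := by
    conv_lhs => rw [← Complex.re_add_im z]
    rw [Complex.cosh_add, Complex.sinh_mul_I, Complex.cosh_mul_I]
    push_cast
    ring
  rw [h, Complex.normSq_add_mul_I]
  have h1 := cosh_sq z.re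
  have h2 := sin_sq_add_cos_sq z.im
  nlinarith

theorem sinh_ne_zero_of_re {z : ℂ} (h : z.re ≠ 0) : Complex.sinh z ≠ 0 := by
  rw [← Complex.normSq_pos, normSq_sinh]
  have : sinh z.re ≠ 0 := fun h0 => h (sinh_eq_zero.1 h0)
  positivity

theorem sinh_ne_zero {z : ℂ} (hz : z ≠ 0) (h : |z.im| < π) : Complex.sinh z ≠ 0 := by
  by_cases hr : z.re = 0
  · have him : z.im ≠ 0 := fun h0 => hz (Complex.ext hr h0)
    have hs : sin z.im ≠ 0 := fun h0 => him (by
      rw [abs_lt] at h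
      exact (sin_eq_zero_iff_of_lt_of_lt h.1 h.2).1 h0)
    rw [← Complex.normSq_pos, normSq_sinh]
    positivity
  · exact sinh_ne_zero_of_re hr

theorem sinhc_ne_zero {z : ℂ} (h : |z.im| < π) : sinhc z ≠ 0 := by
  by_cases hz : z = 0
  · simp [hz, sinhc_zero]
  · rw [sinhc_of_ne hz]
    exact div_ne_zero (sinh_ne_zero hz h) hz

theorem differentiableAt_zcoth {z : ℂ} (h : |z.im| < π) : DifferentiableAt ℂ zcoth z :=
  Complex.differentiable_cosh.differentiableAt.div differentiable_sinhc.differentiableAt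
    (sinhc_ne_zero h)

theorem zcoth_im_pos {z : ℂ} (h : 0 < z.re * z.im) : 0 < (zcoth z).im := by
  wlog hre : 0 < z.re generalizing z
  · have h1 : z.re < 0 := by
      rcases lt_or_eq_of_le (not_lt.1 hre) with h2 | h2
      · exact h2
      · simp [h2] at h
    have := this (z := -z) (by simpa using h) (by simpa using h1)
    rwa [zcoth_neg] at this
  have him : 0 < z.im := (mul_pos_iff_of_pos_left hre).1 h
  have hz : z ≠ 0 := fun h0 => by simp [h0] at hre
  have hs := sinh_ne_zero_of_re hre.ne'
  rw [zcoth_of_ne hz, coth]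
  have e : z * (Complex.cosh z / Complex.sinh z) =
      z * (Complex.cosh z * starRingEnd ℂ (Complex.sinh z)) /
        (Complex.normSq (Complex.sinh z) : ℂ) := by
    rw [Complex.normSq_eq_conj_mul_self]
    have : starRingEnd ℂ (Complex.sinh z) ≠ 0 := by simpa using hs
    field_simp
  have e2 : Complex.cosh z * starRingEnd ℂ (Complex.sinh z) =
      ((sinh z.re * cosh z.re : ℝ) : ℂ) -
        ((sin z.im * cos z.im : ℝ) : ℂ) * I := by
    have hc : Complex.cosh z = (cosh z.re * cos z.im : ℝ) +
        (sinh z.re * sin z.im : ℝ) * I := by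
      conv_lhs => rw [← Complex.re_add_im z]
      rw [Complex.cosh_add, Complex.sinh_mul_I, Complex.cosh_mul_I]
      push_cast; ring
    have hsn : Complex.sinh z = (sinh z.re * cos z.im : ℝ) +
        (cosh z.re * sin z.im : ℝ) * I := by
      conv_lhs => rw [← Complex.re_add_im z]
      rw [Complex.sinh_add, Complex.sinh_mul_I, Complex.cosh_mul_I]
      push_cast; ring
    have h1 := cosh_sq z.re
    have h2 := sin_sq_add_cos_sq z.im
    rw [hc, hsn]
    generalize sinh z.re = A at *
    generalize cosh z.re = B at *
    generalize sin z.im = S at *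
    generalize cos z.im = T at *
    apply Complex.ext
    · simp
      linear_combination (A * B) * h2
    · simp
      linear_combination (-(S * T)) * h1
  rw [e, e2, Complex.div_ofReal_im]
  refine div_pos ?_ (Complex.normSq_pos.2 hs)
  have h3 : z.re < sinh z.re := self_lt_sinh_iff.2 hre
  have h4 : 1 ≤ cosh z.re := one_le_cosh _
  have h5 : sin z.im * cos z.im < z.im := by
    have := sin_lt (x := 2 * z.im) (by linarith)
    rw [sin_two_mul] at this
    linarith
  have h6 : z.re < sinh z.re * cosh z.re := by nlinarith
  have h7 := mul_lt_mul_of_pos_left h6 him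
  have h8 := mul_lt_mul_of_pos_left h5 hre
  generalize sinh z.re * cosh z.re = A at *
  generalize sin z.im * cos z.im = B at *
  simp
  linarith

theorem zcoth_ofReal_pos (x : ℝ) : ∃ r : ℝ, 0 < r ∧ zcoth x = r := by
  by_cases hx : x = 0
  · exact ⟨1, one_pos, by simp [hx, zcoth_zero]⟩
  · refine ⟨x * (cosh x / sinh x), ?_, ?_⟩
    · rw [← mul_div_assoc]
      rcases lt_or_gt_of_ne hx with h | h
      · exact div_pos_of_neg_of_neg (mul_neg_of_neg_of_pos h (cosh_pos x))
          (sinh_neg_iff.2 h)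
      · exact div_pos (mul_pos h (cosh_pos x)) (sinh_pos_iff.2 h)
    · rw [zcoth_of_ne (by exact_mod_cast hx), coth]
      push_cast
      rfl

theorem norm_zcoth_le {z : ℂ} (h : 1 ≤ |z.re|) : ‖zcoth z‖ ≤ 2 * ‖z‖ := by
  have hre : z.re ≠ 0 := fun h0 => by rw [h0] at h; simp at h; linarith
  have hz : z ≠ 0 := fun h0 => hre (by simp [h0])
  have hs := sinh_ne_zero_of_re hre
  rw [zcoth_of_ne hz, coth, norm_mul, norm_div, mul_comm]
  refine mul_le_mul_of_nonneg_right ?_ (norm_nonneg _)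
  rw [div_le_iff₀ (norm_pos_iff.2 hs)]
  refine le_of_sq_le_sq ?_ (by positivity)
  rw [mul_pow, ← Complex.normSq_eq_norm_sq, ← Complex.normSq_eq_norm_sq, normSq_cosh, normSq_sinh]
  have h1 : 1 ≤ sinh z.re ^ 2 := by
    have h2 : |z.re| ≤ sinh |z.re| := self_le_sinh_iff.2 (abs_nonneg _)
    rw [← abs_sinh] at h2
    rw [← sq_abs]
    nlinarith
  nlinarith [cos_sq_le_one z.im, sq_nonneg (sin z.im)]

/-! ### The function `b cot b` -/

theorem zcoth_mul_I {b : ℝ} (hb : b ≠ 0) :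
    zcoth (b * I) = ((b * cos b / sin b : ℝ) : ℂ) := by
  rw [zcoth_of_ne (mul_ne_zero (by exact_mod_cast hb) Complex.I_ne_zero), coth,
    Complex.cosh_mul_I, Complex.sinh_mul_I]
  push_cast
  have := Complex.I_ne_zero
  field_simp

theorem hasDerivAt_bcot {b : ℝ} (hb : sin b ≠ 0) :
    HasDerivAt (fun b : ℝ => b * cos b / sin b)
      ((sin b * cos b - b) / sin b ^ 2) b := by
  have h := ((hasDerivAt_id' b).fun_mul (hasDerivAt_cos b)).fun_div (hasDerivAt_sin b) hb
  refine h.congr_deriv ?_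
  congr 1
  linear_combination (-b) * sin_sq_add_cos_sq b

theorem bcot_deriv_neg {b : ℝ} (h0 : 0 < b) (hπ : b < π) :
    (sin b * cos b - b) / sin b ^ 2 < 0 := by
  have hs := sin_pos_of_pos_of_lt_pi h0 hπ
  refine div_neg_of_neg_of_pos ?_ (by positivity)
  have := sin_lt (x := 2 * b) (by linarith)
  rw [sin_two_mul] at this
  linarith

theorem bcot_strictAntiOn :
    StrictAntiOn (fun b : ℝ => b * cos b / sin b) (Ioo 0 π) := by
  refine strictAntiOn_of_deriv_neg (convex_Ioo 0 π) (fun b hb => ?_) fun b hb => ?_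
  · exact (hasDerivAt_bcot (sin_pos_of_pos_of_lt_pi hb.1 hb.2).ne').continuousAt.continuousWithinAt
  · rw [interior_Ioo] at hb
    rw [(hasDerivAt_bcot (sin_pos_of_pos_of_lt_pi hb.1 hb.2).ne').deriv]
    exact bcot_deriv_neg hb.1 hb.2

theorem bcot_lt_one {b : ℝ} (h0 : 0 < b) (hπ : b < π) : b * cos b / sin b < 1 := by
  have hs := sin_pos_of_pos_of_lt_pi h0 hπ
  rw [div_lt_one hs]
  rcases lt_or_ge b (π / 2) with h | h
  · have := lt_tan h0 h
    have hc := cos_pos_of_mem_Ioo ⟨by linarith, h⟩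
    rwa [tan_eq_sin_div_cos, lt_div_iff₀ hc] at this
  · have hc : cos b ≤ 0 := cos_nonpos_of_pi_div_two_le_of_le h (by linarith)
    nlinarith

theorem tendsto_bcot_atBot :
    Tendsto (fun b : ℝ => b * cos b / sin b) (𝓝[<] π) atBot := by
  have h1 : Tendsto (fun b : ℝ => b * cos b) (𝓝[<] π) (𝓝 (-π)) := by
    have : ContinuousAt (fun b : ℝ => b * cos b) π := by fun_prop
    have h := this.tendsto
    simp only [cos_pi, mul_neg, mul_one] at h
    exact h.mono_left nhdsWithin_le_nhds
  have h2 : Tendsto sin (𝓝[<] π) (𝓝[>] 0) := by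
    refine tendsto_nhdsWithin_iff.2 ⟨?_, ?_⟩
    · have := continuous_sin.continuousAt (x := π) |>.tendsto
      rw [sin_pi] at this
      exact this.mono_left nhdsWithin_le_nhds
    · filter_upwards [Ioo_mem_nhdsLT pi_pos] with b hb
      exact sin_pos_of_pos_of_lt_pi hb.1 hb.2
  exact h1.neg_mul_atTop (by linarith [pi_pos]) (tendsto_inv_nhdsGT_zero.comp h2)

end BimaterialStrip

namespace BimaterialStrip

/-! ### The kernel and its zeros -/

/-- The numerator `ξ² Ξ(ξ)` of the kernel, holomorphic in a strip around the real axis. -/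
noncomputable def kernelNum (P : StripParams) (ξ : ℂ) : ℂ :=
  zcoth (ξ * P.H 0) / (P.μ 0 * P.H 0) + zcoth (ξ * P.H 1) / (P.μ 1 * P.H 1) + P.κ * ξ ^ 2

/-- The values of `kernelNum` on the imaginary axis. -/
noncomputable def kernelDepth (P : StripParams) (b : ℝ) : ℝ :=
  b * P.H 0 * cos (b * P.H 0) / sin (b * P.H 0) / (P.μ 0 * P.H 0) +
    b * P.H 1 * cos (b * P.H 1) / sin (b * P.H 1) / (P.μ 1 * P.H 1) - P.κ * b ^ 2

section
variable (P : StripParams)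

theorem lam_sq : lam P ^ 2 = (1 / (P.μ 0 * P.H 0) + 1 / (P.μ 1 * P.H 1)) / P.κ := by
  have h0 := P.μ_pos 0
  have h1 := P.μ_pos 1
  have h2 := P.H_pos 0
  have h3 := P.H_pos 1
  have h4 := P.κ_pos
  rw [lam, sq_sqrt (by positivity)]
  field_simp
  ring

theorem lam_pos : 0 < lam P := by
  have h0 := P.μ_pos 0
  have h1 := P.μ_pos 1
  have h2 := P.H_pos 0
  have h3 := P.H_pos 1
  have h4 := P.κ_pos
  rw [lam]
  positivity

theorem gammaMinus_pos : 0 < gammaMinus P := by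
  have h2 := P.H_pos 0
  have h3 := P.H_pos 1
  have := pi_pos
  rw [gammaMinus]
  positivity

theorem gammaMinus_mul_le (j : Fin 2) : gammaMinus P * P.H j ≤ π := by
  have h := P.H_pos j
  have h1 : min (1 / P.H 0) (1 / P.H 1) ≤ 1 / P.H j := by
    fin_cases j
    · exact min_le_left _ _
    · exact min_le_right _ _
  rw [gammaMinus]
  calc _ ≤ π * (1 / P.H j) * P.H j := by gcongr
    _ = π := by field_simp

theorem exists_gammaMinus_mul_eq : ∃ j : Fin 2, gammaMinus P * P.H j = π := by
  have h0 := P.H_pos 0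
  have h1 := P.H_pos 1
  rcases min_choice (1 / P.H 0) (1 / P.H 1) with h | h
  · refine ⟨0, ?_⟩
    rw [gammaMinus, h]; field_simp
  · refine ⟨1, ?_⟩
    rw [gammaMinus, h]; field_simp

variable {P}

theorem abs_im_mul_lt {ξ : ℂ} (h : |ξ.im| < gammaMinus P) (j : Fin 2) : |(ξ * P.H j).im| < π := by
  have h1 := P.H_pos j
  rw [Complex.im_mul_ofReal, abs_mul, abs_of_pos h1]
  exact (mul_lt_mul_of_pos_right h h1).trans_le (gammaMinus_mul_le P j)

variable (P)

theorem XiStar_eq {ξ : ℂ} (hξ : ξ ≠ 0) :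
    XiStar P ξ = kernelNum P ξ / (P.κ * ((lam P : ℂ) ^ 2 + ξ ^ 2)) := by
  have h0 : (P.μ 0 : ℂ) ≠ 0 := by exact_mod_cast (P.μ_pos 0).ne'
  have h1 : (P.μ 1 : ℂ) ≠ 0 := by exact_mod_cast (P.μ_pos 1).ne'
  have h2 : (P.H 0 : ℂ) ≠ 0 := by exact_mod_cast (P.H_pos 0).ne'
  have h3 : (P.H 1 : ℂ) ≠ 0 := by exact_mod_cast (P.H_pos 1).ne'
  have e : kernelNum P ξ = ξ * (P.μ 0 * coth (ξ * P.H 1) + P.μ 1 * coth (ξ * P.H 0) +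
      P.μ 0 * P.μ 1 * P.κ * ξ) / (P.μ 0 * P.μ 1) := by
    rw [kernelNum, zcoth_of_ne (mul_ne_zero hξ h2), zcoth_of_ne (mul_ne_zero hξ h3)]
    field_simp
    ring
  rw [XiStar, e, div_div]
  ring_nf

theorem Xi_eq {ξ : ℂ} (hξ : ξ ≠ 0) : Xi P ξ = kernelNum P ξ / ξ ^ 2 := by
  have h2 : (P.H 0 : ℂ) ≠ 0 := by exact_mod_cast (P.H_pos 0).ne'
  have h3 : (P.H 1 : ℂ) ≠ 0 := by exact_mod_cast (P.H_pos 1).ne'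
  rw [Xi, kernelNum, zcoth_of_ne (mul_ne_zero hξ h2), zcoth_of_ne (mul_ne_zero hξ h3)]
  field_simp

theorem Xi_eq_XiStar {ξ : ℂ} (hξ : ξ ≠ 0) (h : (lam P : ℂ) ^ 2 + ξ ^ 2 ≠ 0) :
    Xi P ξ = P.κ * ((lam P : ℂ) ^ 2 + ξ ^ 2) * XiStar P ξ / ξ ^ 2 := by
  have h4 : (P.κ : ℂ) ≠ 0 := by exact_mod_cast P.κ_pos.ne'
  rw [Xi_eq P hξ, XiStar_eq P hξ]
  field_simp

theorem kernelNum_neg (ξ : ℂ) : kernelNum P (-ξ) = kernelNum P ξ := by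
  simp only [kernelNum, neg_mul, zcoth_neg, neg_sq]

theorem kernelNum_conj (ξ : ℂ) :
    kernelNum P (starRingEnd ℂ ξ) = starRingEnd ℂ (kernelNum P ξ) := by
  have h : ∀ j, starRingEnd ℂ ξ * (P.H j : ℂ) = starRingEnd ℂ (ξ * P.H j) := fun j => by simp
  rw [kernelNum, h, h, zcoth_conj, zcoth_conj, kernelNum]
  simp only [map_add, map_div₀, map_mul, map_pow, Complex.conj_ofReal]

theorem kernelNum_zero : kernelNum P 0 = ((P.κ * lam P ^ 2 : ℝ) : ℂ) := by
  have h4 := P.κ_pos.ne'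
  rw [lam_sq, kernelNum]
  simp only [zero_mul, zcoth_zero]
  rw [mul_div_cancel₀ _ h4]
  push_cast
  ring

theorem differentiableAt_kernelNum {ξ : ℂ} (h : |ξ.im| < gammaMinus P) :
    DifferentiableAt ℂ (kernelNum P) ξ := by
  have h1 : ∀ j, DifferentiableAt ℂ (fun ξ : ℂ => zcoth (ξ * P.H j)) ξ := fun j =>
    (differentiableAt_zcoth (abs_im_mul_lt h j)).comp ξ
      (differentiableAt_id.mul_const (P.H j : ℂ))
  exact (((h1 0).div_const _).add ((h1 1).div_const _)).add
    ((differentiableAt_id.pow 2).const_mul _)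

theorem kernelNum_im_pos {ξ : ℂ} (h : 0 < ξ.re * ξ.im) : 0 < (kernelNum P ξ).im := by
  have h1 : ∀ j, 0 < (zcoth (ξ * P.H j) / (P.μ j * P.H j)).im := by
    intro j
    have hμ := P.μ_pos j
    have hH := P.H_pos j
    have h2 : 0 < (ξ * P.H j).re * (ξ * P.H j).im := by
      rw [Complex.im_mul_ofReal, Complex.re_mul_ofReal]
      have : ξ.re * P.H j * (ξ.im * P.H j) = ξ.re * ξ.im * (P.H j * P.H j) := by ring
      rw [this]
      positivity
    have e : (P.μ j * P.H j : ℂ) = ((P.μ j * P.H j : ℝ) : ℂ) := by push_cast; rfl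
    rw [e, Complex.div_ofReal_im]
    exact div_pos (zcoth_im_pos h2) (by positivity)
  have h3 : ((P.κ : ℂ) * ξ ^ 2).im = P.κ * (2 * (ξ.re * ξ.im)) := by
    rw [Complex.im_ofReal_mul, pow_two, Complex.mul_im]
    ring
  rw [kernelNum, Complex.add_im, Complex.add_im, h3]
  have := P.κ_pos
  have := h1 0
  have := h1 1
  positivity

theorem kernelNum_ofReal (t : ℝ) : ∃ r : ℝ, 0 < r ∧ kernelNum P t = r := by
  obtain ⟨r0, h0, e0⟩ := zcoth_ofReal_pos (t * P.H 0)
  obtain ⟨r1, h1, e1⟩ := zcoth_ofReal_pos (t * P.H 1)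
  have := P.μ_pos 0
  have := P.μ_pos 1
  have := P.H_pos 0
  have := P.H_pos 1
  have := P.κ_pos
  refine ⟨r0 / (P.μ 0 * P.H 0) + r1 / (P.μ 1 * P.H 1) + P.κ * t ^ 2, by positivity, ?_⟩
  push_cast at e0 e1
  rw [kernelNum, e0, e1]
  push_cast
  rfl

theorem kernelNum_mul_I {b : ℝ} (hb : b ≠ 0) :
    kernelNum P (b * I) = (kernelDepth P b : ℂ) := by
  have h : ∀ j, (b * I * P.H j : ℂ) = ((b * P.H j : ℝ) : ℂ) * I := fun j => by
    push_cast; ring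
  rw [kernelNum, h, h, zcoth_mul_I (mul_ne_zero hb (P.H_pos 0).ne'),
    zcoth_mul_I (mul_ne_zero hb (P.H_pos 1).ne'), kernelDepth]
  push_cast
  rw [mul_pow, Complex.I_sq]
  ring

theorem mul_H_mem_Ioo {b : ℝ} (hb : b ∈ Ioo 0 (gammaMinus P)) (j : Fin 2) :
    b * P.H j ∈ Ioo 0 π :=
  ⟨mul_pos hb.1 (P.H_pos j),
    (mul_lt_mul_of_pos_right hb.2 (P.H_pos j)).trans_le (gammaMinus_mul_le P j)⟩

theorem kernelDepth_strictAntiOn : StrictAntiOn (kernelDepth P) (Ioo 0 (gammaMinus P)) := by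
  intro a ha b hb hab
  have key : ∀ j : Fin 2, b * P.H j * cos (b * P.H j) / sin (b * P.H j) / (P.μ j * P.H j)
      < a * P.H j * cos (a * P.H j) / sin (a * P.H j) / (P.μ j * P.H j) := by
    intro j
    have := P.μ_pos j
    have hH := P.H_pos j
    refine div_lt_div_of_pos_right ?_ (by positivity)
    exact bcot_strictAntiOn (mul_H_mem_Ioo P ha j) (mul_H_mem_Ioo P hb j)
      (mul_lt_mul_of_pos_right hab hH)
  have h2 : P.κ * a ^ 2 < P.κ * b ^ 2 := by
    have := P.κ_pos
    have := ha.1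
    gcongr
  have := key 0
  have := key 1
  simp only [kernelDepth]
  linarith

theorem hasDerivAt_kernelDepth {b : ℝ} (hb : b ∈ Ioo 0 (gammaMinus P)) :
    ∃ d < 0, HasDerivAt (kernelDepth P) d b := by
  have key : ∀ j : Fin 2, ∃ d < 0, HasDerivAt
      (fun b => b * P.H j * cos (b * P.H j) / sin (b * P.H j) / (P.μ j * P.H j)) d b := by
    intro j
    have hm := mul_H_mem_Ioo P hb j
    have h1 := (hasDerivAt_bcot (sin_pos_of_pos_of_lt_pi hm.1 hm.2).ne').comp b
      ((hasDerivAt_id' b).mul_const (P.H j))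
    refine ⟨_, ?_, h1.div_const (P.μ j * P.H j)⟩
    have := P.μ_pos j
    have hH := P.H_pos j
    refine div_neg_of_neg_of_pos (mul_neg_of_neg_of_pos (bcot_deriv_neg hm.1 hm.2) ?_)
      (by positivity)
    simpa using hH
  obtain ⟨d0, h0, e0⟩ := key 0
  obtain ⟨d1, h1, e1⟩ := key 1
  refine ⟨_, ?_, (e0.fun_add e1).fun_sub (((hasDerivAt_id' b).fun_pow 2).const_mul P.κ)⟩
  have : 0 < P.κ * (2 * b) := by have := P.κ_pos; have := hb.1; positivity
  simp
  linarith

theorem kernelDepth_lt {b : ℝ} (hb : b ∈ Ioo 0 (gammaMinus P)) :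
    kernelDepth P b < P.κ * (lam P ^ 2 - b ^ 2) := by
  have key : ∀ j : Fin 2, b * P.H j * cos (b * P.H j) / sin (b * P.H j) / (P.μ j * P.H j)
      < 1 / (P.μ j * P.H j) := by
    intro j
    have hm := mul_H_mem_Ioo P hb j
    have := P.μ_pos j
    have hH := P.H_pos j
    exact div_lt_div_of_pos_right (bcot_lt_one hm.1 hm.2) (by positivity)
  have h4 := P.κ_pos.ne'
  have e : P.κ * (lam P ^ 2 - b ^ 2) = 1 / (P.μ 0 * P.H 0) + 1 / (P.μ 1 * P.H 1) - P.κ * b ^ 2 := by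
    rw [lam_sq]; field_simp
  have := key 0
  have := key 1
  rw [e, kernelDepth]
  linarith

theorem tendsto_kernelDepth_zero : Tendsto (kernelDepth P) (𝓝[>] 0) (𝓝 (P.κ * lam P ^ 2)) := by
  have h1 : ContinuousAt (kernelNum P) 0 :=
    (differentiableAt_kernelNum P (by simpa using gammaMinus_pos P)).continuousAt
  have h2 : Tendsto (fun b : ℝ => (kernelNum P (b * I)).re) (𝓝[>] 0)
      (𝓝 (kernelNum P 0).re) := by
    refine (Complex.continuous_re.tendsto _).comp (h1.tendsto.comp ?_)
    have : ContinuousAt (fun b : ℝ => (b * I : ℂ)) 0 := by fun_prop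
    have h := this.tendsto
    simp only [Complex.ofReal_zero, zero_mul] at h
    exact h.mono_left nhdsWithin_le_nhds
  rw [kernelNum_zero, Complex.ofReal_re] at h2
  refine h2.congr' ?_
  filter_upwards [self_mem_nhdsWithin] with b hb
  rw [kernelNum_mul_I P (ne_of_gt hb), Complex.ofReal_re]

theorem exists_kernelDepth_neg : ∃ b ∈ Ioo 0 (gammaMinus P), kernelDepth P b < 0 := by
  obtain ⟨j, hj⟩ := exists_gammaMinus_mul_eq P
  have hH := P.H_pos j
  have hμ := P.μ_pos j
  have hg := gammaMinus_pos P
  have h1 : Tendsto (fun b : ℝ => b * P.H j) (𝓝[<] (gammaMinus P)) (𝓝[<] π) := by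
    refine tendsto_nhdsWithin_iff.2 ⟨?_, ?_⟩
    · have : ContinuousAt (fun b : ℝ => b * P.H j) (gammaMinus P) := by fun_prop
      have h := this.tendsto
      rw [hj] at h
      exact h.mono_left nhdsWithin_le_nhds
    · filter_upwards [self_mem_nhdsWithin] with b hb
      change b * P.H j < π
      rw [← hj]
      exact mul_lt_mul_of_pos_right hb hH
  have h2 := (tendsto_bcot_atBot.comp h1).eventually
    (eventually_lt_atBot (-(P.μ j * P.H j * (P.κ * lam P ^ 2))))
  obtain ⟨b, hb, hbm⟩ := (h2.and (Ioo_mem_nhdsLT hg)).exists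
  refine ⟨b, hbm, ?_⟩
  have key : ∀ i : Fin 2, b * P.H i * cos (b * P.H i) / sin (b * P.H i) / (P.μ i * P.H i)
      < 1 / (P.μ i * P.H i) := by
    intro i
    have hm := mul_H_mem_Ioo P hbm i
    have := P.μ_pos i
    have hH := P.H_pos i
    exact div_lt_div_of_pos_right (bcot_lt_one hm.1 hm.2) (by positivity)
  have key2 : b * P.H j * cos (b * P.H j) / sin (b * P.H j) / (P.μ j * P.H j)
      < -(P.κ * lam P ^ 2) := by
    rw [div_lt_iff₀ (by positivity)]
    simp only [Function.comp] at hb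
    linarith
  have h4 := P.κ_pos
  have e : P.κ * lam P ^ 2 = 1 / (P.μ 0 * P.H 0) + 1 / (P.μ 1 * P.H 1) := by
    rw [lam_sq]; field_simp
  have p0 : 0 < 1 / (P.μ 0 * P.H 0) := by have := P.μ_pos 0; have := P.H_pos 0; positivity
  have p1 : 0 < 1 / (P.μ 1 * P.H 1) := by have := P.μ_pos 1; have := P.H_pos 1; positivity
  have p2 : 0 < P.κ * b ^ 2 := by have := hbm.1; positivity
  rw [kernelDepth]
  rw [e] at key2
  fin_cases j
  · have := key 1
    simp only [Fin.zero_eta] at key2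
    linarith
  · have := key 0
    simp only [Fin.mk_one] at key2
    linarith

theorem exists_kernelDepth_eq_zero : ∃ b ∈ Ioo 0 (gammaMinus P), kernelDepth P b = 0 := by
  obtain ⟨b₁, hb₁, hn⟩ := exists_kernelDepth_neg P
  have hp : ∀ᶠ b in 𝓝[>] (0 : ℝ), 0 < kernelDepth P b :=
    (tendsto_kernelDepth_zero P).eventually (lt_mem_nhds (by
      have := P.κ_pos; have := lam_pos P; positivity))
  obtain ⟨b₀, hb₀, hb₀m⟩ := (hp.and (Ioo_mem_nhdsGT hb₁.1)).exists
  have hc : ContinuousOn (kernelDepth P) (Icc b₀ b₁) := by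
    intro b hb
    obtain ⟨d, _, hd⟩ := hasDerivAt_kernelDepth P (b := b)
      ⟨hb₀m.1.trans_le hb.1, hb.2.trans_lt hb₁.2⟩
    exact hd.continuousAt.continuousWithinAt
  obtain ⟨b, hb, h0⟩ := intermediate_value_Icc' hb₀m.2.le hc ⟨hn.le, hb₀.le⟩
  exact ⟨b, ⟨hb₀m.1.trans_le hb.1, hb.2.trans_lt hb₁.2⟩, h0⟩

theorem kernelNum_ne_zero_of_re {ξ : ℂ} (hr : ξ.re ≠ 0) (hi : ξ.im ≠ 0) : kernelNum P ξ ≠ 0 := by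
  rcases lt_or_gt_of_ne (mul_ne_zero hr hi) with h | h
  · have h1 := kernelNum_im_pos P (ξ := starRingEnd ℂ ξ) (by simp; linarith)
    rw [kernelNum_conj] at h1
    intro h0
    simp [h0] at h1
  · intro h0
    have := kernelNum_im_pos P h
    simp [h0] at this

theorem isLeast_zeroDepths_gammaPlus : IsLeast (zeroDepths P) (gammaPlus P) ∧
    gammaPlus P ∈ Ioo 0 (gammaMinus P) ∧ kernelDepth P (gammaPlus P) = 0 := by
  obtain ⟨b, hb, h0⟩ := exists_kernelDepth_eq_zero P
  have hIm : ∀ b : ℝ, b ≠ 0 → kernelNum P (-(b * I)) = kernelDepth P b := fun b hb => by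
    rw [kernelNum_neg, kernelNum_mul_I P hb]
  have hl : IsLeast (zeroDepths P) b := by
    refine ⟨⟨hb.1, -(b * I), by simp, ?_, ?_, ?_⟩, ?_⟩
    · refine sinh_ne_zero (mul_ne_zero ?_ (by exact_mod_cast (P.H_pos 0).ne')) (abs_im_mul_lt ?_ 0)
      · simpa using hb.1.ne'
      · simpa [abs_of_pos hb.1] using hb.2
    · refine sinh_ne_zero (mul_ne_zero ?_ (by exact_mod_cast (P.H_pos 1).ne')) (abs_im_mul_lt ?_ 1)
      · simpa using hb.1.ne'
      · simpa [abs_of_pos hb.1] using hb.2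
    · rw [Xi_eq P (by simpa using hb.1.ne'), hIm b hb.1.ne', h0]
      simp
    · rintro c ⟨hc, ξ, hξ, _, _, hXi⟩
      by_contra hcb
      have hcb := not_le.1 hcb
      have hne : ξ ≠ 0 := fun h => by simp [h] at hξ; linarith
      rw [Xi_eq P hne, div_eq_zero_iff] at hXi
      have hN : kernelNum P ξ = 0 := by
        rcases hXi with h | h
        · exact h
        · exact absurd h (pow_ne_zero 2 hne)
      have hre : ξ.re = 0 := by
        by_contra hr
        exact kernelNum_ne_zero_of_re P hr (by rw [hξ]; linarith) hN
      have hξe : ξ = -(c * I) := Complex.ext (by simp [hre]) (by simp [hξ])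
      rw [hξe, hIm c hc.ne'] at hN
      have := kernelDepth_strictAntiOn P ⟨hc, hcb.trans hb.2⟩ hb hcb
      rw [h0] at this
      have h3 : kernelDepth P c = 0 := by exact_mod_cast hN
      linarith
  have : gammaPlus P = b := hl.csInf_eq
  rw [this]
  exact ⟨hl, hb, h0⟩

theorem gammaPlus_pos : 0 < gammaPlus P := (isLeast_zeroDepths_gammaPlus P).2.1.1

theorem gammaPlus_lt : gammaPlus P < gammaMinus P := (isLeast_zeroDepths_gammaPlus P).2.1.2

theorem gammaPlus_lt_lam : gammaPlus P < lam P := by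
  obtain ⟨_, h1, h2⟩ := isLeast_zeroDepths_gammaPlus P
  have h3 := kernelDepth_lt P h1
  rw [h2] at h3
  have := P.κ_pos
  have h4 : 0 < lam P ^ 2 - gammaPlus P ^ 2 := (mul_pos_iff_of_pos_left this).1 h3
  exact lt_of_pow_lt_pow_left₀ 2 (lam_pos P).le (by linarith)

theorem gammaPlus_cot : 1 / P.μ 0 * cot (gammaPlus P * P.H 0) +
    1 / P.μ 1 * cot (gammaPlus P * P.H 1) - P.κ * gammaPlus P = 0 := by
  obtain ⟨_, h1, h2⟩ := isLeast_zeroDepths_gammaPlus P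
  have h3 := h1.1.ne'
  have := (P.H_pos 0).ne'
  have := (P.H_pos 1).ne'
  have := (P.μ_pos 0).ne'
  have := (P.μ_pos 1).ne'
  have s0 := mul_H_mem_Ioo P h1 0
  have s1 := mul_H_mem_Ioo P h1 1
  have := (sin_pos_of_pos_of_lt_pi s0.1 s0.2).ne'
  have := (sin_pos_of_pos_of_lt_pi s1.1 s1.2).ne'
  rw [cot_eq_cos_div_sin, cot_eq_cos_div_sin]
  have e : kernelDepth P (gammaPlus P) = gammaPlus P *
    (1 / P.μ 0 * (cos (gammaPlus P * P.H 0) / sin (gammaPlus P * P.H 0)) +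
    1 / P.μ 1 * (cos (gammaPlus P * P.H 1) / sin (gammaPlus P * P.H 1)) -
    P.κ * gammaPlus P) := by
    rw [kernelDepth]
    field_simp
  rw [e] at h2
  exact (mul_eq_zero.1 h2).resolve_left h3

/-- In the strip `|Im ξ| < γ₋` the only zeros of the numerator are `± i γ₊`. -/
theorem kernelNum_ne_zero {ξ : ℂ} (h : |ξ.im| < gammaMinus P)
    (h' : ¬ (ξ.re = 0 ∧ |ξ.im| = gammaPlus P)) : kernelNum P ξ ≠ 0 := by
  by_cases hi : ξ.im = 0
  · obtain ⟨r, hr, e⟩ := kernelNum_ofReal P ξ.re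
    have : ξ = (ξ.re : ℂ) := Complex.ext (by simp) (by simp [hi])
    rw [this, e]
    exact_mod_cast hr.ne'
  · by_cases hr : ξ.re = 0
    · have hb : |ξ.im| ∈ Ioo 0 (gammaMinus P) := ⟨abs_pos.2 hi, h⟩
      have e : kernelNum P ξ = kernelDepth P |ξ.im| := by
        rw [← kernelNum_mul_I P hb.1.ne']
        rcases le_total 0 ξ.im with h1 | h1
        · congr 1
          exact Complex.ext (by simp [hr]) (by simp [abs_of_nonneg h1])
        · rw [← kernelNum_neg]
          congr 1
          exact Complex.ext (by simp [hr]) (by simp [abs_of_nonpos h1])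
      rw [e]
      intro h0
      obtain ⟨_, h1, h2⟩ := isLeast_zeroDepths_gammaPlus P
      refine h' ⟨hr, (kernelDepth_strictAntiOn P).injOn hb h1 ?_⟩
      rw [h2]
      exact_mod_cast h0
    · exact kernelNum_ne_zero_of_re P hr hi

theorem kernelNum_gammaPlus : kernelNum P (-(gammaPlus P * I)) = 0 := by
  rw [kernelNum_neg, kernelNum_mul_I P (gammaPlus_pos P).ne',
    (isLeast_zeroDepths_gammaPlus P).2.2, Complex.ofReal_zero]

theorem deriv_kernelNum_gammaPlus : deriv (kernelNum P) (-(gammaPlus P * I)) ≠ 0 := by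
  obtain ⟨_, hb, _⟩ := isLeast_zeroDepths_gammaPlus P
  obtain ⟨d, hd, hder⟩ := hasDerivAt_kernelDepth P hb
  have h1 : HasDerivAt (kernelNum P) (deriv (kernelNum P) (-(gammaPlus P * I)))
      (-(gammaPlus P * I)) :=
    (differentiableAt_kernelNum P (by simpa [abs_of_pos hb.1] using hb.2)).hasDerivAt
  have h2 : HasDerivAt (fun b : ℝ => (-(b * I) : ℂ)) (-(1 * I)) (gammaPlus P) := by
    have := ((hasDerivAt_id' ((gammaPlus P : ℝ) : ℂ)).mul_const I).neg
    exact this.comp_ofReal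
  have h3 := h1.scomp (gammaPlus P) h2
  have h4 : HasDerivAt (fun b : ℝ => (kernelDepth P b : ℂ)) (d : ℂ) (gammaPlus P) := hder.ofReal_comp
  have h5 : HasDerivAt (kernelNum P ∘ fun b : ℝ => (-(b * I) : ℂ)) (d : ℂ) (gammaPlus P) := by
    refine h4.congr_of_eventuallyEq ?_
    filter_upwards [lt_mem_nhds hb.1] with b hb'
    rw [Function.comp, kernelNum_neg, kernelNum_mul_I P (ne_of_gt hb')]
  have h6 := h3.unique h5
  intro h0
  rw [h0, smul_zero] at h6
  exact hd.ne (by exact_mod_cast h6.symm)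

theorem exists_kernelNum_asymp : ∃ R C, 0 < R ∧ 0 < C ∧ ∀ ξ : ℂ, R ≤ |ξ.re| →
    ‖kernelNum P ξ - P.κ * ξ ^ 2‖ ≤ C * ‖ξ‖ := by
  have m0 := P.μ_pos 0
  have m1 := P.μ_pos 1
  have p1 := P.H_pos 1
  refine ⟨max (1 / P.H 0) (1 / P.H 1), 2 / P.μ 0 + 2 / P.μ 1, by positivity, by positivity,
    fun ξ hξ => ?_⟩
  have key : ∀ j, 1 / P.H j ≤ |ξ.re| → ‖zcoth (ξ * P.H j) / (P.μ j * P.H j)‖ ≤ 2 / P.μ j * ‖ξ‖ := by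
    intro j hj
    have hH := P.H_pos j
    have hμ := P.μ_pos j
    have h1 : 1 ≤ |(ξ * P.H j).re| := by
      rw [Complex.re_mul_ofReal, abs_mul, abs_of_pos hH]
      rwa [div_le_iff₀ hH] at hj
    have h2 := norm_zcoth_le h1
    rw [norm_div, norm_mul, Complex.norm_real, Complex.norm_real, norm_of_nonneg hμ.le,
      norm_of_nonneg hH.le, div_le_iff₀ (by positivity)]
    rw [norm_mul, Complex.norm_real, norm_of_nonneg hH.le] at h2
    refine h2.trans (le_of_eq ?_)
    field_simp
  rw [kernelNum, add_sub_cancel_right, add_mul]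
  exact (norm_add_le _ _).trans (add_le_add (key 0 ((le_max_left _ _).trans hξ))
    (key 1 ((le_max_right _ _).trans hξ)))

/-! ### The logarithm of the regularised kernel -/

/-- `Ξ_*`, with its removable singularity at `0` removed. -/
noncomputable def kernelStar (ξ : ℂ) : ℂ := kernelNum P ξ / (P.κ * ((lam P : ℂ) ^ 2 + ξ ^ 2))

theorem kernelStar_neg (ξ : ℂ) : kernelStar P (-ξ) = kernelStar P ξ := by
  simp only [kernelStar, kernelNum_neg, neg_sq]

theorem kernelStar_conj (ξ : ℂ) :
    kernelStar P (starRingEnd ℂ ξ) = starRingEnd ℂ (kernelStar P ξ) := by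
  simp only [kernelStar, kernelNum_conj, map_div₀, map_mul, map_add, map_pow, Complex.conj_ofReal]

theorem kernelStar_zero : kernelStar P 0 = 1 := by
  have h4 := P.κ_pos
  have h5 := lam_pos P
  rw [kernelStar, kernelNum_zero]
  push_cast
  rw [zero_pow two_ne_zero, add_zero, div_self]
  exact_mod_cast (by positivity : P.κ * lam P ^ 2 ≠ 0)

theorem kernelStar_mem_slitPlane {ξ : ℂ} (h : |ξ.im| < gammaPlus P) :
    kernelStar P ξ ∈ Complex.slitPlane := by
  have hκ := P.κ_pos
  have hl := lam_pos P
  have him : ((P.κ : ℂ) * ((lam P : ℂ) ^ 2 + ξ ^ 2)).im = P.κ * (2 * (ξ.re * ξ.im)) := by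
    rw [Complex.im_ofReal_mul, Complex.add_im, ← Complex.ofReal_pow, Complex.ofReal_im, pow_two,
      Complex.mul_im]
    ring
  rcases lt_trichotomy (ξ.re * ξ.im) 0 with h1 | h1 | h1
  · refine div_mem_slitPlane' ?_ ?_
    · have h2 := kernelNum_im_pos P (ξ := starRingEnd ℂ ξ) (by simp; linarith)
      rw [kernelNum_conj, Complex.conj_im] at h2
      linarith
    · rw [him]
      nlinarith
  · have hreal : ∃ r : ℝ, 0 < r ∧ kernelStar P ξ = r := by
      rcases mul_eq_zero.1 h1 with h2 | h2
      · by_cases h3 : ξ.im = 0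
        · refine ⟨1, one_pos, ?_⟩
          rw [show ξ = 0 from Complex.ext h2 h3, kernelStar_zero]
          simp
        · obtain ⟨_, hg, hz⟩ := isLeast_zeroDepths_gammaPlus P
          have hb : 0 < |ξ.im| := abs_pos.2 h3
          have e : kernelStar P ξ = kernelStar P (|ξ.im| * I) := by
            rcases le_total 0 ξ.im with h1 | h1
            · congr 1
              exact Complex.ext (by simp [h2]) (by simp [abs_of_nonneg h1])
            · rw [← kernelStar_neg]
              congr 1
              exact Complex.ext (by simp [h2]) (by simp [abs_of_nonpos h1])
          refine ⟨kernelDepth P |ξ.im| / (P.κ * (lam P ^ 2 - |ξ.im| ^ 2)), div_pos ?_ ?_, ?_⟩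
          · rw [← hz]
            exact kernelDepth_strictAntiOn P ⟨hb, h.trans hg.2⟩ hg h
          · have : |ξ.im| < lam P := h.trans (gammaPlus_lt_lam P)
            have : 0 < lam P ^ 2 - |ξ.im| ^ 2 := by nlinarith
            positivity
          · rw [e, kernelStar, kernelNum_mul_I P hb.ne', mul_pow, Complex.I_sq]
            push_cast
            ring
      · obtain ⟨r, hr, e⟩ := kernelNum_ofReal P ξ.re
        refine ⟨r / (P.κ * (lam P ^ 2 + ξ.re ^ 2)), by positivity, ?_⟩
        rw [kernelStar, show ξ = (ξ.re : ℂ) from Complex.ext (by simp) (by simp [h2]), e]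
        push_cast
        simp
    obtain ⟨r, hr, e⟩ := hreal
    rw [e]
    exact Complex.ofReal_mem_slitPlane.2 hr
  · refine div_mem_slitPlane (kernelNum_im_pos P h1) ?_
    rw [him]
    positivity

/-- The logarithm of the regularised kernel. -/
noncomputable def logStar (ξ : ℂ) : ℂ := Complex.log (kernelStar P ξ)

theorem logStar_neg (ξ : ℂ) : logStar P (-ξ) = logStar P ξ := by
  rw [logStar, kernelStar_neg, logStar]

theorem logStar_zero : logStar P 0 = 0 := by rw [logStar, kernelStar_zero, Complex.log_one]

theorem logStar_conj {ξ : ℂ} (h : |ξ.im| < gammaPlus P) :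
    logStar P (starRingEnd ℂ ξ) = starRingEnd ℂ (logStar P ξ) := by
  rw [logStar, kernelStar_conj, logStar,
    Complex.log_conj _ (Complex.slitPlane_arg_ne_pi (kernelStar_mem_slitPlane P h))]

theorem logStar_eq {ξ : ℂ} (hξ : ξ ≠ 0) : Complex.log (XiStar P ξ) = logStar P ξ := by
  rw [logStar, kernelStar, XiStar_eq P hξ]

theorem exp_logStar {ξ : ℂ} (hξ : ξ ≠ 0) (h : |ξ.im| < gammaPlus P) :
    cexp (logStar P ξ) = XiStar P ξ := by
  rw [logStar, Complex.exp_log (Complex.slitPlane_ne_zero (kernelStar_mem_slitPlane P h)),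
    XiStar_eq P hξ, kernelStar]

theorem lam_sq_add_ne {ξ : ℂ} (h : |ξ.im| < lam P) : (lam P : ℂ) ^ 2 + ξ ^ 2 ≠ 0 := by
  have e : (lam P : ℂ) ^ 2 + ξ ^ 2 = (ξ + lam P * I) * (ξ - lam P * I) := by
    ring_nf
    rw [Complex.I_sq]
    ring
  rw [e]
  rw [abs_lt] at h
  refine mul_ne_zero (fun h0 => ?_) fun h0 => ?_
  · have := congrArg Complex.im h0
    simp at this
    linarith
  · have := congrArg Complex.im h0
    simp at this
    linarith

theorem differentiableAt_logStar {ξ : ℂ} (h : |ξ.im| < gammaPlus P) :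
    DifferentiableAt ℂ (logStar P) ξ := by
  have hκ : (P.κ : ℂ) ≠ 0 := by exact_mod_cast P.κ_pos.ne'
  have h1 : DifferentiableAt ℂ (kernelStar P) ξ :=
    (differentiableAt_kernelNum P (h.trans (gammaPlus_lt P))).div
      ((((differentiableAt_id.pow 2)).const_add _).const_mul _)
      (mul_ne_zero hκ (lam_sq_add_ne P (h.trans (gammaPlus_lt_lam P))))
  exact h1.clog (kernelStar_mem_slitPlane P h)

theorem stripDecay_logStar : StripDecay (logStar P) (gammaPlus P) := by
  refine ⟨fun ξ h => (differentiableAt_logStar P h).differentiableWithinAt, fun β hβ => ?_⟩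
  obtain ⟨R, C, hR, hC, hb⟩ := exists_kernelNum_asymp P
  have hκ := P.κ_pos
  have hl := lam_pos P
  set D := (C + P.κ * lam P ^ 2) * (2 / P.κ) with hD
  have hD0 : 0 < D := by positivity
  set R' := max (max R 1) (max (2 * lam P) (2 * D)) with hR'
  have hfar : ∀ z : ℂ, z.im ∈ Icc (-β) β → R' ≤ |z.re| →
      ‖logStar P z‖ ≤ 3 * D * (1 + |z.re|) ^ (-1 : ℝ) := by
    intro z _ hz
    have z1 : 1 ≤ |z.re| := ((le_max_right _ _).trans (le_max_left _ _)).trans hz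
    have zR : R ≤ |z.re| := ((le_max_left _ _).trans (le_max_left _ _)).trans hz
    have zl : 2 * lam P ≤ |z.re| := ((le_max_left _ _).trans (le_max_right _ _)).trans hz
    have zD : 2 * D ≤ |z.re| := ((le_max_right _ _).trans (le_max_right _ _)).trans hz
    have hn : |z.re| ≤ ‖z‖ := Complex.abs_re_le_norm z
    have hn0 : 0 < ‖z‖ := by linarith
    have hden : P.κ / 2 * ‖z‖ ^ 2 ≤ ‖(P.κ : ℂ) * ((lam P : ℂ) ^ 2 + z ^ 2)‖ := by
      rw [norm_mul, Complex.norm_real, norm_of_nonneg hκ.le]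
      have h1 : ‖z‖ ^ 2 - lam P ^ 2 ≤ ‖(lam P : ℂ) ^ 2 + z ^ 2‖ := by
        have := norm_sub_norm_le (z ^ 2) (-(lam P : ℂ) ^ 2)
        rw [norm_neg, norm_pow, norm_pow, Complex.norm_real, norm_of_nonneg hl.le,
          sub_neg_eq_add, add_comm (z ^ 2)] at this
        exact this
      have h3 : 1 / 2 * ‖z‖ ^ 2 ≤ ‖(lam P : ℂ) ^ 2 + z ^ 2‖ := by nlinarith
      calc _ = P.κ * (1 / 2 * ‖z‖ ^ 2) := by ring
        _ ≤ _ := by gcongr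
    have hdpos : 0 < ‖(P.κ : ℂ) * ((lam P : ℂ) ^ 2 + z ^ 2)‖ := lt_of_lt_of_le (by positivity) hden
    have hne := norm_pos_iff.1 hdpos
    have hnum : ‖kernelNum P z - P.κ * ((lam P : ℂ) ^ 2 + z ^ 2)‖ ≤
        (C + P.κ * lam P ^ 2) * ‖z‖ := by
      have e : kernelNum P z - P.κ * ((lam P : ℂ) ^ 2 + z ^ 2) =
          (kernelNum P z - P.κ * z ^ 2) - ((P.κ * lam P ^ 2 : ℝ) : ℂ) := by push_cast; ring
      rw [e]
      refine (norm_sub_le _ _).trans ?_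
      rw [Complex.norm_real, norm_of_nonneg (by positivity), add_mul]
      refine add_le_add (hb z zR) (le_mul_of_one_le_right (by positivity) (z1.trans hn))
    have hw : ‖kernelStar P z - 1‖ ≤ D / |z.re| := by
      have e : kernelStar P z - 1 = (kernelNum P z - P.κ * ((lam P : ℂ) ^ 2 + z ^ 2)) /
          (P.κ * ((lam P : ℂ) ^ 2 + z ^ 2)) := by
        rw [sub_div, div_self hne, kernelStar]
      rw [e, norm_div, div_le_div_iff₀ hdpos (by linarith)]
      calc _ ≤ (C + P.κ * lam P ^ 2) * ‖z‖ * ‖z‖ := by gcongr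
        _ = D * (P.κ / 2 * ‖z‖ ^ 2) := by rw [hD]; field_simp
        _ ≤ _ := by gcongr
    have hhalf : ‖kernelStar P z - 1‖ ≤ 1 / 2 := by
      refine hw.trans ?_
      rw [div_le_div_iff₀ (by linarith) two_pos]
      linarith
    have h9 := Complex.norm_log_one_add_half_le_self hhalf
    rw [add_sub_cancel] at h9
    rw [logStar, rpow_neg_one]
    calc _ ≤ 3 / 2 * (D / |z.re|) := h9.trans (by gcongr)
      _ ≤ _ := by
        rw [← div_eq_mul_inv, ← mul_div_assoc, div_le_div_iff₀ (by linarith) (by positivity)]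
        nlinarith
  obtain ⟨C', hC', h⟩ := exists_strip_bound (f := logStar P) (y₁ := -β) (y₂ := β) (r := 1)
    (fun z hz => (differentiableAt_logStar P
      ((abs_le.2 ⟨hz.1, hz.2⟩).trans_lt hβ)).continuousAt.continuousWithinAt) hfar
  exact ⟨C', hC', fun z hz => by simpa [rpow_neg_one] using h z (abs_le.1 hz)⟩

end

end BimaterialStrip

namespace BimaterialStrip

/-! ### The Wiener–Hopf factors -/

section
variable (P : StripParams)

theorem XiStarPlus_eq {β : ℝ} (hβ : β ≠ 0) (ξ : ℂ) : XiStarPlus P β ξ =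
    cexp (1 / (2 * π * I) * lineCauchy (logStar P) (-β) ξ) := by
  rw [XiStarPlus, lineCauchy]
  congr 3
  ext t
  have e : (t - I * β : ℂ) = t + ((-β : ℝ) : ℂ) * I := by push_cast; ring
  have h0 : (t - I * β : ℂ) ≠ 0 := fun h => hβ (by
    have := congrArg Complex.im h; simpa using this)
  rw [logStar_eq P h0, e]

theorem XiStarMinus_eq {β : ℝ} (hβ : β ≠ 0) (ξ : ℂ) : XiStarMinus P β ξ =
    cexp (-1 / (2 * π * I) * lineCauchy (logStar P) β ξ) := by
  rw [XiStarMinus, lineCauchy]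
  congr 3
  ext t
  have e : (t + I * β : ℂ) = t + (β : ℂ) * I := by ring
  have h0 : (t + I * β : ℂ) ≠ 0 := fun h => hβ (by
    have := congrArg Complex.im h; simpa using this)
  rw [logStar_eq P h0, e]

theorem XiStarPlus_ne_zero (β : ℝ) (ξ : ℂ) : XiStarPlus P β ξ ≠ 0 := Complex.exp_ne_zero _

theorem XiStarMinus_ne_zero (β : ℝ) (ξ : ℂ) : XiStarMinus P β ξ ≠ 0 := Complex.exp_ne_zero _

theorem XiStarMinus_eq_plus_neg {β : ℝ} (hβ : β ≠ 0) (ξ : ℂ) :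
    XiStarMinus P β ξ = XiStarPlus P β (-ξ) := by
  rw [XiStarPlus_eq P hβ, XiStarMinus_eq P hβ, lineCauchy_neg_of_even (logStar_neg P), neg_neg]
  congr 1
  ring

variable {β : ℝ}

theorem differentiableOn_XiStarPlus (h0 : 0 < β) (h1 : β < gammaPlus P) :
    DifferentiableOn ℂ (XiStarPlus P β) {ξ | -β < ξ.im} := by
  intro ξ hξ
  have h2 : |-β| < gammaPlus P := by rwa [abs_neg, abs_of_pos h0]
  have h := (((stripDecay_logStar P).hasDerivAt_lineCauchy h2
    (ne_of_gt hξ)).differentiableAt.const_mul (1 / (2 * π * I))).cexp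
  rw [show XiStarPlus P β = _ from funext (XiStarPlus_eq P h0.ne')]
  exact h.differentiableWithinAt

theorem differentiableOn_XiStarMinus (h0 : 0 < β) (h1 : β < gammaPlus P) :
    DifferentiableOn ℂ (XiStarMinus P β) {ξ | ξ.im < β} := by
  rw [show XiStarMinus P β = _ from funext (XiStarMinus_eq_plus_neg P h0.ne')]
  refine (differentiableOn_XiStarPlus P h0 h1).comp differentiableOn_id.neg fun ξ hξ => ?_
  simp only [mem_ofPred_eq, Complex.neg_im] at hξ ⊢
  linarith

theorem exp_logStar_eq_mul (h0 : 0 < β) (h1 : β < gammaPlus P) {ξ : ℂ}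
    (h₁ : -β < ξ.im) (h₂ : ξ.im < β) :
    cexp (logStar P ξ) = XiStarPlus P β ξ * XiStarMinus P β ξ := by
  have h := (stripDecay_logStar P).lineCauchy_sub (y₁ := -β) (y₂ := β) (by linarith) h1 h₁ h₂
  rw [XiStarPlus_eq P h0.ne', XiStarMinus_eq P h0.ne', ← Complex.exp_add]
  congr 1
  rw [neg_div, neg_mul, ← sub_eq_add_neg, ← mul_sub, h]
  field_simp

theorem XiStar_eq_mul (h0 : 0 < β) (h1 : β < gammaPlus P) {ξ : ℂ} (hξ : ξ ≠ 0)
    (h₁ : -β < ξ.im) (h₂ : ξ.im < β) : XiStar P ξ = XiStarPlus P β ξ * XiStarMinus P β ξ := by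
  rw [← exp_logStar_eq_mul P h0 h1 h₁ h₂, exp_logStar P hξ ((abs_lt.2 ⟨h₁, h₂⟩).trans h1)]

theorem kernelStar_eq_mul (h0 : 0 < β) (h1 : β < gammaPlus P) {ξ : ℂ}
    (h₁ : -β < ξ.im) (h₂ : ξ.im < β) : kernelStar P ξ = XiStarPlus P β ξ * XiStarMinus P β ξ := by
  rw [← exp_logStar_eq_mul P h0 h1 h₁ h₂, logStar, Complex.exp_log (Complex.slitPlane_ne_zero
    (kernelStar_mem_slitPlane P ((abs_lt.2 ⟨h₁, h₂⟩).trans h1)))]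

theorem XiStarPlus_congr {β' : ℝ} (h0 : 0 < β) (h1 : β < gammaPlus P) (h0' : 0 < β')
    (h1' : β' < gammaPlus P) {ξ : ℂ} (h : -β < ξ.im) (h' : -β' < ξ.im) :
    XiStarPlus P β ξ = XiStarPlus P β' ξ := by
  wlog hle : β ≤ β' generalizing β β'
  · exact (this h0' h1' h0 h1 h' h (not_le.1 hle).le).symm
  rw [XiStarPlus_eq P h0.ne', XiStarPlus_eq P h0'.ne', (stripDecay_logStar P).lineCauchy_eq
    (y₁ := -β') (y₂ := -β) (by linarith) (by linarith) (by linarith) (Or.inr h)]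

theorem XiStarMinus_congr {β' : ℝ} (h0 : 0 < β) (h1 : β < gammaPlus P) (h0' : 0 < β')
    (h1' : β' < gammaPlus P) {ξ : ℂ} (h : ξ.im < β) (h' : ξ.im < β') :
    XiStarMinus P β ξ = XiStarMinus P β' ξ := by
  rw [XiStarMinus_eq_plus_neg P h0.ne', XiStarMinus_eq_plus_neg P h0'.ne']
  exact XiStarPlus_congr P h0 h1 h0' h1' (by simpa using h) (by simpa using h')

theorem norm_cexp_sub_one_le (w : ℂ) : ‖cexp w - 1‖ ≤ ‖w‖ * exp ‖w‖ := by
  have := Complex.norm_exp_sub_sum_le_norm_mul_exp w 1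
  simpa using this

theorem exists_XiStarPlus_sub_one_le {δ : ℝ} (h0 : 0 < β) (h1 : β < gammaPlus P) (hδ : 0 < δ) :
    ∃ C, 0 < C ∧ ∀ ξ : ℂ, δ - β ≤ ξ.im →
      ‖XiStarPlus P β ξ - 1‖ ≤ C * (1 + ‖ξ‖) ^ (-(1 / 2) : ℝ) := by
  have h2 : |-β| < gammaPlus P := by rwa [abs_neg, abs_of_pos h0]
  obtain ⟨C, hC, hb⟩ := (stripDecay_logStar P).exists_lineCauchy_le h2 hδ
  set c := ‖(1 / (2 * π * I) : ℂ)‖ with hc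
  have hc0 : 0 < c := norm_pos_iff.2 (one_div_ne_zero Complex.two_pi_I_ne_zero)
  refine ⟨c * C * exp (c * C), by positivity, fun ξ hξ => ?_⟩
  have h3 := hb ξ (by
    rw [sub_neg_eq_add]
    exact le_trans (by linarith) (le_abs_self _))
  have h4 : (1 + ‖ξ‖) ^ (-(1 / 2) : ℝ) ≤ 1 :=
    rpow_le_one_of_one_le_of_nonpos (by linarith [norm_nonneg ξ]) (by norm_num)
  rw [XiStarPlus_eq P h0.ne']
  refine (norm_cexp_sub_one_le _).trans ?_
  rw [norm_mul, ← hc]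
  have h6 : c * ‖lineCauchy (logStar P) (-β) ξ‖ ≤ c * C := by
    gcongr
    exact h3.trans (mul_le_of_le_one_right hC.le h4)
  calc _ ≤ c * (C * (1 + ‖ξ‖) ^ (-(1 / 2) : ℝ)) * exp (c * C) := by gcongr
    _ = _ := by ring

theorem lineCauchy_logStar_zero (h0 : 0 < β) (h1 : β < gammaPlus P) :
    lineCauchy (logStar P) (-β) 0 = 0 := by
  have h := (stripDecay_logStar P).lineCauchy_sub (y₁ := -β) (y₂ := β) (ξ := 0) (by linarith) h1
    (by simpa using h0) (by simpa using h0)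
  have h2 := lineCauchy_neg_of_even (logStar_neg P) β 0
  rw [neg_zero] at h2
  rw [h2, logStar_zero, mul_zero] at h
  have : (2 : ℂ) * lineCauchy (logStar P) (-β) 0 = 0 := by linear_combination h
  simpa using this

theorem XiStarPlus_zero (h0 : 0 < β) (h1 : β < gammaPlus P) : XiStarPlus P β 0 = 1 := by
  rw [XiStarPlus_eq P h0.ne', lineCauchy_logStar_zero P h0 h1, mul_zero, Complex.exp_zero]

theorem XiStarPlus_neg_conj (h0 : 0 < β) (h1 : β < gammaPlus P) (ξ : ℂ) :
    XiStarPlus P β (-starRingEnd ℂ ξ) = starRingEnd ℂ (XiStarPlus P β ξ) := by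
  have h2 := conj_lineCauchy (f := logStar P) (y := -β) (fun z hz => logStar_conj P (by
    rwa [hz, abs_neg, abs_of_pos h0])) ξ
  rw [XiStarPlus_eq P h0.ne', XiStarPlus_eq P h0.ne', ← Complex.exp_conj, map_mul, h2,
    lineCauchy_neg_of_even (logStar_neg P)]
  congr 1
  simp only [map_div₀, map_mul, map_one, Complex.conj_I, Complex.conj_ofReal, Complex.conj_ofNat]
  ring

theorem XiStarR_pos {t : ℝ} (ht : t ≠ 0) : 0 < XiStarR P t := by
  obtain ⟨r, hr, e⟩ := kernelNum_ofReal P t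
  have hκ := P.κ_pos
  have h : (XiStarR P t : ℂ) = ((r / (P.κ * (lam P ^ 2 + t ^ 2)) : ℝ) : ℂ) := by
    rw [← XiStar_ofReal, XiStar_eq P (by exact_mod_cast ht), e]
    push_cast
    rfl
  rw [Complex.ofReal_inj.1 h]
  positivity

theorem logStar_ofReal {t : ℝ} (ht : t ≠ 0) : logStar P t = (log (XiStarR P t) : ℂ) := by
  rw [← logStar_eq P (by exact_mod_cast ht), XiStar_ofReal, Complex.ofReal_log (XiStarR_pos P ht).le]

theorem integral_logStar_div_sq (h0 : 0 < β) (h1 : β < gammaPlus P) :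
    IntegrableOn (fun t : ℝ => log (XiStarR P t) / t ^ 2) (Ioi 0) ∧
    ∫ t : ℝ, logStar P (t + ((-β : ℝ) : ℂ) * I) / (t + ((-β : ℝ) : ℂ) * I - 0) ^ 2 =
      (2 * alpha P : ℂ) := by
  have hγ := gammaPlus_pos P
  set s := {z : ℂ | |z.im| < gammaPlus P} with hs
  have hs0 : s ∈ 𝓝 (0 : ℂ) := (isOpen_strip _).mem_nhds (by simpa using hγ)
  set q := dslope (logStar P) 0 with hq
  set k := dslope q 0 with hk
  have hqd : DifferentiableOn ℂ q s :=
    (Complex.differentiableOn_dslope hs0).2 (stripDecay_logStar P).diff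
  have hkd : DifferentiableOn ℂ k s := (Complex.differentiableOn_dslope hs0).2 hqd
  have hq0 : q 0 = 0 := by
    rw [hq, dslope_same]
    have h2 : deriv (fun z => logStar P (-z)) 0 = deriv (logStar P) 0 := by
      congr 1
      ext z
      exact logStar_neg P z
    rw [deriv_comp_neg, neg_zero] at h2
    have : (2 : ℂ) * deriv (logStar P) 0 = 0 := by linear_combination -h2
    simpa using this
  have hkne : ∀ z, z ≠ 0 → k z = logStar P z / z ^ 2 := by
    intro z hz
    rw [hk, dslope_of_ne _ hz, slope_def_field, hq0, hq, dslope_of_ne _ hz, slope_def_field,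
      logStar_zero]
    field_simp
    ring
  obtain ⟨C, hC, hb⟩ := (stripDecay_logStar P).bound β h1
  obtain ⟨C', hC', hb'⟩ := exists_strip_bound (f := k) (y₁ := -β) (y₂ := 0) (C := C * 2) (r := 2)
    (R := 1) (hkd.continuousOn.mono fun z hz => by
      change |z.im| < _
      exact abs_lt.2 ⟨by linarith [hz.1], by linarith [hz.2]⟩) (by
      intro z hz hre
      have hn : |z.re| ≤ ‖z‖ := Complex.abs_re_le_norm z
      have hz0 : z ≠ 0 := fun h => by simp [h] at hre; linarith
      have h2 := hb z (abs_le.2 ⟨hz.1, by linarith [hz.2]⟩)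
      rw [hkne z hz0, norm_div, norm_pow, div_eq_mul_inv, rpow_neg_two_eq (abs_nonneg _)]
      have h3 : (‖z‖ ^ 2)⁻¹ ≤ 2 * (1 + |z.re|)⁻¹ := by
        rw [← div_eq_mul_inv, inv_eq_one_div, div_le_div_iff₀ (by positivity) (by positivity)]
        nlinarith
      calc _ ≤ C * (1 + |z.re|)⁻¹ * (2 * (1 + |z.re|)⁻¹) := by gcongr
        _ = _ := by ring)
  have hsub : ∀ z : ℂ, z.im ∈ Icc (-β) 0 → z ∈ s := fun z hz => by
    change |z.im| < _
    exact abs_lt.2 ⟨by linarith [hz.1], by linarith [hz.2]⟩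
  have hshift := integral_horizontal_eq (f := k) (y₁ := -β) (y₂ := 0) (by linarith) one_lt_two
    (hkd.mono hsub) hb'
  have hki : Integrable fun t : ℝ => k t := by
    have := integrable_horizontal (f := k) (y := 0) (C := C') one_lt_two
      (continuous_horizontal hkd.continuousOn fun x => hsub _ (by simpa using h0.le))
      fun x => by simpa using hb' (x + (0 : ℝ) * I) (by simpa using h0.le)
    simpa using this
  have hkr : ∀ t : ℝ, t ≠ 0 → k t = ((log (XiStarR P t) / t ^ 2 : ℝ) : ℂ) := by
    intro t ht
    rw [hkne t (by exact_mod_cast ht), logStar_ofReal P ht]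
    push_cast
    rfl
  have hint : IntegrableOn (fun t : ℝ => log (XiStarR P t) / t ^ 2) (Ioi 0) := by
    have h2 : IntegrableOn (fun t : ℝ => (k t).re) (Ioi 0) := hki.re.integrableOn
    refine h2.congr_fun (fun t ht => ?_) measurableSet_Ioi
    simp only
    rw [hkr t (ne_of_gt ht), Complex.ofReal_re]
  refine ⟨hint, ?_⟩
  have e1 : ∀ t : ℝ, logStar P (t + ((-β : ℝ) : ℂ) * I) /
      (t + ((-β : ℝ) : ℂ) * I - 0) ^ 2 = k (t + ((-β : ℝ) : ℂ) * I) := by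
    intro t
    rw [sub_zero, hkne]
    intro h
    have := congrArg Complex.im h
    simp at this
    linarith
  simp_rw [e1]
  rw [hshift]
  simp only [Complex.ofReal_zero, zero_mul, add_zero]
  have hkeven : ∀ z, k (-z) = k z := by
    intro z
    by_cases hz : z = 0
    · simp [hz]
    · rw [hkne z hz, hkne _ (neg_ne_zero.2 hz), logStar_neg, neg_sq]
  have h3 : ∫ t in Ioi (0 : ℝ), k t = alpha P := by
    rw [alpha, ← integral_complex_ofReal]
    exact setIntegral_congr_fun measurableSet_Ioi fun t ht => hkr t (ne_of_gt ht)
  have h4 : ∫ t in Iic (0 : ℝ), k t = alpha P := by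
    rw [← h3, ← neg_zero, ← integral_comp_neg_Ioi, neg_zero]
    simp only [Complex.ofReal_neg, hkeven]
  rw [← intervalIntegral.integral_Iic_add_Ioi hki.integrableOn hki.integrableOn (b := 0), h3, h4]
  ring

theorem hasDerivAt_XiStarPlus_zero (h0 : 0 < β) (h1 : β < gammaPlus P) :
    HasDerivAt (XiStarPlus P β) (alpha P / (π * I)) 0 := by
  have h2 : |-β| < gammaPlus P := by rwa [abs_neg, abs_of_pos h0]
  have h := (((stripDecay_logStar P).hasDerivAt_lineCauchy (ξ := 0) h2
    (by simpa using h0.ne')).const_mul (1 / (2 * π * I))).cexp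
  rw [(integral_logStar_div_sq P h0 h1).2, lineCauchy_logStar_zero P h0 h1] at h
  rw [show XiStarPlus P β = _ from funext (XiStarPlus_eq P h0.ne')]
  refine h.congr_deriv ?_
  have : (π : ℂ) ≠ 0 := by exact_mod_cast pi_ne_zero
  have := Complex.I_ne_zero
  rw [mul_zero, Complex.exp_zero]
  field_simp

end

end BimaterialStrip

namespace BimaterialStrip

/-! ### Inverse transform of a function holomorphic in a half-plane -/

theorem min_two_le_rpow {θ : ℝ} (hθ : 0 ≤ θ) : min 2 θ ≤ 2 * θ ^ (1 / 4 : ℝ) := by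
  rcases le_total 1 θ with h | h
  · have : (1 : ℝ) ≤ θ ^ (1 / 4 : ℝ) := one_le_rpow h (by norm_num)
    exact (min_le_left _ _).trans (by linarith)
  · refine (min_le_right _ _).trans ?_
    have h1 : θ ^ (1 : ℝ) ≤ θ ^ (1 / 4 : ℝ) :=
      rpow_le_rpow_of_exponent_ge_of_imp hθ h (by norm_num) (by norm_num)
    rw [rpow_one] at h1
    linarith

theorem norm_cexp_I_sub_one_le (θ : ℝ) :
    ‖cexp (I * θ) - 1‖ ≤ 2 * |θ| ^ (1 / 4 : ℝ) := by
  refine le_trans (le_min ?_ ?_) (min_two_le_rpow (abs_nonneg θ))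
  · refine (norm_sub_le _ _).trans ?_
    rw [mul_comm, Complex.norm_exp_ofReal_mul_I]
    norm_num
  · exact norm_exp_I_mul_ofReal_sub_one_le

theorem abs_exp_neg_sub_one_le {c x : ℝ} (hc : 0 ≤ c) (hx : 0 ≤ x) :
    |exp (-c * x) - 1| ≤ 2 * (c * x) ^ (1 / 4 : ℝ) := by
  have h0 : 0 ≤ c * x := mul_nonneg hc hx
  refine le_trans (le_min ?_ ?_) (min_two_le_rpow h0)
  · have h1 : exp (-c * x) ≤ 1 := exp_le_one_iff.2 (by linarith)
    rw [abs_le]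
    constructor <;> linarith [exp_pos (-c * x)]
  · have h1 : exp (-c * x) ≤ 1 := exp_le_one_iff.2 (by linarith)
    have h2 := add_one_le_exp (-c * x)
    rw [abs_le]
    constructor <;> linarith

/-- The inverse transform `(2π)⁻¹ ∫ h(ξ) exp(-iξx) dξ` along the line `Im ξ = y`. -/
noncomputable def inverseTransform (h : ℂ → ℂ) (y x : ℝ) : ℂ :=
  1 / (2 * π) * ∫ t : ℝ, h (t + y * I) *
    cexp (-(I * (t + y * I) * x))

section
variable {h : ℂ → ℂ} {m m' C : ℝ}

theorem norm_cexp_neg_I_mul (t y x : ℝ) :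
    ‖cexp (-(I * (t + y * I) * x))‖ = exp (y * x) := by
  rw [Complex.norm_exp]
  simp

theorem weight_le {z : ℂ} {r : ℝ} (hr : 0 ≤ r) : (1 + ‖z‖) ^ (-r) ≤ (1 + |z.re|) ^ (-r) :=
  rpow_le_rpow_of_nonpos (by positivity) (by linarith [Complex.abs_re_le_norm z])
    (by linarith)

theorem inverseTransform_congr (hm : m' < m) (hd : DifferentiableOn ℂ h {ξ | -m < ξ.im})
    (hC : 0 ≤ C) (hb : ∀ ξ : ℂ, -m' ≤ ξ.im → ‖h ξ‖ ≤ C * (1 + ‖ξ‖) ^ (-(3 / 2) : ℝ)) {y₁ y₂ x : ℝ}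
    (h₁ : -m' ≤ y₁) (h₂ : -m' ≤ y₂) : inverseTransform h y₁ x = inverseTransform h y₂ x := by
  wlog hle : y₁ ≤ y₂ generalizing y₁ y₂
  · exact (this h₂ h₁ (not_le.1 hle).le).symm
  rw [inverseTransform, inverseTransform]
  congr 1
  refine integral_horizontal_eq (f := fun z => h z * cexp (-(I * z * x)))
    (C := C * exp (max (y₁ * x) (y₂ * x))) (r := 3 / 2) hle (by norm_num) ?_ fun z hz => ?_
  · refine (hd.mono fun z hz => ?_).mul (by fun_prop)
    change -m < z.im
    linarith [hz.1]
  · rw [norm_mul]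
    have h3 := hb z (by linarith [hz.1])
    have h4 : ‖cexp (-(I * z * x))‖ ≤ exp (max (y₁ * x) (y₂ * x)) := by
      rw [Complex.norm_exp]
      refine exp_le_exp.2 ?_
      simp only [Complex.neg_re, Complex.mul_re, Complex.I_re, zero_mul, Complex.I_im, one_mul,
        zero_sub, Complex.ofReal_re, Complex.mul_im, Complex.ofReal_im, mul_zero, sub_zero, neg_mul,
        neg_neg]
      rcases le_total 0 x with hx | hx
      · exact (mul_le_mul_of_nonneg_right hz.2 hx).trans (le_max_right _ _)
      · exact (mul_le_mul_of_nonpos_right hz.1 hx).trans (le_max_left _ _)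
    calc _ ≤ (C * (1 + |z.re|) ^ (-(3 / 2) : ℝ)) * exp (max (y₁ * x) (y₂ * x)) := by
          gcongr
          exact h3.trans (mul_le_mul_of_nonneg_left (weight_le (by norm_num)) hC)
      _ = _ := by ring

theorem integrable_shift (hm : m' < m) (hd : DifferentiableOn ℂ h {ξ | -m < ξ.im}) (hC : 0 ≤ C)
    (hb : ∀ ξ : ℂ, -m' ≤ ξ.im → ‖h ξ‖ ≤ C * (1 + ‖ξ‖) ^ (-(3 / 2) : ℝ)) {y : ℝ} (hy : -m' ≤ y) :
    Continuous (fun t : ℝ => h (t + y * I)) ∧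
    Integrable fun t : ℝ => h (t + y * I) := by
  have hc : Continuous fun t : ℝ => h (t + y * I) :=
    continuous_horizontal hd.continuousOn fun x => by
      simp only [mem_ofPred_eq, Complex.add_im, Complex.ofReal_im, Complex.mul_im,
        Complex.ofReal_re, Complex.I_im, mul_one, Complex.I_re, mul_zero, add_zero, zero_add]
      linarith
  refine ⟨hc, integrable_horizontal (C := C) (r := 3 / 2) (by norm_num) hc fun t => ?_⟩
  refine (hb _ (by simpa using hy)).trans (mul_le_mul_of_nonneg_left ?_ hC)
  simpa using weight_le (z := t + y * I) (r := 3 / 2) (by norm_num)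

theorem inverseTransform_nonpos (hm : m' < m) (hm0 : 0 ≤ m')
    (hd : DifferentiableOn ℂ h {ξ | -m < ξ.im})
    (hC : 0 ≤ C) (hb : ∀ ξ : ℂ, -m' ≤ ξ.im → ‖h ξ‖ ≤ C * (1 + ‖ξ‖) ^ (-(3 / 2) : ℝ)) {x : ℝ}
    (hx : x ≤ 0) : inverseTransform h 0 x = 0 := by
  set J : ℝ := ∫ t : ℝ, (1 + ‖t‖) ^ (-(5 / 4) : ℝ) with hJ
  have hJi : Integrable fun t : ℝ => (1 + ‖t‖) ^ (-(5 / 4) : ℝ) :=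
    integrable_one_add_norm (by norm_num)
  have hle : ∀ y : ℝ, 0 ≤ y → ‖inverseTransform h 0 x‖ ≤
      1 / (2 * π) * (C * (1 + |y|) ^ (-(1 / 4) : ℝ) * J) := by
    intro y hy
    rw [inverseTransform_congr hm hd hC hb (by linarith) (by linarith : -m' ≤ y),
      inverseTransform, norm_mul]
    have e : ‖(1 / (2 * π) : ℂ)‖ = 1 / (2 * π) := by
      rw [norm_div, norm_mul, Complex.norm_real]
      simp [abs_of_pos pi_pos]
    rw [e, hJ, ← integral_const_mul]
    refine mul_le_mul_of_nonneg_left (norm_integral_le_of_norm_le (hJi.const_mul _)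
      (Eventually.of_forall fun t => ?_)) (by have := pi_pos; positivity)
    rw [norm_mul, norm_cexp_neg_I_mul]
    have h1 : exp (y * x) ≤ 1 := exp_le_one_iff.2 (mul_nonpos_of_nonneg_of_nonpos hy hx)
    have h2 := hb (t + y * I) (by simp; linarith)
    have h3 : (1 + ‖(t + y * I : ℂ)‖) ^ (-(3 / 2) : ℝ) ≤
        (1 + |y|) ^ (-(1 / 4) : ℝ) * (1 + ‖t‖) ^ (-(5 / 4) : ℝ) := by
      have e2 : (-(3 / 2) : ℝ) = -(1 / 4) + -(5 / 4) := by norm_num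
      rw [e2, rpow_add (by positivity)]
      refine mul_le_mul ?_ ?_ (by positivity) (by positivity)
      · refine rpow_le_rpow_of_nonpos (by positivity) ?_ (by norm_num)
        have := Complex.abs_im_le_norm (t + y * I)
        simp at this
        linarith
      · have := weight_le (z := t + y * I) (r := 5 / 4) (by norm_num)
        simpa using this
    calc _ ≤ C * ((1 + |y|) ^ (-(1 / 4) : ℝ) * (1 + ‖t‖) ^ (-(5 / 4) : ℝ)) * 1 := by
          refine mul_le_mul (h2.trans (mul_le_mul_of_nonneg_left h3 hC)) h1 (exp_pos _).le
            (by positivity)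
      _ = _ := by ring
  have hlim : Tendsto (fun y : ℝ => 1 / (2 * π) * (C * (1 + |y|) ^ (-(1 / 4) : ℝ) * J)) atTop
      (𝓝 0) := by
    simpa using (((tendsto_one_add_rpow_neg (r := 1 / 4) (by norm_num)).const_mul C).mul_const
      J).const_mul (1 / (2 * π))
  have := ge_of_tendsto hlim ((eventually_ge_atTop 0).mono hle)
  exact norm_eq_zero.1 (le_antisymm this (norm_nonneg _))

theorem exists_inverseTransform_le (hm : m' < m) (hm0 : 0 ≤ m')
    (hd : DifferentiableOn ℂ h {ξ | -m < ξ.im})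
    (hC : 0 ≤ C) (hb : ∀ ξ : ℂ, -m' ≤ ξ.im → ‖h ξ‖ ≤ C * (1 + ‖ξ‖) ^ (-(3 / 2) : ℝ)) :
    ∃ K, 0 < K ∧ ∀ x, ‖inverseTransform h 0 x‖ ≤ K * exp (-m' * x) := by
  set J : ℝ := ∫ t : ℝ, (1 + ‖t‖) ^ (-(3 / 2) : ℝ) with hJ
  have hJi : Integrable fun t : ℝ => (1 + ‖t‖) ^ (-(3 / 2) : ℝ) :=
    integrable_one_add_norm (by norm_num)
  refine ⟨‖(1 / (2 * π) : ℂ)‖ * (C * J) + 1, by positivity, fun x => ?_⟩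
  rw [inverseTransform_congr hm hd hC hb (by linarith) (le_refl (-m')), inverseTransform, norm_mul]
  have h1 : ‖∫ t : ℝ, h (t + (-m' : ℝ) * I) *
      cexp (-(I * (t + (-m' : ℝ) * I) * x))‖ ≤
      C * J * exp (-m' * x) := by
    rw [hJ, ← integral_const_mul, ← integral_mul_const]
    refine norm_integral_le_of_norm_le ((hJi.const_mul _).mul_const _)
      (Eventually.of_forall fun t => ?_)
    rw [norm_mul, norm_cexp_neg_I_mul]
    refine mul_le_mul_of_nonneg_right ?_ (exp_pos _).le
    refine (hb _ (by simp)).trans (mul_le_mul_of_nonneg_left ?_ hC)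
    simpa using weight_le (z := t + (-m' : ℝ) * I) (r := 3 / 2) (by norm_num)
  calc _ ≤ ‖(1 / (2 * π) : ℂ)‖ * (C * J * exp (-m' * x)) := by gcongr
    _ ≤ _ := by
      have := exp_pos (-m' * x)
      nlinarith

theorem exists_inverseTransform_sub_le (hm : m' < m) (hm0 : 0 ≤ m')
    (hd : DifferentiableOn ℂ h {ξ | -m < ξ.im})
    (hC : 0 ≤ C) (hb : ∀ ξ : ℂ, -m' ≤ ξ.im → ‖h ξ‖ ≤ C * (1 + ‖ξ‖) ^ (-(3 / 2) : ℝ)) :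
    ∃ K, 0 < K ∧ ∀ x x', ‖inverseTransform h 0 x - inverseTransform h 0 x'‖ ≤
      K * |x - x'| ^ (1 / 4 : ℝ) := by
  set J : ℝ := ∫ t : ℝ, (1 + ‖t‖) ^ (-(5 / 4) : ℝ) with hJ
  have hJi : Integrable fun t : ℝ => (1 + ‖t‖) ^ (-(5 / 4) : ℝ) :=
    integrable_one_add_norm (by norm_num)
  obtain ⟨hc, hi⟩ := integrable_shift hm hd hC hb (y := 0) (by linarith)
  have hi' : ∀ x : ℝ, Integrable fun t : ℝ => h (t + (0 : ℝ) * I) *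
      cexp (-(I * (t + (0 : ℝ) * I) * x)) := by
    intro x
    refine hi.mul_bdd (c := 1) (by fun_prop) (Eventually.of_forall fun t => ?_)
    rw [norm_cexp_neg_I_mul]
    simp
  refine ⟨‖(1 / (2 * π) : ℂ)‖ * (C * 2 * J) + 1, by positivity, fun x x' => ?_⟩
  rw [inverseTransform, inverseTransform, ← mul_sub, norm_mul, ← integral_sub (hi' x) (hi' x')]
  have h1 : ‖∫ t : ℝ, (h (t + (0 : ℝ) * I) *
      cexp (-(I * (t + (0 : ℝ) * I) * x)) - h (t + (0 : ℝ) * I) *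
      cexp (-(I * (t + (0 : ℝ) * I) * x')))‖ ≤
      C * 2 * J * |x - x'| ^ (1 / 4 : ℝ) := by
    rw [hJ, ← integral_const_mul, ← integral_mul_const]
    refine norm_integral_le_of_norm_le ((hJi.const_mul _).mul_const _)
      (Eventually.of_forall fun t => ?_)
    rw [← mul_sub, norm_mul]
    have e : cexp (-(I * (t + (0 : ℝ) * I) * x)) -
        cexp (-(I * (t + (0 : ℝ) * I) * x')) =
        cexp (-(I * (t + (0 : ℝ) * I) * x')) *
          (cexp (I * ((-(t * (x - x')) : ℝ) : ℂ)) - 1) := by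
      rw [mul_sub, ← Complex.exp_add, mul_one]
      congr 2
      push_cast
      ring
    rw [e, norm_mul, norm_cexp_neg_I_mul, zero_mul, exp_zero, one_mul]
    have h2 := norm_cexp_I_sub_one_le (-(t * (x - x')))
    rw [abs_neg, abs_mul, mul_rpow (abs_nonneg _) (abs_nonneg _)] at h2
    have h3 : ‖h (t + (0 : ℝ) * I)‖ ≤ C * (1 + ‖t‖) ^ (-(3 / 2) : ℝ) := by
      refine (hb _ (by simpa using hm0)).trans (mul_le_mul_of_nonneg_left ?_ hC)
      simp
    have h4 : |t| ^ (1 / 4 : ℝ) ≤ (1 + ‖t‖) ^ (1 / 4 : ℝ) :=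
      rpow_le_rpow (abs_nonneg t) (by rw [norm_eq_abs]; linarith) (by norm_num)
    have h5 : (1 + ‖t‖) ^ (-(3 / 2) : ℝ) * (1 + ‖t‖) ^ (1 / 4 : ℝ) = (1 + ‖t‖) ^ (-(5 / 4) : ℝ) := by
      rw [← rpow_add (by positivity)]; norm_num
    calc _ ≤ C * (1 + ‖t‖) ^ (-(3 / 2) : ℝ) *
          (2 * ((1 + ‖t‖) ^ (1 / 4 : ℝ) * |x - x'| ^ (1 / 4 : ℝ))) := by
          refine mul_le_mul h3 (h2.trans ?_) (norm_nonneg _) (by positivity)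
          exact mul_le_mul_of_nonneg_left (mul_le_mul_of_nonneg_right h4 (by positivity)) zero_le_two
      _ = C * 2 * ((1 + ‖t‖) ^ (-(3 / 2) : ℝ) * (1 + ‖t‖) ^ (1 / 4 : ℝ)) * |x - x'| ^ (1 / 4 : ℝ) := by
          ring
      _ = _ := by rw [h5]
  calc _ ≤ ‖(1 / (2 * π) : ℂ)‖ * (C * 2 * J * |x - x'| ^ (1 / 4 : ℝ)) := by gcongr
    _ ≤ _ := by
      have : 0 ≤ |x - x'| ^ (1 / 4 : ℝ) := by positivity
      nlinarith

theorem rightTransform_inverseTransform (hm : m' < m) (hm0 : 0 ≤ m')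
    (hd : DifferentiableOn ℂ h {ξ | -m < ξ.im})
    (hC : 0 ≤ C) (hb : ∀ ξ : ℂ, -m' ≤ ξ.im → ‖h ξ‖ ≤ C * (1 + ‖ξ‖) ^ (-(3 / 2) : ℝ)) {ξ : ℂ}
    (hξ : -m' < ξ.im) : rightTransform (inverseTransform h 0) ξ = h ξ := by
  set y := ξ.im with hy
  obtain ⟨hc, hi⟩ := integrable_shift hm hd hC hb hξ.le
  set H : ℝ → ℂ := fun t => h (t + y * I) with hH
  obtain ⟨K, hK, hKb⟩ := exists_inverseTransform_le hm hm0 hd hC hb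
  obtain ⟨K', hK', hKb'⟩ := exists_inverseTransform_sub_le hm hm0 hd hC hb
  set q := inverseTransform h 0 with hq
  have hqc : Continuous q := by
    rw [continuous_iff_continuousAt]
    intro x
    rw [ContinuousAt, tendsto_iff_norm_sub_tendsto_zero]
    refine squeeze_zero (fun _ => norm_nonneg _) (fun x' => hKb' x' x) ?_
    have : ContinuousAt (fun x' : ℝ => K' * |x' - x| ^ (1 / 4 : ℝ)) x := by
      refine continuousAt_const.mul (ContinuousAt.rpow_const ?_ (Or.inr (by norm_num)))
      fun_prop
    have h2 := this.tendsto
    simpa using h2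
  have hFq : ∀ w : ℝ, FourierTransform.fourier H w =
      2 * π * (q (2 * π * w) * cexp (I * (y * I) * ((2 * π * w : ℝ) : ℂ))) := by
    intro w
    rw [hq, inverseTransform_congr hm hd hC hb (by linarith) hξ.le, inverseTransform,
      fourier_real_eq_integral_exp_smul]
    have hpi : (2 * π : ℂ) ≠ 0 := by exact_mod_cast (by positivity : (2 * π : ℝ) ≠ 0)
    rw [mul_assoc (1 / (2 * π) : ℂ), ← mul_assoc (2 * π : ℂ), mul_one_div_cancel hpi, one_mul,
      ← integral_mul_const]
    congr 1
    ext t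
    rw [smul_eq_mul, mul_comm, mul_assoc (h _), ← Complex.exp_add]
    congr 2
    push_cast
    ring
  have hm' : AEStronglyMeasurable q (volume.restrict (Ioi 0)) := hqc.aestronglyMeasurable
  have hqi : Integrable fun x : ℝ => q x * cexp (I * (y * I) * x) := by
    have h1 := integrableOn_right (ξ := y * I) hm' (fun x _ => hKb x) (by simpa using hξ)
    rw [← integrable_indicator_iff measurableSet_Ioi] at h1
    refine h1.congr (Eventually.of_forall fun x => ?_)
    by_cases hx : 0 < x
    · simp [indicator_of_mem (show x ∈ Ioi (0 : ℝ) from hx)]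
    · simp only [hq]
      rw [indicator_of_notMem (show x ∉ Ioi (0 : ℝ) from hx),
        inverseTransform_nonpos hm hm0 hd hC hb (not_lt.1 hx), zero_mul]
  have hFi : Integrable (FourierTransform.fourier H) := by
    have : FourierTransform.fourier H = fun w : ℝ => 2 * π * (fun x : ℝ => q x *
        cexp (I * (y * I) * x)) (2 * π * w) := funext hFq
    rw [this]
    exact (hqi.comp_mul_left' (by positivity)).const_mul _
  have hinv := hi.fourierInv_fourier_eq hFi (v := ξ.re) hc.continuousAt
  have hHξ : H ξ.re = h ξ := by rw [hH]; simp only [hy, Complex.re_add_im]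
  rw [hHξ, fourierInv_eq'] at hinv
  rw [← hinv, rightTransform]
  have e1 : ∫ x in Ioi (0 : ℝ), q x * cexp (I * ξ * x) =
      ∫ x : ℝ, q x * cexp (I * ξ * x) := by
    refine setIntegral_eq_integral_of_forall_compl_eq_zero fun x hx => ?_
    rw [hq, inverseTransform_nonpos hm hm0 hd hC hb (not_lt.1 hx), zero_mul]
  have e2 := Measure.integral_comp_mul_left
    (fun x : ℝ => q x * cexp (I * ξ * x)) (2 * π)
  rw [abs_of_pos (by positivity), eq_inv_smul_iff₀ (by positivity)] at e2
  rw [e1, ← e2, ← integral_smul]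
  congr 1
  ext w
  rw [hFq, smul_eq_mul, Complex.real_smul]
  have e3 : cexp (I * ξ * ((2 * π * w : ℝ) : ℂ)) =
      cexp (((2 * π * (w * ξ.re) : ℝ) : ℂ) * I) *
      cexp (I * (y * I) * ((2 * π * w : ℝ) : ℂ)) := by
    rw [← Complex.exp_add]
    congr 1
    conv_lhs => rw [← Complex.re_add_im ξ]
    push_cast
    ring
  rw [e3]
  have e4 : (inner ℝ w ξ.re : ℝ) = w * ξ.re := by simp [mul_comm]
  rw [e4]
  push_cast
  ring

end

/-- A Paley–Wiener theorem: a function of the form `G(ξ)/(γ - iξ)`, with `G` holomorphic beyond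
the pole and tending to a constant at infinity, is the transform of a function on the half-line
which is continuous, decays like `exp(-γx)` and is Hölder continuous at `0`. -/
theorem exists_rightTransform_eq {G : ℂ → ℂ} {γ m' m C : ℝ} {c : ℂ} (hγ : 0 < γ) (hγm : γ < m')
    (hm : m' < m) (hG : DifferentiableOn ℂ G {ξ | -m < ξ.im})
    (hb : ∀ ξ : ℂ, -m' ≤ ξ.im → ‖G ξ - c‖ ≤ C * (1 + ‖ξ‖) ^ (-(1 / 2) : ℝ)) :
    ∃ p : ℝ → ℂ, Continuous p ∧ p 0 = c ∧
      (∃ K, 0 < K ∧ ∀ x, 0 ≤ x → ‖p x‖ ≤ K * exp (-γ * x)) ∧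
      (∃ K, 0 < K ∧ ∀ x, 0 ≤ x → ‖p x - p 0‖ ≤ K * x ^ (1 / 4 : ℝ)) ∧
      ∀ ξ : ℂ, -γ < ξ.im → rightTransform p ξ = G ξ / (γ - I * ξ) := by
  set z₀ : ℂ := -(γ * I) with hz₀
  have hz₀im : z₀.im = -γ := by simp [hz₀]
  set b : ℂ := c - G z₀ with hbdef
  have hopen : IsOpen {ξ : ℂ | -m < ξ.im} := isOpen_lt continuous_const Complex.continuous_im
  have hγne : ∀ ξ : ℂ, (γ - I * ξ) = -I * (ξ - z₀) := by
    intro ξ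
    rw [hz₀]
    linear_combination (γ : ℂ) * Complex.I_mul_I
  have hmne : ∀ ξ : ℂ, (m - I * ξ) = -I * (ξ - -(m * I)) := by
    intro ξ
    linear_combination (m : ℂ) * Complex.I_mul_I
  have hm0 : ∀ ξ : ℂ, -m < ξ.im → (m - I * ξ) ≠ 0 := by
    intro ξ hξ h0
    have := congrArg Complex.re h0
    simp at this
    linarith
  set h : ℂ → ℂ := fun ξ => I * dslope G z₀ ξ - b / (m - I * ξ) with hh
  have hhd : DifferentiableOn ℂ h {ξ | -m < ξ.im} := by
    refine DifferentiableOn.sub (DifferentiableOn.const_mul ?_ _) ?_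
    · refine (Complex.differentiableOn_dslope (hopen.mem_nhds ?_)).2 hG
      change -m < z₀.im
      linarith
    · refine (differentiableOn_const _).div (by fun_prop) fun ξ hξ => hm0 ξ hξ
  have hheq : ∀ ξ, ξ ≠ z₀ → h ξ = (G ξ - G z₀) / (γ - I * ξ) - b / (m - I * ξ) := by
    intro ξ hξ
    rw [hh]
    simp only
    rw [dslope_of_ne _ hξ, slope_def_field, hγne]
    congr 1
    have h1 := sub_ne_zero.2 hξ
    field_simp
    rw [Complex.I_sq]
    ring
  have hC : 0 ≤ C := by
    have h1 := (norm_nonneg _).trans (hb 0 (by simp; linarith))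
    simpa using h1
  set d : ℝ := m - m' with hd
  have hdpos : 0 < d := sub_pos.2 hm
  obtain ⟨M, hM⟩ : ∃ M, ∀ ξ ∈ Metric.closedBall z₀ 1 ∩ {ξ | -m' ≤ ξ.im}, ‖h ξ‖ ≤ M := by
    refine IsCompact.exists_bound_of_continuousOn ((isCompact_closedBall z₀ 1).inter_right
      (isClosed_le continuous_const Complex.continuous_im)) (hhd.continuousOn.mono fun ξ hξ => ?_)
    have := hξ.2
    change -m' ≤ ξ.im at this
    change -m < ξ.im
    linarith
  set K : ℝ := (1 + m) / d + 1 with hK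
  have hmpos : 0 < m := by linarith
  set C' : ℝ := C * (2 + γ) + ‖b‖ * (m - γ) * ((2 + γ) * K) + |M| * (2 + γ) ^ (3 / 2 : ℝ) with hC'
  have hmg : 0 < m - γ := by linarith
  have hC'0 : 0 ≤ C' := by positivity
  have hnz : ‖z₀‖ = γ := by simp [hz₀, abs_of_pos hγ]
  have hhb : ∀ ξ : ℂ, -m' ≤ ξ.im → ‖h ξ‖ ≤ C' * (1 + ‖ξ‖) ^ (-(3 / 2) : ℝ) := by
    intro ξ hξ
    set w : ℝ := 1 + ‖ξ‖ with hw
    have hwpos : 0 < w := by positivity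
    have hw1 : 1 ≤ w := by linarith [norm_nonneg ξ]
    have htri : ‖ξ‖ ≤ ‖ξ - z₀‖ + γ := by
      have := norm_add_le (ξ - z₀) z₀
      rwa [sub_add_cancel, hnz] at this
    by_cases hball : ‖ξ - z₀‖ ≤ 1
    · have h1 := hM ξ ⟨by rwa [mem_closedBall_iff_norm], hξ⟩
      have h2 : w ≤ 2 + γ := by linarith
      have h3 : 1 ≤ (2 + γ) ^ (3 / 2 : ℝ) * w ^ (-(3 / 2) : ℝ) := by
        rw [rpow_neg hwpos.le, ← div_eq_mul_inv, one_le_div (by positivity)]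
        exact rpow_le_rpow hwpos.le h2 (by norm_num)
      have h4 : 0 ≤ w ^ (-(3 / 2) : ℝ) := by positivity
      calc ‖h ξ‖ ≤ |M| * 1 := by rw [mul_one]; exact h1.trans (le_abs_self M)
        _ ≤ |M| * ((2 + γ) ^ (3 / 2 : ℝ) * w ^ (-(3 / 2) : ℝ)) :=
            mul_le_mul_of_nonneg_left h3 (abs_nonneg _)
        _ = |M| * (2 + γ) ^ (3 / 2 : ℝ) * w ^ (-(3 / 2) : ℝ) := by ring
        _ ≤ _ := by
            refine mul_le_mul_of_nonneg_right ?_ h4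
            rw [hC']
            have : 0 ≤ C * (2 + γ) + ‖b‖ * (m - γ) * ((2 + γ) * K) := by positivity
            linarith
    · rw [not_le] at hball
      have hne : ξ ≠ z₀ := by
        rintro rfl
        simp at hball
        linarith
      have hn1 : ‖(γ - I * ξ)⁻¹‖ ≤ (2 + γ) * w⁻¹ := by
        rw [hγne, norm_inv, norm_mul, norm_neg, Complex.norm_I, one_mul, inv_le_comm₀ (by linarith)
          (by positivity), mul_inv, inv_inv, inv_mul_le_iff₀ (by positivity)]
        nlinarith
      have hn2 : ‖(m - I * ξ)⁻¹‖ ≤ K * w⁻¹ := by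
        have e1 : d ≤ ‖ξ - -(m * I)‖ := by
          have := Complex.abs_im_le_norm (ξ - -(m * I))
          have e : (ξ - -(m * I)).im = ξ.im + m := by simp
          rw [e] at this
          linarith [le_abs_self (ξ.im + m)]
        have e2 : ‖ξ‖ ≤ ‖ξ - -(m * I)‖ + m := by
          have := norm_add_le (ξ - -(m * I)) (-(m * I))
          rw [sub_add_cancel] at this
          simpa [abs_of_pos hmpos] using this
        have e3 : w ≤ K * ‖ξ - -(m * I)‖ := by
          have : (1 + m) ≤ (1 + m) / d * ‖ξ - -(m * I)‖ := by
            rw [div_mul_eq_mul_div, le_div_iff₀ hdpos]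
            exact mul_le_mul_of_nonneg_left e1 (by linarith)
          rw [hK, add_mul]
          linarith
        rw [hmne, norm_inv, norm_mul, norm_neg, Complex.norm_I, one_mul,
          inv_le_comm₀ (by linarith) (by positivity), mul_inv, inv_inv,
          inv_mul_le_iff₀ (by positivity)]
        exact e3
      have hγ0 : (γ - I * ξ) ≠ 0 := by
        rw [hγne]
        exact mul_ne_zero (by simp) (sub_ne_zero.2 hne)
      have hmm0 := hm0 ξ (by linarith)
      have e5 : h ξ = (G ξ - c) * (γ - I * ξ)⁻¹ +
          b * ((m - γ : ℝ) : ℂ) * ((γ - I * ξ)⁻¹ * (m - I * ξ)⁻¹) := by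
        rw [hheq ξ hne, hbdef]
        push_cast
        field_simp
        ring
      have r1 : w ^ (-(1 / 2) : ℝ) * w⁻¹ = w ^ (-(3 / 2) : ℝ) := by
        rw [← rpow_neg_one, ← rpow_add hwpos]; norm_num
      have r2 : w⁻¹ * w⁻¹ ≤ w ^ (-(3 / 2) : ℝ) := by
        rw [← rpow_neg_one, ← rpow_add hwpos]
        exact rpow_le_rpow_of_exponent_le hw1 (by norm_num)
      rw [e5]
      refine (norm_add_le _ _).trans ?_
      rw [norm_mul, norm_mul, norm_mul, norm_mul, Complex.norm_real, norm_of_nonneg hmg.le]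
      have t1 : ‖G ξ - c‖ * ‖(γ - I * ξ)⁻¹‖ ≤ C * (2 + γ) * w ^ (-(3 / 2) : ℝ) := by
        calc _ ≤ (C * w ^ (-(1 / 2) : ℝ)) * ((2 + γ) * w⁻¹) :=
              mul_le_mul (hb ξ hξ) hn1 (norm_nonneg _) (by positivity)
          _ = C * (2 + γ) * (w ^ (-(1 / 2) : ℝ) * w⁻¹) := by ring
          _ = _ := by rw [r1]
      have t2 : ‖b‖ * (m - γ) * (‖(γ - I * ξ)⁻¹‖ * ‖(m - I * ξ)⁻¹‖) ≤
          ‖b‖ * (m - γ) * ((2 + γ) * K) * w ^ (-(3 / 2) : ℝ) := by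
        calc _ ≤ ‖b‖ * (m - γ) * (((2 + γ) * w⁻¹) * (K * w⁻¹)) :=
              mul_le_mul_of_nonneg_left (mul_le_mul hn1 hn2 (norm_nonneg _) (by positivity))
                (by positivity)
          _ = ‖b‖ * (m - γ) * ((2 + γ) * K) * (w⁻¹ * w⁻¹) := by ring
          _ ≤ _ := mul_le_mul_of_nonneg_left r2 (by positivity)
      refine (add_le_add t1 t2).trans ?_
      rw [← add_mul, hC']
      refine mul_le_mul_of_nonneg_right ?_ (by positivity)
      have : 0 ≤ |M| * (2 + γ) ^ (3 / 2 : ℝ) := by positivity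
      linarith
  have hm'0 : 0 ≤ m' := by linarith
  obtain ⟨K₁, hK₁, hq₁⟩ := exists_inverseTransform_le hm hm'0 hhd hC'0 hhb
  obtain ⟨K₂, hK₂, hq₂⟩ := exists_inverseTransform_sub_le hm hm'0 hhd hC'0 hhb
  have hq0 := inverseTransform_nonpos hm hm'0 hhd hC'0 hhb le_rfl
  set q := inverseTransform h 0 with hq
  have hqc : Continuous q := by
    rw [continuous_iff_continuousAt]
    intro x
    rw [ContinuousAt, tendsto_iff_norm_sub_tendsto_zero]
    refine squeeze_zero (fun _ => norm_nonneg _) (fun x' => hq₂ x' x) ?_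
    have : ContinuousAt (fun x' : ℝ => K₂ * |x' - x| ^ (1 / 4 : ℝ)) x := by
      refine continuousAt_const.mul (ContinuousAt.rpow_const ?_ (Or.inr (by norm_num)))
      fun_prop
    have h2 := this.tendsto
    simpa using h2
  set e₁ : ℝ → ℂ := fun x => G z₀ * (exp (-γ * x) : ℂ) with he₁
  set e₂ : ℝ → ℂ := fun x => b * (exp (-m * x) : ℂ) with he₂
  have hexp : ∀ (g : ℝ) (v : ℂ) (x : ℝ), ‖v * (exp (-g * x) : ℂ)‖ = ‖v‖ * exp (-g * x) := by
    intro g v x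
    rw [norm_mul, Complex.norm_real, norm_of_nonneg (exp_pos _).le]
  have hmono : ∀ g, γ ≤ g → ∀ x, 0 ≤ x → exp (-g * x) ≤ exp (-γ * x) := by
    intro g hg x hx
    exact exp_le_exp.2 (by nlinarith)
  have hT : ∀ (g : ℝ) (v : ℂ) (ξ : ℂ), -g < ξ.im →
      IntegrableOn (fun x : ℝ => v * (exp (-g * x) : ℂ) * cexp (I * ξ * x))
        (Ioi 0) ∧
      ∫ x in Ioi (0 : ℝ), v * (exp (-g * x) : ℂ) * cexp (I * ξ * x) =
        v / (g - I * ξ) := by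
    intro g v ξ hξ
    have hre : (-g + I * ξ).re < 0 := by simp; linarith
    have e0 : ∀ x : ℝ, v * (exp (-g * x) : ℂ) * cexp (I * ξ * x) =
        v * cexp ((-g + I * ξ) * x) := by
      intro x
      rw [mul_assoc, Complex.ofReal_exp, ← Complex.exp_add]
      congr 2
      push_cast
      ring
    simp_rw [e0]
    refine ⟨(integrableOn_exp_mul_complex_Ioi hre 0).const_mul v, ?_⟩
    rw [integral_const_mul, integral_exp_mul_complex_Ioi hre]
    simp only [Complex.ofReal_zero, mul_zero, Complex.exp_zero]
    rw [neg_div, ← div_neg, div_eq_mul_one_div v]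
    congr 2
    ring
  refine ⟨fun x => e₁ x + e₂ x + q x, by fun_prop, ?_, ⟨‖G z₀‖ + ‖b‖ + K₁, by positivity, ?_⟩,
    ⟨‖G z₀‖ * (2 * γ ^ (1 / 4 : ℝ)) + ‖b‖ * (2 * m ^ (1 / 4 : ℝ)) + K₂, by positivity, ?_⟩, ?_⟩
  · simp [he₁, he₂, hq0, hbdef]
  · intro x hx
    refine (norm_add₃_le ..).trans ?_
    rw [add_mul, add_mul, hexp, hexp]
    refine add_le_add_three le_rfl (mul_le_mul_of_nonneg_left (hmono m (by linarith) x hx)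
      (norm_nonneg _)) ((hq₁ x).trans (mul_le_mul_of_nonneg_left (hmono m' hγm.le x hx) hK₁.le))
  · intro x hx
    have hsub : ∀ (g : ℝ) (v : ℂ), 0 ≤ g → ‖v * (exp (-g * x) : ℂ) - v *
        (exp (-g * 0) : ℂ)‖ ≤ ‖v‖ * (2 * g ^ (1 / 4 : ℝ)) * x ^ (1 / 4 : ℝ) := by
      intro g v hg
      have := abs_exp_neg_sub_one_le hg hx
      rw [mul_rpow hg hx] at this
      rw [← mul_sub, norm_mul, mul_zero, exp_zero, ← Complex.ofReal_sub, Complex.norm_real,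
        norm_eq_abs, mul_assoc, mul_assoc]
      exact mul_le_mul_of_nonneg_left this (norm_nonneg _)
    have e6 : e₁ x + e₂ x + q x - (e₁ 0 + e₂ 0 + q 0) =
        (e₁ x - e₁ 0) + (e₂ x - e₂ 0) + (q x - q 0) := by ring
    rw [e6]
    refine (norm_add₃_le ..).trans ?_
    rw [add_mul, add_mul]
    refine add_le_add_three (hsub γ _ hγ.le) (hsub m _ hmpos.le) ?_
    have := hq₂ x 0
    rwa [sub_zero, abs_of_nonneg hx] at this
  · intro ξ hξ
    have i1 := hT γ (G z₀) ξ hξ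
    have i2 := hT m b ξ (by linarith)
    have i3 : IntegrableOn (fun x : ℝ => q x * cexp (I * ξ * x)) (Ioi 0) :=
      integrableOn_right hqc.aestronglyMeasurable (fun x _ => hq₁ x) (by linarith)
    have hqT := rightTransform_inverseTransform hm hm'0 hhd hC'0 hhb (ξ := ξ) (by linarith)
    rw [rightTransform] at hqT ⊢
    simp_rw [add_mul]
    rw [integral_add, integral_add i1.1 i2.1, hqT, i1.2, i2.2, hheq]
    · ring
    · rintro rfl
      linarith
    · exact i1.1.add i2.1
    · exact i3

end BimaterialStrip

namespace BimaterialStrip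

/-! ### The normalised interface traction -/

section NearOne

variable {α : Type*} {l : Filter α} {f g : α → ℂ} {w : α → ℝ}

theorem tendsto_one_of_isBigO (hf : (fun x => f x - 1) =O[l] w) (hw : Tendsto w l (𝓝 0)) :
    Tendsto f l (𝓝 1) := by
  have := (hf.trans_tendsto hw).add_const 1
  simpa using this

theorem isBigO_mul_sub_one (hf : (fun x => f x - 1) =O[l] w) (hg : (fun x => g x - 1) =O[l] w)
    (hw : Tendsto w l (𝓝 0)) : (fun x => f x * g x - 1) =O[l] w := by
  have h1 : (fun x => (f x - 1) * g x) =O[l] fun x => w x * 1 :=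
    hf.mul ((tendsto_one_of_isBigO hg hw).isBigO_one ℝ)
  refine ((h1.congr_right fun x => mul_one _).add hg).congr_left fun x => ?_
  ring

theorem isBigO_inv_sub_one (hf : (fun x => f x - 1) =O[l] w) (hw : Tendsto w l (𝓝 0)) :
    (fun x => (f x)⁻¹ - 1) =O[l] w := by
  have ht := tendsto_one_of_isBigO hf hw
  have h1 : (fun x => -(f x - 1) * (f x)⁻¹) =O[l] fun x => w x * 1 :=
    hf.neg_left.mul ((ht.inv₀ one_ne_zero).isBigO_one ℝ)
  refine (h1.congr_right fun x => mul_one _).congr' ?_ EventuallyEq.rfl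
  filter_upwards [ht.eventually_ne one_ne_zero] with x hx
  field_simp
  ring

end NearOne

/-- The weight `(1 + ‖ξ‖)^(-1/2)`. -/
noncomputable def halfWeight (ξ : ℂ) : ℝ := (1 + ‖ξ‖) ^ (-(1 / 2) : ℝ)

theorem tendsto_halfWeight : Tendsto halfWeight (Bornology.cobounded ℂ) (𝓝 0) :=
  (tendsto_rpow_neg_atTop (by norm_num : (0 : ℝ) < 1 / 2)).comp
    (tendsto_atTop_add_const_left _ 1 tendsto_norm_cobounded_atTop)

theorem inv_isBigO_halfWeight :
    (fun ξ : ℂ => ξ⁻¹) =O[Bornology.cobounded ℂ] halfWeight := by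
  refine IsBigO.of_bound 2 ?_
  filter_upwards [tendsto_norm_cobounded_atTop.eventually_ge_atTop 1] with ξ hξ
  have h1 : 0 < ‖ξ‖ := by linarith
  rw [norm_inv, norm_of_nonneg (by unfold halfWeight; positivity), inv_le_iff_one_le_mul₀ h1]
  have h2 : (1 + ‖ξ‖) ^ (-1 : ℝ) ≤ halfWeight ξ :=
    rpow_le_rpow_of_exponent_le (by linarith) (by norm_num)
  rw [rpow_neg_one] at h2
  have h3 : (1 + ‖ξ‖)⁻¹ * (1 + ‖ξ‖) = 1 := inv_mul_cancel₀ (by positivity)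
  nlinarith [inv_pos.2 (by positivity : 0 < 1 + ‖ξ‖)]

theorem isBigO_linear_sub_one (c : ℂ) {d : ℂ} (hd : d ≠ 0) :
    (fun ξ : ℂ => (c + d * ξ) / (d * ξ) - 1) =O[Bornology.cobounded ℂ] halfWeight := by
  refine (inv_isBigO_halfWeight.const_mul_left (c / d)).congr' ?_ EventuallyEq.rfl
  filter_upwards [tendsto_norm_cobounded_atTop.eventually_gt_atTop 0] with ξ hξ
  have : ξ ≠ 0 := norm_pos_iff.1 hξ
  field_simp
  ring

theorem exists_bound_of_isBigO_cobounded {F : ℂ → ℂ} {S : Set ℂ} (hS : IsClosed S)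
    (hF : ContinuousOn F S) (h : F =O[Bornology.cobounded ℂ ⊓ 𝓟 S] halfWeight) :
    ∃ C, 0 < C ∧ ∀ ξ ∈ S, ‖F ξ‖ ≤ C * halfWeight ξ := by
  obtain ⟨C, hC⟩ := h.bound
  rw [eventually_inf_principal, (Metric.hasBasis_cobounded_compl_closedBall (0 : ℂ)).eventually_iff]
    at hC
  obtain ⟨R, -, hR⟩ := hC
  obtain ⟨M, hM⟩ := IsCompact.exists_bound_of_continuousOn
    ((isCompact_closedBall (0 : ℂ) R).inter_right hS) (hF.mono inter_subset_right)
  have hw : ∀ ξ, 0 < halfWeight ξ := fun ξ => by unfold halfWeight; positivity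
  refine ⟨|C| + |M| * (1 + |R|) ^ (1 / 2 : ℝ) + 1, by positivity, fun ξ hξ => ?_⟩
  have hm : 0 ≤ |M| * (1 + |R|) ^ (1 / 2 : ℝ) := by positivity
  by_cases hb : ξ ∈ Metric.closedBall (0 : ℂ) R
  · refine (hM ξ ⟨hb, hξ⟩).trans ((le_abs_self M).trans ?_)
    have h1 : 1 ≤ (1 + |R|) ^ (1 / 2 : ℝ) * halfWeight ξ := by
      rw [halfWeight, rpow_neg (by positivity), ← div_eq_mul_inv, one_le_div (by positivity)]
      rw [mem_closedBall_zero_iff] at hb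
      exact rpow_le_rpow (by positivity) (by linarith [le_abs_self R]) (by norm_num)
    calc |M| ≤ |M| * ((1 + |R|) ^ (1 / 2 : ℝ) * halfWeight ξ) :=
          le_mul_of_one_le_right (abs_nonneg _) h1
      _ = (|M| * (1 + |R|) ^ (1 / 2 : ℝ)) * halfWeight ξ := by ring
      _ ≤ _ := mul_le_mul_of_nonneg_right (by linarith [abs_nonneg C]) (hw ξ).le
  · have := hR hb hξ
    rw [norm_of_nonneg (hw ξ).le] at this
    exact this.trans (mul_le_mul_of_nonneg_right (by linarith [le_abs_self C]) (hw ξ).le)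

variable (P : StripParams)

/-- The transform `Ψ` of the normalised traction multiplied by `γ₊ - iξ`, continued to
`Im ξ > -γ₋`. -/
noncomputable def tractionSymbol (ξ : ℂ) : ℂ :=
  if -(gammaPlus P / 2) < ξ.im then
    (gammaPlus P - I * ξ) *
      (-1 / (P.κ * (lam P - I * ξ) * XiStarPlus P (gammaPlus P / 2) ξ))
  else I * (lam P + I * ξ) * XiStarMinus P (gammaPlus P / 2) ξ /
    dslope (kernelNum P) (-(gammaPlus P * I)) ξ

theorem lam_sub_ne {ξ : ℂ} (h : -lam P < ξ.im) : (lam P - I * ξ : ℂ) ≠ 0 := by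
  intro h0
  have := congrArg Complex.re h0
  simp at this
  linarith

theorem lam_add_ne {ξ : ℂ} (h : ξ.im < lam P) : (lam P + I * ξ : ℂ) ≠ 0 := by
  intro h0
  have := congrArg Complex.re h0
  simp at this
  linarith

/-- The transform of the normalised traction times the kernel. -/
theorem kernelNum_mul_traction {β : ℝ} (h0 : 0 < β) (h1 : β < gammaPlus P) {ξ : ℂ}
    (h₁ : -β < ξ.im) (h₂ : ξ.im < β) :
    kernelNum P ξ * (-1 / (P.κ * (lam P - I * ξ) * XiStarPlus P β ξ)) =
      -((lam P + I * ξ) * XiStarMinus P β ξ) := by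
  have hl := gammaPlus_lt_lam P
  have e := kernelStar_eq_mul P h0 h1 h₁ h₂
  have n1 := lam_sub_ne P (ξ := ξ) (by linarith)
  have n2 := lam_sq_add_ne P (ξ := ξ) (by rw [abs_lt]; constructor <;> linarith)
  have n3 := XiStarPlus_ne_zero P β ξ
  have n4 : (P.κ : ℂ) ≠ 0 := by exact_mod_cast P.κ_pos.ne'
  rw [kernelStar, div_eq_iff (mul_ne_zero n4 n2)] at e
  rw [e]
  have e2 : (lam P : ℂ) ^ 2 + ξ ^ 2 = (lam P - I * ξ) * (lam P + I * ξ) := by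
    linear_combination (ξ ^ 2) * Complex.I_sq
  rw [e2]
  field_simp

theorem gammaPlus_sub_eq (ξ : ℂ) : (gammaPlus P - I * ξ : ℂ) =
    -I * (ξ - -(gammaPlus P * I)) := by
  linear_combination (gammaPlus P : ℂ) * Complex.I_mul_I

theorem kernelNum_eq_mul_dslope (ξ : ℂ) : kernelNum P ξ = (ξ - -(gammaPlus P * I)) *
    dslope (kernelNum P) (-(gammaPlus P * I)) ξ := by
  have := sub_smul_dslope (kernelNum P) (-(gammaPlus P * I)) ξ
  rw [kernelNum_gammaPlus, sub_zero, smul_eq_mul] at this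
  exact this.symm

theorem dslope_kernelNum_ne_zero {ξ : ℂ} (h : -gammaMinus P < ξ.im) (h' : ξ.im < 0) :
    dslope (kernelNum P) (-(gammaPlus P * I)) ξ ≠ 0 := by
  by_cases hξ : ξ = -(gammaPlus P * I)
  · rw [hξ, dslope_same]
    exact deriv_kernelNum_gammaPlus P
  · intro h0
    have e := kernelNum_eq_mul_dslope P ξ
    rw [h0, mul_zero] at e
    refine kernelNum_ne_zero P (by rw [abs_lt]; constructor <;> linarith [gammaMinus_pos P]) ?_ e
    rintro ⟨hr, hi⟩
    refine hξ (Complex.ext (by simp [hr]) ?_)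
    rw [abs_of_neg h'] at hi
    simp
    linarith

theorem tractionSymbol_of_im_neg {ξ : ℂ} (h : -gammaMinus P < ξ.im) (h' : ξ.im < 0) :
    tractionSymbol P ξ = I * (lam P + I * ξ) *
      XiStarMinus P (gammaPlus P / 2) ξ / dslope (kernelNum P) (-(gammaPlus P * I)) ξ := by
  have hg := gammaPlus_pos P
  unfold tractionSymbol
  split_ifs with hξ
  · rw [eq_div_iff (dslope_kernelNum_ne_zero P h h')]
    have e := kernelNum_mul_traction P (half_pos hg) (half_lt_self hg) hξ (by linarith)
    rw [kernelNum_eq_mul_dslope] at e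
    rw [gammaPlus_sub_eq]
    linear_combination (-I) * e
  · rfl

theorem differentiableOn_tractionSymbol :
    DifferentiableOn ℂ (tractionSymbol P) {ξ | -gammaMinus P < ξ.im} := by
  have hg := gammaPlus_pos P
  have hgm := gammaPlus_lt P
  have hgl := gammaPlus_lt_lam P
  intro ξ hξ
  change -gammaMinus P < ξ.im at hξ
  refine DifferentiableAt.differentiableWithinAt ?_
  rcases lt_or_ge (-(gammaPlus P / 2)) ξ.im with h | h
  · have hU : {ξ : ℂ | -(gammaPlus P / 2) < ξ.im} ∈ 𝓝 ξ :=
      (isOpen_lt continuous_const Complex.continuous_im).mem_nhds h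
    have e : tractionSymbol P =ᶠ[𝓝 ξ] fun ξ => (gammaPlus P - I * ξ) *
        (-1 / (P.κ * (lam P - I * ξ) * XiStarPlus P (gammaPlus P / 2) ξ)) := by
      filter_upwards [hU] with z hz
      exact if_pos hz
    refine DifferentiableAt.congr_of_eventuallyEq ?_ e
    have hX := (differentiableOn_XiStarPlus P (half_pos hg) (half_lt_self hg)).differentiableAt hU
    refine DifferentiableAt.mul (by fun_prop) (DifferentiableAt.div (by fun_prop) ?_ ?_)
    · exact DifferentiableAt.mul (by fun_prop) hX
    · refine mul_ne_zero (mul_ne_zero (by exact_mod_cast P.κ_pos.ne') ?_)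
        (XiStarPlus_ne_zero P _ ξ)
      exact lam_sub_ne P (by linarith)
  · have h0 : ξ.im < 0 := by linarith
    have hU : {ξ : ℂ | -gammaMinus P < ξ.im ∧ ξ.im < 0} ∈ 𝓝 ξ :=
      ((isOpen_lt continuous_const Complex.continuous_im).inter
        (isOpen_lt Complex.continuous_im continuous_const)).mem_nhds ⟨hξ, h0⟩
    have e : tractionSymbol P =ᶠ[𝓝 ξ] fun ξ => I * (lam P + I * ξ) *
      XiStarMinus P (gammaPlus P / 2) ξ / dslope (kernelNum P) (-(gammaPlus P * I)) ξ := by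
      filter_upwards [hU] with z hz
      exact tractionSymbol_of_im_neg P hz.1 hz.2
    refine DifferentiableAt.congr_of_eventuallyEq ?_ e
    have hX := (differentiableOn_XiStarMinus P (half_pos hg) (half_lt_self hg)).differentiableAt
      ((isOpen_lt Complex.continuous_im continuous_const).mem_nhds
        (show ξ.im < gammaPlus P / 2 by linarith))
    have hO : IsOpen {ξ : ℂ | |ξ.im| < gammaMinus P} := isOpen_strip _
    have hN : DifferentiableOn ℂ (kernelNum P) {ξ : ℂ | |ξ.im| < gammaMinus P} :=
      fun z hz => (differentiableAt_kernelNum P hz).differentiableWithinAt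
    have hD := (Complex.differentiableOn_dslope (c := -(gammaPlus P * I)) (hO.mem_nhds (by
      change |(-(gammaPlus P * I) : ℂ).im| < _
      simp [abs_of_pos hg, hgm]))).2 hN
    refine DifferentiableAt.div (DifferentiableAt.mul (by fun_prop) hX)
      (hD.differentiableAt (hO.mem_nhds ?_)) (dslope_kernelNum_ne_zero P hξ h0)
    change |ξ.im| < _
    rw [abs_lt]
    constructor <;> linarith

theorem tractionSymbol_ne_zero : tractionSymbol P (-(gammaPlus P * I)) ≠ 0 := by
  have hg := gammaPlus_pos P
  have hgm := gammaPlus_lt P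
  have him : (-(gammaPlus P * I) : ℂ).im = -gammaPlus P := by simp
  rw [tractionSymbol_of_im_neg P (by rw [him]; linarith) (by rw [him]; linarith)]
  refine div_ne_zero (mul_ne_zero (mul_ne_zero Complex.I_ne_zero (lam_add_ne P ?_))
    (XiStarMinus_ne_zero P _ _)) (dslope_kernelNum_ne_zero P ?_ ?_) <;> rw [him] <;>
    linarith [lam_pos P]

theorem isBigO_tractionSymbol {m' : ℝ} (hm' : m' < gammaMinus P) :
    (fun ξ => -(P.κ : ℂ) * tractionSymbol P ξ - 1)
      =O[Bornology.cobounded ℂ ⊓ 𝓟 {ξ : ℂ | -m' ≤ ξ.im}] halfWeight := by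
  have hg := gammaPlus_pos P
  have hκ : (P.κ : ℂ) ≠ 0 := by exact_mod_cast P.κ_pos.ne'
  set g := gammaPlus P with hgdef
  obtain ⟨C, hC, hE⟩ := exists_XiStarPlus_sub_one_le P (half_pos hg) (half_lt_self hg)
    (half_pos (half_pos hg))
  have hcov : {ξ : ℂ | -m' ≤ ξ.im} ⊆
      {ξ : ℂ | -(g / 4) ≤ ξ.im} ∪ {ξ : ℂ | -m' ≤ ξ.im ∧ ξ.im ≤ -(g / 4)} := by
    intro ξ hξ
    rcases le_total (-(g / 4)) ξ.im with h | h
    · exact Or.inl h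
    · exact Or.inr ⟨hξ, h⟩
  have hne : ∀ᶠ ξ in Bornology.cobounded ℂ, ξ ≠ 0 ∧ ξ ≠ -(g * I) := by
    filter_upwards [tendsto_norm_cobounded_atTop.eventually_gt_atTop ‖(g * I : ℂ)‖] with ξ hξ
    refine ⟨norm_pos_iff.1 ((norm_nonneg _).trans_lt hξ), ?_⟩
    rintro rfl
    rw [norm_neg] at hξ
    exact lt_irrefl _ hξ
  refine IsBigO.mono ?_ (inf_le_inf_left _ (principal_mono.2 hcov))
  rw [← sup_principal, inf_sup_left, isBigO_sup]
  constructor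
  · set l := Bornology.cobounded ℂ ⊓ 𝓟 {ξ : ℂ | -(g / 4) ≤ ξ.im} with hl
    have hw : Tendsto halfWeight l (𝓝 0) := tendsto_halfWeight.mono_left inf_le_left
    have hE' : (fun ξ => XiStarPlus P (g / 2) ξ - 1) =O[l] halfWeight := by
      refine IsBigO.of_bound C ?_
      rw [hl, eventually_inf_principal]
      refine Eventually.of_forall fun ξ hξ => ?_
      change -(g / 4) ≤ ξ.im at hξ
      rw [norm_of_nonneg (by unfold halfWeight; positivity)]
      exact hE ξ (by linarith)
    have h1 := (isBigO_linear_sub_one g (neg_ne_zero.2 Complex.I_ne_zero)).mono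
      (inf_le_left : l ≤ _)
    have h2 := (isBigO_linear_sub_one (lam P) (neg_ne_zero.2 Complex.I_ne_zero)).mono
      (inf_le_left : l ≤ _)
    refine (isBigO_mul_sub_one (isBigO_mul_sub_one h1 (isBigO_inv_sub_one h2 hw) hw)
      (isBigO_inv_sub_one hE' hw) hw).congr' ?_ EventuallyEq.rfl
    rw [EventuallyEq, eventually_inf_principal]
    filter_upwards [hne] with ξ hξ0 hξ
    change -(g / 4) ≤ ξ.im at hξ
    have n4 := hξ0.1
    rw [tractionSymbol, if_pos (by linarith)]
    simp only [neg_mul, ← sub_eq_add_neg, ← hgdef]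
    field_simp
  · set l := Bornology.cobounded ℂ ⊓ 𝓟 {ξ : ℂ | -m' ≤ ξ.im ∧ ξ.im ≤ -(g / 4)} with hl
    have hw : Tendsto halfWeight l (𝓝 0) := tendsto_halfWeight.mono_left inf_le_left
    have hE' : (fun ξ => XiStarMinus P (g / 2) ξ - 1) =O[l] halfWeight := by
      refine IsBigO.of_bound C ?_
      rw [hl, eventually_inf_principal]
      refine Eventually.of_forall fun ξ hξ => ?_
      rw [norm_of_nonneg (by unfold halfWeight; positivity), XiStarMinus_eq_plus_neg P
        (half_pos hg).ne']
      have := hE (-ξ) (by rw [Complex.neg_im]; linarith [hξ.2])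
      rwa [norm_neg] at this
    have h1 := (isBigO_linear_sub_one g (neg_ne_zero.2 Complex.I_ne_zero)).mono
      (inf_le_left : l ≤ _)
    have h2 := (isBigO_linear_sub_one (lam P) Complex.I_ne_zero).mono (inf_le_left : l ≤ _)
    have hN : (fun ξ => kernelNum P ξ / (P.κ * ξ ^ 2) - 1) =O[l] halfWeight := by
      obtain ⟨R, C', hR, hC', hb⟩ := exists_kernelNum_asymp P
      have h3 : (fun ξ => kernelNum P ξ / (P.κ * ξ ^ 2) - 1) =O[l] fun ξ : ℂ => ξ⁻¹ := by
        refine IsBigO.of_bound (C' / P.κ) ?_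
        rw [hl, eventually_inf_principal]
        filter_upwards [tendsto_norm_cobounded_atTop.eventually_ge_atTop (R + |m'|),
          hne] with ξ h3 h4 h5
        have h6 : |ξ.im| ≤ |m'| := by
          rw [abs_of_nonpos (by linarith [h5.2])]
          linarith [le_abs_self m', h5.1]
        have h7 : R ≤ |ξ.re| := by linarith [Complex.norm_le_abs_re_add_abs_im ξ]
        have e : kernelNum P ξ / (P.κ * ξ ^ 2) - 1 =
            (kernelNum P ξ - P.κ * ξ ^ 2) * (P.κ * ξ ^ 2)⁻¹ := by
          have := h4.1
          field_simp
        rw [e, norm_mul, norm_inv, norm_inv, norm_mul, norm_pow, Complex.norm_real,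
          norm_of_nonneg P.κ_pos.le]
        refine (mul_le_mul_of_nonneg_right (hb ξ h7)
          (inv_nonneg.2 (by have := P.κ_pos; positivity))).trans (le_of_eq ?_)
        have := P.κ_pos.ne'
        field_simp
      exact h3.trans (inv_isBigO_halfWeight.mono inf_le_left)
    refine (isBigO_mul_sub_one (isBigO_mul_sub_one (isBigO_mul_sub_one h1 h2 hw)
      hE' hw) (isBigO_inv_sub_one hN hw) hw).congr' ?_ EventuallyEq.rfl
    rw [EventuallyEq, eventually_inf_principal]
    filter_upwards [hne] with ξ hξ0 hξ
    have n2 := dslope_kernelNum_ne_zero P (ξ := ξ) (by linarith [hξ.1]) (by linarith [hξ.2])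
    have n4 := hξ0.1
    have n5 : ξ + g * I ≠ 0 := by
      rw [← sub_neg_eq_add]
      exact sub_ne_zero.2 hξ0.2
    rw [tractionSymbol_of_im_neg P (by linarith [hξ.1]) (by linarith [hξ.2]),
      kernelNum_eq_mul_dslope]
    rw [neg_mul, ← sub_eq_add_neg, gammaPlus_sub_eq, ← hgdef,
      sub_neg_eq_add]
    rw [← hgdef] at n2
    generalize dslope (kernelNum P) (-(g * I)) ξ = D at n2 ⊢
    generalize ξ + g * I = E at n5 ⊢
    field_simp
    linear_combination (P.κ * XiStarMinus P (g / 2) ξ * (lam P + I * ξ)) * Complex.I_sq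

theorem rightTransform_conj (p : ℝ → ℂ) (ξ : ℂ) :
    rightTransform (fun x => starRingEnd ℂ (p x)) ξ =
      starRingEnd ℂ (rightTransform p (-starRingEnd ℂ ξ)) := by
  rw [rightTransform, rightTransform, ← integral_conj]
  congr 1
  ext x
  rw [map_mul, ← Complex.exp_conj]
  simp

/-- The interface traction of the weight function with `A = 1`. -/
theorem exists_normalTraction : ∃ p : ℝ → ℝ, Continuous p ∧ p 0 = -1 / P.κ ∧
    (∃ K, 0 < K ∧ ∀ x, 0 ≤ x → |p x| ≤ K * exp (-gammaPlus P * x)) ∧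
    (∃ K, 0 < K ∧ ∀ x, 0 ≤ x → |p x - p 0| ≤ K * x ^ (1 / 4 : ℝ)) ∧
    (∀ β, 0 < β → β < gammaPlus P → ∀ ξ : ℂ, -β < ξ.im →
      rightTransform (fun x => (p x : ℂ)) ξ =
        -1 / (P.κ * (lam P - I * ξ) * XiStarPlus P β ξ)) ∧
    ∃ G : ℂ → ℂ, ContinuousAt G (-(gammaPlus P * I)) ∧
      G (-(gammaPlus P * I)) ≠ 0 ∧ ∀ ξ : ℂ, -gammaPlus P < ξ.im →
        rightTransform (fun x => (p x : ℂ)) ξ = G ξ / (gammaPlus P - I * ξ) := by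
  have hg := gammaPlus_pos P
  have hgm := gammaPlus_lt P
  have hκ : (P.κ : ℂ) ≠ 0 := by exact_mod_cast P.κ_pos.ne'
  set m₁ := (2 * gammaPlus P + gammaMinus P) / 3 with hm₁
  set m₂ := (gammaPlus P + 2 * gammaMinus P) / 3 with hm₂
  have hd : DifferentiableOn ℂ (tractionSymbol P) {ξ | -m₂ < ξ.im} :=
    (differentiableOn_tractionSymbol P).mono fun ξ hξ => by
      change -m₂ < ξ.im at hξ
      change -gammaMinus P < ξ.im
      linarith
  have hclosed : IsClosed {ξ : ℂ | -m₁ ≤ ξ.im} :=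
    isClosed_le continuous_const Complex.continuous_im
  obtain ⟨C, hC, hb⟩ := exists_bound_of_isBigO_cobounded hclosed
    (F := fun ξ => tractionSymbol P ξ - -1 / P.κ)
    ((hd.continuousOn.mono fun ξ hξ => by
      change -m₁ ≤ ξ.im at hξ
      change -m₂ < ξ.im
      linarith).sub continuousOn_const)
    (((isBigO_tractionSymbol P (by linarith : m₁ < gammaMinus P)).const_mul_left
      (-1 / (P.κ : ℂ))).congr_left fun ξ => by field_simp; ring)
  obtain ⟨q, hqc, hq0, ⟨K, hK, hqK⟩, ⟨K', hK', hqK'⟩, hqT⟩ :=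
    exists_rightTransform_eq hg (by linarith : gammaPlus P < m₁) (by linarith : m₁ < m₂) hd hb
  have hΨ : ∀ β, 0 < β → β < gammaPlus P → ∀ ξ : ℂ, -β < ξ.im → rightTransform q ξ =
      -1 / (P.κ * (lam P - I * ξ) * XiStarPlus P β ξ) := by
    intro β h0 h1 ξ hξ
    rw [hqT ξ (by linarith)]
    have hne : (gammaPlus P - I * ξ : ℂ) ≠ 0 := by
      intro h0
      have := congrArg Complex.re h0
      simp at this
      linarith
    rw [div_eq_iff hne, mul_comm]
    rcases lt_or_ge (-(gammaPlus P / 2)) ξ.im with h | h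
    · rw [tractionSymbol, if_pos h, XiStarPlus_congr P (half_pos hg) (half_lt_self hg) h0 h1 h hξ]
    · have h2 : ξ.im < 0 := by linarith
      have h3 : -gammaMinus P < ξ.im := by linarith
      have n5 := dslope_kernelNum_ne_zero P h3 h2
      rw [tractionSymbol_of_im_neg P h3 h2,
        XiStarMinus_congr P (half_pos hg) (half_lt_self hg) h0 h1 (by linarith) (by linarith),
        div_eq_iff n5]
      have e := kernelNum_mul_traction P h0 h1 hξ (by linarith)
      rw [kernelNum_eq_mul_dslope] at e
      rw [gammaPlus_sub_eq]
      linear_combination I * e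
  have hqi : ∀ ξ : ℂ, -gammaPlus P < ξ.im →
      IntegrableOn (fun x : ℝ => q x * cexp (I * ξ * x)) (Ioi 0) := fun ξ hξ =>
    integrableOn_right hqc.aestronglyMeasurable (fun x hx => hqK x hx.le) hξ
  have hre : ∀ ξ : ℂ, -gammaPlus P < ξ.im →
      rightTransform (fun x => ((q x).re : ℂ)) ξ = rightTransform q ξ := by
    intro ξ hξ
    have hcqi : IntegrableOn (fun x : ℝ => starRingEnd ℂ (q x) * cexp (I * ξ * x))
        (Ioi 0) :=
      integrableOn_right (by fun_prop) (fun x hx => by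
        rw [RCLike.norm_conj]
        exact hqK x hx.le) hξ
    have e1 : rightTransform (fun x => starRingEnd ℂ (q x)) ξ = rightTransform q ξ := by
      obtain ⟨β, hβ1, hβ2⟩ := exists_between (max_lt hg (neg_lt.1 hξ))
      have hβ0 : 0 < β := (le_max_left _ _).trans_lt hβ1
      have hβξ : -β < ξ.im := neg_lt.1 ((le_max_right _ _).trans_lt hβ1)
      rw [rightTransform_conj, hΨ β hβ0 hβ2 _ (by simpa using hβξ), hΨ β hβ0 hβ2 ξ hβξ,
        XiStarPlus_neg_conj P hβ0 hβ2]
      simp [sub_eq_add_neg]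
    have e2 : rightTransform (fun x => ((q x).re : ℂ)) ξ =
        (1 / 2) * (rightTransform q ξ + rightTransform (fun x => starRingEnd ℂ (q x)) ξ) := by
      rw [rightTransform, rightTransform, rightTransform, ← integral_add (hqi ξ hξ) hcqi,
        ← integral_const_mul]
      congr 1
      ext x
      rw [Complex.re_eq_add_conj]
      ring
    rw [e2, e1]
    ring
  refine ⟨fun x => (q x).re, by fun_prop, ?_, ⟨K, hK, fun x hx =>
    (Complex.abs_re_le_norm _).trans (hqK x hx)⟩, ⟨K', hK', fun x hx => ?_⟩, ?_,
    tractionSymbol P, ?_, tractionSymbol_ne_zero P, ?_⟩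
  · have : (-1 / P.κ : ℂ) = ((-1 / P.κ : ℝ) : ℂ) := by push_cast; rfl
    simp only
    rw [hq0, this, Complex.ofReal_re]
  · simp only
    rw [← Complex.sub_re]
    exact (Complex.abs_re_le_norm _).trans (hqK' x hx)
  · intro β h0 h1 ξ hξ
    rw [hre ξ (by linarith), hΨ β h0 h1 ξ hξ]
  · refine (hd.differentiableAt ((isOpen_lt continuous_const Complex.continuous_im).mem_nhds
      ?_)).continuousAt
    change -m₂ < (-(gammaPlus P * I) : ℂ).im
    simp
    linarith
  · intro ξ hξ
    rw [hre ξ hξ, hqT ξ hξ]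

end BimaterialStrip

namespace BimaterialStrip

/-! ### The logarithmic kernel of a strip -/

/-- `log |1 - exp(-a(x + iy))|`, the Neumann kernel of the strip of width `π / a`. -/
noncomputable def stripLog (a x y : ℝ) : ℝ :=
  log ‖1 - cexp (-(a * (x + y * I)))‖

theorem norm_cexp_neg_mul (a x y : ℝ) :
    ‖cexp (-(a * (x + y * I)))‖ = exp (-(a * x)) := by
  rw [Complex.norm_exp]
  simp

theorem stripLog_neg_right (a x y : ℝ) : stripLog a x (-y) = stripLog a x y := by
  rw [stripLog, stripLog, ← RCLike.norm_conj]
  congr 2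
  rw [map_sub, map_one, ← Complex.exp_conj]
  simp

theorem stripLog_eq_add (a x y : ℝ) : stripLog a x y = -(a * x) + stripLog a (-x) y := by
  have e : 1 - cexp (-(a * (x + y * I))) =
      -cexp (-(a * (x + y * I))) *
        (1 - cexp (-(a * (((-x : ℝ) : ℂ) + ((-y : ℝ) : ℂ) * I)))) := by
    rw [mul_sub, mul_one, neg_mul, ← Complex.exp_add]
    have : -(a * (x + y * I)) + -(a * (((-x : ℝ) : ℂ) + ((-y : ℝ) : ℂ) * I)) =
      (0 : ℂ) := by push_cast; ring
    rw [this, Complex.exp_zero]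
    ring
  rw [← stripLog_neg_right a (-x), stripLog, stripLog]
  by_cases h0 : 1 - cexp (-(a * (((-x : ℝ) : ℂ) + ((-y : ℝ) : ℂ) * I))) = 0
  · rw [e, h0, mul_zero, norm_zero, log_zero, add_zero]
    have h1 := congrArg norm (sub_eq_zero.1 h0)
    rw [norm_cexp_neg_mul, norm_one] at h1
    have := exp_eq_one_iff _ |>.1 h1.symm
    linarith
  · rw [e, norm_mul, norm_neg, norm_cexp_neg_mul, log_mul (exp_pos _).ne'
      (norm_ne_zero_iff.2 h0), log_exp]

theorem abs_stripLog_le {a x : ℝ} (ha : 0 < a) (hx : 0 < x) (y : ℝ) :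
    |stripLog a x y| ≤ -log (1 - exp (-(a * x))) := by
  set u := exp (-(a * x)) with hu
  have hu1 : u < 1 := exp_lt_one_iff.2 (by nlinarith)
  have h1 : 1 - u ≤ ‖1 - cexp (-(a * (x + y * I)))‖ := by
    have := norm_sub_norm_le (1 : ℂ) (cexp (-(a * (x + y * I))))
    rwa [norm_one, norm_cexp_neg_mul] at this
  have h2 : ‖1 - cexp (-(a * (x + y * I)))‖ ≤ 1 + u := by
    have := norm_sub_le (1 : ℂ) (cexp (-(a * (x + y * I))))
    rwa [norm_one, norm_cexp_neg_mul] at this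
  rw [abs_le, neg_neg, ← log_inv]
  refine ⟨log_le_log (by linarith) h1, log_le_log (by linarith) (h2.trans ?_)⟩
  rw [le_inv_comm₀ (by linarith) (by linarith), ← one_div, le_div_iff₀ (by linarith)]
  nlinarith

theorem one_add_rpow_le {b r : ℝ} (hb : 0 ≤ b) (hr : 0 < r) (hr1 : r ≤ 1) :
    (1 + b) ^ r ≤ 1 + b ^ r := by
  lift b to NNReal using hb
  have := NNReal.rpow_add_le_add_rpow 1 b hr.le hr1
  rw [NNReal.one_rpow] at this
  exact_mod_cast this

theorem neg_log_one_sub_exp_neg_le {t r : ℝ} (ht : 0 < t) (hr : 0 < r) (hr1 : r ≤ 1) :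
    -log (1 - exp (-t)) ≤ 1 / r * (exp (-(r * t)) * (1 + t ^ (-r))) := by
  have hu1 : exp (-t) < 1 := exp_lt_one_iff.2 (by linarith)
  have hpos : 0 < 1 - exp (-t) := by linarith
  set v := exp (-t) * (1 + t⁻¹) with hv
  have hv0 : 0 ≤ v := by positivity
  have h1 : (1 - exp (-t))⁻¹ ≤ 1 + v := by
    rw [inv_le_iff_one_le_mul₀ hpos]
    have h3 : (1 + t) * exp (-t) ≤ 1 := by
      have := add_one_le_exp t
      have h4 : exp t * exp (-t) = 1 := by rw [← exp_add]; simp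
      nlinarith [exp_pos (-t)]
    have h5 : (1 + v) * (1 - exp (-t)) =
        1 + exp (-t) * t⁻¹ * (1 - (1 + t) * exp (-t)) := by
      rw [hv]
      field_simp
      ring
    rw [h5]
    have : 0 ≤ exp (-t) * t⁻¹ := by positivity
    nlinarith
  have h2 : -log (1 - exp (-t)) ≤ 1 / r * v ^ r := by
    rw [← log_inv]
    have h3 : log (1 + v) ≤ 1 / r * v ^ r := by
      have e : log (1 + v) = 1 / r * log ((1 + v) ^ r) := by
        rw [log_rpow (by positivity)]
        field_simp
      rw [e]
      refine mul_le_mul_of_nonneg_left ?_ (by positivity)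
      have h4 := one_add_rpow_le hv0 hr hr1
      have h5 := log_le_sub_one_of_pos (x := (1 + v) ^ r) (by positivity)
      linarith
    exact (log_le_log (by positivity) h1).trans h3
  refine h2.trans (mul_le_mul_of_nonneg_left ?_ (by positivity))
  rw [hv, mul_rpow (exp_pos _).le (by positivity), ← exp_mul]
  rw [show -t * r = -(r * t) by ring]
  refine mul_le_mul_of_nonneg_left ?_ (exp_pos _).le
  rw [rpow_neg ht.le, ← inv_rpow ht.le]
  exact one_add_rpow_le (by positivity) hr hr1

/-- A majorant of `stripLog`. -/
noncomputable def stripMajorant (a r x : ℝ) : ℝ :=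
  1 / r * (exp (-(r * (a * |x|))) * (1 + (a * |x|) ^ (-r))) + a * max (-x) 0

theorem abs_stripLog_le_majorant {a r x : ℝ} (ha : 0 < a) (hr : 0 < r) (hr1 : r ≤ 1) (hx : x ≠ 0)
    (y : ℝ) : |stripLog a x y| ≤ stripMajorant a r x := by
  rcases hx.lt_or_gt with h | h
  · rw [stripLog_eq_add, stripMajorant, abs_of_neg h, max_eq_left (by linarith)]
    have h1 := abs_stripLog_le ha (neg_pos.2 h) y
    have h2 := neg_log_one_sub_exp_neg_le (mul_pos ha (neg_pos.2 h)) hr hr1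
    refine (abs_add_le _ _).trans ?_
    rw [abs_of_pos (by nlinarith : 0 < -(a * x))]
    linarith
  · rw [stripMajorant, abs_of_pos h, max_eq_right (by linarith), mul_zero, add_zero]
    exact (abs_stripLog_le ha h y).trans (neg_log_one_sub_exp_neg_le (mul_pos ha h) hr hr1)

theorem stripMajorant_nonneg {a r x : ℝ} (ha : 0 < a) (hr : 0 < r) : 0 ≤ stripMajorant a r x := by
  unfold stripMajorant
  have : 0 ≤ max (-x) 0 := le_max_right _ _
  positivity

theorem integrable_of_even {f : ℝ → ℝ} (hf : ∀ x, f (-x) = f x) (h : IntegrableOn f (Ioi 0)) :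
    Integrable f := by
  have h1 : IntegrableOn f (Iio 0) := by
    have h2 : IntegrableOn f (Ioi (-0)) := by rwa [neg_zero]
    exact h2.comp_neg_Iio.congr_fun (fun x _ => hf x) measurableSet_Iio
  rw [← integrableOn_univ, ← Iio_union_Ici (a := (0 : ℝ)), integrableOn_union,
    integrableOn_Ici_iff_integrableOn_Ioi]
  exact ⟨h1, h⟩

theorem integrableOn_exp_neg_mul_rpow {c r : ℝ} (hc : 0 < c) (hr : r < 1) :
    IntegrableOn (fun x : ℝ => x ^ (-r) * exp (-(c * x))) (Ioi 0) := by
  have := integrableOn_rpow_mul_exp_neg_mul_rpow (s := -r) (p := 1) (b := c) (by linarith)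
    one_pos hc
  simpa using this

theorem integrable_stripMajorant {a r γ : ℝ} (ha : 0 < a) (hr : 0 < r) (hr1 : r < 1) (hγ : 0 < γ)
    (hγ1 : γ < r * a) : Integrable fun x => stripMajorant a r x * exp (γ * x) := by
  have hc : 0 < r * a - γ := by linarith
  have h1 : Integrable fun x : ℝ => 1 / r * (exp (-(r * (a * |x|))) * (1 + (a * |x|) ^ (-r))) *
      exp (γ * |x|) := by
    refine integrable_of_even (fun x => by simp) ?_
    have h2 := ((integrableOn_exp_neg_mul_rpow hc (zero_lt_one)).add
      ((integrableOn_exp_neg_mul_rpow hc hr1).const_mul (a ^ (-r)))).const_mul (1 / r)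
    refine IntegrableOn.congr_fun h2 (fun x hx => ?_) measurableSet_Ioi
    change 0 < x at hx
    simp only [Pi.add_apply]
    rw [abs_of_pos hx, mul_rpow ha.le hx.le, neg_zero, rpow_zero, one_mul,
      show -((r * a - γ) * x) = -(r * (a * x)) + γ * x by ring, exp_add]
    ring
  have h3 : Integrable fun x : ℝ => a * (|x| * exp (-(γ * |x|))) := by
    refine (integrable_of_even (fun x => by simp) ?_).const_mul a
    refine IntegrableOn.congr_fun (integrableOn_exp_neg_mul_rpow hγ (r := -1) (by norm_num))
      (fun x hx => ?_) measurableSet_Ioi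
    change 0 < x at hx
    simp [abs_of_pos hx]
  refine (h1.add h3).mono' ?_ (Eventually.of_forall fun x => ?_)
  · unfold stripMajorant
    exact Measurable.aestronglyMeasurable (by fun_prop)
  · rw [norm_of_nonneg (mul_nonneg (stripMajorant_nonneg ha hr) (exp_pos _).le),
      stripMajorant, add_mul]
    refine add_le_add (mul_le_mul_of_nonneg_left (exp_le_exp.2
      (mul_le_mul_of_nonneg_left (le_abs_self x) hγ.le)) (by positivity)) ?_
    rw [mul_assoc]
    refine mul_le_mul_of_nonneg_left ?_ ha.le
    rcases le_total x 0 with h | h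
    · rw [abs_of_nonpos h, max_eq_left (by linarith)]
      simp
    · rw [max_eq_right (by linarith), zero_mul]
      positivity

theorem exists_stripLog_majorant {a γ : ℝ} (hγ : 0 < γ) (hγ1 : γ < a) :
    ∃ D : ℝ → ℝ, (∀ x, 0 ≤ D x) ∧ Integrable (fun x => D x * exp (γ * x)) ∧
      ∀ x y, x ≠ 0 → |stripLog a x y| ≤ D x := by
  have ha : 0 < a := hγ.trans hγ1
  obtain ⟨r, hr, hr1⟩ := exists_between ((div_lt_one ha).2 hγ1)
  have hr0 : 0 < r := (by positivity : 0 < γ / a).trans hr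
  exact ⟨stripMajorant a r, fun x => stripMajorant_nonneg ha hr0,
    integrable_stripMajorant ha hr0 hr1 hγ ((div_lt_iff₀ ha).1 hr),
    fun x y hx => abs_stripLog_le_majorant ha hr0 hr1.le hx y⟩

theorem stripLog_arg_ne_zero {a x y : ℝ} (ha : 0 < a) (hx : x ≠ 0) :
    1 - cexp (-(a * (x + y * I))) ≠ 0 := by
  intro h0
  have h1 := congrArg norm (sub_eq_zero.1 h0)
  rw [norm_cexp_neg_mul, norm_one] at h1
  have h2 := (exp_eq_one_iff _).1 h1.symm
  rcases mul_eq_zero.1 (neg_eq_zero.1 h2) with h | h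
  · exact ha.ne' h
  · exact hx h

theorem continuous_stripLog {a x : ℝ} (ha : 0 < a) (hx : x ≠ 0) :
    Continuous fun y => stripLog a x y :=
  Continuous.log (by fun_prop) fun y => norm_ne_zero_iff.2 (stripLog_arg_ne_zero ha hx)

theorem measurable_stripLog (a y : ℝ) : Measurable fun x => stripLog a x y :=
  measurable_log.comp (by fun_prop)

end BimaterialStrip

namespace BimaterialStrip

/-! ### The Neumann potential of a strip -/

/-- Continuous functions on the half-line decaying like `exp(-γx)`. -/
structure HalfLineDecay (p : ℝ → ℝ) (γ : ℝ) : Prop where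
  pos : 0 < γ
  cont : ContinuousOn p (Ioi 0)
  bound : ∃ K, 0 < K ∧ ∀ x, 0 < x → |p x| ≤ K * exp (-γ * x)

/-- Extension by zero from the half-line. -/
noncomputable def zeroExt (p : ℝ → ℝ) : ℝ → ℝ := (Ioi 0).indicator p

/-- The solution in the strip `0 < Y < π / a` of the Neumann problem with datum `p` on `X > 0`. -/
noncomputable def potential (a : ℝ) (p : ℝ → ℝ) (X Y : ℝ) : ℝ :=
  1 / π * ∫ t, stripLog a t Y * zeroExt p (X - t)

section
variable {p : ℝ → ℝ} {γ a : ℝ}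

theorem zeroExt_of_pos {x : ℝ} (hx : 0 < x) : zeroExt p x = p x := indicator_of_mem hx p

theorem zeroExt_of_nonpos {x : ℝ} (hx : x ≤ 0) : zeroExt p x = 0 :=
  indicator_of_notMem (by simpa using hx) p

namespace HalfLineDecay

theorem zeroExt_le (hp : HalfLineDecay p γ) :
    ∃ K, 0 < K ∧ ∀ x, |zeroExt p x| ≤ K * exp (-γ * x) := by
  obtain ⟨K, hK, hb⟩ := hp.bound
  refine ⟨K, hK, fun x => ?_⟩
  rcases le_or_gt x 0 with h | h
  · rw [zeroExt_of_nonpos h, abs_zero]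
    positivity
  · rw [zeroExt_of_pos h]
    exact hb x h

theorem aestronglyMeasurable (hp : HalfLineDecay p γ) :
    AEStronglyMeasurable p (volume.restrict (Ioi 0)) :=
  hp.cont.aestronglyMeasurable measurableSet_Ioi

theorem measurable_zeroExt (hp : HalfLineDecay p γ) : AEStronglyMeasurable (zeroExt p) :=
  (aestronglyMeasurable_indicator_iff measurableSet_Ioi).2 hp.aestronglyMeasurable

theorem integrableOn (hp : HalfLineDecay p γ) : IntegrableOn p (Ioi 0) := by
  obtain ⟨K, hK, hb⟩ := hp.bound
  refine Integrable.mono' ((integrableOn_exp_mul_Ioi (neg_neg_iff_pos.2 hp.pos) 0).const_mul K)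
    hp.aestronglyMeasurable ?_
  rw [ae_restrict_iff' measurableSet_Ioi]
  exact Eventually.of_forall fun x hx => hb x hx

theorem integrable_zeroExt (hp : HalfLineDecay p γ) : Integrable (zeroExt p) :=
  (integrable_indicator_iff measurableSet_Ioi).2 hp.integrableOn

theorem continuousAt_zeroExt (hp : HalfLineDecay p γ) {x : ℝ} (hx : x ≠ 0) :
    ContinuousAt (zeroExt p) x := by
  rcases hx.lt_or_gt with h | h
  · refine continuousAt_const.congr (f := fun _ => (0 : ℝ)) ?_
    filter_upwards [Iio_mem_nhds h] with y hy
    exact (zeroExt_of_nonpos hy.le).symm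
  · refine (hp.cont.continuousAt (Ioi_mem_nhds h)).congr ?_
    filter_upwards [Ioi_mem_nhds h] with y hy
    exact (zeroExt_of_pos hy).symm

theorem of_le (hp : HalfLineDecay p γ) {γ' : ℝ} (h0 : 0 < γ') (h : γ' ≤ γ) :
    HalfLineDecay p γ' := by
  obtain ⟨K, hK, hb⟩ := hp.bound
  refine ⟨h0, hp.cont, K, hK, fun x hx => (hb x hx).trans ?_⟩
  exact mul_le_mul_of_nonneg_left (exp_le_exp.2 (by nlinarith)) hK.le

theorem const_mul (hp : HalfLineDecay p γ) (c : ℝ) : HalfLineDecay (fun x => c * p x) γ := by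
  obtain ⟨K, hK, hb⟩ := hp.bound
  refine ⟨hp.pos, continuousOn_const.mul hp.cont, |c| * K + 1, by positivity, fun x hx => ?_⟩
  rw [abs_mul]
  have h1 := mul_le_mul_of_nonneg_left (hb x hx) (abs_nonneg c)
  have := exp_pos (-γ * x)
  nlinarith

theorem exists_integrand_le (hp : HalfLineDecay p γ) (hγa : γ < a) :
    ∃ D : ℝ → ℝ, (∀ x, 0 ≤ D x) ∧ Integrable D ∧
      ∀ X t Y, t ≠ 0 → ‖stripLog a t Y * zeroExt p (X - t)‖ ≤ exp (-γ * X) * D t := by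
  obtain ⟨D, hD0, hDi, hD⟩ := exists_stripLog_majorant hp.pos hγa
  obtain ⟨K, hK, hb⟩ := hp.zeroExt_le
  refine ⟨fun t => K * (D t * exp (γ * t)), fun t => ?_, hDi.const_mul K, fun X t Y ht => ?_⟩
  · have := hD0 t
    positivity
  · rw [norm_mul, norm_eq_abs, norm_eq_abs]
    calc _ ≤ D t * (K * exp (-γ * (X - t))) :=
          mul_le_mul (hD t Y ht) (hb _) (abs_nonneg _) (hD0 t)
      _ = _ := by
          rw [show -γ * (X - t) = -γ * X + γ * t by ring, exp_add]
          ring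

theorem measurable_integrand (hp : HalfLineDecay p γ) (X Y : ℝ) :
    AEStronglyMeasurable fun t => stripLog a t Y * zeroExt p (X - t) :=
  (measurable_stripLog a Y).aestronglyMeasurable.mul
    (hp.measurable_zeroExt.comp_measurePreserving (Measure.measurePreserving_sub_left volume X))

theorem ae_ne (c : ℝ) : ∀ᵐ t : ℝ, t ≠ c := by
  simp [ae_iff, measure_singleton]

theorem integrable_integrand (hp : HalfLineDecay p γ) (hγa : γ < a) (X Y : ℝ) :
    Integrable fun t => stripLog a t Y * zeroExt p (X - t) := by
  obtain ⟨D, -, hDi, hD⟩ := hp.exists_integrand_le hγa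
  refine (hDi.const_mul (exp (-γ * X))).mono' (hp.measurable_integrand X Y) ?_
  filter_upwards [ae_ne 0] with t ht
  exact hD X t Y ht

theorem exists_potential_le (hp : HalfLineDecay p γ) (hγa : γ < a) :
    ∃ C, 0 < C ∧ ∀ X Y, |potential a p X Y| ≤ C * exp (-γ * X) := by
  obtain ⟨D, hD0, hDi, hD⟩ := hp.exists_integrand_le hγa
  have hI : 0 ≤ ∫ t, D t := integral_nonneg hD0
  refine ⟨1 / π * (∫ t, D t) + 1, by positivity, fun X Y => ?_⟩
  rw [potential, abs_mul, abs_of_pos (by positivity : 0 < 1 / π)]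
  have h1 : |∫ t, stripLog a t Y * zeroExt p (X - t)| ≤ exp (-γ * X) * ∫ t, D t := by
    rw [← norm_eq_abs, ← integral_const_mul]
    refine norm_integral_le_of_norm_le (hDi.const_mul _) ?_
    filter_upwards [ae_ne 0] with t ht
    exact hD X t Y ht
  have h2 : 0 < exp (-γ * X) := exp_pos _
  calc _ ≤ 1 / π * (exp (-γ * X) * ∫ t, D t) := mul_le_mul_of_nonneg_left h1 (by positivity)
    _ ≤ _ := by nlinarith

theorem continuous_potential (hp : HalfLineDecay p γ) (hγa : γ < a) :
    Continuous fun q : ℝ × ℝ => potential a p q.1 q.2 := by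
  obtain ⟨D, hD0, hDi, hD⟩ := hp.exists_integrand_le hγa
  have ha : 0 < a := hp.pos.trans hγa
  refine continuous_const.mul (continuous_iff_continuousAt.2 fun q => ?_)
  refine continuousAt_of_dominated (bound := fun t => exp (-γ * (q.1 - 1)) * D t)
    (Eventually.of_forall fun r => hp.measurable_integrand r.1 r.2) ?_ (hDi.const_mul _) ?_
  · have : ∀ᶠ r : ℝ × ℝ in 𝓝 q, q.1 - 1 < r.1 :=
      continuous_fst.continuousAt.eventually_const_lt (by linarith)
    filter_upwards [this] with r hr
    filter_upwards [ae_ne 0] with t ht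
    refine (hD r.1 t r.2 ht).trans (mul_le_mul_of_nonneg_right (exp_le_exp.2 ?_) (hD0 t))
    nlinarith [hp.pos]
  · filter_upwards [ae_ne 0, ae_ne q.1] with t ht ht'
    refine ContinuousAt.mul ((continuous_stripLog ha ht).comp continuous_snd).continuousAt ?_
    have h1 : ContinuousAt (zeroExt p) (q.1 - t) :=
      hp.continuousAt_zeroExt (sub_ne_zero.2 ht'.symm)
    exact ContinuousAt.comp (f := fun r : ℝ × ℝ => r.1 - t) h1 (by fun_prop)

end HalfLineDecay

theorem potential_neg_right (X Y : ℝ) : potential a p X (-Y) = potential a p X Y := by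
  simp_rw [potential, stripLog_neg_right]

theorem potential_const_mul (c X Y : ℝ) :
    potential a (fun x => c * p x) X Y = c * potential a p X Y := by
  have h : zeroExt (fun x => c * p x) = fun x => c * zeroExt p x := by
    ext x
    rcases le_or_gt x 0 with h | h
    · rw [zeroExt_of_nonpos h, zeroExt_of_nonpos h, mul_zero]
    · rw [zeroExt_of_pos h, zeroExt_of_pos h]
  rw [potential, potential, h, mul_left_comm, ← integral_const_mul c]
  congr 2
  ext t
  ring

theorem integral_mul_zeroExt_sub {E : Type*} [NormedAddCommGroup E] [NormedSpace ℝ E] (f : ℝ → E)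
    (X : ℝ) : ∫ t, zeroExt p (X - t) • f t = ∫ s in Ioi (0 : ℝ), p s • f (X - s) := by
  rw [← integral_sub_left_eq_self _ volume X, ← integral_indicator measurableSet_Ioi]
  congr 1
  ext s
  rw [sub_sub_cancel]
  rcases le_or_gt s 0 with h | h
  · rw [zeroExt_of_nonpos h, zero_smul, indicator_of_notMem (by simpa using h)]
  · rw [zeroExt_of_pos h, indicator_of_mem (by exact h)]

theorem integrable_zeroExt_sub_iff {E : Type*} [NormedAddCommGroup E] [NormedSpace ℝ E] (f : ℝ → E)
    (X : ℝ) : Integrable (fun t => zeroExt p (X - t) • f t) ↔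
      IntegrableOn (fun s => p s • f (X - s)) (Ioi 0) := by
  rw [← integrable_comp_sub_left _ X, ← integrable_indicator_iff measurableSet_Ioi]
  refine integrable_congr (Eventually.of_forall fun s => ?_)
  simp only
  rw [sub_sub_cancel]
  rcases le_or_gt s 0 with h | h
  · rw [zeroExt_of_nonpos h, zero_smul, indicator_of_notMem (by simpa using h)]
  · rw [zeroExt_of_pos h, indicator_of_mem (by exact h)]

theorem potential_eq (X Y : ℝ) :
    potential a p X Y = 1 / π * ∫ s in Ioi (0 : ℝ), p s * stripLog a (X - s) Y := by
  have := integral_mul_zeroExt_sub (p := p) (fun t => stripLog a t Y) X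
  simp only [smul_eq_mul] at this
  rw [potential, ← this]
  congr 2
  ext t
  ring

/-- The analytic function with real part `potential`. -/
noncomputable def complexPotential (a : ℝ) (p : ℝ → ℝ) (z : ℂ) : ℂ :=
  1 / π * ∫ s in Ioi (0 : ℝ), p s * Complex.log (1 - cexp (-(a * (z - s))))

/-- The derivative of `complexPotential`. -/
noncomputable def potentialDeriv (a : ℝ) (p : ℝ → ℝ) (z : ℂ) : ℂ :=
  1 / π * ∫ s in Ioi (0 : ℝ), p s * (a / (cexp (a * (z - s)) - 1))

theorem one_sub_cexp_im (z : ℂ) (s : ℝ) : (1 - cexp (-(a * (z - s)))).im =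
    exp (-(a * (z.re - s))) * sin (a * z.im) := by
  rw [Complex.sub_im, Complex.exp_im]
  simp

theorem one_sub_cexp_im_pos {z : ℂ} (h : 0 < sin (a * z.im)) (s : ℝ) :
    0 < (1 - cexp (-(a * (z - s)))).im := by
  rw [one_sub_cexp_im]
  positivity

theorem sin_pos_of_mem {y : ℝ} (ha : 0 < a) (h0 : 0 < y) (h1 : a * y < π) : 0 < sin (a * y) :=
  sin_pos_of_pos_of_lt_pi (mul_pos ha h0) h1

theorem sin_le_norm_cexp_sub_one (z : ℂ) (s : ℝ) :
    sin (a * z.im) ≤ ‖cexp (a * (z - s)) - 1‖ := by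
  have e : Complex.normSq (cexp (a * (z - s)) - 1) =
      (exp (a * (z.re - s)) - cos (a * z.im)) ^ 2 + sin (a * z.im) ^ 2 := by
    rw [Complex.normSq_apply, Complex.sub_re, Complex.sub_im, Complex.exp_re, Complex.exp_im]
    simp only [Complex.mul_re, Complex.ofReal_re, Complex.sub_re, Complex.ofReal_im,
      Complex.sub_im, sub_zero, zero_mul, Complex.mul_im, add_zero, Complex.one_re, Complex.one_im]
    linear_combination (exp (a * (z.re - s)) ^ 2 - 1) * sin_sq_add_cos_sq (a * z.im)
  rw [Complex.normSq_eq_norm_sq] at e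
  refine le_of_sq_le_sq ?_ (norm_nonneg _)
  nlinarith [sq_nonneg (exp (a * (z.re - s)) - cos (a * z.im))]

theorem hasDerivAt_log_kernel {z : ℂ} (h : 0 < sin (a * z.im)) (s : ℝ) :
    HasDerivAt (fun z : ℂ => Complex.log (1 - cexp (-(a * (z - s)))))
      (a / (cexp (a * (z - s)) - 1)) z := by
  have hpos := one_sub_cexp_im_pos h s
  have hs : 1 - cexp (-(a * (z - s))) ∈ Complex.slitPlane := Or.inr hpos.ne'
  have h1 : HasDerivAt (fun z : ℂ => 1 - cexp (-(a * (z - s))))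
      (-(cexp (-(a * (z - s))) * (-(a * 1)))) z :=
    ((((hasDerivAt_id' z).sub_const (s : ℂ)).const_mul (a : ℂ)).fun_neg.cexp).const_sub 1
  refine (h1.clog hs).congr_deriv ?_
  have n2 := Complex.slitPlane_ne_zero hs
  rw [Complex.exp_neg] at n2 ⊢
  field_simp

theorem measurable_log_kernel (z : ℂ) :
    Measurable fun s : ℝ => Complex.log (1 - cexp (-(a * (z - s)))) :=
  Complex.measurable_log.comp (by fun_prop)

theorem log_norm_kernel (X Y s : ℝ) :
    (Complex.log (1 - cexp (-(a * ((X + Y * I) - s))))).re =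
      stripLog a (X - s) Y := by
  rw [Complex.log_re, stripLog]
  congr 4
  push_cast
  ring

namespace HalfLineDecay

theorem integrableOn_mul_stripLog (hp : HalfLineDecay p γ) (hγa : γ < a) (X Y : ℝ) :
    IntegrableOn (fun s => p s * stripLog a (X - s) Y) (Ioi 0) := by
  have := (integrable_zeroExt_sub_iff (p := p) (fun t => stripLog a t Y) X).1 (by
    refine (hp.integrable_integrand hγa X Y).congr (Eventually.of_forall fun t => ?_)
    simp only [smul_eq_mul]
    ring)
  exact this

theorem integrableOn_log_kernel (hp : HalfLineDecay p γ) (hγa : γ < a) (z : ℂ) :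
    IntegrableOn (fun s : ℝ => p s * Complex.log (1 - cexp (-(a * (z - s))))) (Ioi 0) := by
  have h1 := (hp.integrableOn_mul_stripLog hγa z.re z.im).norm
  have h2 := (hp.integrableOn.norm).mul_const π
  refine (h1.add h2).mono' ((Complex.continuous_ofReal.comp_aestronglyMeasurable
    hp.aestronglyMeasurable).mul (measurable_log_kernel z).aestronglyMeasurable)
    (Eventually.of_forall fun s => ?_)
  simp only [Pi.add_apply]
  rw [← log_norm_kernel, Complex.re_add_im, norm_mul, norm_mul, Complex.norm_real, ← mul_add]
  refine mul_le_mul_of_nonneg_left ?_ (norm_nonneg _)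
  refine (Complex.norm_le_abs_re_add_abs_im _).trans (add_le_add le_rfl ?_)
  rw [Complex.log_im]
  exact Complex.abs_arg_le_pi _

theorem re_complexPotential (hp : HalfLineDecay p γ) (hγa : γ < a) (X Y : ℝ) :
    (complexPotential a p (X + Y * I)).re = potential a p X Y := by
  rw [complexPotential, potential_eq]
  have e : (1 / π : ℂ) = ((1 / π : ℝ) : ℂ) := by push_cast; rfl
  rw [e, Complex.re_ofReal_mul]
  congr 1
  have := integral_re (hp.integrableOn_log_kernel hγa (X + Y * I))
  simp only [RCLike.re_to_complex] at this
  rw [← this]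
  congr 1
  ext s
  rw [Complex.re_ofReal_mul, log_norm_kernel]

theorem measurable_deriv_kernel (hp : HalfLineDecay p γ) (z : ℂ) : AEStronglyMeasurable
    (fun s : ℝ => (p s : ℂ) * (a / (cexp (a * (z - s)) - 1))) (volume.restrict (Ioi 0)) := by
  refine (Complex.continuous_ofReal.comp_aestronglyMeasurable hp.aestronglyMeasurable).mul
    (Measurable.aestronglyMeasurable ?_)
  exact measurable_const.div (by fun_prop)

theorem norm_deriv_kernel_le {z : ℂ} {c : ℝ} (ha : 0 < a) (hc : 0 < c)
    (h : c ≤ sin (a * z.im)) (s x : ℝ) :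
    ‖(x : ℂ) * (a / (cexp (a * (z - s)) - 1))‖ ≤ ‖x‖ * (a / c) := by
  rw [norm_mul, norm_div, Complex.norm_real, Complex.norm_real, norm_of_nonneg ha.le]
  refine mul_le_mul_of_nonneg_left ?_ (norm_nonneg _)
  exact div_le_div_of_nonneg_left ha.le hc (h.trans (sin_le_norm_cexp_sub_one z s))

theorem integrableOn_deriv_kernel (hp : HalfLineDecay p γ) (ha : 0 < a) {z : ℂ}
    (h : 0 < sin (a * z.im)) :
    IntegrableOn (fun s : ℝ => (p s : ℂ) * (a / (cexp (a * (z - s)) - 1))) (Ioi 0) :=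
  ((hp.integrableOn.norm).mul_const (a / sin (a * z.im))).mono' (hp.measurable_deriv_kernel z)
    (Eventually.of_forall fun s => norm_deriv_kernel_le ha h le_rfl s (p s))

theorem hasDerivAt_complexPotential (hp : HalfLineDecay p γ) (hγa : γ < a) {z : ℂ}
    (h : 0 < sin (a * z.im)) :
    HasDerivAt (complexPotential a p) (potentialDeriv a p z) z := by
  have ha : 0 < a := hp.pos.trans hγa
  set c := sin (a * z.im) / 2 with hc
  have hcpos : 0 < c := half_pos h
  have hU : {w : ℂ | c < sin (a * w.im)} ∈ 𝓝 z :=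
    (isOpen_lt continuous_const (by fun_prop)).mem_nhds (half_lt_self h)
  refine (hasDerivAt_integral_of_dominated_loc_of_deriv_le (bound := fun s => ‖p s‖ * (a / c))
    (F := fun z s => p s * Complex.log (1 - cexp (-(a * (z - s)))))
    (F' := fun z s => p s * (a / (cexp (a * (z - s)) - 1))) hU ?_
    (hp.integrableOn_log_kernel hγa z) (hp.measurable_deriv_kernel z) ?_
    (hp.integrableOn.norm.mul_const _) ?_).2.const_mul (1 / (π : ℂ))
  · exact Eventually.of_forall fun w => (hp.integrableOn_log_kernel hγa w).aestronglyMeasurable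
  · exact Eventually.of_forall fun s w hw => norm_deriv_kernel_le ha hcpos (le_of_lt hw) s (p s)
  · exact Eventually.of_forall fun s w hw =>
      (hasDerivAt_log_kernel (hcpos.trans hw) s).const_mul (p s : ℂ)

theorem differentiableOn_complexPotential (hp : HalfLineDecay p γ) (hγa : γ < a) :
    DifferentiableOn ℂ (complexPotential a p) {z | 0 < sin (a * z.im)} := fun _ hz =>
  (hp.hasDerivAt_complexPotential hγa hz).differentiableAt.differentiableWithinAt

theorem isOpen_sin_pos (a : ℝ) : IsOpen {z : ℂ | 0 < sin (a * z.im)} :=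
  isOpen_lt continuous_const (by fun_prop)

theorem harmonicAt_potential (hp : HalfLineDecay p γ) (hγa : γ < a) {z : ℂ}
    (h : 0 < sin (a * z.im)) :
    InnerProductSpace.HarmonicAt (fun z : ℂ => potential a p z.re z.im) z := by
  have h1 := ((hp.differentiableOn_complexPotential hγa).analyticAt
    ((isOpen_sin_pos a).mem_nhds h)).harmonicAt_re
  have e : (fun z : ℂ => potential a p z.re z.im) = fun z => (complexPotential a p z).re := by
    ext w
    rw [← hp.re_complexPotential hγa, Complex.re_add_im]
  rwa [e]

theorem continuousAt_potentialDeriv (hp : HalfLineDecay p γ) (hγa : γ < a) {z : ℂ}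
    (h : 0 < sin (a * z.im)) : ContinuousAt (potentialDeriv a p) z := by
  have hO := (isOpen_sin_pos a).mem_nhds h
  have h1 := ((hp.differentiableOn_complexPotential hγa).deriv (isOpen_sin_pos a)).continuousOn
    |>.continuousAt hO
  refine h1.congr ?_
  filter_upwards [hO] with w hw
  exact (hp.hasDerivAt_complexPotential hγa hw).deriv

theorem hasDerivAt_potential (hp : HalfLineDecay p γ) (hγa : γ < a) {X Y : ℝ}
    (h : 0 < sin (a * Y)) :
    HasDerivAt (fun y => potential a p X y) (-(potentialDeriv a p (X + Y * I)).im) Y := by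
  have h1 := hp.hasDerivAt_complexPotential hγa (z := X + Y * I) (by simpa using h)
  have h2 : HasDerivAt (fun y : ℝ => (X + y * I : ℂ)) I Y := by
    simpa using ((Complex.ofRealCLM.hasDerivAt (x := Y)).mul_const I).const_add (X : ℂ)
  have h3 := (h1.comp Y h2)
  have h4 : HasDerivAt (fun y : ℝ => (complexPotential a p (X + y * I)).re)
      (potentialDeriv a p (X + Y * I) * I).re Y :=
    (Complex.reCLM.hasFDerivAt.comp_hasDerivAt Y h3)
  simp only [hp.re_complexPotential hγa] at h4
  refine h4.congr_deriv ?_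
  simp

end HalfLineDecay

end

end BimaterialStrip

namespace BimaterialStrip

/-! ### Boundary values of the normal derivative of the potential -/

section
variable {p : ℝ → ℝ} {γ a : ℝ}

/-- The Poisson kernel of the Neumann problem. -/
noncomputable def stripPoisson (a x y : ℝ) : ℝ :=
  -(a / (cexp (a * (x + y * I)) - 1)).im

theorem cexp_strip_im (x y : ℝ) : (cexp (a * (x + y * I))).im =
    exp (a * x) * sin (a * y) := by
  rw [Complex.exp_im]
  simp

theorem cexp_strip_re (x y : ℝ) : (cexp (a * (x + y * I))).re =
    exp (a * x) * cos (a * y) := by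
  rw [Complex.exp_re]
  simp

theorem stripPoisson_eq (x y : ℝ) : stripPoisson a x y = a * (exp (a * x) * sin (a * y)) /
    Complex.normSq (cexp (a * (x + y * I)) - 1) := by
  rw [stripPoisson, Complex.div_im]
  simp [cexp_strip_im]

theorem normSq_cexp_strip_sub_one (x y : ℝ) :
    Complex.normSq (cexp (a * (x + y * I)) - 1) =
      (exp (a * x) - 1) ^ 2 + 2 * exp (a * x) * (1 - cos (a * y)) := by
  rw [Complex.normSq_apply, Complex.sub_re, Complex.sub_im, cexp_strip_re, cexp_strip_im,
    Complex.one_re, Complex.one_im]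
  linear_combination (exp (a * x)) ^ 2 * sin_sq_add_cos_sq (a * y)

theorem stripPoisson_nonneg {x y : ℝ} (ha : 0 ≤ a) (h : 0 ≤ sin (a * y)) :
    0 ≤ stripPoisson a x y := by
  rw [stripPoisson_eq]
  have := Complex.normSq_nonneg (cexp (a * (x + y * I)) - 1)
  positivity

theorem sq_mul_exp_le (t : ℝ) : t ^ 2 * exp t ≤ (exp t - 1) ^ 2 := by
  have h1 : exp t - 1 = exp (t / 2) * (2 * sinh (t / 2)) := by
    rw [sinh_eq, mul_div_cancel₀ _ (two_ne_zero), mul_sub, ← exp_add, ← exp_add]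
    simp
  have h2 : exp t = exp (t / 2) ^ 2 := by rw [← exp_nat_mul]; congr 1; push_cast; ring
  have h3 : (t / 2) ^ 2 ≤ sinh (t / 2) ^ 2 := by
    rw [sq_le_sq]
    rcases le_total 0 (t / 2) with h | h
    · rw [abs_of_nonneg h, abs_of_nonneg (sinh_nonneg_iff.2 h)]
      exact self_le_sinh_iff.2 h
    · rw [abs_of_nonpos h, abs_of_nonpos (sinh_nonpos_iff.2 h)]
      exact neg_le_neg (sinh_le_self_iff.2 h)
  rw [h1, mul_pow, mul_pow, h2]
  have := mul_le_mul_of_nonneg_left h3 (sq_nonneg (exp (t / 2)))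
  nlinarith

theorem stripPoisson_le {x y δ : ℝ} (ha : 0 < a) (hy : 0 ≤ y) (hδ : 0 < δ) (hx : δ ≤ |x|) :
    stripPoisson a x y ≤ y / δ ^ 2 := by
  have hE := exp_pos (a * x)
  have h1 : (a * δ) ^ 2 * exp (a * x) ≤
      Complex.normSq (cexp (a * (x + y * I)) - 1) := by
    rw [normSq_cexp_strip_sub_one]
    have h2 := sq_mul_exp_le (a * x)
    have h3 : (a * δ) ^ 2 ≤ (a * x) ^ 2 := by
      rw [mul_pow, mul_pow]
      refine mul_le_mul_of_nonneg_left ?_ (sq_nonneg a)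
      rw [← sq_abs x]
      exact pow_le_pow_left₀ hδ.le hx 2
    nlinarith [cos_le_one (a * y)]
  have h5 : 0 < (a * δ) ^ 2 * exp (a * x) := by positivity
  rw [stripPoisson_eq, div_le_div_iff₀ (h5.trans_le h1) (by positivity)]
  have h6 : sin (a * y) ≤ a * y := sin_le (by positivity)
  calc a * (exp (a * x) * sin (a * y)) * δ ^ 2
      ≤ a * (exp (a * x) * (a * y)) * δ ^ 2 := by gcongr
    _ = y * ((a * δ) ^ 2 * exp (a * x)) := by ring
    _ ≤ _ := mul_le_mul_of_nonneg_left h1 hy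

theorem stripPoisson_le_sin {x y : ℝ} (ha : 0 < a) (hs : 0 ≤ sin (a * y))
    (hc : cos (a * y) ≤ 0) : stripPoisson a x y ≤ a * sin (a * y) := by
  have hE := exp_pos (a * x)
  have h1 : exp (a * x) ≤ Complex.normSq (cexp (a * (x + y * I)) - 1) := by
    rw [normSq_cexp_strip_sub_one]
    nlinarith [sq_nonneg (exp (a * x) - 1)]
  rw [stripPoisson_eq, div_le_iff₀ (hE.trans_le h1)]
  calc a * (exp (a * x) * sin (a * y)) = a * sin (a * y) * exp (a * x) := by ring
    _ ≤ _ := mul_le_mul_of_nonneg_left h1 (by positivity)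

theorem measurable_stripPoisson (a y : ℝ) : Measurable fun x => stripPoisson a x y := by
  unfold stripPoisson
  exact (Complex.measurable_im.comp (measurable_const.div (by fun_prop))).neg

theorem kernel_im_eq (X Y s : ℝ) : (a / (cexp (a * ((X + Y * I) - s)) - 1)).im =
    -stripPoisson a (X - s) Y := by
  rw [stripPoisson, neg_neg]
  congr 5
  push_cast
  ring

theorem integral_stripPoisson {X Y s₁ s₂ : ℝ} (h : 0 < sin (a * Y)) :
    ∫ s in s₁..s₂, stripPoisson a (X - s) Y =
      Complex.arg (1 - cexp (-(a * ((X + Y * I) - s₂)))) -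
      Complex.arg (1 - cexp (-(a * ((X + Y * I) - s₁)))) := by
  have hd : ∀ s : ℝ, HasDerivAt
      (fun s : ℝ => Complex.arg (1 - cexp (-(a * ((X + Y * I) - s)))))
      (stripPoisson a (X - s) Y) s := by
    intro s
    have h1 := hasDerivAt_log_kernel (a := a) (z := X + Y * I - s)
      (by simpa using h) 0
    have h2 : HasDerivAt (fun s : ℝ => (X + Y * I - s : ℂ)) (-1) s := by
      simpa using (Complex.ofRealCLM.hasDerivAt (x := s)).const_sub (X + Y * I : ℂ)
    have h3 := Complex.imCLM.hasFDerivAt.comp_hasDerivAt s (h1.comp s h2)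
    simp only [Complex.imCLM_apply, Function.comp_def, Complex.ofReal_zero, sub_zero,
      Complex.log_im, mul_neg, mul_one] at h3
    refine h3.congr_deriv ?_
    rw [Complex.neg_im, kernel_im_eq, neg_neg]
  refine intervalIntegral.integral_eq_sub_of_hasDerivAt (fun s _ => hd s) ?_
  refine (Continuous.intervalIntegrable ?_ _ _)
  unfold stripPoisson
  refine (Complex.continuous_im.comp (Continuous.div continuous_const (by fun_prop) fun s => ?_)).neg
  rw [← norm_pos_iff]
  have := sin_le_norm_cexp_sub_one (a := a) (((X - s : ℝ) : ℂ) + Y * I) 0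
  simp only [Complex.add_im, Complex.ofReal_im, Complex.mul_im, Complex.ofReal_re, Complex.I_im,
    mul_one, Complex.I_re, mul_zero, add_zero, zero_add, Complex.ofReal_zero, sub_zero] at this
  exact h.trans_le this

namespace HalfLineDecay

theorem neg_im_potentialDeriv (hp : HalfLineDecay p γ) (ha : 0 < a) {X Y : ℝ}
    (h : 0 < sin (a * Y)) : -(potentialDeriv a p (X + Y * I)).im =
      1 / π * ∫ s in Ioi (0 : ℝ), p s * stripPoisson a (X - s) Y := by
  have hi := hp.integrableOn_deriv_kernel ha (z := X + Y * I) (by simpa using h)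
  have e : (1 / π : ℂ) = ((1 / π : ℝ) : ℂ) := by push_cast; rfl
  rw [potentialDeriv, e, Complex.im_ofReal_mul, ← mul_neg]
  congr 1
  have := integral_im hi
  simp only [RCLike.im_to_complex] at this
  rw [← this, ← integral_neg]
  congr 1
  ext s
  rw [Complex.im_ofReal_mul, kernel_im_eq]
  ring

theorem tendsto_normalDeriv_zero (hp : HalfLineDecay p γ) (ha : 0 < a) {X₀ : ℝ} (hX : X₀ ≠ 0) :
    Tendsto (fun q : ℝ × ℝ => -(potentialDeriv a p (q.1 + q.2 * I)).im)
      (𝓝[{q | 0 < q.2}] (X₀, 0)) (𝓝 (zeroExt p X₀)) := by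
  set l := 𝓝[{q : ℝ × ℝ | 0 < q.2}] (X₀, 0) with hl
  have h2 : Tendsto (fun q : ℝ × ℝ => q.2) l (𝓝 0) :=
    (continuous_snd.tendsto (X₀, (0 : ℝ))).mono_left nhdsWithin_le_nhds
  have h1 : Tendsto (fun q : ℝ × ℝ => q.1) l (𝓝 X₀) :=
    (continuous_fst.tendsto (X₀, (0 : ℝ))).mono_left nhdsWithin_le_nhds
  have hpos : ∀ᶠ q in l, 0 < q.2 := eventually_mem_nhdsWithin
  have hlt : ∀ᶠ q in l, a * q.2 < π := by
    have := h2.const_mul a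
    rw [mul_zero] at this
    exact this.eventually_lt_const pi_pos
  have hsin : ∀ᶠ q in l, 0 < sin (a * q.2) := by
    filter_upwards [hpos, hlt] with q h h'
    exact sin_pos_of_mem ha h h'
  have key := tendsto_integral_peak_smul_of_integrable_of_tendsto (μ := volume) (l := l)
    (φ := fun (q : ℝ × ℝ) (s : ℝ) => 1 / π * stripPoisson a (q.1 - s) q.2) (g := zeroExt p)
    (x₀ := X₀) (a := zeroExt p X₀) (t := Ioc (X₀ - 1) (X₀ + 1)) measurableSet_Ioc
    (Ioc_mem_nhds (by linarith) (by linarith)) (by simp) ?_ ?_ ?_ ?_ hp.integrable_zeroExt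
    (hp.continuousAt_zeroExt hX)
  · refine key.congr' ?_
    filter_upwards [hsin] with q hq
    rw [hp.neg_im_potentialDeriv ha hq, ← integral_const_mul, ← integral_indicator measurableSet_Ioi]
    congr 1
    ext s
    rcases le_or_gt s 0 with h | h
    · rw [zeroExt_of_nonpos h, smul_zero, indicator_of_notMem (by simpa using h)]
    · rw [zeroExt_of_pos h, indicator_of_mem (by exact h), smul_eq_mul]
      ring
  · filter_upwards [hsin] with q hq x
    exact mul_nonneg (by have := pi_pos; positivity) (stripPoisson_nonneg ha.le hq.le)
  · intro u hu hX₀u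
    obtain ⟨δ, hδ, hδu⟩ := Metric.isOpen_iff.1 hu X₀ hX₀u
    rw [Metric.tendstoUniformlyOn_iff]
    intro ε hε
    have h3 : ∀ᶠ q in l, 1 / π * (q.2 / (δ / 2) ^ 2) < ε := by
      have := (h2.div_const ((δ / 2) ^ 2)).const_mul (1 / π)
      rw [zero_div, mul_zero] at this
      exact this.eventually_lt_const hε
    have h4 : ∀ᶠ q in l, |q.1 - X₀| < δ / 2 := by
      have := h1.eventually (Metric.ball_mem_nhds X₀ (half_pos hδ))
      filter_upwards [this] with q hq
      rwa [dist_eq] at hq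
    filter_upwards [h3, h4, hsin, hpos] with q h3 h4 h5 h6 s hs
    have h7 : δ ≤ |s - X₀| := by
      by_contra! h
      exact hs (hδu (by rwa [Metric.mem_ball, dist_eq]))
    have h8 : δ / 2 ≤ |q.1 - s| := by
      have := abs_sub_le s q.1 X₀
      rw [abs_sub_comm s q.1] at this
      linarith
    have h9 := stripPoisson_le ha h6.le (half_pos hδ) h8
    have h10 := stripPoisson_nonneg (x := q.1 - s) ha.le h5.le
    have hpi : 0 < 1 / π := by have := pi_pos; positivity
    rw [Pi.zero_apply, dist_zero_left, norm_of_nonneg (mul_nonneg hpi.le h10)]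
    exact (mul_le_mul_of_nonneg_left h9 hpi.le).trans_lt h3
  · have e : ∀ᶠ q in l, 1 / π *
        (Complex.arg (1 - cexp (-(a * ((q.1 + q.2 * I) - ((X₀ + 1 : ℝ) : ℂ))))) -
        Complex.arg (1 - cexp (-(a * ((q.1 + q.2 * I) - ((X₀ - 1 : ℝ) : ℂ)))))) =
        ∫ s in Ioc (X₀ - 1) (X₀ + 1), 1 / π * stripPoisson a (q.1 - s) q.2 := by
      filter_upwards [hsin] with q hq
      rw [integral_const_mul, ← intervalIntegral.integral_of_le (by linarith),
        integral_stripPoisson hq]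
    have hlim : ∀ c : ℝ, Tendsto (fun q : ℝ × ℝ =>
        1 - cexp (-(a * ((q.1 + q.2 * I) - (c : ℂ))))) l
        (𝓝 ((1 - exp (-(a * (X₀ - c))) : ℝ) : ℂ)) := by
      intro c
      have hc : Continuous fun q : ℝ × ℝ =>
        1 - cexp (-(a * ((q.1 + q.2 * I) - (c : ℂ)))) := by fun_prop
      have := (hc.tendsto (X₀, (0 : ℝ))).mono_left (nhdsWithin_le_nhds (s := {q | 0 < q.2}))
      refine this.trans (le_of_eq ?_)
      simp
    have l1 : Tendsto (fun q : ℝ × ℝ => Complex.arg (1 - cexp (-(a * ((q.1 + q.2 * I)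
        - ((X₀ + 1 : ℝ) : ℂ)))))) l (𝓝 π) := by
      have hneg : 1 - exp (-(a * (X₀ - (X₀ + 1)))) < 0 := by
        rw [show -(a * (X₀ - (X₀ + 1))) = a by ring]
        linarith [add_one_lt_exp ha.ne']
      refine (Complex.tendsto_arg_nhdsWithin_im_nonneg_of_re_neg_of_im_zero
        (z := ((1 - exp (-(a * (X₀ - (X₀ + 1)))) : ℝ) : ℂ)) (by rw [Complex.ofReal_re]; exact hneg)
        (Complex.ofReal_im _)).comp (tendsto_nhdsWithin_iff.2 ⟨hlim _, ?_⟩)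
      filter_upwards [hsin] with q hq
      exact (one_sub_cexp_im_pos (z := q.1 + q.2 * I) (by simpa using hq) _).le
    have l2 : Tendsto (fun q : ℝ × ℝ => Complex.arg (1 - cexp (-(a * ((q.1 + q.2 * I)
        - ((X₀ - 1 : ℝ) : ℂ)))))) l (𝓝 0) := by
      have hposr : 0 < 1 - exp (-(a * (X₀ - (X₀ - 1)))) := by
        rw [show -(a * (X₀ - (X₀ - 1))) = -a by ring]
        linarith [exp_lt_one_iff.2 (neg_lt_zero.2 ha)]
      have := (Complex.continuousAt_arg (Complex.ofReal_mem_slitPlane.2 hposr)).tendsto.comp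
        (hlim (X₀ - 1))
      rwa [Complex.arg_ofReal_of_nonneg hposr.le] at this
    have l3 := (l1.sub l2).const_mul (1 / π)
    rw [sub_zero, one_div_mul_cancel pi_ne_zero] at l3
    exact l3.congr' e
  · exact Eventually.of_forall fun q => Measurable.aestronglyMeasurable
      (((measurable_stripPoisson a q.2).comp (measurable_const.sub measurable_id)).const_mul _)

theorem tendsto_normalDeriv_pi (hp : HalfLineDecay p γ) (ha : 0 < a) (X₀ : ℝ) :
    Tendsto (fun q : ℝ × ℝ => -(potentialDeriv a p (q.1 + q.2 * I)).im)
      (𝓝[{q | a * q.2 < π}] (X₀, π / a)) (𝓝 0) := by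
  set l := 𝓝[{q : ℝ × ℝ | a * q.2 < π}] (X₀, π / a) with hl
  have h2 : Tendsto (fun q : ℝ × ℝ => a * q.2) l (𝓝 π) := by
    have := ((continuous_snd.tendsto (X₀, π / a)).const_mul a).mono_left
      (nhdsWithin_le_nhds (s := {q : ℝ × ℝ | a * q.2 < π}))
    rwa [mul_div_cancel₀ _ ha.ne'] at this
  have hlt : ∀ᶠ q in l, a * q.2 < π := eventually_mem_nhdsWithin
  have hgt : ∀ᶠ q in l, π / 2 < a * q.2 := h2.eventually_const_lt (by linarith [pi_pos])
  have hb : ∀ᶠ q in l, ‖-(potentialDeriv a p (q.1 + q.2 * I)).im‖ ≤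
      1 / π * ((∫ s in Ioi (0 : ℝ), |p s|) * (a * sin (a * q.2))) := by
    filter_upwards [hlt, hgt] with q h h'
    have hs : 0 < sin (a * q.2) :=
      sin_pos_of_pos_of_lt_pi (by linarith [pi_pos]) h
    have hpi : 0 < 1 / π := by have := pi_pos; positivity
    have hcos : cos (a * q.2) ≤ 0 :=
      cos_nonpos_of_pi_div_two_le_of_le h'.le (by linarith [pi_pos])
    rw [hp.neg_im_potentialDeriv ha hs, norm_mul, norm_of_nonneg hpi.le, ← integral_mul_const]
    refine mul_le_mul_of_nonneg_left (norm_integral_le_of_norm_le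
      (hp.integrableOn.abs.mul_const _) (Eventually.of_forall fun s => ?_)) hpi.le
    rw [norm_mul, norm_eq_abs, norm_of_nonneg (stripPoisson_nonneg ha.le hs.le)]
    exact mul_le_mul_of_nonneg_left (stripPoisson_le_sin ha hs.le hcos) (abs_nonneg _)
  refine squeeze_zero_norm' hb ?_
  have h3 := (continuous_sin.tendsto π).comp h2
  rw [sin_pi] at h3
  simpa using ((h3.const_mul a).const_mul (∫ s in Ioi (0 : ℝ), |p s|)).const_mul (1 / π)

end HalfLineDecay

/-- The normal derivative of the potential on the closed strip (away from the tip). -/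
noncomputable def potentialDY (a : ℝ) (p : ℝ → ℝ) (X Y : ℝ) : ℝ :=
  if Y ≤ 0 then zeroExt p X else if π ≤ a * Y then 0
  else -(potentialDeriv a p (X + Y * I)).im

theorem potentialDY_zero (X : ℝ) : potentialDY a p X 0 = zeroExt p X := if_pos le_rfl

theorem potentialDY_top (ha : 0 < a) (X : ℝ) : potentialDY a p X (π / a) = 0 := by
  have : 0 < π / a := by have := pi_pos; positivity
  rw [potentialDY, if_neg (not_le.2 this), if_pos (by rw [mul_div_cancel₀ _ ha.ne'])]

theorem potentialDY_of_mem {X Y : ℝ} (h : 0 < Y) (h' : a * Y < π) :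
    potentialDY a p X Y = -(potentialDeriv a p (X + Y * I)).im := by
  rw [potentialDY, if_neg (not_le.2 h), if_neg (not_le.2 h')]

namespace HalfLineDecay

theorem deriv_potential (hp : HalfLineDecay p γ) (hγa : γ < a) (X : ℝ) {y : ℝ}
    (hy : y ∈ Ioo 0 (π / a)) : DifferentiableAt ℝ (fun y => potential a p X y) y ∧
      deriv (fun y => potential a p X y) y = -(potentialDeriv a p (X + y * I)).im := by
  have ha : 0 < a := hp.pos.trans hγa
  have := (lt_div_iff₀ ha).1 hy.2
  have h := hp.hasDerivAt_potential hγa (X := X) (sin_pos_of_mem ha hy.1 (by linarith))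
  exact ⟨h.differentiableAt, h.deriv⟩

theorem continuous_potential_right (hp : HalfLineDecay p γ) (hγa : γ < a) (X : ℝ) :
    Continuous fun y => potential a p X y :=
  Continuous.comp (g := fun q : ℝ × ℝ => potential a p q.1 q.2) (f := fun y => (X, y))
    (hp.continuous_potential hγa) (by fun_prop)

theorem hasDerivWithinAt_potential_zero (hp : HalfLineDecay p γ) (hγa : γ < a) {X : ℝ}
    (hX : X ≠ 0) : HasDerivWithinAt (fun y => potential a p X y) (zeroExt p X) (Ici 0) 0 := by
  have ha : 0 < a := hp.pos.trans hγa
  have hH : 0 < π / a := by have := pi_pos; positivity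
  refine hasDerivWithinAt_Ici_of_tendsto_deriv (s := Ioo 0 (π / a))
    (fun y hy => (hp.deriv_potential hγa X hy).1.differentiableWithinAt)
    (hp.continuous_potential_right hγa X).continuousWithinAt (Ioo_mem_nhdsGT hH) ?_
  have h1 : Tendsto (fun y : ℝ => (X, y)) (𝓝[>] 0) (𝓝[{q | 0 < q.2}] (X, 0)) :=
    tendsto_nhdsWithin_iff.2 ⟨((by fun_prop : Continuous fun y : ℝ => (X, y)).tendsto 0).mono_left
      nhdsWithin_le_nhds, eventually_mem_nhdsWithin⟩
  refine ((hp.tendsto_normalDeriv_zero ha hX).comp h1).congr' ?_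
  filter_upwards [Ioo_mem_nhdsGT hH] with y hy
  exact (hp.deriv_potential hγa X hy).2.symm

theorem hasDerivWithinAt_potential_top (hp : HalfLineDecay p γ) (hγa : γ < a) (X : ℝ) :
    HasDerivWithinAt (fun y => potential a p X y) 0 (Iic (π / a)) (π / a) := by
  have ha : 0 < a := hp.pos.trans hγa
  have hH : 0 < π / a := by have := pi_pos; positivity
  refine hasDerivWithinAt_Iic_of_tendsto_deriv (s := Ioo 0 (π / a))
    (fun y hy => (hp.deriv_potential hγa X hy).1.differentiableWithinAt)
    (hp.continuous_potential_right hγa X).continuousWithinAt (Ioo_mem_nhdsLT hH) ?_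
  have h1 : Tendsto (fun y : ℝ => (X, y)) (𝓝[<] (π / a)) (𝓝[{q | a * q.2 < π}] (X, π / a)) := by
    refine tendsto_nhdsWithin_iff.2 ⟨((by fun_prop : Continuous fun y : ℝ => (X, y)).tendsto
      _).mono_left nhdsWithin_le_nhds, ?_⟩
    filter_upwards [self_mem_nhdsWithin] with y hy
    have := (lt_div_iff₀ ha).1 hy
    change a * y < π
    linarith
  refine ((hp.tendsto_normalDeriv_pi ha X).comp h1).congr' ?_
  filter_upwards [Ioo_mem_nhdsLT hH] with y hy
  exact (hp.deriv_potential hγa X hy).2.symm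

theorem hasDerivWithinAt_potential (hp : HalfLineDecay p γ) (hγa : γ < a) {X Y : ℝ}
    (hY : Y ∈ Icc 0 (π / a)) (h : X ≠ 0 ∨ Y ≠ 0) :
    HasDerivWithinAt (fun y => potential a p X y) (potentialDY a p X Y) (Icc 0 (π / a)) Y := by
  have ha : 0 < a := hp.pos.trans hγa
  rcases hY.1.eq_or_lt with h0 | h0
  · subst h0
    rw [potentialDY_zero]
    exact (hp.hasDerivWithinAt_potential_zero hγa (h.resolve_right (by simp))).mono
      Icc_subset_Ici_self
  · rcases hY.2.eq_or_lt with h1 | h1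
    · rw [h1, potentialDY_top ha]
      exact (hp.hasDerivWithinAt_potential_top hγa X).mono Icc_subset_Iic_self
    · have := (lt_div_iff₀ ha).1 h1
      rw [potentialDY_of_mem h0 (by linarith)]
      exact (hp.hasDerivAt_potential hγa
        (sin_pos_of_mem ha h0 (by linarith))).hasDerivWithinAt

theorem continuousAt_potentialDY (hp : HalfLineDecay p γ) (hγa : γ < a) {X Y : ℝ}
    (hY : Y ∈ Icc 0 (π / a)) (h : X ≠ 0 ∨ Y ≠ 0) :
    ContinuousAt (fun q : ℝ × ℝ => potentialDY a p q.1 q.2) (X, Y) := by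
  have ha : 0 < a := hp.pos.trans hγa
  rcases hY.1.eq_or_lt with h0 | h0
  · subst h0
    have hX : X ≠ 0 := h.resolve_right (by simp)
    rw [ContinuousAt, potentialDY_zero, ← nhdsWithin_univ,
      show (univ : Set (ℝ × ℝ)) = {q | q.2 ≤ 0} ∪ {q | 0 < q.2} from
        by ext q; simp [le_or_gt], nhdsWithin_union, tendsto_sup]
    constructor
    · have h1 : Tendsto (fun q : ℝ × ℝ => zeroExt p q.1) (𝓝[{q | q.2 ≤ 0}] (X, 0))
          (𝓝 (zeroExt p X)) :=
        (ContinuousAt.comp (f := fun q : ℝ × ℝ => q.1) (x := (X, (0 : ℝ)))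
          (hp.continuousAt_zeroExt hX) continuousAt_fst).tendsto.mono_left nhdsWithin_le_nhds
      refine h1.congr' ?_
      filter_upwards [self_mem_nhdsWithin] with q hq
      exact (if_pos hq).symm
    · refine (hp.tendsto_normalDeriv_zero ha hX).congr' ?_
      have hlt : ∀ᶠ q : ℝ × ℝ in 𝓝[{q | 0 < q.2}] (X, 0), a * q.2 < π := by
        have : ContinuousAt (fun q : ℝ × ℝ => a * q.2) (X, 0) := by fun_prop
        exact (this.eventually_lt_const (by simpa using pi_pos)).filter_mono nhdsWithin_le_nhds
      filter_upwards [self_mem_nhdsWithin, hlt] with q hq hq'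
      exact (potentialDY_of_mem hq hq').symm
  · have hpos : ∀ᶠ q : ℝ × ℝ in 𝓝 (X, Y), 0 < q.2 :=
      continuousAt_snd.eventually_const_lt h0
    rcases hY.2.eq_or_lt with h1 | h1
    · subst h1
      rw [ContinuousAt, potentialDY_top ha, ← nhdsWithin_univ,
        show (univ : Set (ℝ × ℝ)) = {q | π ≤ a * q.2} ∪ {q | a * q.2 < π} from
          by ext q; simp [le_or_gt], nhdsWithin_union, tendsto_sup]
      constructor
      · refine tendsto_const_nhds.congr' ?_
        filter_upwards [self_mem_nhdsWithin, hpos.filter_mono nhdsWithin_le_nhds] with q hq hq'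
        rw [potentialDY, if_neg (not_le.2 hq'), if_pos hq]
      · refine (hp.tendsto_normalDeriv_pi ha X).congr' ?_
        filter_upwards [self_mem_nhdsWithin, hpos.filter_mono nhdsWithin_le_nhds] with q hq hq'
        exact (potentialDY_of_mem hq' hq).symm
    · have h2 : a * Y < π := by
        have := (lt_div_iff₀ ha).1 h1
        linarith
      have hlt : ∀ᶠ q : ℝ × ℝ in 𝓝 (X, Y), a * q.2 < π := by
        have : ContinuousAt (fun q : ℝ × ℝ => a * q.2) (X, Y) := by fun_prop
        exact this.eventually_lt_const h2
      have h3 : ContinuousAt (fun q : ℝ × ℝ => -(potentialDeriv a p (q.1 + q.2 * I)).im)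
          (X, Y) := by
        have h4 := hp.continuousAt_potentialDeriv hγa (z := X + Y * I)
          (by simpa using sin_pos_of_mem ha h0 h2)
        have h5 : ContinuousAt (fun q : ℝ × ℝ => potentialDeriv a p (q.1 + q.2 * I))
            (X, Y) := by
          have h6 : Continuous fun q : ℝ × ℝ => (q.1 + q.2 * I : ℂ) := by fun_prop
          exact Tendsto.comp (g := potentialDeriv a p) (y := 𝓝 (X + Y * I)) h4
            (h6.tendsto (X, Y))
        exact (Complex.continuous_im.continuousAt.comp h5).neg
      refine h3.congr ?_
      filter_upwards [hpos, hlt] with q hq hq'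
      exact (potentialDY_of_mem hq hq').symm

end HalfLineDecay

end

end BimaterialStrip

namespace BimaterialStrip

/-! ### Behaviour of the potential at the left end -/

section
variable {p : ℝ → ℝ} {γ a : ℝ}

theorem neg_log_one_sub_le {u v : ℝ} (hu : 0 ≤ u) (huv : u ≤ v) (hv : v < 1) :
    -log (1 - u) ≤ u / (1 - v) := by
  have h1 : 0 < 1 - u := by linarith
  rw [← log_inv]
  refine (log_le_sub_one_of_pos (inv_pos.2 h1)).trans ?_
  have e : (1 - u)⁻¹ - 1 = u / (1 - u) := by field_simp; ring
  rw [e]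
  exact div_le_div_of_nonneg_left hu (by linarith) (by linarith)

theorem abs_stripLog_le_exp {x : ℝ} (ha : 0 < a) (hx : 1 ≤ x) (y : ℝ) :
    |stripLog a x y| ≤ (1 - exp (-a))⁻¹ * exp (-(a * x)) := by
  refine (abs_stripLog_le ha (by linarith) y).trans ((neg_log_one_sub_le (exp_pos _).le
    (exp_le_exp.2 (by nlinarith)) (exp_lt_one_iff.2 (neg_lt_zero.2 ha))).trans_eq ?_)
  rw [div_eq_mul_inv, mul_comm]

/-- The remainder of the potential after removal of its linear part. -/
noncomputable def potentialRem (a : ℝ) (p : ℝ → ℝ) (X Y : ℝ) : ℝ :=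
  1 / π * ∫ s in Ioi (0 : ℝ), p s * stripLog a (s - X) Y

namespace HalfLineDecay

theorem integrableOn_mul_self (hp : HalfLineDecay p γ) :
    IntegrableOn (fun s => s * p s) (Ioi 0) := by
  obtain ⟨K, hK, hb⟩ := hp.bound
  have h1 := (integrableOn_exp_neg_mul_rpow hp.pos (r := -1) (by norm_num)).const_mul K
  refine Integrable.mono' h1 (measurable_id.aestronglyMeasurable.mul hp.aestronglyMeasurable) ?_
  rw [ae_restrict_iff' measurableSet_Ioi]
  refine Eventually.of_forall fun x hx => ?_
  change 0 < x at hx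
  rw [norm_mul, norm_of_nonneg hx.le, neg_neg, rpow_one, ← neg_mul]
  have := mul_le_mul_of_nonneg_left (hb x hx) hx.le
  rw [norm_eq_abs]
  linarith

theorem integrableOn_mul_stripLog_left (hp : HalfLineDecay p γ) (hγa : γ < a) (X Y : ℝ) :
    IntegrableOn (fun s => p s * stripLog a (s - X) Y) (Ioi 0) := by
  have h1 := hp.integrableOn_mul_stripLog hγa X Y
  have h2 := ((hp.integrableOn.const_mul (a * X)).sub (hp.integrableOn_mul_self.const_mul a))
  refine (h1.add h2).congr (Eventually.of_forall fun s => ?_)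
  have h3 := stripLog_eq_add a (X - s) Y
  rw [neg_sub] at h3
  simp only [Pi.add_apply, Pi.sub_apply]
  rw [h3]
  ring

theorem potential_eq_linear_add (hp : HalfLineDecay p γ) (hγa : γ < a) (X Y : ℝ) :
    potential a p X Y = a / π * ((∫ s in Ioi (0 : ℝ), s * p s) - X * ∫ s in Ioi (0 : ℝ), p s) +
      potentialRem a p X Y := by
  have h1 := hp.integrableOn_mul_stripLog_left hγa X Y
  have h2 := hp.integrableOn.const_mul X
  have h3 := hp.integrableOn_mul_self
  have e : ∀ A : ℝ, a / π * A = 1 / π * (a * A) := fun A => by ring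
  rw [potential_eq, potentialRem, ← integral_const_mul X, ← integral_sub h3 h2, e, ← mul_add,
    ← integral_const_mul a,
    ← integral_add (f := fun s => a * (s * p s - X * p s)) ((h3.sub h2).const_mul a) h1]
  congr 2
  ext s
  have h3 := stripLog_eq_add a (X - s) Y
  rw [neg_sub] at h3
  rw [h3]
  ring

theorem exists_potentialRem_le (hp : HalfLineDecay p γ) (ha : 0 < a) :
    ∃ C, 0 < C ∧ ∀ X Y, X ≤ -1 → |potentialRem a p X Y| ≤ C * exp (a * X) := by
  set c := (1 - exp (-a))⁻¹ with hc
  have hcpos : 0 < c := inv_pos.2 (by linarith [exp_lt_one_iff.2 (neg_lt_zero.2 ha)])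
  refine ⟨1 / π * ((∫ s in Ioi (0 : ℝ), |p s|) * c) + 1, by positivity, fun X Y hX => ?_⟩
  rw [potentialRem, abs_mul, abs_of_pos (by positivity : 0 < 1 / π)]
  have h1 : |∫ s in Ioi (0 : ℝ), p s * stripLog a (s - X) Y| ≤
      (∫ s in Ioi (0 : ℝ), |p s|) * (c * exp (a * X)) := by
    rw [← norm_eq_abs, ← integral_mul_const]
    refine norm_integral_le_of_norm_le (hp.integrableOn.abs.mul_const _) ?_
    rw [ae_restrict_iff' measurableSet_Ioi]
    refine Eventually.of_forall fun s hs => ?_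
    change 0 < s at hs
    rw [norm_mul, norm_eq_abs, norm_eq_abs]
    refine mul_le_mul_of_nonneg_left ((abs_stripLog_le_exp ha (by linarith) Y).trans ?_)
      (abs_nonneg _)
    exact mul_le_mul_of_nonneg_left (exp_le_exp.2 (by nlinarith)) hcpos.le
  have h2 := exp_pos (a * X)
  calc _ ≤ 1 / π * ((∫ s in Ioi (0 : ℝ), |p s|) * (c * exp (a * X))) :=
        mul_le_mul_of_nonneg_left h1 (by positivity)
    _ ≤ _ := by nlinarith

theorem tendsto_log_one_sub_div : Tendsto (fun v : ℝ => log (1 - v) / v) (𝓝[≠] 0) (𝓝 (-1)) := by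
  have h : HasDerivAt (fun v : ℝ => log (1 - v)) (-1) 0 := by
    have := ((hasDerivAt_id' (0 : ℝ)).const_sub 1).log (by norm_num)
    simpa using this
  have h2 := hasDerivAt_iff_tendsto_slope.1 h
  refine h2.congr fun v => ?_
  rw [slope_def_field]
  simp

theorem tendsto_potentialRem (hp : HalfLineDecay p γ) (ha : 0 < a) :
    Tendsto (fun X => exp (-(a * X)) * potentialRem a p X 0) atBot
      (𝓝 (-(1 / π * ∫ s in Ioi (0 : ℝ), p s * exp (-(a * s))))) := by
  set c := (1 - exp (-a))⁻¹ with hc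
  have hcpos : 0 < c := inv_pos.2 (by linarith [exp_lt_one_iff.2 (neg_lt_zero.2 ha)])
  have key : Tendsto (fun X => ∫ s in Ioi (0 : ℝ), exp (-(a * X)) *
      (p s * stripLog a (s - X) 0)) atBot
      (𝓝 (∫ s in Ioi (0 : ℝ), -(p s * exp (-(a * s))))) := by
    refine tendsto_integral_filter_of_dominated_convergence (fun s => |p s| * c)
      (Eventually.of_forall fun X => ?_) ?_ (hp.integrableOn.abs.mul_const c) ?_
    · refine (hp.aestronglyMeasurable.mul (Measurable.aestronglyMeasurable
        ((measurable_stripLog a 0).comp (measurable_id.sub_const X)))).const_mul _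
    · filter_upwards [eventually_le_atBot (-1)] with X hX
      rw [ae_restrict_iff' measurableSet_Ioi]
      refine Eventually.of_forall fun s hs => ?_
      change 0 < s at hs
      rw [norm_mul, norm_mul, norm_of_nonneg (exp_pos _).le, norm_eq_abs,
        norm_eq_abs]
      have h1 := abs_stripLog_le_exp ha (by linarith : 1 ≤ s - X) 0
      have h2 : exp (-(a * X)) * |stripLog a (s - X) 0| ≤ c := by
        calc _ ≤ exp (-(a * X)) * (c * exp (-(a * (s - X)))) :=
              mul_le_mul_of_nonneg_left h1 (exp_pos _).le
          _ = c * exp (-(a * s)) := by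
              rw [mul_left_comm, ← exp_add]
              congr 2
              ring
          _ ≤ c := mul_le_of_le_one_right hcpos.le (exp_le_one_iff.2 (by nlinarith))
      calc _ = |p s| * (exp (-(a * X)) * |stripLog a (s - X) 0|) := by ring
        _ ≤ _ := mul_le_mul_of_nonneg_left h2 (abs_nonneg _)
    · refine Eventually.of_forall fun s => ?_
      have h1 : Tendsto (fun X : ℝ => exp (-(a * (s - X)))) atBot (𝓝[≠] 0) := by
        refine tendsto_nhdsWithin_iff.2 ⟨tendsto_exp_atBot.comp ?_,
          Eventually.of_forall fun X => (exp_pos _).ne'⟩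
        have : Tendsto (fun X : ℝ => a * X + -(a * s)) atBot atBot :=
          tendsto_atBot_add_const_right _ _ (tendsto_id.const_mul_atBot ha)
        refine this.congr fun X => ?_
        ring
      have h2 := (tendsto_log_one_sub_div.comp h1).const_mul (p s * exp (-(a * s)))
      have e : p s * exp (-(a * s)) * -1 = -(p s * exp (-(a * s))) := by ring
      rw [e] at h2
      refine h2.congr' ?_
      filter_upwards [eventually_lt_atBot s] with X hX
      have h3 : exp (-(a * (s - X))) < 1 := exp_lt_one_iff.2 (by nlinarith)
      have h4 : stripLog a (s - X) 0 = log (1 - exp (-(a * (s - X)))) := by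
        rw [stripLog]
        have e2 : 1 - cexp (-(a * (((s - X : ℝ) : ℂ) + ((0 : ℝ) : ℂ) * I))) =
            ((1 - exp (-(a * (s - X))) : ℝ) : ℂ) := by
          push_cast
          simp
        rw [e2, Complex.norm_real, norm_of_nonneg (by linarith)]
      simp only [Function.comp_apply]
      rw [h4, show -(a * (s - X)) = -(a * s) + a * X by ring, exp_add (-(a * s)), exp_neg (a * X)]
      have := (exp_pos (a * X)).ne'
      have := (exp_pos (-(a * s))).ne'
      field_simp
  rw [integral_neg] at key
  have := key.const_mul (1 / π)
  rw [mul_neg] at this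
  refine this.congr fun X => ?_
  rw [integral_const_mul, potentialRem]
  ring

end HalfLineDecay

/-! ### The Fourier transform of the potential -/

theorem exp_neg_mul_le_inv_sq {η x : ℝ} (hη : 0 < η) (hx : 0 ≤ x) :
    exp (-(η * x)) ≤ 2 * exp η / η ^ 2 * (1 + x) ^ (-2 : ℝ) := by
  have h1 := quadratic_le_exp_of_nonneg (x := η * (1 + x)) (by positivity)
  rw [rpow_neg (by positivity), rpow_two, ← div_eq_mul_inv, div_div,
    le_div_iff₀ (by positivity), exp_neg, inv_mul_le_iff₀ (exp_pos _)]
  have h3 : exp (η * (1 + x)) = exp η * exp (η * x) := by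
    rw [← exp_add]; congr 1; ring
  nlinarith

/-- The kernel `exp(iξz) a / (exp(az) - 1)`. -/
noncomputable def waveKernel (a : ℝ) (ξ z : ℂ) : ℂ :=
  cexp (I * ξ * z) * (a / (cexp (a * z) - 1))

/-- `z` times `waveKernel`, with the removable singularity removed. -/
noncomputable def waveKernelReg (a : ℝ) (ξ z : ℂ) : ℂ :=
  cexp (I * ξ * z) * (zcoth (a / 2 * z) - a / 2 * z)

theorem waveKernel_eq {ξ z : ℂ} (ha : 0 < a) (hz : z ≠ 0) (hz' : cexp (a * z) - 1 ≠ 0) :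
    waveKernel a ξ z = waveKernelReg a ξ z / z := by
  have ha' : (a : ℂ) ≠ 0 := by exact_mod_cast ha.ne'
  have hw : (a / 2 * z : ℂ) ≠ 0 := mul_ne_zero (div_ne_zero ha' two_ne_zero) hz
  rw [waveKernel, waveKernelReg, zcoth_of_ne hw, coth, mul_div_assoc]
  congr 1
  have e1 : cexp (a * z) = cexp (a / 2 * z) ^ 2 := by
    rw [← Complex.exp_nat_mul]; congr 1; push_cast; ring
  rw [e1] at hz' ⊢
  rw [Complex.cosh, Complex.sinh, Complex.exp_neg]
  have n := Complex.exp_ne_zero (a / 2 * z)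
  generalize cexp (a / 2 * z) = E at *
  field_simp
  ring

theorem waveKernelReg_zero (ξ : ℂ) : waveKernelReg a ξ 0 = 1 := by
  simp [waveKernelReg, zcoth_zero]

theorem differentiableAt_waveKernelReg {ξ z : ℂ} (h : |a / 2 * z.im| < π) :
    DifferentiableAt ℂ (waveKernelReg a ξ) z := by
  have h1 : DifferentiableAt ℂ (fun z : ℂ => zcoth (a / 2 * z)) z := by
    refine DifferentiableAt.comp (g := zcoth) z (differentiableAt_zcoth ?_) (by fun_prop)
    have e : (a / 2 * z : ℂ).im = a / 2 * z.im := by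
      have : (a / 2 : ℂ) = ((a / 2 : ℝ) : ℂ) := by push_cast; rfl
      rw [this, Complex.im_ofReal_mul]
    rwa [e]
  exact DifferentiableAt.mul (by fun_prop) (h1.sub (by fun_prop))

theorem norm_cexp_sub_one_ge {x y : ℝ} (ha : 0 < a) (hx : 1 ≤ |x|) :
    (1 - exp (-a)) * max 1 (exp (a * x)) ≤
      ‖cexp (a * (x + y * I)) - 1‖ := by
  have hn : ‖cexp (a * (x + y * I))‖ = exp (a * x) := by
    rw [Complex.norm_exp]
    simp
  have h1 := norm_sub_norm_le (cexp (a * (x + y * I))) 1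
  have h2 := norm_sub_norm_le 1 (cexp (a * (x + y * I)))
  rw [norm_sub_rev] at h2
  rw [hn, norm_one] at h1 h2
  rcases le_total 0 x with h | h
  · rw [abs_of_nonneg h] at hx
    rw [max_eq_right (one_le_exp (by positivity))]
    have h3 : 1 ≤ exp (-a) * exp (a * x) := by
      rw [← exp_add]
      exact one_le_exp (by nlinarith)
    linarith
  · rw [abs_of_nonpos h] at hx
    rw [max_eq_left (exp_le_one_iff.2 (by nlinarith))]
    have h3 : exp (a * x) ≤ exp (-a) := exp_le_exp.2 (by nlinarith)
    linarith

/-- Bound of `waveKernel` in the far field. -/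
theorem exists_waveKernel_le {ξ : ℂ} (ha : 0 < a) (h1 : -a < ξ.im) (h2 : ξ.im < 0) (h : ℝ) :
    ∃ C, 0 < C ∧ ∀ x y : ℝ, |y| ≤ h → 1 ≤ |x| →
      ‖waveKernel a ξ (x + y * I)‖ ≤ C * (1 + |x|) ^ (-2 : ℝ) := by
  set η := min (-ξ.im) (a + ξ.im) with hη
  have hη0 : 0 < η := lt_min (by linarith) (by linarith)
  set c := 1 - exp (-a) with hc
  have hcpos : 0 < c := by linarith [exp_lt_one_iff.2 (neg_lt_zero.2 ha)]
  refine ⟨exp (|ξ.re| * |h|) * (a / c) * (2 * exp η / η ^ 2), by positivity,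
    fun x y hy hx => ?_⟩
  have hy' : |y| ≤ |h| := hy.trans (le_abs_self h)
  have hM : 0 < max 1 (exp (a * x)) := lt_max_of_lt_left one_pos
  have h3 : ‖(a / (cexp (a * (x + y * I)) - 1) : ℂ)‖ ≤
      a / (c * max 1 (exp (a * x))) := by
    rw [norm_div, Complex.norm_real, norm_of_nonneg ha.le]
    exact div_le_div_of_nonneg_left ha.le (by positivity) (norm_cexp_sub_one_ge ha hx)
  have h4 : ‖cexp (I * ξ * (x + y * I))‖ ≤
      exp (|ξ.re| * |h|) * exp (-ξ.im * x) := by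
    rw [Complex.norm_exp, ← exp_add]
    refine exp_le_exp.2 ?_
    have e : (I * ξ * (x + y * I)).re = -(ξ.re * y) + -ξ.im * x := by
      simp [Complex.mul_re, Complex.mul_im]
      ring
    rw [e]
    have := neg_abs_le (ξ.re * y)
    rw [abs_mul] at this
    have := mul_le_mul_of_nonneg_left hy' (abs_nonneg ξ.re)
    linarith
  have h5 : exp (-ξ.im * x) / max 1 (exp (a * x)) ≤ exp (-(η * |x|)) := by
    rw [div_le_iff₀ hM]
    rcases le_total 0 x with h | h
    · refine le_trans ?_ (mul_le_mul_of_nonneg_left (le_max_right _ _) (exp_pos _).le)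
      rw [← exp_add, abs_of_nonneg h]
      have : η ≤ a + ξ.im := min_le_right _ _
      exact exp_le_exp.2 (by nlinarith)
    · refine le_trans ?_ (mul_le_mul_of_nonneg_left (le_max_left _ _) (exp_pos _).le)
      rw [mul_one, abs_of_nonpos h]
      have : η ≤ -ξ.im := min_le_left _ _
      exact exp_le_exp.2 (by nlinarith)
  rw [waveKernel, norm_mul]
  calc _ ≤ (exp (|ξ.re| * |h|) * exp (-ξ.im * x)) *
        (a / (c * max 1 (exp (a * x)))) :=
        mul_le_mul h4 h3 (norm_nonneg _) (by positivity)
    _ = exp (|ξ.re| * |h|) * (a / c) *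
        (exp (-ξ.im * x) / max 1 (exp (a * x))) := by
        field_simp
    _ ≤ exp (|ξ.re| * |h|) * (a / c) * (2 * exp η / η ^ 2 * (1 + |x|) ^ (-2 : ℝ)) := by
        refine mul_le_mul_of_nonneg_left (h5.trans (exp_neg_mul_le_inv_sq hη0 (abs_nonneg x)))
          (by positivity)
    _ = _ := by ring

theorem cexp_strip_sub_one_ne {y : ℝ} (h0 : 0 < |a * y|) (h1 : |a * y| < 2 * π) (x : ℝ) :
    cexp (a * (x + y * I)) - 1 ≠ 0 := by
  intro h
  have e := congrArg Complex.normSq h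
  rw [normSq_cexp_strip_sub_one, map_zero] at e
  have hc : cos (a * y) < 1 := by
    refine lt_of_le_of_ne (cos_le_one _) fun hc => ?_
    rw [abs_lt] at h1
    have := (cos_eq_one_iff_of_lt_of_lt h1.1 h1.2).1 hc
    rw [this, abs_zero] at h0
    exact lt_irrefl _ h0
  have := exp_pos (a * x)
  nlinarith [sq_nonneg (exp (a * x) - 1), mul_pos this (sub_pos.2 hc)]

theorem integrable_waveKernel {ξ : ℂ} (ha : 0 < a) (h1 : -a < ξ.im) (h2 : ξ.im < 0) {y : ℝ}
    (hy0 : 0 < |a * y|) (hy1 : |a * y| < 2 * π) :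
    Integrable fun x : ℝ => waveKernel a ξ (x + y * I) := by
  obtain ⟨C, hC, hb⟩ := exists_waveKernel_le ha h1 h2 |y|
  have hcont : Continuous fun x : ℝ => waveKernel a ξ (x + y * I) := by
    unfold waveKernel
    exact (by fun_prop : Continuous fun x : ℝ =>
      cexp (I * ξ * (x + y * I))).mul
        (continuous_const.div (by fun_prop) (cexp_strip_sub_one_ne hy0 hy1))
  obtain ⟨M, hM⟩ := (isCompact_Icc (a := (-1 : ℝ)) (b := 1)).exists_bound_of_continuousOn
    hcont.continuousOn
  refine integrable_horizontal (C := C + |M| * 2 ^ (2 : ℝ)) (r := 2) (by norm_num) hcont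
    fun x => ?_
  have hw : 0 ≤ (1 + |x|) ^ (-2 : ℝ) := by positivity
  rcases le_total 1 |x| with h | h
  · refine (hb x y le_rfl h).trans (mul_le_mul_of_nonneg_right ?_ hw)
    have : 0 ≤ |M| * 2 ^ (2 : ℝ) := by positivity
    linarith
  · have h3 : 1 ≤ 2 ^ (2 : ℝ) * (1 + |x|) ^ (-2 : ℝ) := by
      rw [rpow_neg (by positivity), ← div_eq_mul_inv, one_le_div (by positivity)]
      exact rpow_le_rpow (by positivity) (by linarith) (by norm_num)
    calc _ ≤ |M| * 1 := by rw [mul_one]; exact (hM x (abs_le.1 h)).trans (le_abs_self M)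
      _ ≤ |M| * (2 ^ (2 : ℝ) * (1 + |x|) ^ (-2 : ℝ)) := mul_le_mul_of_nonneg_left h3 (abs_nonneg M)
      _ = |M| * 2 ^ (2 : ℝ) * (1 + |x|) ^ (-2 : ℝ) := by ring
      _ ≤ _ := mul_le_mul_of_nonneg_right (by linarith) hw

theorem waveKernel_sub_period {ξ z : ℂ} (ha : 0 < a) :
    waveKernel a ξ (z - 2 * (π / a) * I) =
      cexp (2 * ξ * (π / a)) * waveKernel a ξ z := by
  have ha' : (a : ℂ) ≠ 0 := by exact_mod_cast ha.ne'
  rw [waveKernel, waveKernel, ← mul_assoc, ← Complex.exp_add]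
  have e1 : (a : ℂ) * (z - 2 * (π / a) * I) = a * z - 2 * π * I := by
    field_simp
  rw [e1, Complex.exp_sub, Complex.exp_two_pi_mul_I, div_one]
  congr 2
  linear_combination (-2 * ξ * (π / a)) * Complex.I_mul_I

theorem integral_waveKernel {ξ : ℂ} (ha : 0 < a) (h1 : -a < ξ.im) (h2 : ξ.im < 0) {y : ℝ}
    (hy0 : 0 < y) (hy1 : a * y < 2 * π) :
    (cexp (2 * ξ * (π / a)) - 1) * ∫ x : ℝ, waveKernel a ξ (x + y * I) =
      2 * π * I := by
  set y₁ : ℝ := y - 2 * (π / a) with hy₁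
  have hay₁ : a * y₁ = a * y - 2 * π := by rw [hy₁]; field_simp
  have hy₁0 : y₁ < 0 := by
    by_contra! h
    have := mul_nonneg ha.le h
    linarith
  have hay : 0 < a * y := mul_pos ha hy0
  set S : Set ℂ := {z | |a / 2 * z.im| < π} with hS
  have hSo : IsOpen S := isOpen_lt (by fun_prop) continuous_const
  have hf : DifferentiableOn ℂ (waveKernelReg a ξ) S := fun z hz =>
    (differentiableAt_waveKernelReg hz).differentiableWithinAt
  have hsub : ∀ z : ℂ, z.im ∈ Icc y₁ y → z ∈ S := by
    intro z hz
    change |a / 2 * z.im| < π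
    have h3 := mul_le_mul_of_nonneg_left hz.1 ha.le
    have h4 := mul_le_mul_of_nonneg_left hz.2 ha.le
    rw [abs_lt]
    constructor <;> linarith
  obtain ⟨C, hC, hb⟩ := exists_waveKernel_le ha h1 h2 (|y₁| + |y|)
  obtain ⟨C', hC', hb'⟩ := exists_strip_bound (f := waveKernelReg a ξ) (y₁ := y₁) (y₂ := y)
    (C := C * (1 + (|y₁| + |y|))) (r := 1) (R := 1)
    (hf.continuousOn.mono fun z hz => hsub z hz) fun z hz hzr => by
      have hzim : |z.im| ≤ |y₁| + |y| := by
        rw [abs_le]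
        constructor
        · linarith [hz.1, neg_abs_le y₁, abs_nonneg y]
        · linarith [hz.2, le_abs_self y, abs_nonneg y₁]
      have hz0 : z ≠ 0 := by
        rintro rfl
        simp at hzr
        linarith
      have hz1 : cexp (a * z) - 1 ≠ 0 := by
        have := norm_cexp_sub_one_ge (y := z.im) ha hzr
        rw [Complex.re_add_im] at this
        rw [← norm_pos_iff]
        refine lt_of_lt_of_le (mul_pos ?_ (lt_max_of_lt_left one_pos)) this
        linarith [exp_lt_one_iff.2 (neg_lt_zero.2 ha)]
      have e : waveKernelReg a ξ z = waveKernel a ξ z * z := by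
        rw [waveKernel_eq ha hz0 hz1, div_mul_cancel₀ _ hz0]
      have h3 := hb z.re z.im hzim hzr
      rw [Complex.re_add_im] at h3
      rw [e, norm_mul]
      have h4 : ‖z‖ ≤ (1 + (|y₁| + |y|)) * (1 + |z.re|) := by
        have := Complex.norm_le_abs_re_add_abs_im z
        nlinarith [abs_nonneg z.re, abs_nonneg y₁, abs_nonneg y]
      calc _ ≤ (C * (1 + |z.re|) ^ (-2 : ℝ)) * ((1 + (|y₁| + |y|)) * (1 + |z.re|)) :=
            mul_le_mul h3 h4 (norm_nonneg _) (by positivity)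
        _ = C * (1 + (|y₁| + |y|)) * ((1 + |z.re|) ^ (-2 : ℝ) * (1 + |z.re|) ^ (1 : ℝ)) := by
            rw [rpow_one]; ring
        _ = _ := by
            rw [← rpow_add (by positivity)]
            norm_num
  have key := cauchy_strip hSo hf hsub (fun z hz => by
    have := hb' z hz
    rwa [rpow_neg_one] at this) (ξ := 0) (by simpa using hy₁0) (by simpa using hy0)
  rw [waveKernelReg_zero, mul_one] at key
  have hline : ∀ v : ℝ, 0 < |a * v| → |a * v| < 2 * π → ∀ t : ℝ,
      waveKernelReg a ξ (t + v * I) / (t + v * I - 0) =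
        waveKernel a ξ (t + v * I) := by
    intro v hv hv' t
    have hv0 : v ≠ 0 := by
      rintro rfl
      simp at hv
    rw [sub_zero, waveKernel_eq ha _ (cexp_strip_sub_one_ne hv hv' t)]
    intro h0
    have := congrArg Complex.im h0
    simp at this
    exact hv0 this
  simp_rw [hline y (abs_pos.2 hay.ne') (by rwa [abs_of_pos hay]),
    hline y₁ (abs_pos.2 (mul_neg_of_pos_of_neg ha hy₁0).ne)
      (by rw [abs_of_neg (mul_neg_of_pos_of_neg ha hy₁0)]; linarith)] at key
  have hper : ∀ t : ℝ, waveKernel a ξ (t + y₁ * I) =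
      cexp (2 * ξ * (π / a)) * waveKernel a ξ (t + y * I) := by
    intro t
    rw [← waveKernel_sub_period ha]
    congr 1
    rw [hy₁]
    push_cast
    ring
  simp_rw [hper, integral_const_mul] at key
  rw [sub_mul, one_mul]
  exact key

end

end BimaterialStrip

namespace BimaterialStrip

section
variable {p : ℝ → ℝ} {γ a : ℝ}

theorem integrable_stripLog_mul_exp {ξ : ℂ} (h1 : -a < ξ.im) (h2 : ξ.im < 0) (y : ℝ) :
    Integrable fun t : ℝ => (stripLog a t y : ℂ) * cexp (I * ξ * t) := by
  obtain ⟨D, hD0, hDi, hD⟩ := exists_stripLog_majorant (a := a) (γ := -ξ.im) (by linarith)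
    (by linarith)
  refine hDi.mono' ?_ ?_
  · exact (Complex.measurable_ofReal.comp (measurable_stripLog a y)).aestronglyMeasurable.mul
      (by fun_prop : Continuous fun t : ℝ => cexp (I * ξ * t)).aestronglyMeasurable
  · filter_upwards [HalfLineDecay.ae_ne 0] with t ht
    rw [norm_mul, norm_cexp_I_mul, Complex.norm_real]
    exact mul_le_mul_of_nonneg_right (hD t y ht) (exp_pos _).le

theorem continuous_integral_stripLog {ξ : ℂ} (h1 : -a < ξ.im) (h2 : ξ.im < 0) :
    Continuous fun y => ∫ t : ℝ, (stripLog a t y : ℂ) * cexp (I * ξ * t) := by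
  have ha : 0 < a := by linarith
  obtain ⟨D, hD0, hDi, hD⟩ := exists_stripLog_majorant (a := a) (γ := -ξ.im) (by linarith)
    (by linarith)
  refine continuous_of_dominated (fun y => (integrable_stripLog_mul_exp h1 h2 y).aestronglyMeasurable)
    (fun y => ?_) hDi ?_
  · filter_upwards [HalfLineDecay.ae_ne 0] with t ht
    rw [norm_mul, norm_cexp_I_mul, Complex.norm_real]
    exact mul_le_mul_of_nonneg_right (hD t y ht) (exp_pos _).le
  · filter_upwards [HalfLineDecay.ae_ne 0] with t ht
    exact (Complex.continuous_ofReal.comp (continuous_stripLog ha ht)).mul continuous_const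

theorem hasDerivAt_stripLog {x y : ℝ} (h : 0 < sin (a * y)) :
    HasDerivAt (fun x => stripLog a x y)
      (a / (cexp (a * (x + y * I)) - 1)).re x := by
  have h1 := hasDerivAt_log_kernel (a := a) (z := x + y * I) (by simpa using h) 0
  have h2 : HasDerivAt (fun x : ℝ => (x + y * I : ℂ)) 1 x := by
    simpa using (Complex.ofRealCLM.hasDerivAt (x := x)).add_const (y * I : ℂ)
  have h3 := Complex.reCLM.hasFDerivAt.comp_hasDerivAt x (h1.comp x h2)
  simp only [Complex.reCLM_apply, Function.comp_def, Complex.ofReal_zero, sub_zero, mul_one,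
    Complex.log_re] at h3
  exact h3

theorem re_kernel_eq (x y : ℝ) :
    (((a / (cexp (a * (x + y * I)) - 1)).re : ℝ) : ℂ) =
      (a / (cexp (a * (x + y * I)) - 1) +
        a / (cexp (a * (x + ((-y : ℝ) : ℂ) * I)) - 1)) / 2 := by
  rw [Complex.re_eq_add_conj]
  congr 2
  rw [map_div₀, map_sub, ← Complex.exp_conj]
  simp

theorem exp_mul_kernel_eq (ξ : ℂ) (x y : ℝ) :
    cexp (I * ξ * x) * (a / (cexp (a * (x + y * I)) - 1)) =
      cexp (ξ * y) * waveKernel a ξ (x + y * I) := by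
  rw [waveKernel, ← mul_assoc, ← Complex.exp_add]
  congr 2
  linear_combination (-ξ * y) * Complex.I_mul_I

theorem integral_stripLog_aux {ξ : ℂ} (h1 : -a < ξ.im) (h2 : ξ.im < 0) {y : ℝ} (hy0 : 0 < y)
    (hy1 : a * y < π) :
    ∫ t : ℝ, (stripLog a t y : ℂ) * cexp (I * ξ * t) =
      -π / ξ * (Complex.cosh (ξ * (y - π / a)) / Complex.sinh (ξ * (π / a))) := by
  have hpi := pi_pos
  have ha : 0 < a := by linarith
  have hay : 0 < a * y := mul_pos ha hy0
  have hξ : ξ ≠ 0 := by rintro rfl; simp at h2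
  have hsin := sin_pos_of_mem ha hy0 hy1
  have i1 : Integrable fun x : ℝ => waveKernel a ξ (x + y * I) :=
    integrable_waveKernel ha h1 h2 (abs_pos.2 hay.ne') (by rw [abs_of_pos hay]; linarith)
  have i2 : Integrable fun x : ℝ => waveKernel a ξ (x + ((-y : ℝ) : ℂ) * I) :=
    integrable_waveKernel ha h1 h2 (abs_pos.2 (by simp; exact ⟨ha.ne', hy0.ne'⟩))
      (by rw [mul_neg, abs_neg, abs_of_pos hay]; linarith)
  set y' : ℝ := 2 * (π / a) - y with hy'
  have hay' : a * y' = 2 * π - a * y := by rw [hy']; field_simp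
  have hy'0 : 0 < y' := by
    by_contra! h
    have := mul_nonpos_of_nonneg_of_nonpos ha.le h
    linarith
  have k1 := integral_waveKernel ha h1 h2 hy0 (by linarith)
  have k2 := integral_waveKernel ha h1 h2 hy'0 (by linarith)
  set q := cexp (2 * ξ * (π / a)) with hq
  have hq1 : q - 1 ≠ 0 := by
    intro h0
    rw [h0, zero_mul] at k1
    exact mul_ne_zero (mul_ne_zero two_ne_zero (by exact_mod_cast hpi.ne')) Complex.I_ne_zero k1.symm
  have k3 : ∫ x : ℝ, waveKernel a ξ (x + ((-y : ℝ) : ℂ) * I) =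
      q * ∫ x : ℝ, waveKernel a ξ (x + y' * I) := by
    rw [← integral_const_mul]
    congr 1
    ext x
    rw [hq, ← waveKernel_sub_period ha]
    congr 1
    rw [hy']
    push_cast
    ring
  rw [mul_comm, ← eq_div_iff hq1] at k1 k2
  set u : ℝ → ℂ := fun t => (stripLog a t y : ℂ) with hu
  set u' : ℝ → ℂ := fun t => (((a / (cexp (a * (t + y * I)) - 1)).re : ℝ) : ℂ) with hu'
  set v : ℝ → ℂ := fun t => cexp (I * ξ * t) / (I * ξ) with hv
  set v' : ℝ → ℂ := fun t => cexp (I * ξ * t) with hv'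
  have e1 : ∀ x : ℝ, u' x * v x = (cexp (ξ * y) * waveKernel a ξ (x + y * I) +
      cexp (ξ * ((-y : ℝ) : ℂ)) * waveKernel a ξ (x + ((-y : ℝ) : ℂ) * I)) *
        (1 / (2 * (I * ξ))) := by
    intro x
    rw [← exp_mul_kernel_eq, ← exp_mul_kernel_eq, hu', hv]
    simp only
    rw [re_kernel_eq]
    field_simp
  have hibp := integral_mul_deriv_eq_deriv_mul_of_integrable (u := u) (v := v) (u' := u') (v' := v')
    (fun x _ => (hasDerivAt_stripLog hsin).ofReal_comp) (fun x _ => ?_)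
    (integrable_stripLog_mul_exp h1 h2 y) ?_ ?_
  · rw [hibp]
    simp_rw [e1]
    rw [integral_mul_const, integral_add (i1.const_mul _) (i2.const_mul _), integral_const_mul,
      integral_const_mul, k3, k1, k2]
    set w := cexp (ξ * (π / a)) with hw
    have hwq : q = w ^ 2 := by
      rw [hw, ← Complex.exp_nat_mul, hq]; congr 1; push_cast; ring
    have hw0 : w ≠ 0 := Complex.exp_ne_zero _
    have ec : Complex.cosh (ξ * (y - π / a)) =
        (cexp (ξ * y) * w⁻¹ + (cexp (ξ * y))⁻¹ * w) / 2 := by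
      rw [Complex.cosh, hw, ← Complex.exp_neg, ← Complex.exp_neg, ← Complex.exp_add,
        ← Complex.exp_add]
      congr 3 <;> ring
    have es : Complex.sinh (ξ * (π / a)) = (w - w⁻¹) / 2 := by
      rw [Complex.sinh, hw, Complex.exp_neg]
    have en : cexp (ξ * ((-y : ℝ) : ℂ)) = (cexp (ξ * y))⁻¹ := by
      rw [← Complex.exp_neg]; congr 1; push_cast; ring
    rw [ec, es, en]
    rw [hwq] at hq1 ⊢
    generalize cexp (ξ * y) = E at *
    have e2 : (w - w⁻¹) = (w ^ 2 - 1) / w := by field_simp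
    rw [e2]
    field_simp
  · have h3 : HasDerivAt (fun t : ℝ => (I * ξ * t : ℂ)) (I * ξ) x := by
      simpa using (Complex.ofRealCLM.hasDerivAt (x := x)).const_mul (I * ξ)
    refine (h3.cexp.div_const (I * ξ)).congr_deriv ?_
    field_simp
    rfl
  · refine (((i1.const_mul (cexp (ξ * y))).add
      (i2.const_mul (cexp (ξ * ((-y : ℝ) : ℂ))))).mul_const
        (1 / (2 * (I * ξ)))).congr (Eventually.of_forall fun x => ?_)
    exact (e1 x).symm
  · refine ((integrable_stripLog_mul_exp h1 h2 y).mul_const (1 / (I * ξ))).congr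
      (Eventually.of_forall fun x => ?_)
    simp only [Pi.mul_apply, hu, hv]
    ring

/-- The Fourier transform of the logarithmic kernel. -/
theorem integral_stripLog {ξ : ℂ} (h1 : -a < ξ.im) (h2 : ξ.im < 0) {y : ℝ}
    (hy : y ∈ Icc 0 (π / a)) :
    ∫ t : ℝ, (stripLog a t y : ℂ) * cexp (I * ξ * t) =
      -π / ξ * (Complex.cosh (ξ * (y - π / a)) / Complex.sinh (ξ * (π / a))) := by
  have ha : 0 < a := by linarith
  have hH : 0 < π / a := by have := pi_pos; positivity
  have hc : Continuous fun y : ℝ =>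
      -π / ξ * (Complex.cosh (ξ * (y - π / a)) / Complex.sinh (ξ * (π / a))) := by
    refine continuous_const.mul (Continuous.div_const ?_ _)
    exact Complex.continuous_cosh.comp (by fun_prop)
  have hcl := isClosed_eq (continuous_integral_stripLog h1 h2) hc
  have hsub : Ioo 0 (π / a) ⊆ {y : ℝ | ∫ t : ℝ, (stripLog a t y : ℂ) *
      cexp (I * ξ * t) =
        -π / ξ * (Complex.cosh (ξ * (y - π / a)) / Complex.sinh (ξ * (π / a)))} := fun y hy => by
    have := (lt_div_iff₀ ha).1 hy.2
    exact integral_stripLog_aux h1 h2 hy.1 (by linarith)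
  have := hcl.closure_subset_iff.2 hsub
  rw [closure_Ioo hH.ne] at this
  exact this hy

theorem rightTransform_eq_integral_zeroExt (p : ℝ → ℝ) (ξ : ℂ) :
    rightTransform (fun x => (p x : ℂ)) ξ =
      ∫ x : ℝ, (zeroExt p x : ℂ) * cexp (I * ξ * x) := by
  rw [rightTransform, ← integral_indicator measurableSet_Ioi]
  congr 1
  ext s
  rcases le_or_gt s 0 with h | h
  · rw [zeroExt_of_nonpos h, indicator_of_notMem (by simpa using h), Complex.ofReal_zero, zero_mul]
  · rw [zeroExt_of_pos h, indicator_of_mem (by exact h)]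

namespace HalfLineDecay

theorem integrable_zeroExt_mul_exp (hp : HalfLineDecay p γ) {ξ : ℂ} (h : -γ < ξ.im) :
    Integrable fun x : ℝ => (zeroExt p x : ℂ) * cexp (I * ξ * x) := by
  obtain ⟨K, hK, hb⟩ := hp.bound
  have h1 := integrableOn_right (φ := fun x => (p x : ℂ)) (C := K) (γ := γ)
    (Complex.continuous_ofReal.comp_aestronglyMeasurable hp.aestronglyMeasurable)
    (fun x hx => by rw [Complex.norm_real]; exact hb x hx) h
  rw [← integrable_indicator_iff measurableSet_Ioi] at h1
  refine h1.congr (Eventually.of_forall fun s => ?_)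
  rcases le_or_gt s 0 with h | h
  · simp only
    rw [zeroExt_of_nonpos h, indicator_of_notMem (by simpa using h), Complex.ofReal_zero, zero_mul]
  · simp only
    rw [zeroExt_of_pos h, indicator_of_mem (by exact h)]

/-- The Fourier transform of the potential. -/
theorem integral_exp_mul_potential (hp : HalfLineDecay p γ) (hγa : γ < a) {ξ : ℂ}
    (h1 : -γ < ξ.im) (h2 : ξ.im < 0) {Y : ℝ} (hY : Y ∈ Icc 0 (π / a)) :
    Integrable (fun X : ℝ => cexp (I * ξ * X) * (potential a p X Y : ℂ)) ∧
    ∫ X : ℝ, cexp (I * ξ * X) * (potential a p X Y : ℂ) =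
      -rightTransform (fun x => (p x : ℂ)) ξ / ξ *
        (Complex.cosh (ξ * (Y - π / a)) / Complex.sinh (ξ * (π / a))) := by
  have i1 := integrable_stripLog_mul_exp (a := a) (by linarith) h2 Y
  have i2 := hp.integrable_zeroExt_mul_exp h1
  set f : ℝ → ℂ := fun t => (stripLog a t Y : ℂ) * cexp (I * ξ * t) with hf
  set g : ℝ → ℂ := fun x => (zeroExt p x : ℂ) * cexp (I * ξ * x) with hg
  have e : ∀ X : ℝ, cexp (I * ξ * X) * (potential a p X Y : ℂ) =
      1 / π * convolution f g (ContinuousLinearMap.mul ℝ ℂ) volume X := by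
    intro X
    rw [convolution, potential]
    push_cast
    rw [mul_left_comm, ← integral_complex_ofReal, ← integral_const_mul]
    congr 2
    ext t
    simp only [ContinuousLinearMap.mul_apply', hf, hg]
    have : cexp (I * ξ * X) = cexp (I * ξ * t) *
        cexp (I * ξ * ((X - t : ℝ) : ℂ)) := by
      rw [← Complex.exp_add]; congr 1; push_cast; ring
    rw [this]
    push_cast
    ring
  simp_rw [e]
  refine ⟨(i1.integrable_convolution (ContinuousLinearMap.mul ℝ ℂ) i2).const_mul _, ?_⟩
  rw [integral_const_mul, integral_convolution _ i1 i2, ContinuousLinearMap.mul_apply',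
    ← rightTransform_eq_integral_zeroExt, integral_stripLog (by linarith) h2 hY]
  field_simp

end HalfLineDecay

end

end BimaterialStrip

namespace BimaterialStrip

/-! ### Expansion of the potential at the tip -/

section
variable {p : ℝ → ℝ} {γ a : ℝ}

theorem abs_log_norm_sub_le_far {z : ℂ} {s : ℝ} (hs : 0 < s) (h : 2 * ‖z‖ ≤ s) :
    |log ‖z - s‖ - log s| ≤ 2 * ‖z‖ / s := by
  have hn : ‖(s : ℂ)‖ = s := by rw [Complex.norm_real, norm_of_nonneg hs.le]
  have h1 : s - ‖z‖ ≤ ‖z - s‖ := by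
    have := norm_sub_norm_le (s : ℂ) z
    rwa [hn, norm_sub_rev] at this
  have h2 : ‖z - s‖ ≤ ‖z‖ + s := by
    have := norm_sub_le z (s : ℂ)
    rwa [hn] at this
  have h0 := norm_nonneg z
  have hpos : 0 < ‖z - s‖ := by linarith
  rw [abs_le, ← log_div hpos.ne' hs.ne']
  constructor
  · rw [neg_le, ← log_inv, inv_div]
    refine (log_le_sub_one_of_pos (by positivity)).trans ?_
    rw [sub_le_iff_le_add, div_le_iff₀ hpos]
    have e : (2 * ‖z‖ / s + 1) * (s - ‖z‖) = s + ‖z‖ * (s - 2 * ‖z‖) / s := by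
      field_simp
      ring
    have h3 : 0 ≤ ‖z‖ * (s - 2 * ‖z‖) / s := div_nonneg (mul_nonneg h0 (by linarith)) hs.le
    have h4 : (2 * ‖z‖ / s + 1) * (s - ‖z‖) ≤ (2 * ‖z‖ / s + 1) * ‖z - s‖ :=
      mul_le_mul_of_nonneg_left h1 (by positivity)
    linarith
  · refine (log_le_sub_one_of_pos (by positivity)).trans ?_
    rw [sub_le_iff_le_add, div_le_iff₀ hs, add_mul, div_mul_cancel₀ _ hs.ne']
    linarith

theorem abs_log_norm_sub_le_near {z : ℂ} {s : ℝ} (hs : 0 < s) (hz : 0 < ‖z‖) (h : s ≤ 2 * ‖z‖)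
    (hne : s ≠ ‖z‖) : |log ‖z - s‖ - log s| ≤
      log 3 + |log (s / ‖z‖)| + |log (1 - s / ‖z‖)| := by
  have hn : ‖(s : ℂ)‖ = s := by rw [Complex.norm_real, norm_of_nonneg hs.le]
  have h1 : |‖z‖ - s| ≤ ‖z - s‖ := by
    have := abs_norm_sub_norm_le z (s : ℂ)
    rwa [hn] at this
  have h2 : ‖z - s‖ ≤ 3 * ‖z‖ := by
    have := norm_sub_le z (s : ℂ)
    rw [hn] at this
    linarith
  have h3 : 0 < |‖z‖ - s| := abs_pos.2 (sub_ne_zero.2 hne.symm)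
  have hpos : 0 < ‖z - s‖ := h3.trans_le h1
  have e1 : log (s / ‖z‖) = log s - log ‖z‖ := log_div hs.ne' hz.ne'
  have e2 : log (1 - s / ‖z‖) = log |‖z‖ - s| - log ‖z‖ := by
    rw [← log_div h3.ne' hz.ne', ← log_abs]
    have : 1 - s / ‖z‖ = (‖z‖ - s) / ‖z‖ := by field_simp
    rw [this, abs_div, abs_of_pos hz]
  have h4 := log_le_log h3 h1
  have h5 := log_le_log hpos h2
  rw [log_mul three_ne_zero hz.ne'] at h5
  have h6 : 0 < log 3 := log_pos (by norm_num)
  rw [abs_le]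
  constructor
  · linarith [le_abs_self (log (s / ‖z‖)), neg_abs_le (log (1 - s / ‖z‖))]
  · linarith [neg_abs_le (log (s / ‖z‖)), abs_nonneg (log (1 - s / ‖z‖))]

/-- Integral estimate for the singular part of the kernel. -/
theorem exists_integral_log_le : ∃ C, 0 < C ∧ ∀ (δ K : ℝ) (z : ℂ) (m : ℝ → ℝ), 0 < δ → 0 ≤ K →
    0 < ‖z‖ → 2 * ‖z‖ ≤ δ → (∀ s, 0 < s → |m s| ≤ K * s ^ (1 / 4 : ℝ)) →
    |∫ s in Ioc 0 δ, (log ‖z - s‖ - log s) * m s| ≤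
      C * K * δ ^ (1 / 4 : ℝ) * ‖z‖ := by
  set g : ℝ → ℝ := fun t => log 3 + |log t| + |log (1 - t)| with hg
  have hgi : IntervalIntegrable g volume 0 2 := by
    have h1 : IntervalIntegrable (fun t => log t) volume 0 2 :=
      intervalIntegral.intervalIntegrable_log'
    have h2 : IntervalIntegrable (fun t => log (1 - t)) volume 0 2 := by
      have := (intervalIntegral.intervalIntegrable_log' (a := 1) (b := -1)).comp_sub_left 1
      norm_num at this
      exact this
    exact (intervalIntegrable_const.add h1.abs).add h2.abs
  have hg0 : ∀ t, 0 ≤ g t := fun t => by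
    have : 0 < log 3 := log_pos (by norm_num)
    positivity
  set J := ∫ t in (0 : ℝ)..2, g t with hJ
  have hJ0 : 0 ≤ J := intervalIntegral.integral_nonneg (by norm_num) fun t _ => hg0 t
  refine ⟨8 + J, by positivity, fun δ K z m hδ hK hz hzδ hm => ?_⟩
  set R := ‖z‖ with hR
  set B : ℝ → ℝ := fun s => 2 * R * K * s ^ (-(3 / 4) : ℝ) +
    K * δ ^ (1 / 4 : ℝ) * (Ioc 0 (2 * R)).indicator (fun s => g (s / R)) s with hB
  have hi1 : IntegrableOn (fun s : ℝ => s ^ (-(3 / 4) : ℝ)) (Ioc 0 δ) := by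
    rw [← intervalIntegrable_iff_integrableOn_Ioc_of_le hδ.le]
    exact intervalIntegral.intervalIntegrable_rpow' (by norm_num)
  have hv1 : ∫ s in Ioc 0 δ, s ^ (-(3 / 4) : ℝ) = 4 * δ ^ (1 / 4 : ℝ) := by
    rw [← intervalIntegral.integral_of_le hδ.le, integral_rpow (Or.inl (by norm_num))]
    norm_num
    ring
  have hgR : IntervalIntegrable (fun s => g (s / R)) volume 0 (2 * R) := by
    have := hgi.comp_mul_right (c := R⁻¹)
    simpa [div_eq_mul_inv] using this
  have hi2 : IntegrableOn ((Ioc 0 (2 * R)).indicator fun s => g (s / R)) (Ioc 0 δ) := by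
    rw [integrableOn_indicator_iff measurableSet_Ioc, inter_eq_left.2 (Ioc_subset_Ioc_right hzδ),
      ← intervalIntegrable_iff_integrableOn_Ioc_of_le (by positivity)]
    exact hgR
  have hv2 : ∫ s in Ioc 0 δ, (Ioc 0 (2 * R)).indicator (fun s => g (s / R)) s = R * J := by
    rw [setIntegral_indicator measurableSet_Ioc, inter_eq_right.2 (Ioc_subset_Ioc_right hzδ),
      ← intervalIntegral.integral_of_le (by positivity), intervalIntegral.integral_comp_div _ hz.ne',
      zero_div, mul_div_cancel_right₀ _ hz.ne', smul_eq_mul]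
  have hBi : IntegrableOn B (Ioc 0 δ) := (hi1.const_mul _).add (hi2.const_mul _)
  have hBv : ∫ s in Ioc 0 δ, B s = (8 + J) * K * δ ^ (1 / 4 : ℝ) * R := by
    rw [hB, integral_add (hi1.const_mul _) (hi2.const_mul _), integral_const_mul, integral_const_mul,
      hv1, hv2]
    ring
  rw [← hBv, ← norm_eq_abs]
  refine norm_integral_le_of_norm_le hBi ?_
  rw [ae_restrict_iff' measurableSet_Ioc]
  filter_upwards [HalfLineDecay.ae_ne R] with s hsR hs
  rw [norm_mul, norm_eq_abs, norm_eq_abs]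
  have hm1 := hm s hs.1
  have hs0 : 0 < s := hs.1
  rcases le_or_gt s (2 * R) with h | h
  · have h1 := abs_log_norm_sub_le_near hs.1 hz h hsR
    have h2 : |m s| ≤ K * δ ^ (1 / 4 : ℝ) := hm1.trans (mul_le_mul_of_nonneg_left
      (rpow_le_rpow hs0.le hs.2 (by norm_num)) hK)
    rw [hB]
    simp only
    rw [indicator_of_mem (show s ∈ Ioc 0 (2 * R) from ⟨hs.1, h⟩)]
    calc _ ≤ g (s / R) * (K * δ ^ (1 / 4 : ℝ)) := mul_le_mul h1 h2 (abs_nonneg _) (hg0 _)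
      _ ≤ _ := by
        have : 0 ≤ 2 * R * K * s ^ (-(3 / 4) : ℝ) := by positivity
        linarith
  · have h1 := abs_log_norm_sub_le_far hs.1 h.le
    rw [hB]
    simp only
    rw [indicator_of_notMem (fun h' => absurd h'.2 (not_le.2 h)), mul_zero, add_zero]
    calc _ ≤ (2 * R / s) * (K * s ^ (1 / 4 : ℝ)) := mul_le_mul h1 hm1 (abs_nonneg _) (by positivity)
      _ = 2 * R * K * (s ^ (-1 : ℝ) * s ^ (1 / 4 : ℝ)) := by
          rw [rpow_neg_one]
          ring
      _ = _ := by
          rw [← rpow_add hs0]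
          norm_num

/-- `stripLog` without its logarithmic singularity at the origin is Lipschitz near the origin. -/
theorem exists_stripLog_sub_log (ha : 0 < a) : ∃ ρ K, 0 < ρ ∧ 0 ≤ K ∧ ∃ M : ℂ → ℝ,
    (∀ z : ℂ, z ≠ 0 → ‖z‖ < ρ → stripLog a z.re z.im = log ‖z‖ + M z) ∧
    ∀ z w : ℂ, ‖z‖ < ρ → ‖w‖ < ρ → |M z - M w| ≤ K * ‖z - w‖ := by
  set E : ℂ → ℂ := dslope (fun z : ℂ => 1 - cexp (-(a * z))) 0 with hE
  have hEd : Differentiable ℂ E := by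
    rw [← differentiableOn_univ]
    exact (Complex.differentiableOn_dslope univ_mem).2 (by fun_prop)
  have hE0 : E 0 = a := by
    rw [hE, dslope_same]
    have : HasDerivAt (fun z : ℂ => 1 - cexp (-(a * z)))
        (-(cexp (-(a * 0)) * (-(a * 1)))) 0 :=
      (((hasDerivAt_id' (0 : ℂ)).const_mul (a : ℂ)).fun_neg.cexp).const_sub 1
    rw [this.deriv]
    simp
  have hslit : E 0 ∈ Complex.slitPlane := by
    rw [hE0]
    exact Complex.ofReal_mem_slitPlane.2 ha
  have han : AnalyticAt ℂ (fun z => Complex.log (E z)) 0 := (hEd.analyticAt 0).clog hslit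
  obtain ⟨K, t, ht, hK⟩ := (han.contDiffAt (n := 1)).exists_lipschitzOnWith
  have hne : {z : ℂ | E z ≠ 0} ∈ 𝓝 (0 : ℂ) := hEd.continuous.continuousAt.eventually_ne
    (by rw [hE0]; exact_mod_cast ha.ne')
  obtain ⟨ρ, hρ, hsub⟩ := Metric.mem_nhds_iff.1 (inter_mem ht hne)
  refine ⟨ρ, K, hρ, K.2, fun z => log ‖E z‖, fun z hz hzρ => ?_, fun z w hz hw => ?_⟩
  · have h1 : E z ≠ 0 := (hsub (mem_ball_zero_iff.2 hzρ)).2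
    rw [← log_mul (norm_ne_zero_iff.2 hz) (norm_ne_zero_iff.2 h1), ← norm_mul, stripLog,
      Complex.re_add_im, hE]
    have := sub_smul_dslope (fun z : ℂ => 1 - cexp (-(a * z))) 0 z
    simp only [sub_zero, smul_eq_mul, mul_zero, neg_zero, Complex.exp_zero, sub_self] at this
    rw [this]
  · have h1 := hK.dist_le_mul z (hsub (mem_ball_zero_iff.2 hz)).1 w
      (hsub (mem_ball_zero_iff.2 hw)).1
    rw [dist_eq_norm, dist_eq_norm] at h1
    change |log ‖E z‖ - log ‖E w‖| ≤ _
    rw [← Complex.log_re, ← Complex.log_re, ← Complex.sub_re]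
    exact (Complex.abs_re_le_norm _).trans h1

/-- An antiderivative of the logarithm. -/
noncomputable def logPrimitive (w : ℂ) : ℂ := w * Complex.log w - w

theorem hasDerivAt_logPrimitive {w : ℂ} (hw : w ∈ Complex.slitPlane) :
    HasDerivAt logPrimitive (Complex.log w) w := by
  have h := ((hasDerivAt_id' w).fun_mul (Complex.hasDerivAt_log hw)).fun_sub (hasDerivAt_id' w)
  refine h.congr_deriv ?_
  have := Complex.slitPlane_ne_zero hw
  field_simp
  ring

theorem integral_log_norm_sub {z : ℂ} (hz : 0 < z.im) {δ : ℝ} (hδ : 0 ≤ δ) :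
    IntegrableOn (fun s : ℝ => log ‖z - s‖) (Ioc 0 δ) ∧
    ∫ s in Ioc 0 δ, log ‖z - s‖ = (logPrimitive z - logPrimitive (z - δ)).re := by
  have hslit : ∀ s : ℝ, z - s ∈ Complex.slitPlane := fun s => Or.inr (by simpa using hz.ne')
  have hc : Continuous fun s : ℝ => Complex.log (z - s) :=
    Continuous.clog (by fun_prop) hslit
  have hd : ∀ s : ℝ, HasDerivAt (fun s : ℝ => -logPrimitive (z - s)) (Complex.log (z - s)) s := by
    intro s
    have h2 : HasDerivAt (fun s : ℝ => (z - s : ℂ)) (-1) s := by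
      simpa using (Complex.ofRealCLM.hasDerivAt (x := s)).const_sub z
    refine ((hasDerivAt_logPrimitive (hslit s)).comp s h2).fun_neg.congr_deriv ?_
    ring
  have h1 := intervalIntegral.integral_eq_sub_of_hasDerivAt (fun s _ => hd s)
    (hc.intervalIntegrable 0 δ)
  have hi : IntegrableOn (fun s : ℝ => Complex.log (z - s)) (Ioc 0 δ) :=
    (hc.intervalIntegrable 0 δ).1
  have hre : ∀ s : ℝ, log ‖z - s‖ = (Complex.log (z - s)).re := fun s => by
    rw [Complex.log_re]
  simp_rw [hre]
  refine ⟨hi.re, ?_⟩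
  have h2 := integral_re hi
  simp only [RCLike.re_to_complex] at h2
  rw [h2, ← intervalIntegral.integral_of_le hδ, h1]
  congr 1
  simp
  ring

theorem logPrimitive_polar {R θ : ℝ} (hR : 0 < R) (hθ : θ ∈ Ioo 0 π) :
    (logPrimitive (R * cexp (θ * I))).re =
      R * cos θ * log R - θ * (R * sin θ) - R * cos θ := by
  have h1 : Complex.log (R * cexp (θ * I)) = log R + θ * I := by
    rw [Complex.log_ofReal_mul hR (Complex.exp_ne_zero _), Complex.log_exp]
    · simpa using by linarith [hθ.1, pi_pos]
    · simpa using hθ.2.le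
  rw [logPrimitive, h1, Complex.exp_mul_I, ← Complex.ofReal_cos, ← Complex.ofReal_sin]
  generalize cos θ = c, sin θ = d, log R = l
  simp
  ring

theorem logPrimitive_shift {z : ℂ} {δ : ℝ} (hz : 0 < z.im) :
    logPrimitive (z - δ) = (z - δ) * (Complex.log (δ - z) + π * I) - (z - δ) := by
  have e : Complex.log (z - δ) = Complex.log (δ - z) + π * I := by
    have h : Complex.log (-(δ - z)) = Complex.log (δ - z) + π * I := by
      rw [Complex.log, Complex.log, norm_neg, Complex.arg_neg_eq_arg_add_pi_of_im_neg (by simpa)]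
      push_cast
      ring
    rwa [neg_sub] at h
  rw [logPrimitive, e]

theorem integral_log_tip {δ : ℝ} (hδ : 0 < δ) : ∀ ε : ℝ, 0 < ε → ∀ᶠ R : ℝ in 𝓝[>] (0 : ℝ),
    ∀ θ ∈ Ioo 0 π,
    |(∫ s in Ioc 0 δ, (log ‖((R : ℂ) * cexp (θ * I) - s : ℂ)‖ - log s)) -
      (R * cos θ * log R - R * cos θ + (π - θ) * (R * sin θ)) +
        log δ * (R * cos θ)| ≤ ε * R := by
  intro ε hε
  set Q : ℂ → ℂ := fun z => (z - δ) * (Complex.log (δ - z) + π * I) - (z - δ) with hQ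
  have hQd : HasDerivAt Q (log δ + π * I) 0 := by
    have hs : ((δ : ℂ) - 0) ∈ Complex.slitPlane := by
      rw [sub_zero]
      exact Complex.ofReal_mem_slitPlane.2 hδ
    have h1 : HasDerivAt (fun z : ℂ => z - δ) 1 0 := (hasDerivAt_id' 0).sub_const _
    have h2 := (((hasDerivAt_id' (0 : ℂ)).const_sub (δ : ℂ)).clog hs).add_const (π * I)
    refine ((h1.fun_mul h2).fun_sub h1).congr_deriv ?_
    have : (δ : ℂ) ≠ 0 := by exact_mod_cast hδ.ne'
    rw [sub_zero, ← Complex.ofReal_log hδ.le]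
    field_simp
    ring
  have hQ0 : (Q 0).re = -(δ * log δ - δ) := by
    rw [hQ]
    simp only [sub_zero, zero_sub]
    rw [← Complex.ofReal_log hδ.le]
    simp
    ring
  have hlittle := (hasDerivAt_iff_isLittleO.1 hQd).def hε
  obtain ⟨r, hr, hball⟩ := Metric.eventually_nhds_iff.1 hlittle
  filter_upwards [Ioo_mem_nhdsGT hr] with R hR θ hθ
  set z : ℂ := R * cexp (θ * I) with hz
  have hnz : ‖z‖ = R := by
    rw [hz, norm_mul, Complex.norm_exp_ofReal_mul_I, Complex.norm_real,
      norm_of_nonneg hR.1.le, mul_one]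
  have hzre : z.re = R * cos θ := by
    rw [hz, Complex.re_ofReal_mul, Complex.exp_ofReal_mul_I_re]
  have hzim : z.im = R * sin θ := by
    rw [hz, Complex.im_ofReal_mul, Complex.exp_ofReal_mul_I_im]
  have hzpos : 0 < z.im := by
    rw [hzim]
    exact mul_pos hR.1 (sin_pos_of_pos_of_lt_pi hθ.1 hθ.2)
  obtain ⟨i1, v1⟩ := integral_log_norm_sub hzpos hδ.le
  have i2 : IntegrableOn (fun s : ℝ => log s) (Ioc 0 δ) :=
    (intervalIntegral.intervalIntegrable_log' (a := 0) (b := δ)).1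
  have v2 : ∫ s in Ioc 0 δ, log s = δ * log δ - δ := by
    rw [← intervalIntegral.integral_of_le hδ.le, integral_log]
    simp
  have h1 := hball (y := z) (by rw [dist_zero_right, hnz]; exact hR.2)
  rw [sub_zero, hnz, smul_eq_mul] at h1
  have h2 := (Complex.abs_re_le_norm _).trans h1
  rw [integral_sub i1 i2, v1, v2, Complex.sub_re, logPrimitive_shift hzpos, hz,
    logPrimitive_polar hR.1 hθ, ← hz]
  have e : (z * (log δ + π * I)).re =
      log δ * (R * cos θ) - π * (R * sin θ) := by
    rw [← hzre, ← hzim, Complex.mul_re]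
    simp
    ring
  rw [Complex.sub_re, Complex.sub_re, e, hQ0, abs_sub_comm] at h2
  refine (congrArg _ ?_).trans_le h2
  simp only [hQ]
  ring

namespace HalfLineDecay

theorem exists_far_expansion (hp : HalfLineDecay p γ) (ha : 0 < a) {δ : ℝ} (hδ : 0 < δ) :
    ∃ c : ℝ, ∀ ε : ℝ, 0 < ε → ∀ᶠ z : ℂ in 𝓝 0,
      |(∫ s in Ioi δ, p s * (stripLog a (z.re - s) z.im - stripLog a (0 - s) 0)) - c * z.re| ≤
        ε * ‖z‖ := by
  have hpi : IntegrableOn p (Ioi δ) := hp.integrableOn.mono_set (Ioi_subset_Ioi hδ.le)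
  have hpi' : IntegrableOn (fun s => (p s : ℂ)) (Ioi δ) := hpi.ofReal
  set q := exp (-(a * (δ / 2))) with hq
  have hq1 : q < 1 := exp_lt_one_iff.2 (by nlinarith)
  have hexp : ∀ z ∈ Metric.ball (0 : ℂ) (δ / 2), ∀ s, δ < s →
      ‖cexp (a * (z - s))‖ ≤ q := by
    intro z hz s hs
    rw [Complex.norm_exp, hq, exp_le_exp, Complex.re_ofReal_mul, Complex.sub_re,
      Complex.ofReal_re, ← mul_neg]
    refine mul_le_mul_of_nonneg_left ?_ ha.le
    have := (Complex.re_le_norm z).trans_lt (mem_ball_zero_iff.1 hz)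
    linarith
  have hslit : ∀ z ∈ Metric.ball (0 : ℂ) (δ / 2), ∀ s, δ < s →
      1 - cexp (a * (z - s)) ∈ Complex.slitPlane := by
    intro z hz s hs
    refine Or.inl ?_
    rw [Complex.sub_re, Complex.one_re]
    have := (Complex.re_le_norm _).trans (hexp z hz s hs)
    linarith
  set F : ℂ → ℝ → ℂ := fun z s => Complex.log (1 - cexp (a * (z - s))) * p s with hF
  set F' : ℂ → ℝ → ℂ := fun z s =>
    -(cexp (a * (z - s)) * a) / (1 - cexp (a * (z - s))) * p s with hF'
  have hmeas : ∀ z, AEStronglyMeasurable (F z) (volume.restrict (Ioi δ)) := fun z =>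
    (Complex.measurable_log.comp (by fun_prop : Measurable fun s : ℝ =>
      1 - cexp (a * (z - s)))).aestronglyMeasurable.mul hpi'.aestronglyMeasurable
  have hbd : ∀ z ∈ Metric.ball (0 : ℂ) (δ / 2), ∀ s, δ < s →
      ‖F' z s‖ ≤ a / (1 - q) * |p s| := by
    intro z hz s hs
    have h1 := hexp z hz s hs
    have h2 : 1 - q ≤ ‖1 - cexp (a * (z - s))‖ := by
      have := norm_sub_norm_le (1 : ℂ) (cexp (a * (z - s)))
      rw [norm_one] at this
      linarith
    rw [hF', norm_mul, norm_div, norm_neg, norm_mul, Complex.norm_real, Complex.norm_real,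
      norm_of_nonneg ha.le, norm_eq_abs]
    refine mul_le_mul_of_nonneg_right ?_ (abs_nonneg _)
    refine div_le_div₀ ha.le ?_ (by linarith) h2
    nlinarith
  have hball : Metric.ball (0 : ℂ) (δ / 2) ∈ 𝓝 (0 : ℂ) := Metric.ball_mem_nhds _ (by linarith)
  have hder : ∀ s, δ < s → ∀ z ∈ Metric.ball (0 : ℂ) (δ / 2), HasDerivAt (F · s) (F' z s) z := by
    intro s hs z hz
    have h1 : HasDerivAt (fun z : ℂ => (a : ℂ) * (z - s)) (a * 1) z :=
      ((hasDerivAt_id' z).sub_const _).const_mul _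
    refine (((h1.cexp.const_sub 1).clog (hslit z hz s hs)).mul_const (p s : ℂ)).congr_deriv ?_
    rw [hF', mul_one]
  have hint : ∀ z ∈ Metric.ball (0 : ℂ) (δ / 2), IntegrableOn (F z) (Ioi δ) := by
    intro z hz
    refine Integrable.mono' (hpi.norm.const_mul (-log (1 - q) + π)) (hmeas z) ?_
    rw [ae_restrict_iff' measurableSet_Ioi]
    refine Eventually.of_forall fun s hs => ?_
    have h1 := hexp z hz s hs
    have h2 : 1 - q ≤ ‖1 - cexp (a * (z - s))‖ := by
      have := norm_sub_norm_le (1 : ℂ) (cexp (a * (z - s)))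
      rw [norm_one] at this
      linarith
    have h3 : ‖1 - cexp (a * (z - s))‖ ≤ (1 - q)⁻¹ := by
      have := norm_sub_le (1 : ℂ) (cexp (a * (z - s)))
      rw [norm_one] at this
      refine this.trans ((add_le_add_right h1 1).trans ?_)
      rw [← one_div, le_div_iff₀ (by linarith)]
      nlinarith [sq_nonneg q]
    rw [hF, norm_mul, Complex.norm_real]
    refine mul_le_mul_of_nonneg_right ?_ (norm_nonneg _)
    refine (Complex.norm_le_abs_re_add_abs_im _).trans ?_
    rw [Complex.log_re, Complex.log_im]
    refine add_le_add ?_ (Complex.abs_arg_le_pi _)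
    rw [abs_le, neg_neg]
    refine ⟨log_le_log (by linarith) h2, ?_⟩
    rw [← log_inv]
    exact log_le_log (by linarith) h3
  have hD := (hasDerivAt_integral_of_dominated_loc_of_deriv_le (μ := volume.restrict (Ioi δ))
    (F := F) (F' := F') (x₀ := 0) (bound := fun s => a / (1 - q) * |p s|) hball
    (Eventually.of_forall hmeas) (hint 0 (mem_of_mem_nhds hball))
    (by
      refine AEStronglyMeasurable.mul ?_ hpi'.aestronglyMeasurable
      exact (by fun_prop : Measurable fun s : ℝ => -(cexp (a * ((0 : ℂ) - s)) * a) /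
        (1 - cexp (a * ((0 : ℂ) - s)))).aestronglyMeasurable)
    (by
      rw [ae_restrict_iff' measurableSet_Ioi]
      exact Eventually.of_forall fun s hs z hz => hbd z hz s hs)
    (hpi.abs.const_mul _)
    (by
      rw [ae_restrict_iff' measurableSet_Ioi]
      exact Eventually.of_forall fun s hs z hz => hder s hs z hz)).2
  have hreal : ∫ s in Ioi δ, F' 0 s = ((∫ s in Ioi δ,
      -(exp (a * (0 - s)) * a) / (1 - exp (a * (0 - s))) * p s : ℝ) : ℂ) := by
    rw [← integral_complex_ofReal]
    refine integral_congr_ae (Eventually.of_forall fun s => ?_)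
    simp only [hF']
    push_cast
    rfl
  set c := ∫ s in Ioi δ, -(exp (a * (0 - s)) * a) / (1 - exp (a * (0 - s))) * p s
  rw [hreal] at hD
  refine ⟨c - a * ∫ s in Ioi δ, p s, fun ε hε => ?_⟩
  filter_upwards [hball, (hasDerivAt_iff_isLittleO.1 hD).def hε] with z hz h
  have hlog : ∀ w : ℂ, ∀ s, stripLog a (w.re - s) w.im =
      -(a * (w.re - s)) + (Complex.log (1 - cexp (a * (w - s)))).re := by
    intro w s
    rw [stripLog_eq_add, ← stripLog_neg_right, stripLog, Complex.log_re]
    congr 5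
    conv_rhs => rw [← Complex.re_add_im w]
    push_cast
    ring
  have hkey : ∀ s, p s * (stripLog a (z.re - s) z.im - stripLog a (0 - s) 0) =
      -(a * z.re) * p s + ((F z s).re - (F 0 s).re) := by
    intro s
    have h0 := hlog 0 s
    rw [Complex.zero_re, Complex.zero_im] at h0
    rw [hlog, h0, hF, Complex.re_mul_ofReal, Complex.re_mul_ofReal]
    ring
  have i1 := (hint z hz)
  have i0 := (hint 0 (mem_of_mem_nhds hball))
  have e1 : ∫ s in Ioi δ, (F z s).re = (∫ s in Ioi δ, F z s).re := integral_re i1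
  have e0 : ∫ s in Ioi δ, (F 0 s).re = (∫ s in Ioi δ, F 0 s).re := integral_re i0
  have i1r : IntegrableOn (fun s => (F z s).re) (Ioi δ) := i1.re
  have i0r : IntegrableOn (fun s => (F 0 s).re) (Ioi δ) := i0.re
  simp_rw [hkey]
  have e2 : ∫ s in Ioi δ, (-(a * z.re) * p s + ((F z s).re - (F 0 s).re)) =
      -(a * z.re) * (∫ s in Ioi δ, p s) + ((∫ s in Ioi δ, F z s).re - (∫ s in Ioi δ, F 0 s).re) := by
    rw [integral_add (f := fun s => -(a * z.re) * p s) (g := fun s => (F z s).re - (F 0 s).re)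
      (hpi.const_mul _) (i1r.sub i0r), integral_sub i1r i0r, e1, e0, integral_const_mul]
  rw [e2]
  rw [sub_zero, smul_eq_mul] at h
  have h2 := (Complex.abs_re_le_norm _).trans h
  rw [Complex.sub_re, Complex.sub_re, Complex.re_mul_ofReal] at h2
  refine (congrArg _ ?_).trans_le h2
  ring

theorem exists_tip_approx (hp : HalfLineDecay p γ) (hγa : γ < a) {p₀ K : ℝ} (hK : 0 < K)
    (hp₀ : ∀ s, 0 < s → |p s - p₀| ≤ K * s ^ (1 / 4 : ℝ)) {ε : ℝ} (hε : 0 < ε) :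
    ∃ c : ℝ, ∀ᶠ R : ℝ in 𝓝[>] (0 : ℝ), ∀ θ ∈ Ioo 0 π,
      |π * (potential a p (R * cos θ) (R * sin θ) - potential a p 0 0) -
        p₀ * (R * cos θ * log R - R * cos θ + (π - θ) * (R * sin θ)) -
          c * (R * cos θ)| ≤ ε * R := by
  have ha : 0 < a := hp.pos.trans hγa
  obtain ⟨C, hC, hlog⟩ := exists_integral_log_le
  obtain ⟨ρ, Λ, hρ, hΛ, M, hM, hMlip⟩ := exists_stripLog_sub_log ha
  obtain ⟨K₁, hK₁, hpb⟩ := hp.bound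
  have hpb' : ∀ s, 0 < s → |p s| ≤ K₁ := fun s hs => (hpb s hs).trans
    (mul_le_of_le_one_right hK₁.le (exp_le_one_iff.2 (by nlinarith [hp.pos])))
  obtain ⟨δ, hδ, hδρ, hδ1, hδ2⟩ : ∃ δ : ℝ, 0 < δ ∧ 2 * δ < ρ ∧ Λ * (K₁ * δ) < ε / 4 ∧
      C * K * δ ^ (1 / 4 : ℝ) < ε / 4 := by
    have t1 : Tendsto (fun δ : ℝ => 2 * δ) (𝓝[>] 0) (𝓝 (2 * 0)) :=
      (by fun_prop : Continuous fun δ : ℝ => 2 * δ).continuousAt.tendsto.mono_left inf_le_left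
    have t2 : Tendsto (fun δ : ℝ => Λ * (K₁ * δ)) (𝓝[>] 0) (𝓝 (Λ * (K₁ * 0))) :=
      (by fun_prop : Continuous fun δ : ℝ => Λ * (K₁ * δ)).continuousAt.tendsto.mono_left
        inf_le_left
    have t3 : Tendsto (fun δ : ℝ => C * K * δ ^ (1 / 4 : ℝ)) (𝓝[>] 0)
        (𝓝 (C * K * 0 ^ (1 / 4 : ℝ))) :=
      ((continuous_rpow_const (by norm_num)).const_mul
        (C * K)).continuousAt.tendsto.mono_left inf_le_left
    rw [mul_zero] at t1
    rw [mul_zero, mul_zero] at t2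
    rw [zero_rpow (by norm_num), mul_zero] at t3
    have t0 : ∀ᶠ δ : ℝ in 𝓝[>] 0, 0 < δ := self_mem_nhdsWithin
    obtain ⟨δ, h⟩ := (t0.and
      ((t1.eventually_lt_const hρ).and ((t2.eventually_lt_const (by linarith : 0 < ε / 4)).and
        (t3.eventually_lt_const (by linarith : 0 < ε / 4))))).exists
    exact ⟨δ, h.1, h.2.1, h.2.2.1, h.2.2.2⟩
  obtain ⟨c, hc⟩ := hp.exists_far_expansion ha hδ
  refine ⟨c - p₀ * log δ, ?_⟩
  obtain ⟨r, hr, hcr⟩ := Metric.eventually_nhds_iff.1 (hc (ε / 4) (by linarith))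
  set η := ε / (4 * (|p₀| + 1)) with hη
  have hη0 : 0 < η := by positivity
  filter_upwards [integral_log_tip hδ η hη0, Ioo_mem_nhdsGT hr,
    Ioo_mem_nhdsGT (half_pos hδ)] with R h3 hRr hRδ θ hθ
  have hR : 0 < R := hRr.1
  set z : ℂ := R * cexp (θ * I) with hz
  have hnz : ‖z‖ = R := by
    rw [hz, norm_mul, Complex.norm_exp_ofReal_mul_I, Complex.norm_real,
      norm_of_nonneg hR.le, mul_one]
  have hzre : z.re = R * cos θ := by
    rw [hz, Complex.re_ofReal_mul, Complex.exp_ofReal_mul_I_re]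
  have hzim : z.im = R * sin θ := by
    rw [hz, Complex.im_ofReal_mul, Complex.exp_ofReal_mul_I_im]
  have hzpos : 0 < z.im := by
    rw [hzim]
    exact mul_pos hR (sin_pos_of_pos_of_lt_pi hθ.1 hθ.2)
  have T1 := hcr (y := z) (by rw [dist_zero_right, hnz]; exact hRr.2)
  have T3 := h3 θ hθ
  have T4 := hlog δ K z (fun s => p s - p₀) hδ hK.le (by rw [hnz]; exact hR)
    (by rw [hnz]; linarith [hRδ.2]) hp₀
  rw [hnz] at T1 T4
  set G : ℝ → ℝ := fun s => p s * (stripLog a (z.re - s) z.im - stripLog a (0 - s) 0) with hG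
  have hGi : IntegrableOn G (Ioi 0) := by
    have := (hp.integrableOn_mul_stripLog hγa z.re z.im).sub
      (hp.integrableOn_mul_stripLog hγa 0 0)
    refine this.congr (Eventually.of_forall fun s => ?_)
    simp only [Pi.sub_apply, hG]
    ring
  have hV : π * (potential a p z.re z.im - potential a p 0 0) = ∫ s in Ioi 0, G s := by
    rw [potential_eq, potential_eq, ← mul_sub, ← integral_sub
      (hp.integrableOn_mul_stripLog hγa z.re z.im) (hp.integrableOn_mul_stripLog hγa 0 0),
      ← mul_assoc, mul_one_div_cancel pi_ne_zero, one_mul]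
    refine integral_congr_ae (Eventually.of_forall fun s => ?_)
    simp only [hG]
    ring
  have hsplit : ∫ s in Ioi 0, G s = (∫ s in Ioc 0 δ, G s) + ∫ s in Ioi δ, G s := by
    rw [← Ioc_union_Ioi_eq_Ioi hδ.le, setIntegral_union (Ioc_disjoint_Ioi le_rfl)
      measurableSet_Ioi (hGi.mono_set Ioc_subset_Ioi_self)
      (hGi.mono_set (Ioi_subset_Ioi hδ.le))]
  set ℓ : ℝ → ℝ := fun s => log ‖z - s‖ - log s with hℓ
  have hℓi : IntegrableOn ℓ (Ioc 0 δ) := (integral_log_norm_sub hzpos hδ.le).1.sub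
    (intervalIntegral.intervalIntegrable_log' (a := 0) (b := δ)).1
  have hmi : IntegrableOn (fun s => ℓ s * (p s - p₀)) (Ioc 0 δ) := by
    refine Integrable.mul_bdd (c := K₁ + |p₀|) hℓi ?_ ?_
    · exact ((hp.cont.mono Ioc_subset_Ioi_self).sub continuousOn_const).aestronglyMeasurable
        measurableSet_Ioc
    · rw [ae_restrict_iff' measurableSet_Ioc]
      exact Eventually.of_forall fun s hs =>
        (norm_sub_le _ _).trans (add_le_add_left (hpb' s hs.1) _)
  have T2 : |∫ s in Ioc 0 δ, (G s - ℓ s * p₀ - ℓ s * (p s - p₀))| ≤ Λ * R * K₁ * δ := by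
    have hb : ∀ s ∈ Ioc 0 δ, ‖G s - ℓ s * p₀ - ℓ s * (p s - p₀)‖ ≤ Λ * R * K₁ := by
      intro s hs
      have hzs : z - s ≠ 0 := fun h => by
        have := congrArg Complex.im h
        simp at this
        linarith
      have hs0 : (0 : ℂ) - s ≠ 0 := by
        rw [zero_sub, neg_ne_zero]
        exact_mod_cast hs.1.ne'
      have hns : ‖(0 : ℂ) - s‖ = s := by
        rw [zero_sub, norm_neg, Complex.norm_real, norm_of_nonneg hs.1.le]
      have b2 : ‖(0 : ℂ) - s‖ < ρ := by rw [hns]; linarith [hs.2]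
      have b1 : ‖z - s‖ < ρ := by
        have := norm_add_le z (0 - s)
        rw [hnz, hns, ← add_sub_assoc, add_zero] at this
        linarith [hs.2, hRδ.2]
      have m1 := hM _ hzs b1
      have m2 := hM _ hs0 b2
      have m3 := hMlip _ _ b1 b2
      rw [hns] at m2
      simp only [Complex.sub_re, Complex.sub_im, Complex.ofReal_re, Complex.ofReal_im, sub_zero,
        Complex.zero_re, Complex.zero_im] at m1 m2
      rw [show z - s - (0 - s) = z by ring, hnz] at m3
      have e : G s - ℓ s * p₀ - ℓ s * (p s - p₀) = p s * (M (z - s) - M (0 - s)) := by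
        simp only [hG, hℓ]
        rw [m1, m2]
        ring
      rw [e, norm_mul, norm_eq_abs, norm_eq_abs, mul_comm]
      exact mul_le_mul m3 (hpb' s hs.1) (abs_nonneg _) (by positivity)
    have := norm_setIntegral_le_of_norm_le_const (μ := volume) (s := Ioc 0 δ) (by simp) hb
    rwa [norm_eq_abs, volume_real_Ioc_of_le hδ.le, sub_zero] at this
  have hGδ := hGi.mono_set (Ioc_subset_Ioi_self : Ioc 0 δ ⊆ Ioi 0)
  have e2 : ∫ s in Ioc 0 δ, (G s - ℓ s * p₀ - ℓ s * (p s - p₀)) =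
      (∫ s in Ioc 0 δ, G s) - (∫ s in Ioc 0 δ, ℓ s) * p₀ - ∫ s in Ioc 0 δ, ℓ s * (p s - p₀) := by
    rw [integral_sub (f := fun s => G s - ℓ s * p₀) (g := fun s => ℓ s * (p s - p₀))
      (hGδ.sub (hℓi.mul_const _)) hmi, integral_sub (g := fun s => ℓ s * p₀) hGδ
      (hℓi.mul_const _), integral_mul_const]
  rw [e2] at T2
  rw [← hzre, ← hzim] at T3 ⊢
  rw [hV, hsplit]
  have hp3 : |p₀ * ((∫ s in Ioc 0 δ, ℓ s) - (z.re * log R - z.re + (π - θ) * z.im) +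
      log δ * z.re)| ≤ ε / 4 * R := by
    rw [abs_mul]
    calc _ ≤ |p₀| * (η * R) := mul_le_mul_of_nonneg_left T3 (abs_nonneg _)
      _ ≤ (|p₀| + 1) * (η * R) := by gcongr; linarith
      _ = _ := by rw [hη]; field_simp
  have d1 : Λ * R * K₁ * δ ≤ ε / 4 * R := by
    have := mul_le_mul_of_nonneg_right hδ1.le hR.le
    linarith
  have d2 : C * K * δ ^ (1 / 4 : ℝ) * R ≤ ε / 4 * R := mul_le_mul_of_nonneg_right hδ2.le hR.le
  have f2 := abs_le.1 (T2.trans d1)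
  have f4 := abs_le.1 (T4.trans d2)
  have f1 := abs_le.1 T1
  have f3 := abs_le.1 hp3
  rw [abs_le]
  simp only [hG, hℓ] at f1 f2 f3 f4 ⊢
  constructor <;> linarith [f1.1, f1.2, f2.1, f2.2, f3.1, f3.2, f4.1, f4.2]

end HalfLineDecay

theorem exists_common_slope {f : ℝ → ℝ → ℝ} (h : ∀ ε : ℝ, 0 < ε → ∃ c : ℝ, ∀ᶠ R : ℝ in 𝓝[>] (0 : ℝ),
    ∀ θ ∈ Icc 0 π, |f R θ - c * (R * cos θ)| ≤ ε * R) :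
    ∃ c : ℝ, ∀ ε : ℝ, 0 < ε → ∀ᶠ R : ℝ in 𝓝[>] (0 : ℝ), ∀ θ ∈ Icc 0 π,
      |f R θ - c * (R * cos θ)| ≤ ε * R := by
  choose c hc using fun n : ℕ => h (1 / (n + 1)) (by positivity)
  have hcm : ∀ n m, |c n - c m| ≤ 1 / ((n : ℝ) + 1) + 1 / ((m : ℝ) + 1) := by
    intro n m
    obtain ⟨R, ⟨h1, h2⟩, hR⟩ := (((hc n).and (hc m)).and
      (self_mem_nhdsWithin : ∀ᶠ R : ℝ in 𝓝[>] 0, R ∈ Ioi 0)).exists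
    have hR' : 0 < R := hR
    have m0 : (0 : ℝ) ∈ Icc 0 π := ⟨le_rfl, pi_pos.le⟩
    have g1 := abs_le.1 (h1 0 m0)
    have g2 := abs_le.1 (h2 0 m0)
    rw [cos_zero, mul_one] at g1 g2
    have : |c n - c m| * R ≤ (1 / ((n : ℝ) + 1) + 1 / ((m : ℝ) + 1)) * R := by
      rw [← abs_of_pos hR', ← abs_mul, abs_of_pos hR', abs_le]
      constructor <;> linarith [g1.1, g1.2, g2.1, g2.2]
    exact le_of_mul_le_mul_right this hR'
  have hcs : CauchySeq c := by
    refine cauchySeq_of_le_tendsto_0 (fun n : ℕ => 2 * (1 / ((n : ℝ) + 1))) (fun n m N hn hm => ?_) ?_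
    · have e1 : 1 / ((n : ℝ) + 1) ≤ 1 / ((N : ℝ) + 1) :=
        one_div_le_one_div_of_le (by positivity) (by exact_mod_cast Nat.succ_le_succ hn)
      have e2 : 1 / ((m : ℝ) + 1) ≤ 1 / ((N : ℝ) + 1) :=
        one_div_le_one_div_of_le (by positivity) (by exact_mod_cast Nat.succ_le_succ hm)
      rw [dist_eq]
      linarith [hcm n m]
    · simpa using tendsto_one_div_add_atTop_nhds_zero_nat.const_mul (2 : ℝ)
  obtain ⟨c', hc'⟩ := cauchySeq_tendsto_of_complete hcs
  have hcl : ∀ n, |c n - c'| ≤ 1 / ((n : ℝ) + 1) := by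
    intro n
    have t1 : Tendsto (fun m => |c n - c m|) atTop (𝓝 |c n - c'|) := (hc'.const_sub _).abs
    have t2 := (tendsto_one_div_add_atTop_nhds_zero_nat (𝕜 := ℝ)).const_add (1 / ((n : ℝ) + 1))
    rw [add_zero] at t2
    exact le_of_tendsto_of_tendsto' t1 t2 (hcm n)
  refine ⟨c', fun ε hε => ?_⟩
  obtain ⟨n, hn⟩ := exists_nat_one_div_lt (half_pos hε)
  filter_upwards [hc n, self_mem_nhdsWithin] with R h1 hR θ hθ
  have hR' : 0 < R := hR
  have e1 : |(c n - c') * (R * cos θ)| ≤ 1 / ((n : ℝ) + 1) * R := by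
    rw [abs_mul, abs_mul, abs_of_pos hR']
    refine mul_le_mul (hcl n) ?_ (by positivity) (by positivity)
    exact mul_le_of_le_one_right hR'.le (abs_cos_le_one θ)
  have e2 : f R θ - c' * (R * cos θ) =
      (f R θ - c n * (R * cos θ)) + (c n - c') * (R * cos θ) := by ring
  have e3 : 1 / ((n : ℝ) + 1) * R ≤ ε / 2 * R := mul_le_mul_of_nonneg_right hn.le hR'.le
  rw [e2]
  refine (abs_add_le _ _).trans ?_
  linarith [h1 θ hθ]

/-- The behaviour of the potential at the tip. -/
theorem HalfLineDecay.exists_tip_expansion (hp : HalfLineDecay p γ) (hγa : γ < a) {p₀ K : ℝ}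
    (hK : 0 < K) (hp₀ : ∀ s, 0 < s → |p s - p₀| ≤ K * s ^ (1 / 4 : ℝ)) :
    ∃ c : ℝ, ∀ ε : ℝ, 0 < ε → ∀ᶠ R : ℝ in 𝓝[>] (0 : ℝ), ∀ θ ∈ Icc 0 π,
      |π * (potential a p (R * cos θ) (R * sin θ) - potential a p 0 0) -
        p₀ * (R * cos θ * log R - R * cos θ + (π - θ) * (R * sin θ)) -
          c * (R * cos θ)| ≤ ε * R := by
  have h1 := fun ε (hε : 0 < ε) => hp.exists_tip_approx hγa hK hp₀ hε
  have hV := hp.continuous_potential hγa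
  generalize potential a p = V at *
  have h2 : ∀ R : ℝ, Continuous fun θ : ℝ =>
      π * (V (R * cos θ) (R * sin θ) - V 0 0) -
        p₀ * (R * cos θ * log R - R * cos θ + (π - θ) * (R * sin θ)) := by
    intro R
    have h3 : Continuous fun θ => V (R * cos θ) (R * sin θ) :=
      hV.comp (by fun_prop : Continuous fun θ : ℝ => ((R * cos θ, R * sin θ) : ℝ × ℝ))
    exact ((h3.sub continuous_const).const_mul π).sub (by fun_prop)
  generalize hf : (fun R θ : ℝ => π * (V (R * cos θ) (R * sin θ) - V 0 0) -
        p₀ * (R * cos θ * log R - R * cos θ + (π - θ) * (R * sin θ))) = f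
  have hf' : ∀ R θ, π * (V (R * cos θ) (R * sin θ) - V 0 0) -
        p₀ * (R * cos θ * log R - R * cos θ + (π - θ) * (R * sin θ)) = f R θ :=
    fun R θ => by rw [← hf]
  simp_rw [hf'] at h1 h2 ⊢
  refine exists_common_slope fun ε hε => ?_
  obtain ⟨c, hc⟩ := h1 ε hε
  refine ⟨c, hc.mono fun R hR => ?_⟩
  have hclosed : IsClosed {θ | |f R θ - c * (R * cos θ)| ≤ ε * R} :=
    isClosed_le ((h2 R).sub (by fun_prop)).abs continuous_const
  rw [← closure_Ioo pi_pos.ne]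
  exact hclosed.closure_subset_iff.2 hR

end

end BimaterialStrip

namespace BimaterialStrip

/-! ### Uniqueness for the Neumann problem in a strip -/

theorem false_of_strict_max {d : ℂ → ℝ} {k : ℂ → ℂ} {z₀ : ℂ} {c : ℝ}
    (hd : InnerProductSpace.HarmonicAt d z₀) (hk : AnalyticAt ℂ k z₀) (hc : 0 < c)
    (h : ∀ᶠ z in 𝓝 z₀, d z + (k z).re + c * ‖z - z₀‖ ^ 2 ≤ d z₀ + (k z₀).re) : False := by
  obtain ⟨r, hr, hball⟩ := Metric.eventually_nhds_iff_ball.1 hd.eventually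
  obtain ⟨F, hF, hFd⟩ := InnerProductSpace.HarmonicOnNhd.exists_analyticOnNhd_ball_re_eq
    (fun z hz => hball z hz)
  have hF0 : AnalyticAt ℂ F z₀ := hF z₀ (Metric.mem_ball_self hr)
  have hball' : ∀ᶠ z in 𝓝 z₀, (F z).re = d z :=
    eventually_of_mem (Metric.ball_mem_nhds z₀ hr) fun z hz => hFd hz
  have han : AnalyticAt ℂ (fun z => cexp (F z + k z)) z₀ := (hF0.add hk).cexp
  have h0 : (F z₀).re = d z₀ := hFd (Metric.mem_ball_self hr)
  have hmax : IsLocalMax (norm ∘ fun z => cexp (F z + k z)) z₀ := by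
    filter_upwards [hball', h] with z h1 h2
    simp only [Function.comp_apply, Complex.norm_exp, exp_le_exp, Complex.add_re]
    have : 0 ≤ c * ‖z - z₀‖ ^ 2 := by positivity
    linarith
  have hev := Complex.eventually_eq_of_isLocalMax_norm
    (han.eventually_analyticAt.mono fun z hz => hz.differentiableAt) hmax
  have hne : ∀ᶠ z in 𝓝[≠] z₀, False := by
    filter_upwards [hev.filter_mono nhdsWithin_le_nhds, h.filter_mono nhdsWithin_le_nhds,
      hball'.filter_mono nhdsWithin_le_nhds, self_mem_nhdsWithin] with z h1 h2 h3 h4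
    have h5 := congrArg norm h1
    rw [Complex.norm_exp, Complex.norm_exp, exp_eq_exp, Complex.add_re, Complex.add_re] at h5
    have : 0 < ‖z - z₀‖ := norm_pos_iff.2 (sub_ne_zero.2 h4)
    have : 0 < c * ‖z - z₀‖ ^ 2 := by positivity
    linarith
  exact hne.exists.elim fun _ h => h

theorem stripLog_arg_ne_zero' {a x y : ℝ} (ha : 0 < a) (hy : y ∈ Icc 0 (π / a))
    (h : x ≠ 0 ∨ y ≠ 0) : 1 - cexp (-(a * (x + y * I))) ≠ 0 := by
  by_cases hx : x = 0
  · have hy0 : 0 < y := lt_of_le_of_ne hy.1 (Ne.symm (h.resolve_left (not_not.2 hx)))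
    intro h0
    rw [sub_eq_zero, eq_comm, Complex.exp_eq_one_iff] at h0
    obtain ⟨n, hn⟩ := h0
    have h1 := congrArg Complex.im hn
    simp at h1
    have h2 : a * y ≤ π := by
      have := mul_le_mul_of_nonneg_left hy.2 ha.le
      rwa [mul_div_cancel₀ _ ha.ne'] at this
    have hpi := pi_pos
    have h4 : (n : ℝ) < 0 := by nlinarith
    have h5 : (n : ℝ) ≤ -1 := by
      have : n < 0 := by exact_mod_cast h4
      exact_mod_cast (by omega : n ≤ -1)
    nlinarith
  · exact stripLog_arg_ne_zero ha hx

theorem stripLog_eq_half_log (a x y : ℝ) : stripLog a x y =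
    log (1 - 2 * exp (-(a * x)) * cos (a * y) + exp (-(a * x)) ^ 2) / 2 := by
  have e : 1 - 2 * exp (-(a * x)) * cos (a * y) + exp (-(a * x)) ^ 2 =
      ‖1 - cexp (-(a * (x + y * I)))‖ ^ 2 := by
    rw [← Complex.normSq_eq_norm_sq, show (-(a * (x + y * I)) : ℂ) =
      ((-(a * x) : ℝ) : ℂ) + ((-(a * y) : ℝ) : ℂ) * I by push_cast; ring,
      Complex.exp_add_mul_I, ← Complex.ofReal_exp, ← Complex.ofReal_cos, ← Complex.ofReal_sin,
      cos_neg, sin_neg, Complex.normSq_apply]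
    have h := sin_sq_add_cos_sq (a * y)
    generalize exp (-(a * x)) = u, cos (a * y) = c, sin (a * y) = s at *
    simp
    linear_combination (-u ^ 2) * h
  rw [e, log_pow, stripLog]
  push_cast
  ring

theorem hasDerivAt_stripLog_face {a x y : ℝ} (h : 1 - cexp (-(a * (x + y * I))) ≠ 0)
    (hs : sin (a * y) = 0) : HasDerivAt (fun y => stripLog a x y) 0 y := by
  have hq : 1 - 2 * exp (-(a * x)) * cos (a * y) + exp (-(a * x)) ^ 2 ≠ 0 := by
    intro h0
    have h1 := sin_sq_add_cos_sq (a * y)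
    rw [hs] at h1
    have h2 : (exp (-(a * x)) - cos (a * y)) ^ 2 = 0 := by linarith
    have h3 := sub_eq_zero.1 (pow_eq_zero_iff two_ne_zero |>.1 h2)
    apply h
    rw [show (-(a * (x + y * I)) : ℂ) =
      ((-(a * x) : ℝ) : ℂ) + ((-(a * y) : ℝ) : ℂ) * I by push_cast; ring,
      Complex.exp_add_mul_I, ← Complex.ofReal_exp, ← Complex.ofReal_cos, ← Complex.ofReal_sin,
      cos_neg, sin_neg, hs, h3]
    rw [neg_zero, Complex.ofReal_zero, zero_mul, add_zero,
      ← Complex.ofReal_mul, ← sq]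
    have : cos (a * y) ^ 2 = 1 := by linarith
    rw [this, Complex.ofReal_one, sub_self]
  simp_rw [stripLog_eq_half_log]
  have h1 : HasDerivAt (fun y : ℝ => a * y) (a * 1) y := (hasDerivAt_id' y).const_mul a
  have h2 := (((h1.cos.const_mul (2 * exp (-(a * x)))).const_sub 1).add_const
    (exp (-(a * x)) ^ 2)).log hq
  refine (h2.div_const 2).congr_deriv ?_
  rw [hs]
  simp

theorem tendsto_stripLog_tip {a : ℝ} (ha : 0 < a) (K : ℝ) : ∃ r, 0 < r ∧ ∀ x y : ℝ,
    (x ≠ 0 ∨ y ≠ 0) → x ^ 2 + y ^ 2 ≤ r ^ 2 → stripLog a x y ≤ K := by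
  obtain ⟨ρ, Λ, hρ, hΛ, M, hM, hMlip⟩ := exists_stripLog_sub_log ha
  set K' := K - (|M 0| + Λ * ρ)
  refine ⟨min (ρ / 2) (exp K'), by positivity, fun x y h hr => ?_⟩
  set z : ℂ := ⟨x, y⟩ with hz
  have hz0 : z ≠ 0 := fun h0 => by
    have h1 := congrArg Complex.re h0
    have h2 := congrArg Complex.im h0
    simp [hz] at h1 h2
    tauto
  have hn : ‖z‖ ≤ min (ρ / 2) (exp K') := by
    refine abs_le_of_sq_le_sq' ?_ (by positivity) |>.2
    rwa [← Complex.normSq_eq_norm_sq, Complex.normSq_apply, ← sq, ← sq]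
  have h1 : ‖z‖ < ρ := lt_of_le_of_lt (hn.trans (min_le_left _ _)) (by linarith)
  have h2 := hM z hz0 h1
  have h3 := hMlip z 0 h1 (by rwa [norm_zero])
  rw [sub_zero] at h3
  have h4 : log ‖z‖ ≤ K' :=
    (log_le_iff_le_exp (norm_pos_iff.2 hz0)).2 (hn.trans (min_le_right _ _))
  have h5 : Λ * ‖z‖ ≤ Λ * ρ := mul_le_mul_of_nonneg_left h1.le hΛ
  change stripLog a x y = _ at h2
  rw [h2]
  linarith [le_abs_self (M 0), (abs_le.1 h3).2]

/-- Derivative test on the left end of an interval. -/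
theorem not_isMaxOn_of_hasDerivWithinAt_left {f : ℝ → ℝ} {f' H : ℝ} (hH : 0 < H)
    (hf : HasDerivWithinAt f f' (Icc 0 H) 0) (hpos : 0 < f') :
    ∃ᶠ y in 𝓝[>] (0 : ℝ), y ∈ Icc 0 H ∧ f 0 < f y := by
  have h1 := (hasDerivWithinAt_iff_tendsto_slope.1 hf).eventually_const_lt hpos
  rw [Icc_sdiff_left] at h1
  rw [nhdsWithin_Ioc_eq_nhdsGT hH] at h1
  refine Eventually.frequently ?_
  filter_upwards [h1, Ioc_mem_nhdsGT hH] with y hy hy'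
  refine ⟨Ioc_subset_Icc_self hy', ?_⟩
  rw [slope_def_field, sub_zero] at hy
  have := (div_pos_iff_of_pos_right hy'.1).1 hy
  linarith

theorem le_of_neumann {H N η : ℝ} (hH : 0 < H) {d : ℝ → ℝ → ℝ}
    (hcont : ContinuousOn (fun p : ℝ × ℝ => d p.1 p.2) (Icc (-N) N ×ˢ Icc 0 H))
    (hharm : ∀ z : ℂ, z.im ∈ Ioo 0 H →
      InnerProductSpace.HarmonicAt (fun z : ℂ => d z.re z.im) z)
    (h0 : ∀ X, X ≠ 0 → HasDerivWithinAt (d X) 0 (Icc 0 H) 0)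
    (h1 : ∀ X, HasDerivWithinAt (d X) 0 (Icc 0 H) H)
    (hL : ∀ Y ∈ Icc 0 H, d (-N) Y ≤ η) (hR : ∀ Y ∈ Icc 0 H, d N Y ≤ η) {X Y : ℝ}
    (hX : X ∈ Icc (-N) N) (hY : Y ∈ Icc 0 H) (hXY : X ≠ 0 ∨ Y ≠ 0) : d X Y ≤ η := by
  set a := π / H with ha
  have ha0 : 0 < a := by positivity
  have haH : π / a = H := by rw [ha]; field_simp
  have hN : 0 ≤ N := by linarith [hX.1.trans hX.2]
  set g : ℝ → ℝ → ℝ := fun X Y => 2 * X ^ 2 - (Y - H / 2) ^ 2 with hg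
  have hgb : ∀ X ∈ Icc (-N) N, ∀ Y ∈ Icc 0 H, g X Y ≤ 2 * N ^ 2 := by
    intro X hX Y _
    have := abs_le.2 hX
    have : X ^ 2 ≤ N ^ 2 := sq_le_sq.2 (by rwa [abs_of_nonneg hN])
    simp only [hg]
    nlinarith [sq_nonneg (Y - H / 2)]
  obtain ⟨ℓ, hℓ0, hℓ⟩ : ∃ ℓ, 0 ≤ ℓ ∧ ∀ X ∈ Icc (-N) N, ∀ Y, stripLog a X Y ≤ ℓ := by
    refine ⟨exp (a * N) + 1, by positivity, fun X hX Y => ?_⟩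
    refine (log_le_self (norm_nonneg _)).trans ?_
    have h3 := norm_sub_le (1 : ℂ) (cexp (-(a * (X + Y * I))))
    rw [norm_one, norm_cexp_neg_mul] at h3
    have h4 : exp (-(a * X)) ≤ exp (a * N) := exp_le_exp.2 (by nlinarith [hX.1])
    linarith
  have hcomp : IsCompact (Icc (-N) N ×ˢ Icc 0 H) := isCompact_Icc.prod isCompact_Icc
  obtain ⟨D, hD⟩ := (hcomp.bddAbove_image hcont)
  have hDb : ∀ X ∈ Icc (-N) N, ∀ Y ∈ Icc 0 H, d X Y ≤ D := fun X hX Y hY =>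
    hD (mem_image_of_mem _ (mk_mem_prod hX hY))
  have key : ∀ ε : ℝ, 0 < ε →
      d X Y + ε * (g X Y + stripLog a X Y) ≤ η + ε * (2 * N ^ 2 + ℓ) := by
    intro ε hε
    set F : ℝ × ℝ → ℝ := fun p => d p.1 p.2 + ε * (g p.1 p.2 + stripLog a p.1 p.2) with hF
    obtain ⟨r₀, hr₀, htip⟩ := tendsto_stripLog_tip ha0 ((η - D) / ε - 2 * N ^ 2)
    have hpos : 0 < X ^ 2 + Y ^ 2 := by
      rcases hXY with h | h <;> positivity
    set r := min r₀ √(X ^ 2 + Y ^ 2) with hr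
    have hr0 : 0 < r := lt_min hr₀ (sqrt_pos.2 hpos)
    set Q : Set (ℝ × ℝ) := (Icc (-N) N ×ˢ Icc 0 H) ∩ {p | r ^ 2 ≤ p.1 ^ 2 + p.2 ^ 2} with hQ
    have hQc : IsCompact Q := hcomp.inter_right (isClosed_le continuous_const (by fun_prop))
    have hQne : ∀ p ∈ Q, p.1 ≠ 0 ∨ p.2 ≠ 0 := by
      rintro p ⟨-, hp⟩
      by_contra! hcon
      change r ^ 2 ≤ _ at hp
      rw [hcon.1, hcon.2] at hp
      nlinarith
    have hXYQ : (X, Y) ∈ Q := by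
      refine ⟨mk_mem_prod hX hY, ?_⟩
      change r ^ 2 ≤ X ^ 2 + Y ^ 2
      have h3 : r ≤ √(X ^ 2 + Y ^ 2) := min_le_right _ _
      calc r ^ 2 ≤ √(X ^ 2 + Y ^ 2) ^ 2 := pow_le_pow_left₀ hr0.le h3 2
        _ = _ := sq_sqrt hpos.le
    have hLc : ContinuousOn (fun p : ℝ × ℝ => stripLog a p.1 p.2) Q := by
      refine ContinuousOn.log (by fun_prop) fun p hp => norm_ne_zero_iff.2 ?_
      exact stripLog_arg_ne_zero' ha0 (by rw [haH]; exact hp.1.2) (hQne p hp)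
    have hFc : ContinuousOn F Q := (hcont.mono inter_subset_left).add
      (continuousOn_const.mul ((by fun_prop : Continuous fun p : ℝ × ℝ => g p.1 p.2).continuousOn.add
        hLc))
    obtain ⟨⟨X₀, Y₀⟩, hp₀, hmax⟩ := hQc.exists_isMaxOn ⟨_, hXYQ⟩ hFc
    have hmax' : ∀ x y, (x, y) ∈ Q → F (x, y) ≤ F (X₀, Y₀) := fun x y h => hmax h
    suffices F (X₀, Y₀) ≤ η + ε * (2 * N ^ 2 + ℓ) from (hmax' X Y hXYQ).trans this
    have hX₀ : X₀ ∈ Icc (-N) N := hp₀.1.1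
    have hY₀ : Y₀ ∈ Icc 0 H := hp₀.1.2
    have hr2 : r ^ 2 ≤ X₀ ^ 2 + Y₀ ^ 2 := hp₀.2
    have hne₀ : X₀ ≠ 0 ∨ Y₀ ≠ 0 := hQne _ hp₀
    have hg₀ := hgb X₀ hX₀ Y₀ hY₀
    have hℓ₀ := hℓ X₀ hX₀ Y₀
    by_contra! hcon
    simp only [hF] at hcon
    have hside : η < d X₀ Y₀ := by
      have : ε * (g X₀ Y₀ + stripLog a X₀ Y₀) ≤ ε * (2 * N ^ 2 + ℓ) :=
        mul_le_mul_of_nonneg_left (add_le_add hg₀ hℓ₀) hε.le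
      linarith
    have hXl : -N < X₀ := lt_of_le_of_ne hX₀.1 fun h => by
      rw [← h] at hside
      linarith [hL Y₀ hY₀]
    have hXr : X₀ < N := lt_of_le_of_ne hX₀.2 fun h => by
      rw [h] at hside
      linarith [hR Y₀ hY₀]
    have hrlt : r ^ 2 < X₀ ^ 2 + Y₀ ^ 2 := by
      refine lt_of_le_of_ne hr2 fun h => ?_
      have h3 := htip X₀ Y₀ hne₀ (by
        rw [← h]
        exact pow_le_pow_left₀ hr0.le (min_le_left _ _) 2)
      have h4 := hDb X₀ hX₀ Y₀ hY₀
      have h5 : ε * (g X₀ Y₀ + stripLog a X₀ Y₀) ≤ ε * ((η - D) / ε) :=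
        mul_le_mul_of_nonneg_left (by linarith) hε.le
      rw [mul_div_cancel₀ _ hε.ne'] at h5
      have : 0 ≤ ε * (2 * N ^ 2 + ℓ) := by positivity
      linarith
    have hmem : ∀ᶠ q : ℝ × ℝ in 𝓝 (X₀, Y₀), q.2 ∈ Icc 0 H → q ∈ Q := by
      have c1 : Continuous fun q : ℝ × ℝ => q.1 := continuous_fst
      have c2 : Continuous fun q : ℝ × ℝ => q.1 ^ 2 + q.2 ^ 2 := by fun_prop
      filter_upwards [c1.continuousAt.eventually_const_lt hXl, c1.continuousAt.eventually_lt_const hXr,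
        c2.continuousAt.eventually_const_lt hrlt] with q e1 e2 e3 e4
      exact ⟨⟨⟨e1.le, e2.le⟩, e4⟩, e3.le⟩
    have hmemY : ∀ᶠ y in 𝓝 Y₀, y ∈ Icc 0 H → F (X₀, y) ≤ F (X₀, Y₀) := by
      have c1 : Continuous fun y : ℝ => (X₀, y) := by fun_prop
      filter_upwards [c1.continuousAt.eventually hmem] with y e1 e2
      exact hmax' _ _ (e1 e2)
    have hgd : ∀ y : ℝ, HasDerivAt (fun y => g X₀ y) (-(2 * (y - H / 2))) y := by
      intro y
      have := (((hasDerivAt_id' y).sub_const (H / 2)).fun_pow 2).const_sub (2 * X₀ ^ 2)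
      refine this.congr_deriv ?_
      norm_num
    rcases eq_or_lt_of_le hY₀.1 with hy | hy
    · rw [← hy] at hne₀ hmemY hp₀
      have hX0 : X₀ ≠ 0 := by simpa using hne₀
      have hder : HasDerivWithinAt (fun y => F (X₀, y)) (ε * H) (Icc 0 H) 0 := by
        have e1 := (hasDerivAt_stripLog_face (stripLog_arg_ne_zero' ha0 (y := 0)
          ⟨le_rfl, by positivity⟩ (Or.inl hX0)) (by simp)).hasDerivWithinAt (s := Icc 0 H)
        refine ((h0 X₀ hX0).add ((((hgd 0).hasDerivWithinAt (s := Icc 0 H)).add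
          e1).const_mul ε)).congr_deriv ?_
        ring
      obtain ⟨y, ⟨e1, e2⟩, e3⟩ := ((not_isMaxOn_of_hasDerivWithinAt_left hH hder
        (by positivity)).and_eventually (hmemY.filter_mono nhdsWithin_le_nhds)).exists
      linarith [e3 e1]
    rcases eq_or_lt_of_le hY₀.2 with hy' | hy'
    · rw [hy'] at hmemY
      have hder : HasDerivWithinAt (fun y => F (X₀, H - y)) (ε * H) (Icc 0 H) 0 := by
        have e1 := (hasDerivAt_stripLog_face (stripLog_arg_ne_zero' (a := a) (x := X₀) (y := H) ha0
          (by rw [haH]; exact ⟨hH.le, le_rfl⟩) (Or.inr hH.ne'))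
            (by rw [ha, div_mul_cancel₀ _ hH.ne']; exact sin_pi)).hasDerivWithinAt
              (s := Icc 0 H)
        have e2 : HasDerivWithinAt (fun y => F (X₀, y)) (-(ε * H)) (Icc 0 H) (H - 0) := by
          rw [sub_zero]
          refine ((h1 X₀).add ((((hgd H).hasDerivWithinAt (s := Icc 0 H)).add
            e1).const_mul ε)).congr_deriv ?_
          ring
        have e3 : HasDerivWithinAt (fun y => H - y) (-1) (Icc 0 H) 0 :=
          ((hasDerivAt_id' (0 : ℝ)).const_sub H).hasDerivWithinAt
        refine (HasDerivWithinAt.comp (h₂ := fun y => F (X₀, y)) (h := fun y => H - y) 0 e2 e3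
          (fun y hy => ⟨by linarith [hy.2], by linarith [hy.1]⟩)).congr_deriv ?_
        ring
      have c1 : Tendsto (fun y => H - y) (𝓝[>] 0) (𝓝 H) := by
        have : Tendsto (fun y => H - y) (𝓝 0) (𝓝 (H - 0)) :=
          (by fun_prop : Continuous fun y => H - y).continuousAt
        rw [sub_zero] at this
        exact this.mono_left nhdsWithin_le_nhds
      obtain ⟨y, ⟨e1, e2⟩, e3⟩ := ((not_isMaxOn_of_hasDerivWithinAt_left hH hder
        (by positivity)).and_eventually (c1.eventually hmemY)).exists
      have := e3 ⟨by linarith [e1.2], by linarith [e1.1]⟩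
      rw [sub_zero] at e2
      linarith
    · set z₀ : ℂ := ⟨X₀, Y₀⟩ with hz₀
      set k : ℂ → ℂ := fun z => ε * (3 / 2 * z ^ 2 - I * H * z + starRingEnd ℂ z₀ * z +
        Complex.log (1 - cexp (-(a * z)))) with hk
      have hsin : 0 < sin (a * z₀.im) := by
        refine sin_pos_of_mem ha0 hy ?_
        rw [ha, div_mul_eq_mul_div, div_lt_iff₀ hH]
        exact mul_lt_mul_of_pos_left hy' pi_pos
      have hkan : AnalyticAt ℂ k z₀ := by
        have hl : AnalyticAt ℂ (fun z : ℂ => Complex.log (1 - cexp (-(a * z)))) z₀ := by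
          refine AnalyticAt.clog (by fun_prop) (Or.inr ?_)
          have := one_sub_cexp_im_pos hsin 0
          rw [Complex.ofReal_zero, sub_zero] at this
          exact this.ne'
        exact analyticAt_const.mul (AnalyticAt.add (by fun_prop) hl)
      refine false_of_strict_max (c := ε / 2) (hharm z₀ ⟨hy, hy'⟩) hkan (by positivity) ?_
      have hkey : ∀ z : ℂ, d z.re z.im + (k z).re + ε / 2 * ‖z - z₀‖ ^ 2 =
          F (z.re, z.im) + ε / 2 * (‖z₀‖ ^ 2 + H ^ 2 / 2) := by
        intro z
        have hlog : (Complex.log (1 - cexp (-(a * z)))).re = stripLog a z.re z.im := by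
          rw [Complex.log_re, stripLog, Complex.re_add_im]
        have hq : (3 / 2 * z ^ 2 - I * H * z + starRingEnd ℂ z₀ * z).re =
            3 / 2 * (z.re ^ 2 - z.im ^ 2) + H * z.im + (z₀.re * z.re + z₀.im * z.im) := by
          have h2 : (3 / 2 : ℂ) = ((3 / 2 : ℝ) : ℂ) := by push_cast; rfl
          rw [h2, sq]
          simp only [Complex.add_re, Complex.sub_re, Complex.mul_re, Complex.mul_im, Complex.ofReal_re,
            Complex.ofReal_im, Complex.I_re, Complex.I_im, Complex.conj_re, Complex.conj_im]
          ring
        simp only [hk, hF, hg]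
        rw [Complex.re_ofReal_mul, Complex.add_re, hlog, hq, ← Complex.normSq_eq_norm_sq,
          ← Complex.normSq_eq_norm_sq, Complex.normSq_apply, Complex.normSq_apply, Complex.sub_re,
          Complex.sub_im]
        ring
      have c1 : Continuous fun z : ℂ => (z.re, z.im) := by fun_prop
      have c2 : ∀ᶠ z : ℂ in 𝓝 z₀, z.im ∈ Icc 0 H :=
        Complex.continuous_im.continuousAt.eventually (Icc_mem_nhds hy hy')
      filter_upwards [(c1.continuousAt (x := z₀)).eventually hmem, c2] with z e1 e2
      have e3 := hmax' _ _ (e1 e2)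
      have e4 := hkey z₀
      rw [sub_self, norm_zero] at e4
      rw [hkey z]
      have : F (z₀.re, z₀.im) = F (X₀, Y₀) := rfl
      linarith
  have hlim : Tendsto (fun ε : ℝ => η + ε * (2 * N ^ 2 + ℓ) - ε * (g X Y + stripLog a X Y)) (𝓝[>] 0)
      (𝓝 (η + 0 * (2 * N ^ 2 + ℓ) - 0 * (g X Y + stripLog a X Y))) :=
    (by fun_prop : Continuous fun ε : ℝ => η + ε * (2 * N ^ 2 + ℓ) -
      ε * (g X Y + stripLog a X Y)).continuousAt.tendsto.mono_left nhdsWithin_le_nhds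
  rw [zero_mul, zero_mul, add_zero, sub_zero] at hlim
  refine ge_of_tendsto hlim ?_
  filter_upwards [self_mem_nhdsWithin] with ε hε
  linarith [key ε hε]

/-- Uniqueness for the Neumann problem in a strip, among functions vanishing at one end and
asymptotically linear at the other. -/
theorem eq_zero_of_neumann {H C D : ℝ} (hH : 0 < H) {w : ℝ → ℝ → ℝ}
    (hcont : ContinuousOn (fun p : ℝ × ℝ => w p.1 p.2) (univ ×ˢ Icc 0 H))
    (hharm : ∀ z : ℂ, z.im ∈ Ioo 0 H →
      InnerProductSpace.HarmonicAt (fun z : ℂ => w z.re z.im) z)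
    (h0 : ∀ X, X ≠ 0 → HasDerivWithinAt (w X) 0 (Icc 0 H) 0)
    (h1 : ∀ X, HasDerivWithinAt (w X) 0 (Icc 0 H) H)
    (hR : ∀ η : ℝ, 0 < η → ∀ᶠ X in atTop, ∀ Y ∈ Icc 0 H, |w X Y| ≤ η)
    (hL : ∀ η : ℝ, 0 < η → ∀ᶠ X in atBot, ∀ Y ∈ Icc 0 H, |w X Y - (C * X + D)| ≤ η)
    {X Y : ℝ} (hY : Y ∈ Icc 0 H) : w X Y = 0 := by
  have hcmp : ∀ η : ℝ, 0 < η → ∀ᶠ N in atTop, ∀ X ∈ Icc (-N) N, ∀ Y ∈ Icc 0 H, (X ≠ 0 ∨ Y ≠ 0) →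
      |w X Y - (-C * N + D) * (N - X) / (2 * N)| ≤ η := by
    intro η hη
    filter_upwards [hR η hη, tendsto_neg_atTop_atBot.eventually (hL η hη), eventually_gt_atTop 0]
      with N hN1 hN2 hN X hX Y hY hXY
    set b := (-C * N + D) / (2 * N) with hb
    have hbN : b * (2 * N) = -C * N + D := by rw [hb]; field_simp
    have e : ∀ x, (-C * N + D) * (N - x) / (2 * N) = b * (N - x) := fun x => by rw [hb]; ring
    rw [e]
    have hlin : ∀ z : ℂ, InnerProductSpace.HarmonicAt (fun z : ℂ => b * (N - z.re)) z := by
      intro z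
      have : AnalyticAt ℂ (fun z : ℂ => (b : ℂ) * (N - z)) z := by fun_prop
      refine (InnerProductSpace.harmonicAt_congr_nhds (Eventually.of_forall fun z => ?_)).1
        this.harmonicAt_re
      simp
    have A1 : w X Y - b * (N - X) ≤ η := by
      refine le_of_neumann (d := fun X Y => w X Y - b * (N - X)) (N := N) hH ?_ ?_ ?_ ?_ ?_ ?_
        hX hY hXY
      · exact (hcont.mono (prod_mono_left (subset_univ _))).sub (by fun_prop)
      · exact fun z hz => (hharm z hz).sub (hlin z)
      · exact fun X hX => (h0 X hX).sub_const _
      · exact fun X => (h1 X).sub_const _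
      · intro Y hY
        have := (abs_le.1 (hN2 Y hY)).2
        linarith
      · intro Y hY
        have := (abs_le.1 (hN1 Y hY)).2
        linarith
    have A2 : b * (N - X) - w X Y ≤ η := by
      refine le_of_neumann (d := fun X Y => b * (N - X) - w X Y) (N := N) hH ?_ ?_ ?_ ?_ ?_ ?_
        hX hY hXY
      · exact ContinuousOn.sub (by fun_prop) (hcont.mono (prod_mono_left (subset_univ _)))
      · exact fun z hz => (hlin z).sub (hharm z hz)
      · exact fun X hX => by simpa using (h0 X hX).const_sub (b * (N - X))
      · exact fun X => by simpa using (h1 X).const_sub (b * (N - X))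
      · intro Y hY
        have := (abs_le.1 (hN2 Y hY)).1
        linarith
      · intro Y hY
        have := (abs_le.1 (hN1 Y hY)).1
        linarith
    rw [abs_le]
    constructor <;> linarith
  have hlim : ∀ X, ∀ Y ∈ Icc 0 H, (X ≠ 0 ∨ Y ≠ 0) →
      Tendsto (fun N : ℝ => (-C * N + D) * (N - X) / (2 * N)) atTop (𝓝 (w X Y)) := by
    intro X Y hY hXY
    rw [Metric.tendsto_nhds]
    intro ε hε
    filter_upwards [hcmp (ε / 2) (half_pos hε), eventually_ge_atTop |X|] with N h2 h3
    rw [dist_comm, dist_eq]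
    have := h2 X (abs_le.1 h3) Y hY hXY
    linarith
  have hH0 : H ∈ Icc 0 H := ⟨hH.le, le_rfl⟩
  have hconst : ∀ X, ∀ Y ∈ Icc 0 H, (X ≠ 0 ∨ Y ≠ 0) → w X Y = w 0 H + C * X / 2 := by
    intro X Y hY hXY
    have t1 := hlim X Y hY hXY
    have t2 := hlim 0 H hH0 (Or.inr hH.ne')
    have t3 : Tendsto (fun N : ℝ => C * X / 2 - D * X / 2 * N⁻¹) atTop
        (𝓝 (C * X / 2 - D * X / 2 * 0)) := (tendsto_inv_atTop_zero.const_mul _).const_sub _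
    rw [mul_zero, sub_zero] at t3
    refine tendsto_nhds_unique t1 ((t2.add t3).congr' ?_)
    filter_upwards [eventually_gt_atTop 0] with N hN
    field_simp
    ring
  have hC : C = 0 ∧ w 0 H = 0 := by
    have hw : Tendsto (fun X => w 0 H + C / 2 * X) atTop (𝓝 0) := by
      rw [Metric.tendsto_nhds]
      intro ε hε
      filter_upwards [hR (ε / 2) (half_pos hε), eventually_ne_atTop 0] with X h2 h3
      have := h2 H hH0
      rw [hconst X H hH0 (Or.inl h3)] at this
      rw [dist_eq, sub_zero, show C / 2 * X = C * X / 2 by ring]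
      linarith
    have h2 : Tendsto (fun X => w 0 H + C / 2 * (X + 2)) atTop (𝓝 0) :=
      hw.comp (tendsto_atTop_add_const_right _ 2 tendsto_id)
    have h3 : C = 0 := by
      have := h2.sub hw
      rw [sub_zero] at this
      refine tendsto_nhds_unique (tendsto_const_nhds.congr fun X => ?_) this
      ring
    rw [h3] at hw
    refine ⟨h3, tendsto_nhds_unique (tendsto_const_nhds.congr fun X => ?_) hw⟩
    ring
  have hz : ∀ X, ∀ Y ∈ Icc 0 H, (X ≠ 0 ∨ Y ≠ 0) → w X Y = 0 := by
    intro X Y hY hXY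
    rw [hconst X Y hY hXY, hC.1, hC.2]
    ring
  by_cases hXY : X ≠ 0 ∨ Y ≠ 0
  · exact hz X Y hY hXY
  · push Not at hXY
    rw [hXY.1, hXY.2]
    have hc0 : ContinuousWithinAt (fun p : ℝ × ℝ => w p.1 p.2) (univ ×ˢ Icc 0 H) (0, 0) :=
      hcont _ ⟨mem_univ _, le_rfl, hH.le⟩
    have hpath : Tendsto (fun x : ℝ => ((x, 0) : ℝ × ℝ)) (𝓝[>] 0) (𝓝[univ ×ˢ Icc 0 H] (0, 0)) := by
      refine tendsto_nhdsWithin_iff.2 ⟨?_, Eventually.of_forall fun x => ⟨mem_univ _, le_rfl, hH.le⟩⟩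
      exact (by fun_prop : Continuous fun x : ℝ => ((x, 0) : ℝ × ℝ)).continuousAt.tendsto.mono_left
        nhdsWithin_le_nhds
    refine tendsto_nhds_unique (hc0.tendsto.comp hpath) (tendsto_const_nhds.congr' ?_)
    filter_upwards [self_mem_nhdsWithin] with x hx
    exact (hz x 0 ⟨le_rfl, hH.le⟩ (Or.inl (ne_of_gt hx))).symm

end BimaterialStrip

namespace BimaterialStrip

/-! ### The Wiener–Hopf equation -/

section
variable (P : StripParams) {p : ℝ → ℝ} {γ : ℝ}

theorem gammaMinus_le_div (j : Fin 2) : gammaMinus P ≤ π / P.H j :=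
  (le_div_iff₀ (P.H_pos j)).2 (gammaMinus_mul_le P j)

theorem pi_div_pi_div (j : Fin 2) : π / (π / P.H j) = P.H j := by
  have := pi_ne_zero
  field_simp

/-- The interfacial jump of the displacement generated by the traction `p`. -/
noncomputable def stripJump (p : ℝ → ℝ) (X : ℝ) : ℝ :=
  1 / P.μ 0 * potential (π / P.H 0) p X 0 + 1 / P.μ 1 * potential (π / P.H 1) p X 0

variable {P}

namespace HalfLineDecay

theorem continuous_stripJump (hp : HalfLineDecay p γ) (hγ : γ < gammaMinus P) :
    Continuous (stripJump P p) := by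
  have h : ∀ j, Continuous fun X => potential (π / P.H j) p X 0 := by
    intro j
    have h1 := hp.continuous_potential (hγ.trans_le (gammaMinus_le_div P j))
    exact Continuous.comp (g := fun q : ℝ × ℝ => potential (π / P.H j) p q.1 q.2)
      (f := fun X : ℝ => ((X, 0) : ℝ × ℝ)) h1 (by fun_prop)
  exact ((h 0).const_mul _).add ((h 1).const_mul _)

theorem exists_stripJump_le (hp : HalfLineDecay p γ) (hγ : γ < gammaMinus P) :
    ∃ C, 0 < C ∧ ∀ X, ‖(stripJump P p X : ℂ)‖ ≤ C * exp (-γ * X) := by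
  obtain ⟨C₀, hC₀, h₀⟩ := hp.exists_potential_le (hγ.trans_le (gammaMinus_le_div P 0))
  obtain ⟨C₁, hC₁, h₁⟩ := hp.exists_potential_le (hγ.trans_le (gammaMinus_le_div P 1))
  have hμ0 := P.μ_pos 0
  have hμ1 := P.μ_pos 1
  refine ⟨1 / P.μ 0 * C₀ + 1 / P.μ 1 * C₁, by positivity, fun X => ?_⟩
  rw [Complex.norm_real, norm_eq_abs, stripJump]
  refine (abs_add_le _ _).trans ?_
  rw [abs_mul, abs_mul, abs_of_pos (by positivity : 0 < 1 / P.μ 0),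
    abs_of_pos (by positivity : 0 < 1 / P.μ 1), add_mul, mul_assoc, mul_assoc]
  exact add_le_add (mul_le_mul_of_nonneg_left (h₀ X 0) (by positivity))
    (mul_le_mul_of_nonneg_left (h₁ X 0) (by positivity))

theorem integral_stripJump_mul_exp (hp : HalfLineDecay p γ) (hγ : γ < gammaMinus P) {ξ : ℂ}
    (h1 : -γ < ξ.im) (h2 : ξ.im < 0) :
    Integrable (fun X : ℝ => (stripJump P p X : ℂ) * cexp (I * ξ * X)) ∧
    ∫ X : ℝ, (stripJump P p X : ℂ) * cexp (I * ξ * X) =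
      -(kernelNum P ξ / ξ ^ 2 - P.κ) * rightTransform (fun x => (p x : ℂ)) ξ := by
  have h : ∀ j, _ := fun j => hp.integral_exp_mul_potential (a := π / P.H j)
    (hγ.trans_le (gammaMinus_le_div P j)) h1 h2
    (Y := 0) ⟨le_rfl, by rw [pi_div_pi_div]; exact (P.H_pos j).le⟩
  have e : ∀ X : ℝ, (stripJump P p X : ℂ) * cexp (I * ξ * X) =
      1 / P.μ 0 * (cexp (I * ξ * X) * (potential (π / P.H 0) p X 0 : ℂ)) +
      1 / P.μ 1 * (cexp (I * ξ * X) * (potential (π / P.H 1) p X 0 : ℂ)) := by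
    intro X
    rw [stripJump]
    push_cast
    ring
  simp_rw [e]
  have hξ : ξ ≠ 0 := by
    rintro rfl
    simp at h2
  have hpd : ∀ j, ((π : ℂ) / ((π / P.H j : ℝ) : ℂ)) = P.H j := fun j => by
    rw [← Complex.ofReal_div, pi_div_pi_div]
  refine ⟨((h 0).1.const_mul _).add ((h 1).1.const_mul _), ?_⟩
  rw [integral_add ((h 0).1.const_mul _) ((h 1).1.const_mul _), integral_const_mul,
    integral_const_mul, (h 0).2, (h 1).2, ← Xi_eq P hξ, Xi, coth, coth, hpd, hpd,
    Complex.ofReal_zero, zero_sub, zero_sub, mul_neg, mul_neg, Complex.cosh_neg, Complex.cosh_neg]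
  have hd : (1 : ℂ) / ξ * (P.κ * ξ) = P.κ := by field_simp
  linear_combination (-rightTransform (fun x => (p x : ℂ)) ξ) * (-hd)

theorem left_add_right_stripJump (hp : HalfLineDecay p γ) (hγ : γ < gammaMinus P) {ξ : ℂ}
    (h1 : -γ < ξ.im) (h2 : ξ.im < 0) :
    leftTransform (fun X => (stripJump P p X : ℂ)) ξ +
      rightTransform (fun X => (stripJump P p X : ℂ)) ξ =
      -(kernelNum P ξ / ξ ^ 2 - P.κ) * rightTransform (fun x => (p x : ℂ)) ξ := by
  obtain ⟨hi, hv⟩ := hp.integral_stripJump_mul_exp hγ h1 h2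
  rw [← hv, leftTransform, rightTransform, ← integral_Iic_eq_integral_Iio]
  exact intervalIntegral.integral_Iic_add_Ioi hi.integrableOn hi.integrableOn

theorem leftTransform_stripJump (hp : HalfLineDecay p γ) (hγ : γ < gammaMinus P)
    (hj : ∀ X, 0 < X → stripJump P p X = P.κ * p X) {ξ : ℂ} (h1 : -γ < ξ.im) (h2 : ξ.im < 0) :
    leftTransform (fun X => (stripJump P p X : ℂ)) ξ =
      -(kernelNum P ξ / ξ ^ 2) * rightTransform (fun x => (p x : ℂ)) ξ := by
  have h := hp.left_add_right_stripJump hγ h1 h2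
  have e : rightTransform (fun X => (stripJump P p X : ℂ)) ξ =
      P.κ * rightTransform (fun x => (p x : ℂ)) ξ := by
    rw [rightTransform, rightTransform, ← integral_const_mul]
    refine setIntegral_congr_fun measurableSet_Ioi fun X hX => ?_
    simp only [hj X hX]
    push_cast
    ring
  rw [e] at h
  linear_combination h

theorem differentiableOn_left_stripJump (hp : HalfLineDecay p γ) (hγ : γ < gammaMinus P) :
    DifferentiableOn ℂ (leftTransform fun X => (stripJump P p X : ℂ)) {ξ | ξ.im < 0} := by
  intro ξ hξ
  change ξ.im < 0 at hξ
  set δ := min γ (-ξ.im / 2) with hδ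
  have hδ0 : 0 < δ := lt_min hp.pos (by linarith)
  obtain ⟨C, -, hC⟩ := (hp.of_le hδ0 (min_le_left _ _)).exists_stripJump_le
    ((min_le_left _ _).trans_lt hγ)
  have h := differentiableOn_leftTransform (φ := fun X => (stripJump P p X : ℂ)) (γ := δ)
    (Complex.continuous_ofReal.comp (hp.continuous_stripJump hγ)).aestronglyMeasurable
    (fun x _ => hC x)
  have hlt : ξ.im < -δ := by linarith [min_le_right γ (-ξ.im / 2)]
  exact (h.differentiableAt ((isOpen_lt Complex.continuous_im continuous_const).mem_nhds
    hlt)).differentiableWithinAt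

theorem integrableOn_left_stripJump (hp : HalfLineDecay p γ) (hγ : γ < gammaMinus P) {ξ : ℂ}
    (hξ : ξ.im < 0) : IntegrableOn
      (fun X : ℝ => (stripJump P p X : ℂ) * cexp (I * ξ * X)) (Iio 0) := by
  set δ := min γ (-ξ.im / 2) with hδ
  have hδ0 : 0 < δ := lt_min hp.pos (by linarith)
  obtain ⟨C, -, hC⟩ := (hp.of_le hδ0 (min_le_left _ _)).exists_stripJump_le
    ((min_le_left _ _).trans_lt hγ)
  exact integrableOn_left (γ := δ) (Complex.continuous_ofReal.comp
    (hp.continuous_stripJump hγ)).aestronglyMeasurable (fun x _ => hC x)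
    (by linarith [min_le_right γ (-ξ.im / 2)])

theorem exists_left_stripJump_le (hp : HalfLineDecay p γ) (hγ : γ < gammaMinus P) {s : ℝ}
    (hs : 0 < s) : ∃ C, 0 < C ∧ ∀ ξ : ℂ, ξ.im ≤ -s →
      ‖leftTransform (fun X => (stripJump P p X : ℂ)) ξ‖ ≤ C := by
  set δ := min γ (s / 2) with hδ
  have hδ0 : 0 < δ := lt_min hp.pos (by linarith)
  have hδs : δ ≤ s / 2 := min_le_right _ _
  obtain ⟨C, hC0, hC⟩ := (hp.of_le hδ0 (min_le_left _ _)).exists_stripJump_le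
    ((min_le_left _ _).trans_lt hγ)
  refine ⟨C / (s / 2), by positivity, fun ξ hξ => ?_⟩
  refine (norm_leftTransform_le (γ := δ) (fun x _ => hC x) (by linarith)).trans ?_
  exact div_le_div_of_nonneg_left hC0.le (by positivity) (by linarith)

theorem ofReal_aestronglyMeasurable (hp : HalfLineDecay p γ) :
    AEStronglyMeasurable (fun x => (p x : ℂ)) (volume.restrict (Ioi 0)) :=
  hp.integrableOn.ofReal.aestronglyMeasurable

theorem ofReal_bound (hp : HalfLineDecay p γ) :
    ∃ C, 0 < C ∧ ∀ x, 0 < x → ‖(p x : ℂ)‖ ≤ C * exp (-γ * x) := by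
  obtain ⟨C, hC, h⟩ := hp.bound
  exact ⟨C, hC, fun x hx => by rw [Complex.norm_real]; exact h x hx⟩

end HalfLineDecay

variable (P)

theorem exists_XiStarPlus_bounds {β δ : ℝ} (h0 : 0 < β) (h1 : β < gammaPlus P) (hδ : 0 < δ) :
    ∃ M, 0 < M ∧ ∀ ξ : ℂ, δ - β ≤ ξ.im → ‖XiStarPlus P β ξ‖ ≤ M ∧ ‖(XiStarPlus P β ξ)⁻¹‖ ≤ M := by
  obtain ⟨C, hC, hE⟩ := exists_XiStarPlus_sub_one_le P h0 h1 hδ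
  set S : Set ℂ := {ξ | δ - β ≤ ξ.im} with hS
  have hw : ∀ ξ, halfWeight ξ ≤ 1 := fun ξ => rpow_le_one_of_one_le_of_nonpos
    (by linarith [norm_nonneg ξ]) (by norm_num)
  have hO : (fun ξ => XiStarPlus P β ξ - 1) =O[Bornology.cobounded ℂ ⊓ 𝓟 S] halfWeight := by
    refine IsBigO.of_bound C ?_
    rw [eventually_inf_principal]
    refine Eventually.of_forall fun ξ hξ => ?_
    rw [norm_of_nonneg (by unfold halfWeight; positivity)]
    exact hE ξ hξ
  have hcont : ContinuousOn (XiStarPlus P β) S :=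
    (differentiableOn_XiStarPlus P h0 h1).continuousOn.mono fun ξ hξ => by
      change δ - β ≤ ξ.im at hξ
      change -β < ξ.im
      linarith
  obtain ⟨C', hC', hE'⟩ := exists_bound_of_isBigO_cobounded
    (isClosed_le continuous_const Complex.continuous_im)
    ((hcont.inv₀ fun ξ _ => XiStarPlus_ne_zero P β ξ).sub continuousOn_const)
    (isBigO_inv_sub_one hO (tendsto_halfWeight.mono_left inf_le_left))
  have aux : ∀ (v : ℂ) (D : ℝ) (ξ : ℂ), 0 < D → ‖v - 1‖ ≤ D * halfWeight ξ → ‖v‖ ≤ 1 + D := by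
    intro v D ξ hD h
    have h2 := norm_add_le (v - 1) 1
    rw [sub_add_cancel, norm_one] at h2
    have := mul_le_mul_of_nonneg_left (hw ξ) hD.le
    linarith
  refine ⟨1 + C + C', by positivity, fun ξ hξ => ⟨?_, ?_⟩⟩
  · linarith [aux _ C ξ hC (hE ξ hξ)]
  · linarith [aux (XiStarPlus P β ξ)⁻¹ C' ξ hC' (hE' ξ hξ)]

theorem norm_lam_sub_le (ξ : ℂ) : ‖(lam P - I * ξ : ℂ)‖ ≤ (lam P + 1) * (1 + ‖ξ‖) := by
  have hl := lam_pos P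
  refine (norm_sub_le _ _).trans ?_
  rw [Complex.norm_real, norm_of_nonneg hl.le, norm_mul, Complex.norm_I, one_mul]
  nlinarith [norm_nonneg ξ, mul_nonneg hl.le (norm_nonneg ξ)]

theorem norm_lam_add_le (ξ : ℂ) : ‖(lam P + I * ξ : ℂ)‖ ≤ (lam P + 1) * (1 + ‖ξ‖) := by
  have := norm_lam_sub_le P (-ξ)
  rwa [mul_neg, sub_neg_eq_add, norm_neg] at this

theorem eq_zero_of_bounded_on_ray {a b : ℂ} {K : ℝ}
    (h : ∀ τ : ℝ, 1 ≤ τ → ‖a + b * (τ * I)‖ ≤ K) : b = 0 := by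
  by_contra hb
  have hb' : 0 < ‖b‖ := norm_pos_iff.2 hb
  set τ := max 1 ((K + ‖a‖ + 1) / ‖b‖) with hτ
  have h1 := h τ (le_max_left _ _)
  have h2 : (K + ‖a‖ + 1) ≤ τ * ‖b‖ := by
    rw [← div_le_iff₀ hb']
    exact le_max_right _ _
  have h3 := norm_sub_le (a + b * (τ * I)) a
  rw [add_sub_cancel_left, norm_mul, norm_mul, Complex.norm_I, mul_one, Complex.norm_real,
    norm_of_nonneg (zero_le_one.trans (le_max_left _ _)), mul_comm] at h3
  linarith

theorem eq_zero_of_decay_on_ray {a b : ℂ} {K : ℝ}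
    (h : ∀ τ : ℝ, 1 ≤ τ → ‖a + b * (τ * I)‖ ≤ K / τ) : a = 0 ∧ b = 0 := by
  have hK : 0 ≤ K := by
    have := (norm_nonneg _).trans (h 1 le_rfl)
    rwa [div_one] at this
  have hb : b = 0 := eq_zero_of_bounded_on_ray (a := a) (K := K) fun τ hτ =>
    (h τ hτ).trans (div_le_self hK hτ)
  refine ⟨?_, hb⟩
  have h0 : Tendsto (fun τ : ℝ => K / τ) atTop (𝓝 0) := tendsto_id.const_div_atTop K
  rw [← norm_le_zero_iff]
  refine ge_of_tendsto h0 ?_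
  filter_upwards [eventually_ge_atTop 1] with τ hτ
  have := h τ hτ
  rwa [hb, zero_mul, add_zero] at this

/-- A traction whose transform has the Wiener–Hopf form satisfies the interface relation. -/
theorem stripJump_eq_of_transform (hp : HalfLineDecay p (gammaPlus P / 2))
    (hΨ : ∀ ξ : ℂ, -(gammaPlus P / 2) < ξ.im → rightTransform (fun x => (p x : ℂ)) ξ =
      -1 / (P.κ * (lam P - I * ξ) * XiStarPlus P (gammaPlus P / 2) ξ)) :
    (∀ X, 0 < X → stripJump P p X = P.κ * p X) ∧ ∀ ξ : ℂ, ξ.im < 0 →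
      leftTransform (fun X => (stripJump P p X : ℂ)) ξ =
        (lam P + I * ξ) * XiStarMinus P (gammaPlus P / 2) ξ / ξ ^ 2 := by
  have hg := gammaPlus_pos P
  have hgm := gammaPlus_lt P
  set β := gammaPlus P / 2 with hβ
  have hβ0 : 0 < β := by positivity
  have hβ1 : β < gammaPlus P := by linarith
  have hβm : β < gammaMinus P := by linarith
  set q : ℝ → ℝ := fun X => stripJump P p X - P.κ * p X with hq
  obtain ⟨C₁, hC₁, hb₁⟩ := hp.exists_stripJump_le hβm
  obtain ⟨C₂, hC₂, hb₂⟩ := hp.ofReal_bound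
  have hqc : ContinuousOn (fun x => (q x : ℂ)) (Ioi 0) :=
    Complex.continuous_ofReal.comp_continuousOn
      ((hp.continuous_stripJump hβm).continuousOn.sub (hp.cont.const_smul P.κ))
  set C := C₁ + P.κ * C₂ with hC
  have hκ := P.κ_pos
  have hC0 : 0 < C := by positivity
  have hqb : ∀ x, 0 < x → ‖(q x : ℂ)‖ ≤ C * exp (-β * x) := by
    intro x hx
    simp only [hq]
    push_cast
    refine (norm_sub_le _ _).trans ?_
    rw [norm_mul, Complex.norm_real P.κ, norm_of_nonneg hκ.le, hC, add_mul, mul_assoc]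
    exact add_le_add (hb₁ x) (mul_le_mul_of_nonneg_left (hb₂ x hx) hκ.le)
  have hqm := hqc.aestronglyMeasurable (μ := volume) measurableSet_Ioi
  set f := rightTransform fun x => (q x : ℂ) with hf
  set g : ℂ → ℂ := fun ξ => (lam P + I * ξ) * XiStarMinus P β ξ / ξ ^ 2 -
    leftTransform (fun X => (stripJump P p X : ℂ)) ξ with hgdef
  have hfd : DifferentiableOn ℂ f {z | -β < z.im} := differentiableOn_rightTransform hqm hqb
  have hgd : DifferentiableOn ℂ g {z | z.im < 0} := by
    refine DifferentiableOn.sub (DifferentiableOn.div (DifferentiableOn.mul (by fun_prop)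
      ((differentiableOn_XiStarMinus P hβ0 hβ1).mono fun ξ hξ => ?_)) (by fun_prop)
        fun ξ hξ => ?_) (hp.differentiableOn_left_stripJump hβm)
    · exact (show ξ.im < 0 from hξ).trans hβ0
    · refine pow_ne_zero 2 ?_
      rintro rfl
      exact lt_irrefl _ (show (0 : ℂ).im < 0 from hξ)
  have hfg : ∀ z : ℂ, -β < z.im → z.im < 0 → f z = g z := by
    intro ξ h1 h2
    have e1 := hp.left_add_right_stripJump hβm h1 h2
    have e2 := kernelNum_mul_traction P hβ0 hβ1 h1 (h2.trans hβ0)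
    rw [← hΨ ξ h1] at e2
    have e3 : f ξ = rightTransform (fun X => (stripJump P p X : ℂ)) ξ -
        P.κ * rightTransform (fun x => (p x : ℂ)) ξ := by
      rw [hf, rightTransform, rightTransform, rightTransform, ← integral_const_mul,
        ← integral_sub]
      · refine integral_congr_ae (Eventually.of_forall fun x => ?_)
        simp only [hq]
        push_cast
        ring
      · exact integrableOn_right (Complex.continuous_ofReal.comp
          (hp.continuous_stripJump hβm)).aestronglyMeasurable (fun x _ => hb₁ x) h1
      · exact (integrableOn_right hp.ofReal_aestronglyMeasurable hb₂ h1).const_mul _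
    rw [e3, hgdef]
    linear_combination e1 - e2 / ξ ^ 2
  obtain ⟨M, hM, hE⟩ := exists_XiStarPlus_bounds P hβ0 hβ1 hβ0
  obtain ⟨C₃, hC₃, hb₃⟩ := hp.exists_left_stripJump_le hβm (half_pos hβ0)
  have hl := lam_pos P
  set K := C / (β / 2) + ((lam P + 1) * M / (β / 2) ^ 2 + C₃) with hK
  obtain ⟨a, b, haf, hag⟩ := exists_affine_of_glue (C := K) (half_pos hβ0) (half_lt_self hβ0) hfd hgd
    hfg (fun z hz => by
      have h1 := norm_rightTransform_le hqb (ξ := z) (by linarith)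
      have h2 : C / (β + z.im) ≤ C / (β / 2) :=
        div_le_div_of_nonneg_left hC0.le (by positivity) (by linarith)
      have h3 : 0 ≤ (lam P + 1) * M / (β / 2) ^ 2 + C₃ := by positivity
      have h4 : K ≤ K * (1 + ‖z‖) := le_mul_of_one_le_right (by positivity)
        (by linarith [norm_nonneg z])
      linarith [h1.trans h2])
    (fun z hz => by
      have h1 := hb₃ z hz
      have h2 : β / 2 ≤ ‖z‖ := by
        have := (neg_le_abs _).trans (Complex.abs_im_le_norm z)
        linarith
      have h3 : ‖XiStarMinus P β z‖ ≤ M := by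
        rw [XiStarMinus_eq_plus_neg P hβ0.ne']
        exact (hE _ (by rw [Complex.neg_im]; linarith)).1
      have h4 : ‖(lam P + I * z) * XiStarMinus P β z / z ^ 2‖ ≤
          (lam P + 1) * M / (β / 2) ^ 2 * (1 + ‖z‖) := by
        rw [norm_div, norm_mul, norm_pow]
        calc _ ≤ (lam P + 1) * (1 + ‖z‖) * M / (β / 2) ^ 2 :=
              div_le_div₀ (by positivity) (mul_le_mul (norm_lam_add_le P z) h3 (norm_nonneg _)
                (by positivity)) (by positivity) (pow_le_pow_left₀ (by positivity) h2 2)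
          _ = _ := by ring
      refine (norm_sub_le _ _).trans ?_
      have h5 : C₃ ≤ C₃ * (1 + ‖z‖) := le_mul_of_one_le_right hC₃.le (by linarith [norm_nonneg z])
      have h6 : 0 ≤ C / (β / 2) * (1 + ‖z‖) := by positivity
      rw [hK]
      linarith)
  have him : ∀ τ : ℝ, ((τ : ℂ) * I).im = τ := fun τ => by simp
  obtain ⟨ha, hb⟩ := eq_zero_of_decay_on_ray (a := a) (b := b) (K := C) fun τ hτ => by
    rw [← haf _ (by rw [him]; linarith)]
    refine (norm_rightTransform_le hqb (by rw [him]; linarith)).trans ?_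
    rw [him]
    exact div_le_div_of_nonneg_left hC0.le (by linarith) (by linarith)
  refine ⟨fun X hX => ?_, fun ξ hξ => ?_⟩
  swap
  · have h := hag ξ hξ
    rw [ha, hb, zero_mul, add_zero] at h
    exact (sub_eq_zero.1 h).symm
  have hz := eq_zero_of_rightTransform_eq_zero hβ0 hqc hqb (fun t => by
    have := haf t (by rw [Complex.ofReal_im]; linarith)
    rw [ha, hb] at this
    simpa using this) X hX
  have : q X = 0 := by exact_mod_cast hz
  exact sub_eq_zero.1 this

/-- Solutions of the homogeneous Wiener–Hopf equation form a one-dimensional space. -/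
theorem exists_rightTransform_eq_const_mul (hp : HalfLineDecay p γ) (hγ : γ ≤ gammaPlus P / 2)
    (hj : ∀ X, 0 < X → stripJump P p X = P.κ * p X) : ∃ A : ℝ, ∀ ξ : ℂ, -γ < ξ.im →
      rightTransform (fun x => (p x : ℂ)) ξ =
        A * (-1 / (P.κ * (lam P - I * ξ) * XiStarPlus P (gammaPlus P / 2) ξ)) := by
  have hg := gammaPlus_pos P
  have hgm := gammaPlus_lt P
  have hgl := gammaPlus_lt_lam P
  have hγ0 := hp.pos
  set β := gammaPlus P / 2 with hβ
  have hβ0 : 0 < β := by positivity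
  have hβ1 : β < gammaPlus P := by linarith
  have hγm : γ < gammaMinus P := by linarith
  have hκ := P.κ_pos
  have hκ' : (P.κ : ℂ) ≠ 0 := by exact_mod_cast hκ.ne'
  have hl := lam_pos P
  obtain ⟨C, hC, hb⟩ := hp.ofReal_bound
  set Φ := rightTransform fun x => (p x : ℂ) with hΦ
  set L := leftTransform fun X => (stripJump P p X : ℂ) with hL
  set f : ℂ → ℂ := fun ξ => Φ ξ * (P.κ * (lam P - I * ξ) * XiStarPlus P β ξ) with hf
  set g : ℂ → ℂ := fun ξ => -(ξ ^ 2 * L ξ) / ((lam P + I * ξ) * XiStarMinus P β ξ)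
    with hgdef
  have hfd : DifferentiableOn ℂ f {z | -γ < z.im} := by
    refine (differentiableOn_rightTransform hp.ofReal_aestronglyMeasurable hb).mul
      (DifferentiableOn.mul (by fun_prop) ((differentiableOn_XiStarPlus P hβ0 hβ1).mono
        fun ξ hξ => ?_))
    change -γ < ξ.im at hξ
    change -β < ξ.im
    linarith
  have hgd : DifferentiableOn ℂ g {z | z.im < 0} := by
    refine DifferentiableOn.div (DifferentiableOn.neg (DifferentiableOn.mul (by fun_prop)
      (hp.differentiableOn_left_stripJump hγm))) (DifferentiableOn.mul (by fun_prop)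
      ((differentiableOn_XiStarMinus P hβ0 hβ1).mono fun ξ hξ => ?_)) fun ξ hξ => ?_
    · exact (show ξ.im < 0 from hξ).trans hβ0
    · exact mul_ne_zero (lam_add_ne P ((show ξ.im < 0 from hξ).trans hl))
        (XiStarMinus_ne_zero P _ _)
  have hfg : ∀ z : ℂ, -γ < z.im → z.im < 0 → f z = g z := by
    intro ξ h1 h2
    have e1 := hp.leftTransform_stripJump hγm hj h1 h2
    have e2 := kernelNum_mul_traction P hβ0 hβ1 (by linarith : -β < ξ.im) (h2.trans hβ0)
    have hξ : ξ ≠ 0 := by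
      rintro rfl
      simp at h2
    have n1 := lam_sub_ne P (ξ := ξ) (by linarith)
    have n2 := lam_add_ne P (ξ := ξ) (by linarith)
    have n3 := XiStarPlus_ne_zero P β ξ
    have n4 := XiStarMinus_ne_zero P β ξ
    simp only [hf, hgdef]
    rw [eq_div_iff (mul_ne_zero n2 n4), hL, e1]
    rw [mul_div_assoc', div_eq_iff (mul_ne_zero (mul_ne_zero hκ' n1) n3)] at e2
    have e3 : kernelNum P ξ = (lam P + I * ξ) * XiStarMinus P β ξ *
        (P.κ * (lam P - I * ξ) * XiStarPlus P β ξ) := by linear_combination -e2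
    rw [e3]
    field_simp
    rfl
  set s := γ / 2 with hs
  have hs0 : 0 < s := by positivity
  obtain ⟨M, hM, hE⟩ := exists_XiStarPlus_bounds P hβ0 hβ1 hs0
  obtain ⟨C₃, hC₃, hb₃⟩ := hp.exists_left_stripJump_le hγm hs0
  have hfb : ∀ ξ : ℂ, -s ≤ ξ.im → ‖f ξ‖ ≤ C / s * (P.κ * ((lam P + 1) * (1 + ‖ξ‖)) * M) := by
    intro ξ hξ
    simp only [hf]
    rw [norm_mul, norm_mul, norm_mul, Complex.norm_real, norm_of_nonneg hκ.le]
    have h1 : ‖Φ ξ‖ ≤ C / s := (norm_rightTransform_le hb (by linarith)).trans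
      (div_le_div_of_nonneg_left hC.le hs0 (by linarith))
    refine mul_le_mul h1 (mul_le_mul (mul_le_mul_of_nonneg_left (norm_lam_sub_le P ξ) hκ.le)
      (hE ξ (by linarith)).1 (norm_nonneg _) (by positivity)) (by positivity) (by positivity)
  set K := C / s * P.κ * (lam P + 1) * M + C₃ * M with hK
  obtain ⟨a, b, haf, -⟩ := exists_affine_of_glue (C := K) hs0 (half_lt_self hγ0) hfd hgd hfg
    (fun z hz => by
      have h1 := hfb z hz
      have h2 : 0 ≤ C₃ * M * (1 + ‖z‖) := by positivity
      rw [hK]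
      linarith)
    (fun z hz => by
      have n2 := lam_add_ne P (ξ := z) (by linarith)
      have h3 : ‖(XiStarMinus P β z)⁻¹‖ ≤ M := by
        rw [XiStarMinus_eq_plus_neg P hβ0.ne']
        exact (hE _ (by rw [Complex.neg_im]; linarith)).2
      have h4 : ‖z‖ ≤ ‖(lam P + I * z : ℂ)‖ := by
        refine abs_le_of_sq_le_sq' ?_ (norm_nonneg _) |>.2
        rw [← Complex.normSq_eq_norm_sq, ← Complex.normSq_eq_norm_sq, Complex.normSq_apply,
          Complex.normSq_apply]
        simp
        nlinarith
      have h5 : g z = -(z * L z * (z / (lam P + I * z)) * (XiStarMinus P β z)⁻¹) := by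
        simp only [hgdef]
        rw [div_eq_mul_inv, mul_inv]
        ring
      have h6 : ‖z / (lam P + I * z)‖ ≤ 1 := by
        rw [norm_div]
        exact div_le_one_of_le₀ h4 (norm_nonneg _)
      rw [h5, norm_neg, norm_mul, norm_mul, norm_mul]
      have h7 : ‖z‖ * ‖L z‖ * ‖z / (lam P + I * z)‖ * ‖(XiStarMinus P β z)⁻¹‖ ≤
          ‖z‖ * C₃ * 1 * M := by
        have := hb₃ z hz
        gcongr
      have h8 : 0 ≤ C / s * P.κ * (lam P + 1) * M * (1 + ‖z‖) := by positivity
      have h9 : 0 ≤ C₃ * M := by positivity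
      rw [hK]
      linarith)
  have him : ∀ τ : ℝ, ((τ : ℂ) * I).im = τ := fun τ => by simp
  have hb0 : b = 0 := eq_zero_of_bounded_on_ray (a := a) (b := b)
    (K := C * (P.κ * ((lam P + 1) * 2) * M)) fun τ hτ => by
    rw [← haf _ (by rw [him]; linarith)]
    simp only [hf]
    rw [norm_mul, norm_mul, norm_mul, Complex.norm_real, norm_of_nonneg hκ.le]
    have h1 : ‖Φ (τ * I)‖ ≤ C / τ := by
      refine (norm_rightTransform_le hb (by rw [him]; linarith)).trans ?_
      rw [him]
      exact div_le_div_of_nonneg_left hC.le (by linarith) (by linarith)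
    have h2 : ‖(lam P - I * (τ * I) : ℂ)‖ ≤ (lam P + 1) * 2 * τ := by
      refine (norm_lam_sub_le P _).trans ?_
      rw [norm_mul, Complex.norm_I, mul_one, Complex.norm_real, norm_of_nonneg (by linarith),
        mul_assoc]
      exact mul_le_mul_of_nonneg_left (by linarith) (by linarith)
    calc _ ≤ C / τ * (P.κ * ((lam P + 1) * 2 * τ) * M) :=
          mul_le_mul h1 (mul_le_mul (mul_le_mul_of_nonneg_left h2 hκ.le)
            (hE _ (by rw [him]; linarith)).1 (norm_nonneg _) (by positivity))
            (by positivity) (by positivity)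
      _ = _ := by field_simp
  have hΦa : ∀ ξ : ℂ, -γ < ξ.im → Φ ξ * (P.κ * (lam P - I * ξ) * XiStarPlus P β ξ) = a :=
    fun ξ hξ => by
      have := haf ξ hξ
      rwa [hb0, zero_mul, add_zero] at this
  have h0 := hΦa 0 (by simpa using hγ0)
  have hΦ0 : Φ 0 = ((∫ x in Ioi 0, p x : ℝ) : ℂ) := by
    rw [hΦ, rightTransform, ← integral_complex_ofReal]
    simp
  rw [XiStarPlus_zero P hβ0 hβ1, hΦ0, mul_zero, sub_zero, mul_one] at h0
  refine ⟨-((∫ x in Ioi 0, p x) * (P.κ * lam P)), fun ξ hξ => ?_⟩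
  have n1 := lam_sub_ne P (ξ := ξ) (by linarith)
  have n3 := XiStarPlus_ne_zero P β ξ
  rw [mul_div_assoc', eq_div_iff (mul_ne_zero (mul_ne_zero hκ' n1) n3), hΦa ξ hξ, ← h0]
  push_cast
  ring

end

end BimaterialStrip

namespace BimaterialStrip

/-! ### Weight functions are potentials of their interface traction -/

section
variable {P : StripParams} {u : Fin 2 → ℝ → ℝ → ℝ} {C D : Fin 2 → ℝ} {j : Fin 2}

theorem side_mul_side (j : Fin 2) : side j * side j = 1 := by fin_cases j <;> simp [side]

theorem abs_side (j : Fin 2) : |side j| = 1 := by fin_cases j <;> simp [side]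

theorem side_mul_mem {Y : ℝ} : side j * Y ∈ section_ P j ↔ Y ∈ Icc 0 (P.H j) := by
  change side j * (side j * Y) ∈ Icc 0 (P.H j) ↔ _
  rw [← mul_assoc, side_mul_side, one_mul]

theorem exists_section_eq (P : StripParams) (j : Fin 2) :
    ∃ a b : ℝ, a < b ∧ section_ P j = Icc a b ∧ ∀ Y, side j * Y ∈ Ioo 0 (P.H j) ↔ Y ∈ Ioo a b := by
  fin_cases j
  · exact ⟨0, P.H 0, P.H_pos 0, by ext; simp [section_, side], by simp [side]⟩
  · refine ⟨-P.H 1, 0, by simpa using P.H_pos 1, ?_, fun Y => ?_⟩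
    · ext Y
      simp [section_, side, and_comm, neg_le]
    · simp [side, and_comm, neg_lt]

theorem potential_side (j : Fin 2) (a : ℝ) (p : ℝ → ℝ) (X Y : ℝ) :
    potential a p X (side j * Y) = potential a p X Y := by
  fin_cases j
  · simp [side]
  · simpa [side] using potential_neg_right X Y

theorem harmonicAt_comp_conj {f : ℂ → ℝ} {z : ℂ}
    (h : InnerProductSpace.HarmonicAt f (starRingEnd ℂ z)) :
    InnerProductSpace.HarmonicAt (fun w => f (starRingEnd ℂ w)) z := by
  obtain ⟨r, hr, hball⟩ := Metric.eventually_nhds_iff_ball.1 h.eventually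
  obtain ⟨F, hF, hFf⟩ := InnerProductSpace.HarmonicOnNhd.exists_analyticOnNhd_ball_re_eq
    (fun z hz => hball z hz)
  have hmem : ∀ w ∈ Metric.ball z r, starRingEnd ℂ w ∈ Metric.ball (starRingEnd ℂ z) r :=
    fun w hw => by rwa [Metric.mem_ball, Complex.dist_conj_conj]
  have hd : DifferentiableOn ℂ (starRingEnd ℂ ∘ F ∘ starRingEnd ℂ) (Metric.ball z r) :=
    fun w hw => by
      have := (hF _ (hmem w hw)).differentiableAt.conj_conj
      rw [Complex.conj_conj] at this
      exact this.differentiableWithinAt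
  have han := (hd.analyticAt (Metric.ball_mem_nhds z hr)).harmonicAt_re
  refine (InnerProductSpace.harmonicAt_congr_nhds ?_).1 han
  filter_upwards [Metric.ball_mem_nhds z hr] with w hw
  simpa using hFf (hmem w hw)

theorem harmonicAt_side {f : ℝ → ℝ → ℝ} {z : ℂ}
    (h : InnerProductSpace.HarmonicAt (fun z : ℂ => f z.re z.im) ⟨z.re, side j * z.im⟩) :
    InnerProductSpace.HarmonicAt (fun z : ℂ => f z.re (side j * z.im)) z := by
  fin_cases j
  · simpa [side] using h
  · have e : starRingEnd ℂ z = ⟨z.re, side 1 * z.im⟩ := by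
      apply Complex.ext <;> simp [side]
    have := harmonicAt_comp_conj (f := fun z : ℂ => f z.re z.im) (z := z) (by rw [e]; exact h)
    simpa [side] using this

theorem hasDerivWithinAt_of_continuousWithinAt_derivWithin {f : ℝ → ℝ} {a b y : ℝ} (hab : a < b)
    (hc : ContinuousOn f (Icc a b)) (hd : ∀ y ∈ Ioo a b, DifferentiableAt ℝ f y)
    (hy : y ∈ Icc a b) (h : ContinuousWithinAt (derivWithin f (Icc a b)) (Icc a b) y) :
    HasDerivWithinAt f (derivWithin f (Icc a b) y) (Icc a b) y := by
  have hd' : DifferentiableOn ℝ f (Ioo a b) := fun y hy => (hd y hy).differentiableWithinAt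
  have he : ∀ y ∈ Ioo a b, derivWithin f (Icc a b) y = deriv f y := fun y hy =>
    derivWithin_of_mem_nhds (Icc_mem_nhds hy.1 hy.2)
  rcases hy.1.eq_or_lt with rfl | h1
  · refine (hasDerivWithinAt_Ici_of_tendsto_deriv hd' ((hc _ hy).mono Ioo_subset_Icc_self)
      (Ioo_mem_nhdsGT hab) ?_).mono Icc_subset_Ici_self
    have := h.mono Ioo_subset_Icc_self
    rw [ContinuousWithinAt, nhdsWithin_Ioo_eq_nhdsGT hab] at this
    exact this.congr' (eventually_of_mem (Ioo_mem_nhdsGT hab) he)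
  rcases hy.2.eq_or_lt with rfl | h2
  · refine (hasDerivWithinAt_Iic_of_tendsto_deriv hd' ((hc _ hy).mono Ioo_subset_Icc_self)
      (Ioo_mem_nhdsLT hab) ?_).mono Icc_subset_Iic_self
    have := h.mono Ioo_subset_Icc_self
    rw [ContinuousWithinAt, nhdsWithin_Ioo_eq_nhdsLT hab] at this
    exact this.congr' (eventually_of_mem (Ioo_mem_nhdsLT hab) he)
  · exact (hd y ⟨h1, h2⟩).differentiableWithinAt.hasDerivWithinAt

theorem exists_exp_bound {f : ℝ → ℝ} {γ K : ℝ} (hc : Continuous f)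
    (h : ∀ᶠ x in atTop, |f x| ≤ K * exp (-γ * x)) :
    ∃ M, 0 < M ∧ ∀ x, 0 < x → |f x| ≤ M * exp (-γ * x) := by
  obtain ⟨N, hN⟩ := eventually_atTop.1 h
  obtain ⟨M, hM⟩ := (isCompact_Icc (a := 0) (b := N)).exists_bound_of_continuousOn
    (f := fun x => f x * exp (γ * x)) (by fun_prop)
  refine ⟨|K| + |M| + 1, by positivity, fun x hx => ?_⟩
  have he := exp_pos (-γ * x)
  rcases le_total N x with h | h
  · exact (hN x h).trans (mul_le_mul_of_nonneg_right
      (by linarith [le_abs_self K, abs_nonneg M]) he.le)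
  · have h1 := hM x ⟨hx.le, h⟩
    rw [norm_eq_abs, abs_mul, abs_of_pos (exp_pos _)] at h1
    have h2 : |f x| = |f x| * exp (γ * x) * exp (-γ * x) := by
      rw [mul_assoc, ← exp_add]
      simp
    rw [h2]
    exact mul_le_mul_of_nonneg_right (by linarith [le_abs_self M, abs_nonneg K]) he.le

theorem eventually_abs_le_of_isBigO {f : ℝ → ℝ → ℝ} {g : ℝ → ℝ} {l : Filter ℝ} {S : Set ℝ}
    (h : (fun q : ℝ × ℝ => f q.1 q.2) =O[l ×ˢ 𝓟 S] fun q => g q.1) :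
    ∃ K, 0 < K ∧ ∀ᶠ X in l, ∀ Y ∈ S, |f X Y| ≤ K * |g X| := by
  obtain ⟨K, hK, hb⟩ := h.exists_pos
  exact ⟨K, hK, eventually_prod_principal_iff.1 hb.bound⟩

theorem zero_mem_section (P : StripParams) (j : Fin 2) : (0 : ℝ) ∈ section_ P j := by
  simpa [section_] using (P.H_pos j).le

theorem exists_jump_bound {γ : ℝ} (hr : DecaysRight P u γ) :
    ∃ K, ∀ᶠ x in atTop, |jump u x| ≤ K * exp (-γ * x) := by
  obtain ⟨K₀, -, h0⟩ := eventually_abs_le_of_isBigO (f := u 0)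
    (g := fun X => exp (-γ * X)) (hr 0)
  obtain ⟨K₁, -, h1⟩ := eventually_abs_le_of_isBigO (f := u 1)
    (g := fun X => exp (-γ * X)) (hr 1)
  refine ⟨K₀ + K₁, ?_⟩
  filter_upwards [h0, h1] with x b0 b1
  have c0 := b0 0 (zero_mem_section P 0)
  have c1 := b1 0 (zero_mem_section P 1)
  rw [abs_of_pos (exp_pos _)] at c0 c1
  rw [jump]
  refine (abs_sub _ _).trans ?_
  linarith

namespace IsWeightFunction

theorem hasDerivWithinAt (hu : IsWeightFunction P u C D) {X Y : ℝ} (hY : Y ∈ section_ P j)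
    (h : X ≠ 0 ∨ Y ≠ 0) :
    HasDerivWithinAt (fun y => u j X y) (dY P u j X Y) (section_ P j) Y := by
  obtain ⟨a, b, hab, hS, hI⟩ := exists_section_eq P j
  have hc : ContinuousOn (fun y => u j X y) (section_ P j) :=
    (hu.cont j).comp (f := fun y : ℝ => ((X, y) : ℝ × ℝ)) (by fun_prop) fun y hy => hy
  have hd : ContinuousWithinAt (fun y => dY P u j X y) (section_ P j) Y := by
    have h1 : ContinuousWithinAt (fun q : ℝ × ℝ => dY P u j q.1 q.2) (closedStrip P j \ {0})
        (X, Y) := hu.cont_dY j _ ⟨hY, by simpa [Prod.ext_iff, or_iff_not_imp_left] using h⟩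
    have h2 : ContinuousWithinAt (fun y : ℝ => ((X, y) : ℝ × ℝ)) (section_ P j) Y :=
      (by fun_prop : Continuous fun y : ℝ => ((X, y) : ℝ × ℝ)).continuousWithinAt
    have h3 := h1.tendsto
    refine h3.comp (tendsto_nhdsWithin_iff.2 ⟨h2.tendsto, ?_⟩)
    have hne : ∀ᶠ y : ℝ in 𝓝 Y, ((X, y) : ℝ × ℝ) ≠ 0 :=
      (by fun_prop : Continuous fun y : ℝ => ((X, y) : ℝ × ℝ)).continuousAt.eventually_ne
        (by simpa [Prod.ext_iff, or_iff_not_imp_left] using h)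
    filter_upwards [self_mem_nhdsWithin, hne.filter_mono nhdsWithin_le_nhds] with y h4 h5
    exact ⟨h4, h5⟩
  rw [hS] at hY hc hd ⊢
  have hdiff : ∀ y ∈ Ioo a b, DifferentiableAt ℝ (fun y => u j X y) y := by
    intro y hy
    have h1 := (hu.harmonic j ⟨X, y⟩ ((hI y).2 hy)).1.differentiableAt two_ne_zero
    have h2 : DifferentiableAt ℝ (fun y : ℝ => (⟨X, y⟩ : ℂ)) y := by
      have : (fun y : ℝ => (⟨X, y⟩ : ℂ)) = fun y : ℝ => (X : ℂ) + y * I := by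
        ext y
        exact Complex.mk_eq_add_mul_I X y
      rw [this]
      exact (Complex.ofRealCLM.differentiableAt.mul_const _).const_add _
    exact h1.comp y h2
  have := hasDerivWithinAt_of_continuousWithinAt_derivWithin hab hc hdiff hY
    (by simpa only [dY, hS] using hd)
  rwa [dY, hS]

theorem mul_dY_zero (hu : IsWeightFunction P u C D) {X : ℝ} (hX : X ≠ 0) :
    P.μ j * dY P u j X 0 = zeroExt (fun x => jump u x / P.κ) X := by
  rcases hX.lt_or_gt with h | h
  · rw [zeroExt_of_nonpos h.le, hu.crack_free j X h]
  · have e : P.μ 0 * dY P u 0 X 0 = jump u X / P.κ := by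
      rw [hu.imperfect X h, mul_div_cancel_left₀ _ P.κ_pos.ne']
    rw [zeroExt_of_pos h]
    fin_cases j
    · exact e
    · exact (hu.traction X h).symm.trans e

theorem halfLineDecay (hu : IsWeightFunction P u C D) :
    ∃ γ, γ ≤ gammaPlus P / 2 ∧ HalfLineDecay (fun x => jump u x / P.κ) γ := by
  obtain ⟨γ, hγ, hr⟩ := hu.right
  have hg := gammaPlus_pos P
  have hκ := P.κ_pos
  have hc : Continuous (jump u) := by
    have : ∀ j, Continuous fun X => u j X 0 := fun j => by
      rw [← continuousOn_univ]
      exact (hu.cont j).comp (f := fun x : ℝ => ((x, 0) : ℝ × ℝ)) (by fun_prop)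
        fun x _ => zero_mem_section P j
    exact (this 0).sub (this 1)
  obtain ⟨K, hK⟩ := exists_jump_bound hr
  obtain ⟨M, hM, hb⟩ := exists_exp_bound hc hK
  refine ⟨min γ (gammaPlus P / 2), min_le_right _ _, HalfLineDecay.of_le (γ := γ)
    ⟨hγ, (hc.div_const _).continuousOn, M / P.κ, by positivity, fun x hx => ?_⟩
    (lt_min hγ (by positivity)) (min_le_left _ _)⟩
  rw [abs_div, abs_of_pos hκ, div_mul_eq_mul_div]
  exact div_le_div_of_nonneg_right (hb x hx) hκ.le

/-- The representation of a weight function by its interface traction. -/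
theorem eq_potential (hu : IsWeightFunction P u C D) {γ : ℝ} (hγ : γ < gammaMinus P)
    (hp : HalfLineDecay (fun x => jump u x / P.κ) γ) {X Y : ℝ} (hY : Y ∈ section_ P j) :
    u j X Y = side j / P.μ j * potential (π / P.H j) (fun x => jump u x / P.κ) X Y := by
  set p : ℝ → ℝ := fun x => jump u x / P.κ with hpdef
  set a := π / P.H j with ha
  have hH := P.H_pos j
  have hμ := P.μ_pos j
  have ha0 : 0 < a := by positivity
  have hπa : π / a = P.H j := pi_div_pi_div P j
  have hγa : γ < a := hγ.trans_le (gammaMinus_le_div P j)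
  set c := side j / P.μ j with hcdef
  set w : ℝ → ℝ → ℝ := fun X Y => u j X (side j * Y) - c * potential a p X Y with hw
  have hmaps : MapsTo (fun y => side j * y) (Icc 0 (P.H j)) (section_ P j) :=
    fun y hy => side_mul_mem.2 hy
  have hder : ∀ X Y, Y ∈ Icc 0 (P.H j) → (X ≠ 0 ∨ Y ≠ 0) → HasDerivWithinAt (w X)
      (dY P u j X (side j * Y) * side j - c * potentialDY a p X Y) (Icc 0 (P.H j)) Y := by
    intro X Y hY hXY
    have hs : side j ≠ 0 := left_ne_zero_of_mul_eq_one (side_mul_side j)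
    have d1 := hu.hasDerivWithinAt (side_mul_mem.2 hY : side j * Y ∈ section_ P j)
      (hXY.imp_right (mul_ne_zero hs))
    have d2 := hp.hasDerivWithinAt_potential hγa (X := X) (Y := Y) (by rwa [hπa]) hXY
    rw [hπa] at d2
    have d3 : HasDerivWithinAt (fun y => side j * y) (side j * 1) (Icc 0 (P.H j)) Y :=
      ((hasDerivAt_id' Y).const_mul _).hasDerivWithinAt
    rw [mul_one] at d3
    exact (HasDerivWithinAt.comp (h₂ := fun y => u j X y) Y d1 d3 hmaps).sub (d2.const_mul c)
  obtain ⟨K, hK, hpb⟩ := hp.exists_potential_le hγa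
  obtain ⟨K', hK', hrem⟩ := hp.exists_potentialRem_le ha0
  obtain ⟨γr, hγr, hr⟩ := hu.right
  obtain ⟨γl, hγl, hl⟩ := hu.left
  obtain ⟨Kr, hKr, br⟩ := eventually_abs_le_of_isBigO (f := u j) (g := fun X => exp (-γr * X))
    (hr j)
  obtain ⟨Kl, hKl, bl⟩ := eventually_abs_le_of_isBigO (f := fun X Y => u j X Y - (C j * X + D j))
    (g := fun X => exp (γl * X)) (hl j)
  have texp : ∀ (k b : ℝ), 0 < b → Tendsto (fun X : ℝ => k * exp (b * X)) atBot (𝓝 0) :=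
    fun k b hb => by
      have := (tendsto_exp_atBot.comp (tendsto_id.const_mul_atBot hb)).const_mul k
      rwa [mul_zero] at this
  have texp' : ∀ (k b : ℝ), 0 < b → Tendsto (fun X : ℝ => k * exp (-b * X)) atTop (𝓝 0) :=
    fun k b hb => ((texp k b hb).comp tendsto_neg_atTop_atBot).congr fun X => by simp
  set I₀ := ∫ s in Ioi (0 : ℝ), p s
  set I₁ := ∫ s in Ioi (0 : ℝ), s * p s
  have key : w X (side j * Y) = 0 := by
    refine eq_zero_of_neumann (C := C j + c * (a / π * I₀)) (D := D j - c * (a / π * I₁)) hH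
      ?_ ?_ ?_ ?_ ?_ ?_ hY
    · refine ContinuousOn.sub ((hu.cont j).comp
        (f := fun q : ℝ × ℝ => ((q.1, side j * q.2) : ℝ × ℝ)) (by fun_prop) fun q hq => ?_)
        ((hp.continuous_potential hγa).const_smul c).continuousOn
      exact hmaps hq.2
    · intro z hz
      refine (harmonicAt_side (f := u j) (hu.harmonic j _ ?_)).sub ((hp.harmonicAt_potential hγa
        (sin_pos_of_mem ha0 hz.1 ?_)).const_smul (c := c))
      · change side j * (side j * z.im) ∈ Ioo 0 (P.H j)
        rwa [← mul_assoc, side_mul_side, one_mul]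
      · rw [ha, div_mul_eq_mul_div, div_lt_iff₀ hH]
        exact mul_lt_mul_of_pos_left hz.2 pi_pos
    · intro X hX
      refine (hder X 0 ⟨le_rfl, hH.le⟩ (Or.inl hX)).congr_deriv ?_
      rw [mul_zero, potentialDY_zero, ← hu.mul_dY_zero (j := j) hX, hcdef]
      field_simp
      ring
    · intro X
      refine (hder X (P.H j) ⟨hH.le, le_rfl⟩ (Or.inr hH.ne')).congr_deriv ?_
      have h1 := potentialDY_top (p := p) ha0 X
      rw [hπa] at h1
      rw [h1, (mul_eq_zero.1 (hu.outer_free j X)).resolve_left hμ.ne']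
      ring
    · intro η hη
      have t1 := (texp' Kr γr hγr).eventually_le_const (half_pos hη)
      have t2 := (texp' (|c| * K) γ hp.pos).eventually_le_const (half_pos hη)
      filter_upwards [br, t1, t2] with X h1 h2 h3 Y hY
      have h4 := h1 _ (hmaps hY)
      rw [abs_of_pos (exp_pos _)] at h4
      have h5 := mul_le_mul_of_nonneg_left (hpb X Y) (abs_nonneg c)
      rw [← abs_mul] at h5
      refine (abs_sub _ _).trans ?_
      linarith
    · intro η hη
      have t1 := (texp Kl γl hγl).eventually_le_const (half_pos hη)
      have t2 := (texp (|c| * K') a ha0).eventually_le_const (half_pos hη)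
      filter_upwards [bl, t1, t2, eventually_le_atBot (-1)] with X h1 h2 h3 h6 Y hY
      have h4 := h1 _ (hmaps hY)
      rw [abs_of_pos (exp_pos _)] at h4
      have h5 := mul_le_mul_of_nonneg_left (hrem X Y h6) (abs_nonneg c)
      rw [← abs_mul] at h5
      have e : w X Y - ((C j + c * (a / π * I₀)) * X + (D j - c * (a / π * I₁))) =
          (u j X (side j * Y) - (C j * X + D j)) - c * potentialRem a p X Y := by
        simp only [hw]
        rw [hp.potential_eq_linear_add hγa]
        ring
      rw [e]
      refine (abs_sub _ _).trans ?_
      linarith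
  simp only [hw] at key
  rw [← mul_assoc, side_mul_side, one_mul, potential_side] at key
  exact sub_eq_zero.1 key

end IsWeightFunction

end

end BimaterialStrip

namespace BimaterialStrip

/-! ### The explicit solutions -/

/-- The interface traction of the explicit solution with `A = 1`. -/
noncomputable def normalTraction (P : StripParams) : ℝ → ℝ := (exists_normalTraction P).choose

/-- The displacement with interface traction `A * normalTraction P`. -/
noncomputable def explicitSol (P : StripParams) (A : ℝ) (j : Fin 2) (X Y : ℝ) : ℝ :=
  A * (side j / P.μ j) * potential (π / P.H j) (normalTraction P) X Y

/-- `u` coincides with the explicit solution on the closed strips. -/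
def IsExplicit (P : StripParams) (u : Fin 2 → ℝ → ℝ → ℝ) (A : ℝ) : Prop :=
  ∀ j X Y, Y ∈ section_ P j → u j X Y = explicitSol P A j X Y

section
variable (P : StripParams)

theorem halfLineDecay_normalTraction : HalfLineDecay (normalTraction P) (gammaPlus P) := by
  obtain ⟨h1, -, ⟨K, hK, h2⟩, -⟩ := (exists_normalTraction P).choose_spec
  exact ⟨gammaPlus_pos P, h1.continuousOn, K, hK, fun x hx => h2 x hx.le⟩

theorem gammaPlus_lt_div (j : Fin 2) : gammaPlus P < π / P.H j :=
  (gammaPlus_lt P).trans_le (gammaMinus_le_div P j)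

theorem rightTransform_normalTraction {β : ℝ} (h0 : 0 < β) (h1 : β < gammaPlus P) {ξ : ℂ}
    (h : -β < ξ.im) : rightTransform (fun x => (normalTraction P x : ℂ)) ξ =
      -1 / (P.κ * (lam P - I * ξ) * XiStarPlus P β ξ) :=
  ((exists_normalTraction P).choose_spec).2.2.2.2.1 β h0 h1 ξ h

theorem stripJump_normalTraction :
    (∀ X, 0 < X → stripJump P (normalTraction P) X = P.κ * normalTraction P X) ∧
    ∀ ξ : ℂ, ξ.im < 0 → leftTransform (fun X => (stripJump P (normalTraction P) X : ℂ)) ξ =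
      (lam P + I * ξ) * XiStarMinus P (gammaPlus P / 2) ξ / ξ ^ 2 := by
  have hg := gammaPlus_pos P
  exact stripJump_eq_of_transform P
    ((halfLineDecay_normalTraction P).of_le (half_pos hg) (half_le_self hg.le))
    fun ξ hξ => rightTransform_normalTraction P (half_pos hg) (half_lt_self hg) hξ

theorem stripJump_normalTraction_zero : stripJump P (normalTraction P) 0 = -1 := by
  have h1 := (halfLineDecay_normalTraction P).continuous_stripJump (gammaPlus_lt P)
  have h2 := ((exists_normalTraction P).choose_spec).1.const_mul P.κ
  have t1 := (h1.continuousAt (x := 0)).tendsto.mono_left (nhdsWithin_le_nhds (s := Ioi (0 : ℝ)))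
  have t2 := (h2.continuousAt (x := 0)).tendsto.mono_left (nhdsWithin_le_nhds (s := Ioi (0 : ℝ)))
  have h3 := tendsto_nhds_unique (t1.congr' (by
    filter_upwards [self_mem_nhdsWithin] with X hX
    exact (stripJump_normalTraction P).1 X hX)) t2
  change _ = P.κ * normalTraction P 0 at h3
  have h4 : normalTraction P 0 = _ := ((exists_normalTraction P).choose_spec).2.1
  have := P.κ_pos.ne'
  rw [h3, h4]
  field_simp

theorem hasDerivAt_rightTransform_zero {p : ℝ → ℝ} {γ : ℝ} (hp : HalfLineDecay p γ) :
    HasDerivAt (rightTransform fun x => (p x : ℂ))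
      (I * (∫ x in Ioi 0, x * p x : ℝ)) 0 := by
  obtain ⟨K, hK, hb⟩ := hp.bound
  have hγ := hp.pos
  have hq : HalfLineDecay (fun x => p x * exp (γ / 2 * x)) (γ / 2) :=
    ⟨half_pos hγ, hp.cont.mul (by fun_prop), K, hK, fun x hx => by
      rw [abs_mul, abs_of_pos (exp_pos _)]
      refine (mul_le_mul_of_nonneg_right (hb x hx) (exp_pos _).le).trans (le_of_eq ?_)
      rw [mul_assoc, ← exp_add]
      ring_nf⟩
  have hm := hp.ofReal_aestronglyMeasurable
  have h := (hasDerivAt_integral_of_dominated_loc_of_deriv_le (μ := volume.restrict (Ioi 0))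
    (F := fun (ξ : ℂ) (x : ℝ) => (p x : ℂ) * cexp (I * ξ * x))
    (F' := fun (ξ : ℂ) (x : ℝ) => p x * (cexp (I * ξ * x) * (I * x)))
    (x₀ := 0) (bound := fun x => |x * (p x * exp (γ / 2 * x))|)
    (Metric.ball_mem_nhds (0 : ℂ) (half_pos hγ))
    (Eventually.of_forall fun ξ => hm.mul (by fun_prop))
    (by
      simp only [mul_zero, zero_mul, Complex.exp_zero, mul_one]
      exact hp.integrableOn.ofReal) (hm.mul (by fun_prop))
    (by
      rw [ae_restrict_iff' measurableSet_Ioi]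
      refine Eventually.of_forall fun x hx ξ hξ => ?_
      have hx' : 0 < x := hx
      have h1 : -ξ.im ≤ γ / 2 := ((neg_le_abs _).trans (Complex.abs_im_le_norm ξ)).trans
        (mem_ball_zero_iff.1 hξ).le
      rw [norm_mul, norm_mul, norm_cexp_I_mul, norm_mul, Complex.norm_I, one_mul,
        Complex.norm_real, Complex.norm_real, abs_mul, abs_mul, abs_of_pos (exp_pos _)]
      calc _ ≤ ‖p x‖ * (exp (γ / 2 * x) * ‖x‖) := by gcongr
        _ = _ := by simp only [norm_eq_abs]; ring)
    hq.integrableOn_mul_self.abs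
    (Eventually.of_forall fun x ξ _ => by
      have h1 : HasDerivAt (fun ξ : ℂ => I * ξ * x) (I * x) ξ := by
        simpa using ((hasDerivAt_id' ξ).const_mul I).mul_const (x : ℂ)
      exact (h1.cexp.const_mul (p x : ℂ)))).2
  refine h.congr_deriv ?_
  rw [← integral_complex_ofReal, ← integral_const_mul]
  refine integral_congr_ae (Eventually.of_forall fun x => ?_)
  simp
  ring

theorem moments_normalTraction : ∫ x in Ioi 0, normalTraction P x = -1 / (P.κ * lam P) ∧
    ∫ x in Ioi 0, x * normalTraction P x =
      -1 / (P.κ * lam P) * (alpha P / π + 1 / lam P) := by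
  have hg := gammaPlus_pos P
  have h0 := half_pos hg
  have h1 := half_lt_self hg
  have hκ : (P.κ : ℂ) ≠ 0 := by exact_mod_cast P.κ_pos.ne'
  have hl : (lam P : ℂ) ≠ 0 := by exact_mod_cast (lam_pos P).ne'
  have hp := halfLineDecay_normalTraction P
  have e0 : (0 : ℂ).im = 0 := rfl
  constructor
  · have h := rightTransform_normalTraction P h0 h1 (ξ := 0) (by rw [e0]; linarith)
    rw [XiStarPlus_zero P h0 h1, rightTransform] at h
    simp only [mul_zero, zero_mul, Complex.exp_zero, mul_one, sub_zero] at h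
    rw [integral_complex_ofReal] at h
    exact_mod_cast h
  · have hE := hasDerivAt_XiStarPlus_zero P h0 h1
    have d1 : HasDerivAt (fun ξ : ℂ => (P.κ : ℂ) * (lam P - I * ξ))
        (P.κ * -(I * 1)) 0 :=
      (((hasDerivAt_id' (0 : ℂ)).const_mul I).const_sub (lam P : ℂ)).const_mul _
    have d2 := (hasDerivAt_const (0 : ℂ) (-1 : ℂ)).fun_div (d1.fun_mul hE) (by
      rw [XiStarPlus_zero P h0 h1]
      simpa using ⟨P.κ_pos.ne', (lam_pos P).ne'⟩)
    have d3 := (hasDerivAt_rightTransform_zero hp).congr_of_eventuallyEq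
      (f₁ := fun ξ => -1 / (P.κ * (lam P - I * ξ) * XiStarPlus P (gammaPlus P / 2) ξ)) (by
        filter_upwards [Complex.continuous_im.continuousAt.eventually_const_lt
          (by rw [e0]; linarith : -(gammaPlus P / 2) < (0 : ℂ).im)] with ξ hξ
        exact (rightTransform_normalTraction P h0 h1 hξ).symm)
    have h := d3.unique d2
    rw [XiStarPlus_zero P h0 h1] at h
    simp only [mul_zero, sub_zero, mul_one, zero_mul, zero_sub] at h
    have hI := Complex.I_sq
    have : ((∫ x in Ioi 0, x * normalTraction P x : ℝ) : ℂ) =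
        ((-1 / (P.κ * lam P) * (alpha P / π + 1 / lam P) : ℝ) : ℂ) := by
      refine mul_left_cancel₀ Complex.I_ne_zero (h.trans ?_)
      push_cast
      field_simp
      linear_combination (lam P * alpha P : ℂ) * hI
    exact_mod_cast this

end

section
variable {P : StripParams} {u : Fin 2 → ℝ → ℝ → ℝ} {A : ℝ}

theorem dY_explicitSol (hu : IsExplicit P u A)
    (j : Fin 2) {X Y : ℝ} (hY : Y ∈ section_ P j) (h : X ≠ 0 ∨ Y ≠ 0) :
    dY P u j X Y = A / P.μ j * potentialDY (π / P.H j) (normalTraction P) X (side j * Y) := by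
  obtain ⟨a, b, hab, hS, -⟩ := exists_section_eq P j
  have hs : side j ≠ 0 := left_ne_zero_of_mul_eq_one (side_mul_side j)
  have d1 := (halfLineDecay_normalTraction P).hasDerivWithinAt_potential (gammaPlus_lt_div P j)
    (X := X) (Y := side j * Y) (by rw [pi_div_pi_div]; exact hY) (h.imp_right (mul_ne_zero hs))
  rw [pi_div_pi_div] at d1
  have d3 : HasDerivWithinAt (fun y => side j * y) (side j * 1) (section_ P j) Y :=
    ((hasDerivAt_id' Y).const_mul _).hasDerivWithinAt
  have d4 := (HasDerivWithinAt.comp Y d1 d3 fun y hy => hy).const_mul (A * (side j / P.μ j))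
  have d5 := d4.congr (f₁ := fun y => u j X y) (fun y hy => by
    rw [hu j X y hy, explicitSol, Function.comp_apply, potential_side]) (by
    rw [hu j X Y hY, explicitSol, Function.comp_apply, potential_side])
  rw [dY, d5.derivWithin (by rw [hS] at hY ⊢; exact uniqueDiffOn_Icc hab Y hY)]
  linear_combination (A / P.μ j * potentialDY (π / P.H j) (normalTraction P) X (side j * Y)) *
    side_mul_side j

theorem mul_dY_explicitSol (hu : IsExplicit P u A)
    (j : Fin 2) {X : ℝ} (hX : X ≠ 0) :
    P.μ j * dY P u j X 0 = A * zeroExt (normalTraction P) X := by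
  have := (P.μ_pos j).ne'
  rw [dY_explicitSol hu j (zero_mem_section P j) (Or.inl hX), mul_zero, potentialDY_zero]
  field_simp

theorem jump_explicitSol (hu : IsExplicit P u A)
    (X : ℝ) : jump u X = A * stripJump P (normalTraction P) X := by
  rw [jump, hu 0 X 0 (zero_mem_section P 0), hu 1 X 0 (zero_mem_section P 1), explicitSol,
    explicitSol, stripJump]
  simp [side]
  ring

theorem hasExplicitTransforms_explicitSol (hu : IsExplicit P u A) :
    HasExplicitTransforms P u A := by
  have hp := halfLineDecay_normalTraction P
  have hg := gammaPlus_pos P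
  have hgm := gammaPlus_lt P
  obtain ⟨C, hC, hb⟩ := hp.ofReal_bound
  have eP : ∀ ξ : ℂ, EqOn (phiPlusIntegrand P u ξ)
      (fun X => A * (normalTraction P X * cexp (I * ξ * X))) (Ioi 0) := by
    intro ξ X hX
    simp only [phiPlusIntegrand]
    rw [mul_dY_explicitSol hu 0 (ne_of_gt hX), zeroExt_of_pos hX]
    push_cast
    ring
  have eM : ∀ ξ : ℂ, EqOn (phiMinusIntegrand P u ξ) (fun X => A *
      (stripJump P (normalTraction P) X * cexp (I * ξ * X))) (Iio 0) := by
    intro ξ X hX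
    have h := mul_dY_explicitSol hu 0 (ne_of_lt hX)
    rw [zeroExt_of_nonpos (le_of_lt hX), mul_zero] at h
    simp only [phiMinusIntegrand]
    rw [jump_explicitSol hu, mul_right_comm, h, zero_mul, sub_zero]
    push_cast
    ring
  have vP : ∀ ξ : ℂ, PhiPlus P u ξ = A * rightTransform (fun x => (normalTraction P x : ℂ)) ξ :=
    fun ξ => by
      rw [PhiPlus, setIntegral_congr_fun measurableSet_Ioi (eP ξ), integral_const_mul,
        rightTransform]
  have vM : ∀ ξ : ℂ, PhiMinus P u ξ =
      A * leftTransform (fun x => (stripJump P (normalTraction P) x : ℂ)) ξ := fun ξ => by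
    rw [PhiMinus, setIntegral_congr_fun measurableSet_Iio (eM ξ), integral_const_mul,
      leftTransform]
  refine ⟨fun β h0 h1 ξ hξ => ⟨?_, ?_⟩, fun β h0 h1 ξ hξ => ⟨?_, ?_⟩, fun ξ h1 h2 => ?_,
    fun j ξ h1 h2 Y hY => ?_⟩
  · exact IntegrableOn.congr_fun ((integrableOn_right hp.ofReal_aestronglyMeasurable hb
      (by linarith)).const_mul (A : ℂ)) (eP ξ).symm measurableSet_Ioi
  · rw [vP, rightTransform_normalTraction P h0 h1 hξ]
    ring
  · exact IntegrableOn.congr_fun ((hp.integrableOn_left_stripJump hgm hξ).const_mul (A : ℂ))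
      (eM ξ).symm measurableSet_Iio
  · rw [vM, (stripJump_normalTraction P).2 ξ hξ, XiStarMinus_congr P (half_pos hg)
      (half_lt_self hg) h0 h1 (by linarith) (by linarith)]
    ring
  · have hξ : ξ ≠ 0 := by
      rintro rfl
      simp at h2
    rw [vM, vP, hp.leftTransform_stripJump hgm (stripJump_normalTraction P).1 h1 h2, Xi_eq P hξ]
    ring
  · obtain ⟨i1, v1⟩ := hp.integral_exp_mul_potential (gammaPlus_lt_div P j) h1 h2
      (Y := side j * Y) (by rw [pi_div_pi_div]; exact hY)
    have e : fourierIntegrand u j ξ Y = fun X : ℝ => ((A * (side j / P.μ j) : ℝ) : ℂ) *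
        (cexp (I * ξ * X) *
          (potential (π / P.H j) (normalTraction P) X (side j * Y) : ℂ)) := by
      ext X
      rw [fourierIntegrand, hu j X Y hY, explicitSol, potential_side]
      push_cast
      ring
    rw [fourierX, e]
    refine ⟨i1.const_mul _, ?_⟩
    rw [integral_const_mul, v1, vP, ← Complex.ofReal_div, pi_div_pi_div]
    push_cast
    fin_cases j
    · simp only [side]
      simp
      ring
    · simp only [side]
      simp only [Fin.mk_one, pow_one, neg_mul, one_mul, mul_neg, Complex.sinh_neg,
        sub_neg_eq_add, Complex.ofReal_neg, Complex.ofReal_one]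
      rw [← Complex.cosh_neg (ξ * (-(Y : ℂ) - P.H 1))]
      ring_nf

theorem linear_eq_potentialRem
    (hu : IsExplicit P u A) (j : Fin 2) (X : ℝ) {Y : ℝ}
    (hY : Y ∈ section_ P j) :
    u j X Y - (A / (P.κ * lam P) * constC P j * X + A / (P.κ * lam P) * constD P j) =
      A * (side j / P.μ j) * potentialRem (π / P.H j) (normalTraction P) X Y := by
  obtain ⟨m0, m1⟩ := moments_normalTraction P
  rw [hu j X Y hY, explicitSol, (halfLineDecay_normalTraction P).potential_eq_linear_add
    (gammaPlus_lt_div P j), m0, m1, constC, constD]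
  field_simp
  ring

theorem linearLeft_explicitSol (hu : IsExplicit P u A) :
    LinearLeft P u (fun j => A / (P.κ * lam P) * constC P j)
      (fun j => A / (P.κ * lam P) * constD P j) (gammaMinus P) := by
  intro j
  have hp := halfLineDecay_normalTraction P
  obtain ⟨K, hK, hb⟩ := hp.exists_potentialRem_le (hp.pos.trans (gammaPlus_lt_div P j))
  refine IsBigO.of_bound (|A * (side j / P.μ j)| * K) (eventually_prod_principal_iff.2 ?_)
  filter_upwards [eventually_le_atBot (-1)] with X hX Y hY
  have e := linear_eq_potentialRem hu j X hY
  rw [e, norm_mul, norm_eq_abs, norm_eq_abs, norm_of_nonneg (exp_pos _).le,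
    mul_assoc]
  refine mul_le_mul_of_nonneg_left ((hb X Y hX).trans (mul_le_mul_of_nonneg_left
    (exp_le_exp.2 ?_) hK.le)) (abs_nonneg _)
  exact mul_le_mul_of_nonpos_right (gammaMinus_le_div P j) (by linarith)

theorem decaysRight_explicitSol (hu : IsExplicit P u A) :
    DecaysRight P u (gammaPlus P) := by
  intro j
  obtain ⟨K, hK, hb⟩ := (halfLineDecay_normalTraction P).exists_potential_le
    (gammaPlus_lt_div P j)
  refine IsBigO.of_bound (|A * (side j / P.μ j)| * K) (eventually_prod_principal_iff.2
    (Eventually.of_forall fun X Y hY => ?_))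
  rw [hu j X Y hY, explicitSol, norm_mul, norm_eq_abs, norm_eq_abs,
    norm_of_nonneg (exp_pos _).le, mul_assoc]
  exact mul_le_mul_of_nonneg_left (hb X Y) (abs_nonneg _)

theorem le_gammaPlus_of_decaysRight
    (hu : IsExplicit P u A) (hA : A ≠ 0) {γ : ℝ}
    (h : DecaysRight P u γ) : γ ≤ gammaPlus P := by
  by_contra! hγ
  obtain ⟨hc, -, -, -, -, G, hG, hG0, hGv⟩ := (exists_normalTraction P).choose_spec
  obtain ⟨K, hK⟩ := exists_jump_bound h
  have hκ := P.κ_pos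
  obtain ⟨M, hM, hb⟩ := exists_exp_bound (f := normalTraction P) (K := K / (|A| * P.κ)) hc (by
    filter_upwards [hK, eventually_gt_atTop 0] with x hx hx0
    rw [jump_explicitSol hu, (stripJump_normalTraction P).1 x hx0, abs_mul, abs_mul,
      abs_of_pos hκ] at hx
    rw [div_mul_eq_mul_div, le_div_iff₀ (by positivity)]
    linarith)
  have him : ∀ τ : ℝ, (-(τ * I) : ℂ).im = -τ := fun τ => by simp
  have hcont : Continuous fun τ : ℝ => (-(τ * I) : ℂ) := by fun_prop
  have t1 : Tendsto (fun τ : ℝ => ‖G (-(τ * I))‖) (𝓝[<] gammaPlus P)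
      (𝓝 ‖G (-(gammaPlus P * I))‖) :=
    ((ContinuousAt.comp (g := G) (f := fun τ : ℝ => (-(τ * I) : ℂ)) hG hcont.continuousAt).norm).tendsto.mono_left nhdsWithin_le_nhds
  have t2 : Tendsto (fun τ : ℝ => M / (γ - gammaPlus P) * (gammaPlus P - τ)) (𝓝[<] gammaPlus P)
      (𝓝 (M / (γ - gammaPlus P) * (gammaPlus P - gammaPlus P))) :=
    (by fun_prop : Continuous fun τ : ℝ =>
      M / (γ - gammaPlus P) * (gammaPlus P - τ)).continuousAt.tendsto.mono_left nhdsWithin_le_nhds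
  rw [sub_self, mul_zero] at t2
  refine hG0 (norm_le_zero_iff.1 (le_of_tendsto_of_tendsto t1 t2 ?_))
  filter_upwards [self_mem_nhdsWithin] with τ hτ
  have hτ' : τ < gammaPlus P := hτ
  have h1 := hGv (-(τ * I)) (by rw [him]; linarith)
  have h2 : (gammaPlus P - I * -(τ * I) : ℂ) = ((gammaPlus P - τ : ℝ) : ℂ) := by
    push_cast
    linear_combination (τ : ℂ) * Complex.I_sq
  have h3 : ((gammaPlus P - τ : ℝ) : ℂ) ≠ 0 := by exact_mod_cast (sub_pos.2 hτ').ne'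
  rw [h2, eq_div_iff h3] at h1
  rw [← h1, norm_mul, Complex.norm_real, norm_of_nonneg (sub_pos.2 hτ').le]
  refine mul_le_mul_of_nonneg_right ?_ (sub_pos.2 hτ').le
  refine (norm_rightTransform_le (C := M) (γ := γ) (fun x hx => by
    rw [Complex.norm_real]; exact hb x hx) (by rw [him]; linarith)).trans ?_
  rw [him]
  exact div_le_div_of_nonneg_left hM.le (by linarith) (by linarith)

theorem le_gammaMinus_of_linearLeft
    (hu : IsExplicit P u A) (hA : A ≠ 0) {γ : ℝ}
    (h : LinearLeft P u (fun j => A / (P.κ * lam P) * constC P j)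
      (fun j => A / (P.κ * lam P) * constD P j) γ) : γ ≤ gammaMinus P := by
  by_contra! hγ
  obtain ⟨j, hj⟩ := exists_gammaMinus_mul_eq P
  have hH := P.H_pos j
  have hμ := P.μ_pos j
  have hg := gammaPlus_pos P
  have hκ := P.κ_pos
  have hl := lam_pos P
  have ha : gammaMinus P = π / P.H j := by rw [← hj]; field_simp
  rw [ha] at hγ
  set a := π / P.H j with hadef
  have ha0 : 0 < a := hg.trans (gammaPlus_lt_div P j)
  have hp := halfLineDecay_normalTraction P
  obtain ⟨K, hK, hb⟩ := eventually_abs_le_of_isBigO (f := fun X Y => u j X Y -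
    (A / (P.κ * lam P) * constC P j * X + A / (P.κ * lam P) * constD P j))
    (g := fun X => exp (γ * X)) (h j)
  set c := A * (side j / P.μ j) with hc
  have hc0 : 0 < |c| := by
    rw [hc, abs_mul, abs_div, abs_side, abs_of_pos hμ]
    positivity
  have t1 := (hp.tendsto_potentialRem ha0).abs
  have t2 : Tendsto (fun X : ℝ => K / |c| * exp ((γ - a) * X)) atBot (𝓝 0) := by
    have := (tendsto_exp_atBot.comp (tendsto_id.const_mul_atBot
      (sub_pos.2 hγ))).const_mul (K / |c|)
    rwa [mul_zero] at this
  have h0 := le_of_tendsto_of_tendsto t1 t2 (by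
    filter_upwards [hb] with X hX
    have h1 := hX 0 (zero_mem_section P j)
    rw [linear_eq_potentialRem hu j X (zero_mem_section P j), abs_mul,
      abs_of_pos (exp_pos _)] at h1
    rw [abs_mul, abs_of_pos (exp_pos _), div_mul_eq_mul_div K, le_div_iff₀ hc0]
    have h2 := mul_le_mul_of_nonneg_left h1 (exp_pos (-(a * X))).le
    have h3 : exp ((γ - a) * X) = exp (-(a * X)) * exp (γ * X) := by
      rw [← exp_add]
      ring_nf
    rw [h3]
    linarith)
  have hI : ∫ s in Ioi (0 : ℝ), normalTraction P s * exp (-(a * s)) = 0 := by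
    have := abs_nonpos_iff.1 h0
    rw [neg_eq_zero] at this
    exact (mul_eq_zero.1 this).resolve_left (by positivity)
  have him : (a * I : ℂ).im = a := by simp
  have h1 := rightTransform_normalTraction P (half_pos hg) (half_lt_self hg) (ξ := a * I)
    (by rw [him]; linarith)
  have h2 : rightTransform (fun x => (normalTraction P x : ℂ)) (a * I) =
      ((∫ s in Ioi (0 : ℝ), normalTraction P s * exp (-(a * s)) : ℝ) : ℂ) := by
    rw [rightTransform, ← integral_complex_ofReal]
    refine integral_congr_ae (Eventually.of_forall fun x => ?_)
    simp only
    push_cast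
    congr 2
    linear_combination (a * x : ℂ) * Complex.I_sq
  rw [h2, hI, Complex.ofReal_zero] at h1
  have hκ' : (P.κ : ℂ) ≠ 0 := by exact_mod_cast hκ.ne'
  exact div_ne_zero (neg_ne_zero.2 one_ne_zero) (mul_ne_zero (mul_ne_zero hκ'
    (lam_sub_ne P (by rw [him]; linarith))) (XiStarPlus_ne_zero P _ _)) h1.symm

end

end BimaterialStrip

namespace BimaterialStrip
variable {P : StripParams} {u : Fin 2 → ℝ → ℝ → ℝ} {A : ℝ} {C D : Fin 2 → ℝ}

/-! ### The crack tip -/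

theorem exists_tip_explicitSol (hu : IsExplicit P u A) (j : Fin 2) : ∃ c : ℝ, ∀ ε : ℝ, 0 < ε →
    ∀ᶠ R : ℝ in 𝓝[>] (0 : ℝ), ∀ θ ∈ Icc 0 π,
      |u j (R * cos θ) (side j * (R * sin θ)) - (u j 0 0 - side j * A / (π * P.μ j * P.κ) *
        (R * cos θ * log R - R * cos θ + (π - θ) * (R * sin θ) + c * (R * cos θ)))| ≤ ε * R := by
  obtain ⟨-, h0, -, ⟨K, hK, hb⟩, -⟩ := (exists_normalTraction P).choose_spec
  obtain ⟨c, hc⟩ := (halfLineDecay_normalTraction P).exists_tip_expansion (gammaPlus_lt_div P j)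
    hK fun s hs => hb s hs.le
  have hκ := P.κ_pos
  have hc' : (exists_normalTraction P).choose 0 = -1 / P.κ := h0
  rw [hc'] at hc
  set B := side j * A / (π * P.μ j) with hB
  refine ⟨-(P.κ * c), fun ε hε => ?_⟩
  filter_upwards [hc (ε / (|B| + 1)) (by positivity), self_mem_nhdsWithin,
    nhdsWithin_le_nhds (eventually_lt_nhds (P.H_pos j))] with R hR hR0 hRH θ hθ
  have hR0' : 0 < R := hR0
  have hs := sin_nonneg_of_mem_Icc hθ
  have hmem : side j * (R * sin θ) ∈ section_ P j := side_mul_mem.2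
    ⟨by positivity, by nlinarith [sin_le_one θ]⟩
  have h := hR θ hθ
  have e : ∀ X Y, Y ∈ section_ P j → u j X Y = B * (π * potential (π / P.H j) (normalTraction P)
      X Y) := fun X Y hY => by
    rw [hu j X Y hY, explicitSol, hB]
    field_simp
  rw [e _ _ hmem, e 0 0 (zero_mem_section P j), potential_side]
  have h2 := mul_le_mul_of_nonneg_left h (abs_nonneg B)
  rw [← abs_mul] at h2
  refine (congrArg _ ?_).trans_le (h2.trans ?_)
  · rw [hB]
    field_simp
    ring
  · rw [← mul_assoc]
    refine mul_le_mul_of_nonneg_right ?_ hR0'.le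
    rw [mul_div_assoc', div_le_iff₀ (by positivity)]
    nlinarith [abs_nonneg B]

theorem hasTipConstant_explicitSol (hu : IsExplicit P u A) : HasTipConstant P u (A / P.κ) := by
  choose c hc using exists_tip_explicitSol hu
  have h0 := (P.μ_pos 0)
  have h1 := (P.μ_pos 1)
  have hκ := P.κ_pos
  have hj := jump_explicitSol hu 0
  rw [stripJump_normalTraction_zero, jump] at hj
  refine ⟨u 0 0 0 + A * P.μ 1 / (P.μ 0 + P.μ 1), fun j => exp (-c j), fun j => exp_pos _, fun j => ?_⟩
  have ek : u j 0 0 = u 0 0 0 + A * P.μ 1 / (P.μ 0 + P.μ 1) + -side j * (A / P.κ) / (π * P.μ j) *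
      (P.μ 0 * P.κ * π / (1 + P.μ 0 / P.μ 1)) := by
    fin_cases j
    · simp [side]
      field_simp
      ring
    · simp [side]
      field_simp
      linear_combination (-(P.μ 0 + P.μ 1) ^ 2) * hj
  refine isLittleO_iff.2 fun ε hε => eventually_prod_principal_iff.2 ?_
  filter_upwards [hc j ε hε, self_mem_nhdsWithin] with R hR hR0 θ hθ
  have hR0' : 0 < R := hR0
  have hs : side j * sin θ = sin (side j * θ) ∧ cos θ = cos (side j * θ) := by
    fin_cases j <;> simp [side]
  have h := hR _ hθ
  rw [← hs.1, ← hs.2] at h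
  rw [norm_eq_abs, norm_of_nonneg hR0'.le, log_div hR0'.ne' (exp_pos _).ne', log_exp]
  have e : side j * (R * (side j * sin θ)) = R * sin θ := by
    linear_combination (R * sin θ) * side_mul_side j
  rw [e] at h
  refine (congrArg _ ?_).trans_le h
  rw [ek]
  have := (P.μ_pos j).ne'
  field_simp
  ring

theorem isBigO_tip_explicitSol (hu : IsExplicit P u A) (j : Fin 2) :
    (fun p : ℝ × ℝ => u j p.1 p.2 - u j 0 0) =O[𝓝[closedStrip P j] 0]
      fun p => √(p.1 ^ 2 + p.2 ^ 2) * log √(p.1 ^ 2 + p.2 ^ 2) := by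
  obtain ⟨c, hc⟩ := exists_tip_explicitSol hu j
  obtain ⟨δ, hδ, hδs⟩ := mem_nhdsGT_iff_exists_Ioo_subset.1 (hc 1 one_pos)
  set B := |side j * A / (π * P.μ j * P.κ)| with hB
  refine IsBigO.of_bound (B * (2 + π + |c|) + 1) ?_
  have hcont : Continuous fun p : ℝ × ℝ => √(p.1 ^ 2 + p.2 ^ 2) := by fun_prop
  have ht := hcont.tendsto (0 : ℝ × ℝ)
  simp only [Prod.fst_zero, Prod.snd_zero, ne_eq, OfNat.ofNat_ne_zero, not_false_eq_true, zero_pow,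
    add_zero, sqrt_zero] at ht
  filter_upwards [self_mem_nhdsWithin, nhdsWithin_le_nhds (ht.eventually_lt_const hδ),
    nhdsWithin_le_nhds (ht.eventually_lt_const (exp_pos (-1)))] with q hq h1 h2
  have hq' : 0 ≤ side j * q.2 := hq.1
  set w : ℂ := ⟨q.1, side j * q.2⟩ with hw
  have hn : √(q.1 ^ 2 + q.2 ^ 2) = ‖w‖ := by
    rw [Complex.norm_def, Complex.normSq_mk]
    congr 1
    linear_combination -q.2 ^ 2 * side_mul_side j
  rw [hn] at h1 h2 ⊢
  rcases eq_or_ne w 0 with h0 | h0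
  · have e1 : q.1 = 0 := congrArg Complex.re h0
    have e2 : side j * q.2 = 0 := congrArg Complex.im h0
    have e3 : q.2 = 0 := by linear_combination side j * e2 - q.2 * side_mul_side j
    simp [e1, e3, h0]
  have hR : 0 < ‖w‖ := norm_pos_iff.2 h0
  have h := hδs ⟨hR, h1⟩ w.arg ⟨Complex.arg_nonneg_iff.2 (show 0 ≤ w.im from hq'), Complex.arg_le_pi w⟩
  have e2 : side j * w.im = q.2 := by
    simp only [hw]
    linear_combination q.2 * side_mul_side j
  rw [Complex.norm_mul_cos_arg, Complex.norm_mul_sin_arg, e2] at h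
  have hL : log ‖w‖ < -1 := (log_lt_iff_lt_exp hR).2 h2
  rw [norm_eq_abs, norm_mul, norm_eq_abs, norm_eq_abs, abs_of_pos hR]
  set L := |log ‖w‖| with hLdef
  have hL1 : 1 ≤ L := by rw [hLdef, abs_of_neg (by linarith)]; linarith
  have hre := Complex.abs_re_le_norm w
  have him := Complex.abs_im_le_norm w
  have ha : |π - w.arg| ≤ π := by
    rw [abs_of_nonneg (sub_nonneg.2 (Complex.arg_le_pi w))]
    linarith [Complex.arg_nonneg_iff.2 (show 0 ≤ w.im from hq')]
  have b1 : |w.re * log ‖w‖ - w.re + (π - w.arg) * w.im + c * w.re| ≤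
      ‖w‖ * L + ‖w‖ + π * ‖w‖ + |c| * ‖w‖ := by
    refine (abs_add_le _ _).trans (add_le_add ((abs_add_le _ _).trans (add_le_add
      ((abs_sub _ _).trans (add_le_add ?_ hre)) ?_)) ?_) <;> rw [abs_mul] <;> gcongr
  have hB0 : 0 ≤ B := abs_nonneg _
  have b2 := mul_le_mul_of_nonneg_left b1 hB0
  rw [hB, ← abs_mul, ← hB] at b2
  have b3 : ‖w‖ ≤ ‖w‖ * L := le_mul_of_one_le_right hR.le hL1
  have b4 := mul_le_mul_of_nonneg_left b3 (by positivity : 0 ≤ B * (1 + π + |c|) + 1)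
  have b5 := abs_sub_le (u j q.1 q.2 - u j 0 0) (-(side j * A / (π * P.μ j * P.κ) *
    (w.re * log ‖w‖ - w.re + (π - w.arg) * w.im + c * w.re))) 0
  rw [sub_zero, sub_zero, abs_neg] at b5
  have b6 : u j q.1 q.2 - u j 0 0 - -(side j * A / (π * P.μ j * P.κ) *
    (w.re * log ‖w‖ - w.re + (π - w.arg) * w.im + c * w.re)) = u j w.re q.2 - (u j 0 0 -
    side j * A / (π * P.μ j * P.κ) *
    (w.re * log ‖w‖ - w.re + (π - w.arg) * w.im + c * w.re)) := by
    simp only [hw]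
    ring
  rw [b6] at b5
  linarith

theorem tendsto_interface_explicitSol (hu : IsExplicit P u A) :
    Tendsto (fun X => jump u X) (𝓝[>] 0) (𝓝 (-A)) ∧
    Tendsto (fun X => P.μ 0 * dY P u 0 X 0) (𝓝[>] 0) (𝓝 (-(A / P.κ))) := by
  obtain ⟨hc, h0, -⟩ := (exists_normalTraction P).choose_spec
  have h0' : normalTraction P 0 = -1 / P.κ := h0
  have hκ := P.κ_pos.ne'
  have t : Tendsto (normalTraction P) (𝓝[>] 0) (𝓝 (-1 / P.κ)) := by
    rw [← h0']
    exact hc.continuousAt.tendsto.mono_left nhdsWithin_le_nhds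
  constructor
  · refine ((t.const_mul (A * P.κ)).congr' ?_).trans (le_of_eq (congrArg _ (by field_simp)))
    filter_upwards [self_mem_nhdsWithin] with X hX
    rw [jump_explicitSol hu, (stripJump_normalTraction P).1 X hX, mul_assoc]
  · refine ((t.const_mul A).congr' ?_).trans (le_of_eq (congrArg _ (by field_simp)))
    filter_upwards [self_mem_nhdsWithin] with X hX
    rw [mul_dY_explicitSol hu 0 (ne_of_gt hX), zeroExt_of_pos hX]

/-! ### Existence and uniqueness -/

theorem isWeightFunction_explicitSol (hu : IsExplicit P u A) :
    IsWeightFunction P u (fun j => A / (P.κ * lam P) * constC P j)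
      (fun j => A / (P.κ * lam P) * constD P j) := by
  have hp := halfLineDecay_normalTraction P
  have hd := mul_dY_explicitSol hu
  refine ⟨fun j z hz => ?_, fun j => ?_, fun j => ?_, fun j X => ?_, fun j X hX => ?_,
    fun X hX => ?_, fun X hX => ?_, ⟨_, gammaPlus_pos P, decaysRight_explicitSol hu⟩,
    ⟨_, (gammaPlus_pos P).trans (gammaPlus_lt P), linearLeft_explicitSol hu⟩,
    isBigO_tip_explicitSol hu⟩
  · have hz' : side j * z.im ∈ Ioo 0 (P.H j) := hz
    have ho : IsOpen (openStrip P j) := isOpen_Ioo.preimage (by fun_prop)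
    have h1 := ((hp.harmonicAt_potential (gammaPlus_lt_div P j) (z := ⟨z.re, side j * z.im⟩)
      (sin_pos_of_mem (div_pos pi_pos (P.H_pos j)) hz'.1 (by
        rw [div_mul_eq_mul_div, div_lt_iff₀ (P.H_pos j)]
        exact mul_lt_mul_of_pos_left hz'.2 pi_pos)))).const_smul (c := A * (side j / P.μ j))
    refine (InnerProductSpace.harmonicAt_congr_nhds ?_).2 (harmonicAt_side (j := j)
      (f := fun X Y => A * (side j / P.μ j) * potential (π / P.H j) (normalTraction P) X Y) h1)
    filter_upwards [ho.mem_nhds hz] with w hw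
    rw [hu j _ _ (Ioo_subset_Icc_self hw), potential_side, explicitSol]
  · refine (((hp.continuous_potential (gammaPlus_lt_div P j)).const_mul
      (A * (side j / P.μ j))).continuousOn).congr fun q hq => ?_
    exact hu j _ _ hq
  · have hne : ∀ q ∈ closedStrip P j \ {0}, q.1 ≠ 0 ∨ q.2 ≠ 0 := fun q hq => by
      by_contra! h
      exact hq.2 (Prod.ext h.1 h.2)
    intro q hq
    have hs : side j ≠ 0 := left_ne_zero_of_mul_eq_one (side_mul_side j)
    have h1 := hp.continuousAt_potentialDY (gammaPlus_lt_div P j) (X := q.1) (Y := side j * q.2)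
      (by rw [pi_div_pi_div]; exact hq.1) ((hne q hq).imp_right (mul_ne_zero hs))
    have h2 := (ContinuousAt.comp (f := fun q : ℝ × ℝ => (q.1, side j * q.2)) h1
      (by fun_prop)).const_mul (A / P.μ j)
    exact (h2.continuousWithinAt).congr (fun q' hq' => dY_explicitSol hu j hq'.1 (hne q' hq'))
      (dY_explicitSol hu j hq.1 (hne q hq))
  · have hH := P.H_pos j
    have e : side j * (side j * P.H j) = π / (π / P.H j) := by
      rw [pi_div_pi_div, ← mul_assoc, side_mul_side, one_mul]
    rw [dY_explicitSol hu j (side_mul_mem.2 ⟨hH.le, le_rfl⟩) (Or.inr (mul_ne_zero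
      (left_ne_zero_of_mul_eq_one (side_mul_side j)) hH.ne')), e,
      potentialDY_top (div_pos pi_pos hH), mul_zero, mul_zero]
  · rw [hd j hX.ne, zeroExt_of_nonpos hX.le, mul_zero]
  · rw [hd 0 hX.ne', zeroExt_of_pos hX, jump_explicitSol hu, (stripJump_normalTraction P).1 X hX]
    ring
  · rw [hd 0 hX.ne', hd 1 hX.ne']

theorem IsWeightFunction.exists_isExplicit (hu : IsWeightFunction P u C D) :
    ∃ A, IsExplicit P u A := by
  obtain ⟨γ, hγ, hp⟩ := hu.halfLineDecay
  have hg := gammaPlus_pos P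
  have hgm := gammaPlus_lt P
  set p := fun x => jump u x / P.κ with hpdef
  have hV : ∀ j X Y, Y ∈ section_ P j → u j X Y = side j / P.μ j * potential (π / P.H j) p X Y :=
    fun j X Y hY => hu.eq_potential (by linarith) hp hY
  obtain ⟨A, hA⟩ := exists_rightTransform_eq_const_mul P hp hγ fun X _ => by
    have : P.κ * p X = jump u X := mul_div_cancel₀ _ P.κ_pos.ne'
    rw [this, jump, hV 0 X 0 (zero_mem_section P 0), hV 1 X 0 (zero_mem_section P 1), stripJump]
    simp [side]
    ring
  have hn := (halfLineDecay_normalTraction P).of_le hp.pos (by linarith : γ ≤ gammaPlus P)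
  obtain ⟨K₁, -, hb₁⟩ := hp.ofReal_bound
  obtain ⟨K₂, -, hb₂⟩ := (hn.const_mul A).ofReal_bound
  have hm₁ := hp.ofReal_aestronglyMeasurable
  have hm₂ := (hn.const_mul A).ofReal_aestronglyMeasurable
  have h0 := eq_zero_of_rightTransform_eq_zero (C := K₁ + K₂) hp.pos
    (φ := fun x => (p x : ℂ) - (A * normalTraction P x : ℝ))
    ((Complex.continuous_ofReal.comp_continuousOn hp.cont).sub
      (Complex.continuous_ofReal.comp_continuousOn (hn.const_mul A).cont))
    (fun x hx => (norm_sub_le _ _).trans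
      ((add_le_add (hb₁ x hx) (hb₂ x hx)).trans_eq (add_mul _ _ _).symm)) fun t => by
      have him : -γ < (t : ℂ).im := by simpa using hp.pos
      have e1 := hA t him
      rw [← rightTransform_normalTraction P (half_pos hg) (half_lt_self hg)
        (by simpa using half_pos hg)] at e1
      have e2 := integral_sub (integrableOn_right hm₁ hb₁ him) (integrableOn_right hm₂ hb₂ him)
      simp only [rightTransform] at e1 ⊢
      simp only [sub_mul]
      rw [e2, e1, ← integral_const_mul, sub_eq_zero]
      congr 1
      ext x
      push_cast
      ring
  have hz : zeroExt p = zeroExt fun x => A * normalTraction P x := by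
    ext x
    rcases lt_or_ge 0 x with hx | hx
    · rw [zeroExt_of_pos hx, zeroExt_of_pos hx]
      exact_mod_cast sub_eq_zero.1 (h0 x hx)
    · rw [zeroExt_of_nonpos hx, zeroExt_of_nonpos hx]
  refine ⟨A, fun j X Y hY => ?_⟩
  have e : potential (π / P.H j) p X Y = A * potential (π / P.H j) (normalTraction P) X Y := by
    rw [← potential_const_mul, potential, potential, hz]
  rw [hV j X Y hY, e, explicitSol]
  ring

theorem LinearLeft.unique {C' D' : Fin 2 → ℝ} {γ γ' : ℝ} (h : LinearLeft P u C D γ) (hγ : 0 < γ)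
    (h' : LinearLeft P u C' D' γ') (hγ' : 0 < γ') (j : Fin 2) : C j = C' j ∧ D j = D' j := by
  have ht : ∀ {C D : Fin 2 → ℝ} {γ : ℝ}, LinearLeft P u C D γ → 0 < γ →
      Tendsto (fun X => u j X 0 - (C j * X + D j)) atBot (𝓝 0) := fun {C D γ} h hγ => by
    refine ((h j).comp_tendsto (tendsto_id.prodMk (tendsto_principal.2 (Eventually.of_forall
      fun X => zero_mem_section P j)))).trans_tendsto ?_
    exact tendsto_exp_atBot.comp (tendsto_id.const_mul_atBot hγ)
  have h1 := (ht h hγ).sub (ht h' hγ')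
  have h2 : Tendsto (fun X : ℝ => (C' j - C j) * X + (D' j - D j)) atBot (𝓝 0) := by
    rw [sub_zero] at h1
    exact h1.congr fun X => by ring
  have h3 : C' j - C j = 0 := by
    have h4 := h2.sub (h2.comp (tendsto_atBot_add_const_right atBot (-1) tendsto_id))
    rw [sub_zero] at h4
    exact tendsto_nhds_unique (tendsto_const_nhds.congr fun X => by simp; ring) h4
  rw [h3] at h2
  have h5 : D' j - D j = 0 := tendsto_nhds_unique (tendsto_const_nhds.congr fun X => by ring) h2
  exact ⟨(sub_eq_zero.1 h3).symm, (sub_eq_zero.1 h5).symm⟩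

theorem isGreatest_rates_explicitSol (hu : IsExplicit P u A) (hA : A ≠ 0) :
    IsGreatest {γ | DecaysRight P u γ} (gammaPlus P) ∧
    IsGreatest {γ | LinearLeft P u (fun j => A / (P.κ * lam P) * constC P j)
      (fun j => A / (P.κ * lam P) * constD P j) γ} (gammaMinus P) :=
  ⟨⟨decaysRight_explicitSol hu, fun _ h => le_gammaPlus_of_decaysRight hu hA h⟩,
    ⟨linearLeft_explicitSol hu, fun _ h => le_gammaMinus_of_linearLeft hu hA h⟩⟩

end BimaterialStrip

theorem mainTheorem2 (P : StripParams) :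
    -- the kernel and its regularisation
    (∀ ξ : ℂ, ξ ≠ 0 → (lam P : ℂ) ^ 2 + ξ ^ 2 ≠ 0 →
      Xi P ξ = P.κ * ((lam P : ℂ) ^ 2 + ξ ^ 2) * XiStar P ξ / ξ ^ 2) ∧
    -- positivity of the regularised kernel on the line, and convergence of the integral for `α`
    (∀ t : ℝ, t ≠ 0 → 0 < XiStarR P t) ∧
    IntegrableOn (fun t : ℝ => Real.log (XiStarR P t) / t ^ 2) (Ioi 0) ∧
    -- the first zero of the kernel below the real axis
    IsLeast (zeroDepths P) (gammaPlus P) ∧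
    1 / P.μ 0 * Real.cot (gammaPlus P * P.H 0) + 1 / P.μ 1 * Real.cot (gammaPlus P * P.H 1)
      - P.κ * gammaPlus P = 0 ∧
    -- the factorisation, for every contour within the strip of analyticity
    (∀ β, 0 < β → β < gammaPlus P →
      DifferentiableOn ℂ (XiStarPlus P β) {ξ | -β < ξ.im} ∧
      DifferentiableOn ℂ (XiStarMinus P β) {ξ | ξ.im < β} ∧
      ∀ ξ : ℂ, ξ ≠ 0 → -β < ξ.im → ξ.im < β →
        XiStar P ξ = XiStarPlus P β ξ * XiStarMinus P β ξ) ∧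
    -- the weight function, normalised by `A = κλ`: existence, constants, exact decay rates
    (∃ u, IsWeightFunction P u (constC P) (constD P) ∧
      HasExplicitTransforms P u (P.κ * lam P) ∧
      HasTipConstant P u (lam P) ∧
      Tendsto (fun X => jump u X) (𝓝[>] 0) (𝓝 (-(P.κ * lam P))) ∧
      Tendsto (fun X => P.μ 0 * dY P u 0 X 0) (𝓝[>] 0) (𝓝 (-lam P)) ∧
      IsGreatest {γ | DecaysRight P u γ} (gammaPlus P) ∧
      IsGreatest {γ | LinearLeft P u (constC P) (constD P) γ} (gammaMinus P)) ∧
    -- every solution is given by the explicit formulas with some constant `A`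
    -- (for `A = κλ` its constants are those above)
    (∀ u C D, IsWeightFunction P u C D → ∃ A : ℝ,
      HasExplicitTransforms P u A ∧
      (∀ j, C j = A / (P.κ * lam P) * constC P j) ∧
      (∀ j, D j = A / (P.κ * lam P) * constD P j) ∧
      HasTipConstant P u (A / P.κ) ∧
      Tendsto (fun X => jump u X) (𝓝[>] 0) (𝓝 (-A)) ∧
      Tendsto (fun X => P.μ 0 * dY P u 0 X 0) (𝓝[>] 0) (𝓝 (-(A / P.κ))) ∧
      (A ≠ 0 → IsGreatest {γ | DecaysRight P u γ} (gammaPlus P) ∧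
        IsGreatest {γ | LinearLeft P u C D γ} (gammaMinus P))) := by
  have hκ := P.κ_pos.ne'
  have hl := lam_pos P
  have hg := gammaPlus_pos P
  have hgm := hg.trans (gammaPlus_lt P)
  have hβ := half_lt_self hg
  refine ⟨fun ξ => Xi_eq_XiStar P, fun t => XiStarR_pos P,
    (integral_logStar_div_sq P (half_pos hg) hβ).1, (isLeast_zeroDepths_gammaPlus P).1,
    gammaPlus_cot P, fun β h0 h1 => ⟨differentiableOn_XiStarPlus P h0 h1,
      differentiableOn_XiStarMinus P h0 h1, fun ξ => XiStar_eq_mul P h0 h1⟩, ?_,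
    fun u C D hu => ?_⟩
  · have hA : P.κ * lam P ≠ 0 := mul_ne_zero hκ hl.ne'
    have hu : IsExplicit P (explicitSol P (P.κ * lam P)) (P.κ * lam P) := fun j X Y _ => rfl
    have hw := isWeightFunction_explicitSol hu
    have hr := isGreatest_rates_explicitSol hu hA
    have ht := hasTipConstant_explicitSol hu
    have hi := tendsto_interface_explicitSol hu
    simp only [div_self hA, one_mul, mul_div_cancel_left₀ _ hκ] at hw hr ht hi
    exact ⟨_, hw, hasExplicitTransforms_explicitSol hu, ht, hi.1, hi.2, hr⟩
  · obtain ⟨A, hA⟩ := hu.exists_isExplicit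
    obtain ⟨γ, hγ, h⟩ := hu.left
    have hCD := h.unique hγ (linearLeft_explicitSol hA) hgm
    have hi := tendsto_interface_explicitSol hA
    have hC : C = _ := funext fun j => (hCD j).1
    have hD : D = _ := funext fun j => (hCD j).2
    refine ⟨A, hasExplicitTransforms_explicitSol hA, fun j => (hCD j).1, fun j => (hCD j).2,
      hasTipConstant_explicitSol hA, hi.1, hi.2, fun h0 => ?_⟩
    rw [hC, hD]
    exact isGreatest_rates_explicitSol hA h0
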